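/- **Setting.** Let $F$ be a non-archimedean local field with residue field $k$ of odd characteristic, $q=\#k$, and let $E/F$ be a quadratic extension (automatically tame). Let $A=M_2(F)$, let $B$ be the nonsplit quaternion algebra over $F$, and let $j_A:E\to A$, $j_B:E\to B$ be $F$-embeddings, through which $E$ is regarded as a subfield of $A$, of $B$, and (diagonally) of $A\times B$. Representations have coefficients in an algebraically closed field $\Omega$ of characteristic $0$; characters of $F^\times$ and $E^\times$ are smooth. Fix $\psi:F\to\Omega^\times$ trivial on $\mathfrak p_F$ but not on $\mathcal O_F$; put $\psi_E=\psi\circ\mathrm{tr}_{E/F}$, $\psi_A=\psi\circ\mathrm{tr}$, $\psi_B=\psi\circ\mathrm{trd}$. Valuations $v_E$, $v_B$ are normalized, $U_E^1=1+\mathfrak p_E$, and $U_B^n=1+\mathfrak P_B^n$. The $\mathcal O_E$-lattices in $F^2$ (an $E$-line via $j_A$) form a chain $(\Lambda_i)_{i\in\mathbb Z}$; $\mathfrak P^n=\{x\in A: x\Lambda_i\subset\Lambda_{i+n}\ \forall i\}$ and $U_{\mathfrak A}^n=1+\mathfrak P^n$. Let $s_A:A\to E$, $s_B:B\to E$ be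 the orthogonal projections for the (reduced) trace pairings, and $s(x,y)=s_A(x)-s_B(y)$. Let $\mu_E,\mu_F$ be the groups of roots of unity of order prime to the residue characteristic. Let $m\ge1$ and let $\alpha\in E^\times$ be minimal of valuation $-m$: $v_E(\alpha)=-m$; if $E/F$ is ramified, $m$ is odd; if $E/F$ is unramified, $\alpha\notin F$ and the minimal polynomial of $\varpi_F^m\alpha$ over $F$ is irreducible modulo $\mathfrak p_F$. **Groups.** Put $V_A^m=s_A^{-1}(\mathfrak p_E^m)\cap\mathfrak P^{\lfloor (m+1)/2\rfloor}$, $W_A^m=s_A^{-1}(\mathfrak p_E^m)\cap\mathfrak P^{\lfloor m/2\rfloor+1}$, $V_B^m=s_B^{-1}(\mathfrak p_E^m)\cap\mathfrak P_B^{r}$, $W_B^m=s_B^{-1}(\mathfrak p_E^m)\cap\mathfrak P_B^{r'}$, where $(r,r')=(2\lfloor m/2\rfloor,m+1)$ if $E/F$ is unramified and $(\lfloor (m+1)/2\rfloor,\lfloor m/2\rfloor+1)$ if it is ramified. Let $V^m=V_A^m\times V_B^m$, $W^m=W_A^m\times W_B^m$, $\mathcal K=E^\times(1+V^m)$, $\mathcal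 P=F^\times U_E^1(1+W^m)$, and let $\mathcal K^1$ be the kernel on $\mathcal K$ of $\delta(g,b)=\det(g)^{-1}\mathrm{nrd}(b)$. Let $J_A=E^\times U_{\mathfrak A}^{\lfloor (m+1)/2\rfloor}$, and $J_B=E^\times U_B^{m}$ if $E/F$ is unramified, $J_B=E^\times U_B^{(m+1)/2}$ if it is ramified. **The representation $\tau_\alpha^1$.** Let $\psi_\alpha$ be the character of $\mathcal P$ that is trivial on $F^\times U_E^1$ and satisfies $\psi_\alpha(1+w)=\psi_E(\alpha s(w))$ for $w\in W^m$. Let $\tau_\alpha$ be the irreducible representation of $\mathcal K$ lying over $\psi_\alpha$ such that: if $E/F$ is ramified, $\tau_\alpha$ is a character with $\tau_\alpha(\beta)=(-1)^{v_E(\beta)}$ for $\beta\in E^\times$; if $E/F$ is unramified, $\mathrm{tr}\,\tau_\alpha(\zeta)=-1$ for all $\zeta\in\mu_E\setminus\mu_F$. Put $\tau_\alpha^1=\tau_\alpha|_{\mathcal K^1}$. **The representations $\Lambda_\chi$, $\Lambda'_\chi$.** Let $Y_\alpha$ be the set of characters $\chi=\chi'\cdot(\omega\circ N_{E/F})$ of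 $E^\times$ with $\omega$ a character of $F^\times$ and $\chi'(1+x)=\psi_E(\alpha x)$ for $x\in\mathfrak p_E^m$. First let $\chi$ satisfy $\chi(1+x)=\psi_E(\beta x)$ for $x\in\mathfrak p_E^{\lfloor m/2\rfloor+1}$, with $\beta$ minimal of valuation $-m$. * $m$ odd: $\Lambda_\chi$ is the character of $J_A$ equal to $\chi$ on $E^\times$ with $\Lambda_\chi(1+x)=\psi_A(\beta x)$ for $x\in\mathfrak P^{(m+1)/2}$. * $m=2r$ (so $E/F$ is unramified): $\Lambda_\chi$ is the representation of $J_A$ whose restriction to $U_E^1U_{\mathfrak A}^r$ is irreducible of dimension $q$ and lies over the character of $U_E^1U_{\mathfrak A}^{r+1}$ that equals $\chi$ on $U_E^1$ and $1+x\mapsto\psi_A(\beta x)$ on $U_{\mathfrak A}^{r+1}$, on which $F^\times$ acts through $\chi$, and with $\mathrm{tr}\,\Lambda_\chi(\zeta)=-\chi(\zeta)$ for $\zeta\in\mu_E\setminus\mu_F$. * $E/F$ ramified: $\Lambda'_\chi$ is the character of $J_B$ equal to $x\mapsto(-1)^{v_E(x)}\chi(x)$ on $E^\times$ with $\Lambda'_\chi(1+x)=\psi_B(\beta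 x)$ for $x\in\mathfrak P_B^{(m+1)/2}$. * $E/F$ unramified, $m$ even: $\Lambda'_\chi$ is the character of $J_B$ equal to $\chi$ on $E^\times$ with $\Lambda'_\chi(1+x)=\psi_B(\beta x)$ for $x\in\mathfrak P_B^{m+1}$. * $E/F$ unramified, $m$ odd: $\Lambda'_\chi$ is the representation of $J_B$ whose restriction to $U_E^1U_B^m$ is irreducible of dimension $q$ and lies over the character of $U_E^1U_B^{m+1}$ that equals $\chi$ on $U_E^1$ and $1+x\mapsto\psi_B(\beta x)$ on $U_B^{m+1}$, on which $F^\times$ acts through $\chi$, and with $\mathrm{tr}\,\Lambda'_\chi(\zeta)=-\chi(\zeta)$ for $\zeta\in\mu_E\setminus\mu_F$. In general write $\chi=\chi'\cdot(\omega\circ N_{E/F})$ with $\chi'$ as just considered, and put $\Lambda_\chi=\Lambda_{\chi'}\otimes(\omega\circ\det)$, $\Lambda'_\chi=\Lambda'_{\chi'}\otimes(\omega\circ\mathrm{nrd})$. **Proposition.** Let $\Lambda$ be a smooth irreducible representation of $J_A\times J_B$. Then $\Lambda$ lies over $\tau_\alpha^1$ (that is, $\Lambda|_{\mathcal K^1}$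 contains $\tau_\alpha^1$) if and only if there is $\chi\in Y_\alpha$ such that $\Lambda\cong\Lambda_\chi\otimes\check\Lambda'_\chi$, where $\check\Lambda'_\chi$ is the contragredient of $\Lambda'_\chi$. -/

import Mathlib

open scoped Quaternion ValuativeRel

namespace LocalTypes

noncomputable section

/-! ### Local fields -/

section LocalField

variable {L : Type*} [Field L] [ValuativeRel L] [TopologicalSpace L]
  [IsNonarchimedeanLocalField L]

/-- The normalized additive valuation `v_L : Lˣ → ℤ` (uniformizers have valuation `1`);
the value at `0` is irrelevant. -/
def ord (x : L) : ℤ :=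
  -WithZero.log (IsNonarchimedeanLocalField.valueGroupWithZeroIsoInt L
    (ValuativeRel.valuation L x))

variable (L) in
/-- The fractional ideal `𝔭_L ^ n`. -/
def pPow (n : ℤ) : Set L := {x | x = 0 ∨ n ≤ ord x}

/-- A character of `Lˣ` is smooth if it is trivial on `U_L ^ n = 1 + 𝔭_L ^ n` for some `n ≥ 1`. -/
def IsSmoothChar {Ω : Type*} [Field Ω] (χ : Lˣ →* Ωˣ) : Prop :=
  ∃ n : ℕ, 1 ≤ n ∧ ∀ u : Lˣ, (u : L) - 1 ∈ pPow L n → χ u = 1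

/-- An additive character of `L` has level zero if it is trivial on `𝔭_L` but not on `𝒪_L`. -/
def HasLevelZero {Ω : Type*} [Field Ω] (ψ : AddChar L Ω) : Prop :=
  (∀ x ∈ pPow L 1, ψ x = 1) ∧ ∃ x ∈ pPow L 0, ψ x ≠ 1

end LocalField

/-! ### Quaternion algebras -/

section Quaternion

variable {F : Type*} [Field F] {a b : F}

/-- The reduced trace `x ↦ x + x̄`. -/
def trd : ℍ[F,a,b] →ₗ[F] F where
  toFun x := (x + star x).re
  map_add' x y := by simp; ring
  map_smul' c x := by simp; ring

/-- The reduced norm `x ↦ x x̄`. -/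
def nrd : ℍ[F,a,b] →* F where
  toFun x := (x * star x).re
  map_one' := by simp
  map_mul' x y := by simp; ring

end Quaternion

section Main

variable {F E Ω : Type*} [Field F] [ValuativeRel F] [TopologicalSpace F]
  [IsNonarchimedeanLocalField F] [Field E] [ValuativeRel E] [TopologicalSpace E]
  [IsNonarchimedeanLocalField E] [Algebra F E] [Field Ω]

variable (F E) in
/-- `E/F` has ramification index one. (For a quadratic extension of local fields,
"ramified" is the negation and means ramification index two.) -/
def Unramified : Prop := ∀ x : F, ord (algebraMap F E x) = ord x

/-- The norm `Eˣ → Fˣ`. -/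
def normUnits : Eˣ →* Fˣ := Units.map (Algebra.norm F)

variable (F) in
/-- Minimal elements of `Eˣ` of valuation `-m` (`E/F` quadratic). In the unramified case `ϖ ^ m α`
is a generator of `E/F` whose minimal polynomial is irreducible modulo `𝔭_F`. -/
def IsMinimal (m : ℕ) (α : Eˣ) : Prop :=
  ord (α : E) = -(m : ℤ) ∧
  (¬ Unramified F E → Odd m) ∧
  (Unramified F E → (α : E) ∉ Set.range (algebraMap F E) ∧
    ∀ ϖ : F, ord ϖ = 1 → Irreducible
      ((minpoly 𝒪[F] (algebraMap F E ϖ ^ m * (α : E))).map (IsLocalRing.residue 𝒪[F])))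

variable (F) in
/-- `μ_E ∖ μ_F`, where `μ` denotes the roots of unity of order prime to the residue
characteristic. -/
def rootsOutside : Set Eˣ :=
  {ζ | (∃ n : ℕ, n.Coprime (Nat.card 𝓀[F]) ∧ ζ ^ n = 1) ∧
    (ζ : E) ∉ Set.range (algebraMap F E)}

/-- The relation `χ (1 + x) = ψ_E (α x)` for all `x ∈ 𝔭_E ^ n` (where `n ≥ 1`). -/
def AgreesOn (ψ : AddChar F Ω) (α : Eˣ) (χ : Eˣ →* Ωˣ) (n : ℕ) : Prop :=
  ∀ u : Eˣ, (u : E) - 1 ∈ pPow E n →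
    (χ u : Ω) = ψ (Algebra.trace F E ((α : E) * ((u : E) - 1)))

/-- The set `Y_α` of characters of `Eˣ`. -/
def Y (ψ : AddChar F Ω) (m : ℕ) (α : Eˣ) : Set (Eˣ →* Ωˣ) :=
  {χ | ∃ (χ' : Eˣ →* Ωˣ) (ω : Fˣ →* Ωˣ), IsSmoothChar χ' ∧ IsSmoothChar ω ∧
    χ = χ' * ω.comp normUnits ∧ AgreesOn ψ α χ' m}

/-! ### Constructions common to `A = M₂(F)` and `B`

In this part `D` is `A` or `B`, `T : D → F` is its (reduced) trace and `j : E → D` an embedding. -/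

section Generic

variable {D : Type*} [Ring D] [Algebra F D]

/-- The units `u` of `D` with `u - 1 ∈ P`. -/
def unitsNear (P : Set D) : Set Dˣ := {u | (u : D) - 1 ∈ P}

/-- The embedding `Eˣ → Dˣ`. -/
def embU (j : E →ₐ[F] D) : Eˣ →* Dˣ := Units.map (j : E →* D)

/-- The subgroup `Eˣ (1 + P)` of `Dˣ`. -/
def torusGroup (j : E →ₐ[F] D) (P : Set D) : Subgroup Dˣ :=
  Subgroup.closure (Set.range (embU j) ∪ unitsNear P)

/-- The subgroup `U_E¹ (1 + P)` of `Dˣ`. -/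
def torusGroupOne (j : E →ₐ[F] D) (P : Set D) : Subgroup Dˣ :=
  Subgroup.closure (embU j '' {e : Eˣ | (e : E) - 1 ∈ pPow E 1} ∪ unitsNear P)

open Classical in
/-- The tame corestriction `s : D → E`: the projection onto `E` for the decomposition `D = E ⊕ C`,
with `C` the orthogonal complement of `E` under the pairing `(x, y) ↦ T (x y)`. So `s d` is the
(unique) `e ∈ E` with `d - e ∈ C`. -/
def corestr (T : D →ₗ[F] F) (j : E →ₐ[F] D) (d : D) : E :=
  if h : ∃ e : E, ∀ x : E, T ((d - j e) * j x) = 0 then h.choose else 0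

/-- The `𝒪_E`-module `s⁻¹(𝔭_E ^ m) ∩ P`. -/
def corestrModule (T : D →ₗ[F] F) (j : E →ₐ[F] D) (m : ℕ) (P : Set D) : Set D :=
  {d | corestr T j d ∈ pPow E m} ∩ P

/-- `ρ` is the character of `J` which is `ξ` on `Eˣ` and satisfies
`ρ (1 + x) = ψ (T (α x))` for `x ∈ P`. -/
structure IsCharType (ψ : AddChar F Ω) (T : D →ₗ[F] F) (j : E →ₐ[F] D) (α : Eˣ) (ξ : Eˣ → Ω)
    (P : Set D) {J : Subgroup Dˣ} {V : Type*} [AddCommGroup V] [Module Ω V]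
    (ρ : Representation Ω J V) : Prop where
  finrank_eq : Module.finrank Ω V = 1
  torus : ∀ (e : Eˣ) (h : embU j e ∈ J) (v : V), ρ ⟨embU j e, h⟩ v = ξ e • v
  unip : ∀ (u : J), (u : Dˣ) ∈ unitsNear P →
    ∀ v : V, ρ u v = ψ (T (j α * (((u : Dˣ) : D) - 1))) • v

/-- `ρ` is a representation of `J` whose restriction to `J₁` is irreducible of dimension `q = #k_F`
and lies over the character `θ` of `U_E¹ (1 + P)` that agrees with `χ` on `U_E¹` and satisfies
`θ (1 + x) = ψ (T (α x))` for `x ∈ P`; moreover `Fˣ` acts through `χ`, and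
`tr ρ(ζ) = -χ(ζ)` for all `ζ ∈ μ_E ∖ μ_F`. -/
structure IsHeisenbergType (ψ : AddChar F Ω) (T : D →ₗ[F] F) (j : E →ₐ[F] D) (α : Eˣ)
    (χ : Eˣ →* Ωˣ) (P : Set D) {J : Subgroup Dˣ} (J₁ : Subgroup Dˣ) {V : Type*} [AddCommGroup V]
    [Module Ω V] (ρ : Representation Ω J V) : Prop where
  finrank_eq : Module.finrank Ω V = Nat.card 𝓀[F]
  irreducible : Representation.IsIrreducible (ρ.comp (J₁.subgroupOf J).subtype)
  lies_over : ∃ v : V, v ≠ 0 ∧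
    (∀ (e : Eˣ) (h : embU j e ∈ J), (e : E) - 1 ∈ pPow E 1 →
      ρ ⟨embU j e, h⟩ v = (χ e : Ω) • v) ∧
    (∀ (u : J), (u : Dˣ) ∈ unitsNear P → ρ u v = ψ (T (j α * (((u : Dˣ) : D) - 1))) • v)
  central : ∀ (c : Fˣ) (h : embU j (Units.map (algebraMap F E) c) ∈ J) (v : V),
    ρ ⟨embU j (Units.map (algebraMap F E) c), h⟩ v
      = (χ (Units.map (algebraMap F E) c) : Ω) • v
  trace_eq : ∀ (ζ : Eˣ) (h : embU j ζ ∈ J), ζ ∈ rootsOutside F →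
    LinearMap.trace Ω V (ρ ⟨embU j ζ, h⟩) = -(χ ζ : Ω)

end Generic

/-! ### The algebra `A = M₂(F)` -/

/-- For `v ≠ 0`, the lattice `Λ_i = 𝔭_E ^ i v` of `F²`, viewed as an `E`-line through `jA`. These
form the chain of all `𝒪_E`-lattices in `F²`. -/
def lattice (jA : E →ₐ[F] Matrix (Fin 2) (Fin 2) F) (v : Fin 2 → F) (i : ℤ) : Set (Fin 2 → F) :=
  {w | ∃ e ∈ pPow E i, w = (jA e).mulVec v}

/-- `𝔓_𝔄 ^ n`: the matrices that map `Λ_i` into `Λ_{i+n}` for all `i`. -/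
def radA (jA : E →ₐ[F] Matrix (Fin 2) (Fin 2) F) (n : ℕ) : Set (Matrix (Fin 2) (Fin 2) F) :=
  {x | ∀ v : Fin 2 → F, v ≠ 0 → ∀ i : ℤ, ∀ w ∈ lattice jA v i,
    x.mulVec w ∈ lattice jA v (i + n)}

/-- The trace of `A`. -/
def trA : Matrix (Fin 2) (Fin 2) F →ₗ[F] F := Matrix.traceLinearMap (Fin 2) F F

/-- `V_A ^ m`. -/
def VA (jA : E →ₐ[F] Matrix (Fin 2) (Fin 2) F) (m : ℕ) : Set (Matrix (Fin 2) (Fin 2) F) :=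
  corestrModule trA jA m (radA jA ((m + 1) / 2))

/-- `W_A ^ m`. -/
def WA (jA : E →ₐ[F] Matrix (Fin 2) (Fin 2) F) (m : ℕ) : Set (Matrix (Fin 2) (Fin 2) F) :=
  corestrModule trA jA m (radA jA (m / 2 + 1))

/-- `J_A = Eˣ U_𝔄 ^ ⌊(m+1)/2⌋`. -/
def JA (jA : E →ₐ[F] Matrix (Fin 2) (Fin 2) F) (m : ℕ) : Subgroup (GL (Fin 2) F) :=
  torusGroup jA (radA jA ((m + 1) / 2))

/-- `ρ` is the representation `Λ_χ` of `J_A`, for `χ` with `χ (1 + x) = ψ_E (α x)`,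
`x ∈ 𝔭_E ^ (⌊m/2⌋ + 1)`. -/
def IsBasicLambdaA (ψ : AddChar F Ω) (jA : E →ₐ[F] Matrix (Fin 2) (Fin 2) F) (m : ℕ) (α : Eˣ)
    (χ : Eˣ →* Ωˣ) {V : Type*} [AddCommGroup V] [Module Ω V]
    (ρ : Representation Ω (JA jA m) V) : Prop :=
  (Odd m → IsCharType ψ trA jA α (fun e => (χ e : Ω)) (radA jA (m / 2 + 1)) ρ) ∧
  (¬ Odd m → IsHeisenbergType ψ trA jA α χ (radA jA (m / 2 + 1))
    (torusGroupOne jA (radA jA (m / 2))) ρ)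

/-- `ρ` is the representation `Λ_χ` of `J_A`, for a character `χ` of essential level `m ≥ 1`:
write `χ = χ' · (ω ∘ N_{E/F})` with `χ' (1 + x) = ψ_E (α x)` for `x ∈ 𝔭_E ^ (⌊m/2⌋ + 1)` and `α`
minimal of valuation `-m`; then `Λ_χ = Λ_{χ'} ⊗ (ω ∘ det)`. -/
def IsLambdaA (ψ : AddChar F Ω) (jA : E →ₐ[F] Matrix (Fin 2) (Fin 2) F) (m : ℕ)
    (χ : Eˣ →* Ωˣ) {V : Type*} [AddCommGroup V] [Module Ω V]
    (ρ : Representation Ω (JA jA m) V) : Prop :=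
  ∃ (α : Eˣ) (χ' : Eˣ →* Ωˣ) (ω : Fˣ →* Ωˣ) (ρ' : Representation Ω (JA jA m) V),
    IsMinimal F m α ∧ IsSmoothChar χ' ∧ IsSmoothChar ω ∧ χ = χ' * ω.comp normUnits ∧
    AgreesOn ψ α χ' (m / 2 + 1) ∧ IsBasicLambdaA ψ jA m α χ' ρ' ∧
    ∀ g : JA jA m,
      ρ g = (ω (Matrix.GeneralLinearGroup.det (g : GL (Fin 2) F)) : Ω) • ρ' g

/-! ### The quaternion algebra `B` -/

variable {a b : F}

variable (a b) in
/-- `𝔓_B ^ n`, where the valuation of `B` is `v_F ∘ nrd`. -/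
def radB (n : ℕ) : Set ℍ[F,a,b] := {x | x = 0 ∨ (n : ℤ) ≤ ord (nrd x)}

open Classical in
/-- `V_B ^ m`. -/
def VB (jB : E →ₐ[F] ℍ[F,a,b]) (m : ℕ) : Set ℍ[F,a,b] :=
  corestrModule trd jB m (radB a b (if Unramified F E then 2 * (m / 2) else (m + 1) / 2))

open Classical in
/-- `W_B ^ m`. -/
def WB (jB : E →ₐ[F] ℍ[F,a,b]) (m : ℕ) : Set ℍ[F,a,b] :=
  corestrModule trd jB m (radB a b (if Unramified F E then m + 1 else m / 2 + 1))

open Classical in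
/-- `J_B`, which is `Eˣ U_B ^ m` for `E/F` unramified, `Eˣ U_B ^ ((m+1)/2)` for `E/F` ramified
(and `m` odd). -/
def JB (jB : E →ₐ[F] ℍ[F,a,b]) (m : ℕ) : Subgroup (ℍ[F,a,b])ˣ :=
  torusGroup jB (radB a b (if Unramified F E then m else (m + 1) / 2))

/-- `ρ` is the representation `Λ'_χ` of `J_B`, for `χ` with `χ (1 + x) = ψ_E (α x)`,
`x ∈ 𝔭_E ^ (⌊m/2⌋ + 1)`. -/
def IsBasicLambdaB (ψ : AddChar F Ω) (jB : E →ₐ[F] ℍ[F,a,b]) (m : ℕ) (α : Eˣ)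
    (χ : Eˣ →* Ωˣ) {V : Type*} [AddCommGroup V] [Module Ω V]
    (ρ : Representation Ω (JB jB m) V) : Prop :=
  (¬ Unramified F E →
    IsCharType ψ trd jB α (fun e => (-1 : Ω) ^ ord (e : E) * (χ e : Ω)) (radB a b (m / 2 + 1)) ρ) ∧
  (Unramified F E → ¬ Odd m →
    IsCharType ψ trd jB α (fun e => (χ e : Ω)) (radB a b (m + 1)) ρ) ∧
  (Unramified F E → Odd m →
    IsHeisenbergType ψ trd jB α χ (radB a b (m + 1)) (torusGroupOne jB (radB a b m)) ρ)

/-- `ρ` is the representation `Λ'_χ` of `J_B`, for a character `χ` of essential level `m ≥ 1`: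
for `χ = χ' · (ω ∘ N_{E/F})` as for `Λ_χ`, one has `Λ'_χ = Λ'_{χ'} ⊗ (ω ∘ nrd)`. -/
def IsLambdaB (ψ : AddChar F Ω) (jB : E →ₐ[F] ℍ[F,a,b]) (m : ℕ)
    (χ : Eˣ →* Ωˣ) {V : Type*} [AddCommGroup V] [Module Ω V]
    (ρ : Representation Ω (JB jB m) V) : Prop :=
  ∃ (α : Eˣ) (χ' : Eˣ →* Ωˣ) (ω : Fˣ →* Ωˣ) (ρ' : Representation Ω (JB jB m) V),
    IsMinimal F m α ∧ IsSmoothChar χ' ∧ IsSmoothChar ω ∧ χ = χ' * ω.comp normUnits ∧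
    AgreesOn ψ α χ' (m / 2 + 1) ∧ IsBasicLambdaB ψ jB m α χ' ρ' ∧
    ∀ g : JB jB m, ρ g = (ω (Units.map nrd (g : (ℍ[F,a,b])ˣ)) : Ω) • ρ' g

/-! ### The groups `𝒦`, `𝒦¹` and the representation `τ_α` -/

/-- `δ (g, b) = det(g)⁻¹ nrd(b)`. -/
def delta : GL (Fin 2) F × (ℍ[F,a,b])ˣ →* Fˣ :=
  (Matrix.GeneralLinearGroup.det.comp (MonoidHom.fst _ _))⁻¹ *
    (Units.map nrd).comp (MonoidHom.snd _ _)

/-- The diagonal embedding `Eˣ → GL₂(F) × Bˣ`. -/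
def diagE (jA : E →ₐ[F] Matrix (Fin 2) (Fin 2) F) (jB : E →ₐ[F] ℍ[F,a,b]) :
    Eˣ →* GL (Fin 2) F × (ℍ[F,a,b])ˣ := (embU jA).prod (embU jB)

/-- `𝒦 = Eˣ (1 + V ^ m)`, `V ^ m = V_A ^ m × V_B ^ m`. -/
def K (jA : E →ₐ[F] Matrix (Fin 2) (Fin 2) F) (jB : E →ₐ[F] ℍ[F,a,b]) (m : ℕ) :
    Subgroup (GL (Fin 2) F × (ℍ[F,a,b])ˣ) :=
  Subgroup.closure (Set.range (diagE jA jB) ∪ unitsNear (VA jA m) ×ˢ unitsNear (VB jB m))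

/-- `𝒦¹`, the kernel of `δ` on `𝒦`. -/
def K1 (jA : E →ₐ[F] Matrix (Fin 2) (Fin 2) F) (jB : E →ₐ[F] ℍ[F,a,b]) (m : ℕ) :
    Subgroup (GL (Fin 2) F × (ℍ[F,a,b])ˣ) := K jA jB m ⊓ delta.ker

lemma diagE_mem_K (jA : E →ₐ[F] Matrix (Fin 2) (Fin 2) F) (jB : E →ₐ[F] ℍ[F,a,b]) (m : ℕ)
    (e : Eˣ) : diagE jA jB e ∈ K jA jB m :=
  Subgroup.subset_closure (Or.inl ⟨e, rfl⟩)

/-- `s (a, b) = s_A(a) - s_B(b)`. -/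
def sAB (jA : E →ₐ[F] Matrix (Fin 2) (Fin 2) F) (jB : E →ₐ[F] ℍ[F,a,b])
    (x : Matrix (Fin 2) (Fin 2) F) (y : ℍ[F,a,b]) : E :=
  corestr trA jA x - corestr trd jB y

/-- `τ` is the representation `τ_α` of `𝒦`: irreducible, lying over the character `ψ_α` of
`𝒫 = Fˣ U_E¹ (1 + W ^ m)` (trivial on `Fˣ U_E¹`, and `1 + w ↦ ψ_E (α s(w))` for `w ∈ W ^ m`), and
* if `E/F` is ramified, a character which is `β ↦ (-1) ^ v_E(β)` on `Eˣ`;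
* if `E/F` is unramified, with `tr τ(ζ) = -1` for all `ζ ∈ μ_E ∖ μ_F`. -/
structure IsTau (ψ : AddChar F Ω) (jA : E →ₐ[F] Matrix (Fin 2) (Fin 2) F)
    (jB : E →ₐ[F] ℍ[F,a,b]) (m : ℕ) (α : Eˣ) {V : Type*} [AddCommGroup V] [Module Ω V]
    (τ : Representation Ω (K jA jB m) V) : Prop where
  irreducible : Representation.IsIrreducible τ
  lies_over : ∃ v : V, v ≠ 0 ∧
    (∀ c : Fˣ, τ ⟨_, diagE_mem_K jA jB m (Units.map (algebraMap F E) c)⟩ v = v) ∧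
    (∀ e : Eˣ, (e : E) - 1 ∈ pPow E 1 → τ ⟨_, diagE_mem_K jA jB m e⟩ v = v) ∧
    (∀ k : K jA jB m, k.1.1 ∈ unitsNear (WA jA m) → k.1.2 ∈ unitsNear (WB jB m) →
      τ k v = ψ (Algebra.trace F E ((α : E) *
        sAB jA jB ((k.1.1 : Matrix (Fin 2) (Fin 2) F) - 1) ((k.1.2 : ℍ[F,a,b]) - 1))) • v)
  ramified : ¬ Unramified F E → Module.finrank Ω V = 1 ∧
    ∀ (β : Eˣ) (v : V), τ ⟨_, diagE_mem_K jA jB m β⟩ v = (-1 : Ω) ^ ord (β : E) • v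
  unramified : Unramified F E → ∀ ζ ∈ rootsOutside F (E := E),
    LinearMap.trace Ω V (τ ⟨_, diagE_mem_K jA jB m ζ⟩) = -1

/-! ### Representations of `J_A × J_B` -/

section Reps

variable {jA : E →ₐ[F] Matrix (Fin 2) (Fin 2) F} {jB : E →ₐ[F] ℍ[F,a,b]} {m : ℕ}
  {V : Type*} [AddCommGroup V] [Module Ω V]

/-- Every vector is fixed by an open subgroup; the groups `U_𝔄 ^ n × U_B ^ n` form a basis of
neighbourhoods of `1`. -/
def IsSmoothRep (Λ : Representation Ω (JA jA m × JB jB m) V) : Prop :=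
  ∀ v : V, ∃ n : ℕ, 1 ≤ n ∧ ∀ (g : JA jA m) (h : JB jB m),
    (g : GL (Fin 2) F) ∈ unitsNear (radA jA n) → (h : (ℍ[F,a,b])ˣ) ∈ unitsNear (radB a b n) →
    Λ (g, h) v = v

/-- `Λ` lies over `τ_α¹`, the restriction of `τ_α` to `𝒦¹ ⊆ J_A × J_B`: the restriction of `Λ` to
`𝒦¹` contains `τ_α¹`. -/
def LiesOverTauOne (ψ : AddChar F Ω) (α : Eˣ) (Λ : Representation Ω (JA jA m × JB jB m) V) : Prop :=
  ∃ (d : ℕ) (τ : Representation Ω (K jA jB m) (Fin d → Ω)), IsTau ψ jA jB m α τ ∧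
    ∃ f : (Fin d → Ω) →ₗ[Ω] V, Function.Injective f ∧
      ∀ (g : JA jA m) (h : JB jB m)
        (hk : ((g : GL (Fin 2) F), (h : (ℍ[F,a,b])ˣ)) ∈ K1 jA jB m) (w : Fin d → Ω),
        f (τ ⟨_, hk.1⟩ w) = Λ (g, h) (f w)

/-- `Λ ≅ Λ_χ ⊗ Λ̌'_χ`, with the contragredient on the second factor. -/
def IsLambdaTensorDual (ψ : AddChar F Ω) (χ : Eˣ →* Ωˣ)
    (Λ : Representation Ω (JA jA m × JB jB m) V) : Prop :=
  ∃ (d d' : ℕ) (ρ : Representation Ω (JA jA m) (Fin d → Ω))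
    (ρ' : Representation Ω (JB jB m) (Fin d' → Ω)),
    IsLambdaA ψ jA m χ ρ ∧ IsLambdaB ψ jB m χ ρ' ∧
    ∃ φ : V ≃ₗ[Ω] TensorProduct Ω (Fin d → Ω) (Module.Dual Ω (Fin d' → Ω)),
      ∀ (g : JA jA m) (h : JB jB m) (v : V),
        φ (Λ (g, h) v) = TensorProduct.map (ρ g) (ρ'.dual h) (φ v)

end Reps

end Main

end

end LocalTypes

/-!
Why the proposition holds. Both algebras have the same shape: if `σ` is the conjugation of `E/F`
and `D` is `A` or `B`, then `D = E ⊕ E c` with `c x = σ(x) c` and `c² = γ ∈ F` (`Frame`), where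
`γ = 1` for `A` and `γ` is not a norm for `B`. In these coordinates the corestriction is the
`E`-coordinate, all lattices in sight are of the form `𝔭_E ^ s ⊕ 𝔭_E ^ t c`, and `J_A`, `J_B`
consist of the units `x + y c` with `y / x ∈ 𝔭_E ^ t` (`Frame.Setup`). Conjugation and commutators
then become congruences between `E`-coordinates (`Frame.At.conj`, `Frame.At.commutator`), and the
reduced norm of `x + y c` is `N(x)` up to norms from `U_E ^ (m + 1)` when `y / x` is small enough
(`Frame.At.exists_nr`). The representations `Λ_χ` and `Λ'_χ` are determined by the scalars through
which the elements with `e ∈ Fˣ U_E¹` as `E`-coordinate and small `c`-coordinate act, together with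
either the remaining values of a character or a trace at the roots of unity outside `F`
(`Frame.IsTypeOn`). That these data force dimension `q` and irreducibility in the Heisenberg case
is a computation of `∑ |tr ρ|²` modulo scalars (`finrank_sq_eq`, `Frame.finrank_of_isIrreducible`,
`Frame.isIrreducible_of_finrank`): the trace vanishes on elements having a commutator that acts by
a nontrivial scalar, and every element outside the Heisenberg group is, up to scalars, conjugate to
a root of unity.

At most one of the two factors is of Heisenberg type, so in all representations of `J_A × J_B`
considered here one factor acts by scalars. As `𝒦` contains `(g, e)` and `(e, h)` whenever the
`E`-coordinate of `g`, respectively `h`, is `e`, such a representation stays irreducible on `𝒦`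
(`isIrreducible_restrict`).

For `χ = χ' · (ω ∘ N)` in `Y_α`, twisting `Λ_χ ⊗ Λ̌'_χ` by `ω ∘ δ` replaces `χ` by `χ'`, and the
restriction of the result to `𝒦` has all properties of `τ_α`: the scalars `χ'(e) χ'(e')⁻¹` on `𝒫`
give `ψ_α`, and the traces multiply to `-1` (`IsTensor.isTauLike`). The twist is invisible on `𝒦¹`.

Conversely, let `Λ` lie over `τ_α¹`. It is finite-dimensional by a Nullstellensatz argument
(`finiteDimensional_of_isSmoothRep`). The group `𝒦` acts on the nonzero space of
`𝒦¹`-intertwining operators from `τ_α` to `Λ` through the commutative group `δ(𝒦)`, so there is a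
character `ω` of `Fˣ` such that `Λ ⊗ (ω ∘ δ)` contains `τ_α` (`exists_twist_intertwiner`); `ω` is
smooth because elements of `1 + 𝔭_F ^ N` are determinants of matrices close to the identity.
Conjugation by `J_A × J_B` preserves the scalars by which `𝒫` acts, so they are the same on all of
`Λ` (`actsByPsi_of_isTau`). On the factor where commutators act trivially, Schur's lemma gives
scalars, hence the character `χ'` and the tensor decomposition
(`IsTauLike.exists_isTensor_of_odd`, `IsTauLike.exists_isTensor_of_even`). Finally `χ'` agrees with
`ψ_E (β ·)` on `U_E ^ (⌊m/2⌋ + 1)` for some minimal `β` (`exists_agreesOn`).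
-/

namespace LocalTypes

noncomputable section

set_option linter.unusedSectionVars false

/-! ### Valuations and fractional ideals -/

section LocalField

open ValuativeRel IsNonarchimedeanLocalField WithZero

variable {L : Type*} [Field L] [ValuativeRel L] [TopologicalSpace L]
  [IsNonarchimedeanLocalField L]

theorem ord_mul {x y : L} (hx : x ≠ 0) (hy : y ≠ 0) : ord (x * y) = ord x + ord y := by
  have hx' : valueGroupWithZeroIsoInt L (valuation L x) ≠ 0 := by simpa using hx
  have hy' : valueGroupWithZeroIsoInt L (valuation L y) ≠ 0 := by simpa using hy
  simp only [ord, map_mul, WithZero.log_mul hx' hy']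
  ring

@[simp] theorem ord_one : ord (1 : L) = 0 := by simp [ord]

theorem ord_inv (x : L) : ord x⁻¹ = -ord x := by
  simp [ord]

@[simp] theorem ord_neg (x : L) : ord (-x) = ord x := by
  simp [ord, Valuation.map_neg]

theorem ord_div {x y : L} (hx : x ≠ 0) (hy : y ≠ 0) : ord (x / y) = ord x - ord y := by
  rw [div_eq_mul_inv, ord_mul hx (inv_ne_zero hy), ord_inv]; ring

theorem ord_pow {x : L} (hx : x ≠ 0) (n : ℕ) : ord (x ^ n) = n * ord x := by
  induction n with
  | zero => simp
  | succ n ih => rw [pow_succ, ord_mul (pow_ne_zero n hx) hx, ih]; push_cast; ring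

theorem ord_zpow {x : L} (hx : x ≠ 0) (n : ℤ) : ord (x ^ n) = n * ord x := by
  cases n with
  | ofNat n => simpa using ord_pow hx n
  | negSucc n =>
    rw [zpow_negSucc, ord_inv, ord_pow hx, Int.negSucc_eq]; push_cast; ring

theorem mem_pPow_iff_val {x : L} {n : ℤ} :
    x ∈ pPow L n ↔ valueGroupWithZeroIsoInt L (valuation L x) ≤ exp (-n) := by
  by_cases hx : x = 0
  · simp [pPow, hx]
  · have hx' : valueGroupWithZeroIsoInt L (valuation L x) ≠ 0 := by simpa using hx
    have : x ∈ pPow L n ↔ n ≤ ord x := by simp [pPow, hx]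
    rw [this, ord, ← WithZero.log_le_iff_le_exp hx']
    constructor <;> intro h <;> linarith

theorem mem_pPow_iff {x : L} (hx : x ≠ 0) {n : ℤ} : x ∈ pPow L n ↔ n ≤ ord x := by
  simp [pPow, hx]

@[simp] theorem zero_mem_pPow (n : ℤ) : (0 : L) ∈ pPow L n := Or.inl rfl

theorem pPow_anti {n k : ℤ} (h : n ≤ k) {x : L} (hx : x ∈ pPow L k) : x ∈ pPow L n :=
  hx.imp id fun h' => h.trans h'

theorem pPow_add {n : ℤ} {x y : L} (hx : x ∈ pPow L n) (hy : y ∈ pPow L n) :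
    x + y ∈ pPow L n := by
  rw [mem_pPow_iff_val] at *
  have := (valuation L).map_add x y
  refine ((valueGroupWithZeroIsoInt L).strictMono.monotone this).trans ?_
  rcases le_total (valuation L x) (valuation L y) with h | h
  · rwa [max_eq_right h]
  · rwa [max_eq_left h]

theorem pPow_neg {n : ℤ} {x : L} (hx : x ∈ pPow L n) : -x ∈ pPow L n := by
  rw [mem_pPow_iff_val] at *
  rwa [Valuation.map_neg]

theorem pPow_sub {n : ℤ} {x y : L} (hx : x ∈ pPow L n) (hy : y ∈ pPow L n) :
    x - y ∈ pPow L n := by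
  rw [sub_eq_add_neg]; exact pPow_add hx (pPow_neg hy)

theorem pPow_mul {n k : ℤ} {x y : L} (hx : x ∈ pPow L n) (hy : y ∈ pPow L k) :
    x * y ∈ pPow L (n + k) := by
  by_cases hx0 : x = 0
  · simp [hx0]
  by_cases hy0 : y = 0
  · simp [hy0]
  rw [mem_pPow_iff hx0] at hx
  rw [mem_pPow_iff hy0] at hy
  rw [mem_pPow_iff (mul_ne_zero hx0 hy0), ord_mul hx0 hy0]
  exact add_le_add hx hy

theorem pPow_mul' {n k l : ℤ} {x y : L} (hx : x ∈ pPow L n) (hy : y ∈ pPow L k)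
    (h : l ≤ n + k) : x * y ∈ pPow L l := pPow_anti h (pPow_mul hx hy)

theorem mem_pPow_ord (x : L) : x ∈ pPow L (ord x) := Or.inr le_rfl

theorem one_mem_pPow : (1 : L) ∈ pPow L 0 := by simpa using mem_pPow_ord (1 : L)

variable (L) in
/-- The fractional ideal `𝔭_L ^ n` as an additive subgroup. -/
def pSub (n : ℤ) : AddSubgroup L where
  carrier := pPow L n
  add_mem' := pPow_add
  zero_mem' := zero_mem_pPow n
  neg_mem' := pPow_neg

@[simp] theorem mem_pSub {n : ℤ} {x : L} : x ∈ pSub L n ↔ x ∈ pPow L n := Iff.rfl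

theorem pPow_mul_iff {n k : ℤ} {x y : L} (hx : x ≠ 0) (h : ord x = k) :
    x * y ∈ pPow L (k + n) ↔ y ∈ pPow L n := by
  by_cases hy : y = 0
  · simp [hy]
  · rw [mem_pPow_iff (mul_ne_zero hx hy), mem_pPow_iff hy, ord_mul hx hy, h]
    constructor <;> intro h <;> linarith

theorem ord_eq_of_mem_of_not_mem {n : ℤ} {x : L} (h1 : x ∈ pPow L n) (h2 : x ∉ pPow L (n + 1)) :
    ord x = n := by
  have hx : x ≠ 0 := fun h => h2 (h ▸ zero_mem_pPow _)
  rw [mem_pPow_iff hx] at h1 h2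
  omega

theorem ord_add_eq {n : ℤ} {x y : L} (hx0 : x ≠ 0) (hx : ord x = n) (hy : y ∈ pPow L (n + 1)) :
    x + y ≠ 0 ∧ ord (x + y) = n := by
  have h2 : x + y ∉ pPow L (n + 1) := fun h => by
    have := pPow_sub h hy
    rw [add_sub_cancel_right, mem_pPow_iff hx0] at this
    omega
  have h1 : x + y ∈ pPow L n := pPow_add (hx ▸ mem_pPow_ord x) (pPow_anti (by omega) hy)
  exact ⟨fun h => h2 (h ▸ zero_mem_pPow _), ord_eq_of_mem_of_not_mem h1 h2⟩

theorem one_add_ne_zero {x : L} (hx : x ∈ pPow L 1) : 1 + x ≠ 0 :=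
  (ord_add_eq one_ne_zero ord_one (by simpa using hx)).1

theorem ord_one_add {x : L} (hx : x ∈ pPow L 1) : ord (1 + x) = 0 :=
  (ord_add_eq one_ne_zero ord_one (by simpa using hx)).2

theorem ord_of_sub_one {x : L} (hx : x - 1 ∈ pPow L 1) : ord x = 0 := by
  simpa using ord_one_add hx

theorem exists_ord_eq_one : ∃ x : L, x ≠ 0 ∧ ord x = 1 := by
  obtain ⟨γ, hγ⟩ := (valueGroupWithZeroIsoInt L).toEquiv.surjective (exp (-1))
  obtain ⟨x, rfl⟩ := valuation_surjective γ
  replace hγ : valueGroupWithZeroIsoInt L (valuation L x) = exp (-1) := hγ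
  refine ⟨x, ?_, ?_⟩
  · rintro rfl
    rw [map_zero, map_zero] at hγ
    exact exp_ne_zero hγ.symm
  · rw [ord, hγ, log_exp]; rfl

variable (L) in
/-- A uniformizer of `L`. -/
def unif : L := (exists_ord_eq_one (L := L)).choose

theorem unif_ne_zero : unif L ≠ 0 := (exists_ord_eq_one (L := L)).choose_spec.1

@[simp] theorem ord_unif : ord (unif L) = 1 := (exists_ord_eq_one (L := L)).choose_spec.2

theorem ord_unif_zpow (n : ℤ) : ord (unif L ^ n) = n := by
  rw [ord_zpow unif_ne_zero, ord_unif, mul_one]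

theorem unif_zpow_ne_zero (n : ℤ) : unif L ^ n ≠ 0 := zpow_ne_zero n unif_ne_zero

theorem unif_zpow_mem (n : ℤ) : unif L ^ n ∈ pPow L n := by
  simpa [ord_unif_zpow] using mem_pPow_ord (unif L ^ n)

theorem mem_integers_iff {x : L} : x ∈ 𝒪[L] ↔ x ∈ pPow L 0 := by
  rw [mem_pPow_iff_val, Valuation.mem_integer_iff]
  simp only [neg_zero, exp_zero]
  constructor
  · intro h
    simpa using (valueGroupWithZeroIsoInt L).strictMono.monotone h
  · intro h
    rw [← map_one (valueGroupWithZeroIsoInt L)] at h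
    exact (valueGroupWithZeroIsoInt L).strictMono.le_iff_le.mp h

theorem isUnit_integers_iff {x : 𝒪[L]} : IsUnit x ↔ (x : L) ∉ pPow L 1 := by
  have hx := mem_integers_iff.mp x.2
  constructor
  · intro h hx1
    obtain ⟨y, hy⟩ := h.exists_right_inv
    have hy' : (x : L) * (y : L) = 1 := by exact_mod_cast congrArg Subtype.val hy
    have := pPow_mul hx1 (mem_integers_iff.mp y.2)
    rw [hy', mem_pPow_iff one_ne_zero, ord_one] at this
    omega
  · intro h
    have hx0 : (x : L) ≠ 0 := fun h0 => h (h0 ▸ zero_mem_pPow _)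
    have h0 : ord (x : L) = 0 := ord_eq_of_mem_of_not_mem hx (by simpa using h)
    refine isUnit_iff_exists_inv.mpr ⟨⟨(x : L)⁻¹, mem_integers_iff.mpr ?_⟩, ?_⟩
    · rw [mem_pPow_iff (inv_ne_zero hx0), ord_inv, h0]; simp
    · ext; simp [hx0]

theorem mem_maximalIdeal_iff {x : 𝒪[L]} : x ∈ 𝓂[L] ↔ (x : L) ∈ pPow L 1 := by
  rw [IsLocalRing.mem_maximalIdeal, mem_nonunits_iff, isUnit_integers_iff, not_not]

theorem residue_eq_iff {x y : 𝒪[L]} :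
    IsLocalRing.residue 𝒪[L] x = IsLocalRing.residue 𝒪[L] y ↔ (x : L) - y ∈ pPow L 1 := by
  rw [← sub_eq_zero, ← map_sub, IsLocalRing.residue_eq_zero_iff, mem_maximalIdeal_iff]
  rfl

/-- Hensel's lemma for the ring of integers of a local field. -/
theorem exists_root_of_simple_root (f : Polynomial 𝒪[L]) (hf : f.Monic) (a : 𝒪[L])
    (h : ((f.eval a : 𝒪[L]) : L) ∈ pPow L 1)
    (h' : ((f.derivative.eval a : 𝒪[L]) : L) ∉ pPow L 1) :
    ∃ b : 𝒪[L], f.eval b = 0 ∧ (b : L) - a ∈ pPow L 1 := by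
  let := IsTopologicalAddGroup.rightUniformSpace L
  have := isUniformAddGroup_of_addCommGroup (G := L)
  obtain ⟨b, hb, hb'⟩ := HenselianRing.is_henselian (I := 𝓂[L]) f hf a (mem_maximalIdeal_iff.mpr h)
    ((isUnit_integers_iff.mpr h').map _)
  exact ⟨b, hb, mem_maximalIdeal_iff.mp hb'⟩

/-- Every ball is a finite union of smaller balls. -/
theorem exists_finite_approx (k : ℕ) :
    ∃ S : Set L, S.Finite ∧ ∀ x ∈ pPow L 0, ∃ s ∈ S, x - s ∈ pPow L k := by
  induction k with
  | zero => exact ⟨{0}, Set.finite_singleton 0, fun x hx => ⟨0, rfl, by simpa using hx⟩⟩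
  | succ k ih =>
    obtain ⟨S, hS, h⟩ := ih
    let r : 𝓀[L] → 𝒪[L] := Function.surjInv (IsLocalRing.residue_surjective (R := 𝒪[L]))
    refine ⟨(fun p : L × 𝓀[L] => p.1 + unif L ^ (k : ℤ) * (r p.2 : L)) '' (S ×ˢ Set.univ),
      (hS.prod Set.finite_univ).image _, fun x hx => ?_⟩
    obtain ⟨s, hs, hxs⟩ := h x hx
    have hu : (unif L ^ (k : ℤ))⁻¹ * (x - s) ∈ pPow L 0 := by
      rw [← pPow_mul_iff (unif_zpow_ne_zero (k : ℤ)) (ord_unif_zpow _),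
        mul_inv_cancel_left₀ (unif_zpow_ne_zero _)]
      simpa using hxs
    set y : 𝒪[L] := ⟨_, mem_integers_iff.mpr hu⟩ with hy
    refine ⟨_, ⟨(s, IsLocalRing.residue _ y), ⟨hs, trivial⟩, rfl⟩, ?_⟩
    have hry : IsLocalRing.residue 𝒪[L] y = IsLocalRing.residue _ (r (IsLocalRing.residue _ y)) :=
      (Function.surjInv_eq (IsLocalRing.residue_surjective (R := 𝒪[L])) _).symm
    rw [residue_eq_iff] at hry
    have : x - (s + unif L ^ (k : ℤ) * (r (IsLocalRing.residue _ y) : L))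
        = unif L ^ (k : ℤ) * ((y : L) - r (IsLocalRing.residue _ y)) := by
      simp only [hy, mul_sub, mul_inv_cancel_left₀ (unif_zpow_ne_zero (L := L) (k : ℤ))]
      ring
    push_cast
    rw [this, pPow_mul_iff (unif_zpow_ne_zero (k : ℤ)) (ord_unif_zpow _)]
    exact hry

theorem mem_pPow_inv_mul {x y : L} {n : ℤ} (hx : x ≠ 0) :
    x⁻¹ * y ∈ pPow L n ↔ y ∈ pPow L (ord x + n) := by
  rw [← pPow_mul_iff (n := n) hx rfl, mul_inv_cancel_left₀ hx]

/-- In odd residue characteristic `2` is a unit. -/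
theorem two_unit (hp : ringChar 𝓀[L] ≠ 2) : (2 : L) ≠ 0 ∧ ord (2 : L) = 0 := by
  have h2 : (2 : 𝓀[L]) ≠ 0 := Ring.two_ne_zero hp
  have h : IsLocalRing.residue 𝒪[L] 2 ≠ IsLocalRing.residue 𝒪[L] 0 := by
    rw [map_zero, map_ofNat]; exact h2
  rw [Ne, residue_eq_iff] at h
  have h' : (2 : L) ∉ pPow L 1 := fun h2 => h (by
    rw [ZeroMemClass.coe_zero, sub_zero]; exact h2)
  have h0 : (2 : L) ∈ pPow L 0 := by
    have := pPow_add (one_mem_pPow (L := L)) one_mem_pPow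
    rwa [one_add_one_eq_two] at this
  exact ⟨fun h0 => h' (h0 ▸ zero_mem_pPow _), ord_eq_of_mem_of_not_mem h0 (by simpa using h')⟩

end LocalField

/-! ### Consequences of Hensel's lemma -/

section Hensel

open Polynomial

variable {L : Type*} [Field L] [ValuativeRel L] [TopologicalSpace L]
  [IsNonarchimedeanLocalField L]

theorem exists_sq_eq (h2 : ord (2 : L) = 0) (h2' : (2 : L) ≠ 0) {u : L} (hu : u - 1 ∈ pPow L 1) :
    ∃ w : L, w ^ 2 = u ∧ w - 1 ∈ pPow L 1 := by
  have hu0 : u ∈ 𝒪[L] := mem_integers_iff.mpr (by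
    have := pPow_add (pPow_anti (by omega : (0 : ℤ) ≤ 1) hu) one_mem_pPow
    simpa using this)
  obtain ⟨b, hb, hb'⟩ := exists_root_of_simple_root (X ^ 2 - C (⟨u, hu0⟩ : 𝒪[L]))
    (monic_X_pow_sub_C _ two_ne_zero) 1
    (by
      simp only [eval_sub, eval_pow, eval_X, one_pow, eval_C]
      have := pPow_neg hu
      rwa [neg_sub] at this)
    (by
      simp only [derivative_sub, derivative_X_pow, derivative_C, sub_zero, eval_mul, eval_C]
      norm_num
      intro h
      have h' : (2 : L) ∈ pPow L 1 := h
      rw [mem_pPow_iff h2'] at h'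
      omega)
  refine ⟨b, ?_, hb'⟩
  simp only [eval_sub, eval_pow, eval_X, eval_C, sub_eq_zero] at hb
  exact congrArg Subtype.val hb

/-- Teichmüller representatives. -/
theorem exists_root_of_unity {x : L} (hx0 : x ≠ 0) (hx : ord x = 0) :
    ∃ ζ : L, ζ ^ (Nat.card 𝓀[L] - 1) = 1 ∧ ζ - x ∈ pPow L 1 := by
  have : Fintype 𝓀[L] := Fintype.ofFinite _
  set n := Nat.card 𝓀[L] - 1 with hn
  have hcard : Nat.card 𝓀[L] = n + 1 := by
    have := Nat.card_pos (α := 𝓀[L])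
    omega
  have hn0 : n ≠ 0 := by
    have := Finite.one_lt_card (α := 𝓀[L])
    omega
  have hxO : x ∈ 𝒪[L] := mem_integers_iff.mpr (hx ▸ mem_pPow_ord x)
  have hres : IsLocalRing.residue 𝒪[L] ⟨x, hxO⟩ ≠ 0 := by
    rw [Ne, IsLocalRing.residue_eq_zero_iff, mem_maximalIdeal_iff, mem_pPow_iff hx0]
    omega
  have hpow : IsLocalRing.residue 𝒪[L] ⟨x, hxO⟩ ^ n = 1 := by
    rw [hn, Nat.card_eq_fintype_card]
    exact FiniteField.pow_card_sub_one_eq_one _ hres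
  have hnk : ((n : ℕ) : 𝓀[L]) = -1 := by
    have h : ((Fintype.card 𝓀[L] : ℕ) : 𝓀[L]) = 0 := Nat.cast_card_eq_zero _
    rw [← Nat.card_eq_fintype_card, hcard] at h
    push_cast at h
    linear_combination h
  obtain ⟨b, hb, hb'⟩ := exists_root_of_simple_root (X ^ n - C (1 : 𝒪[L]))
    (monic_X_pow_sub_C _ hn0) ⟨x, hxO⟩
    (by
      rw [← mem_maximalIdeal_iff, ← IsLocalRing.residue_eq_zero_iff]
      simp only [eval_sub, eval_pow, eval_X, eval_one, map_sub, map_pow, map_one, hpow, sub_self])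
    (by
      rw [← mem_maximalIdeal_iff, ← IsLocalRing.residue_eq_zero_iff]
      simp only [derivative_sub, derivative_X_pow, derivative_C, sub_zero, eval_mul, eval_natCast,
        eval_pow, eval_X, map_mul, map_pow, map_natCast, hnk]
      exact mul_ne_zero (neg_ne_zero.mpr one_ne_zero) (pow_ne_zero _ hres))
  refine ⟨b, ?_, hb'⟩
  simp only [eval_sub, eval_pow, eval_X, eval_C, sub_eq_zero] at hb
  exact congrArg Subtype.val hb

end Hensel

/-! ### Quadratic extensions -/

section Quadratic

variable (F E : Type*) [Field F] [ValuativeRel F] [TopologicalSpace F]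
  [IsNonarchimedeanLocalField F] [Field E] [ValuativeRel E] [TopologicalSpace E]
  [IsNonarchimedeanLocalField E] [Algebra F E]

/-- A tame quadratic extension of local fields of odd residue characteristic, with its conjugation
`σ`, a generator `δ` of trace zero, and the ramification index `e`. -/
structure Quad where
  /-- The nontrivial automorphism. -/
  σ : E ≃ₐ[F] E
  /-- A generator of trace zero. -/
  δ : E
  δ_ne : δ ≠ 0
  σ_δ : σ δ = -δ
  tr_eq : ∀ x, algebraMap F E (Algebra.trace F E x) = x + σ x
  nm_eq : ∀ x, algebraMap F E (Algebra.norm F x) = x * σ x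
  two_ne : (2 : E) ≠ 0
  ord_two : ord (2 : E) = 0
  ord_two' : ord (2 : F) = 0
  odd_char : ringChar 𝓀[F] ≠ 2
  ord_σ : ∀ x, ord (σ x) = ord x
  /-- The ramification index. -/
  e : ℤ
  e_cases : e = 1 ∨ e = 2
  ord_map : ∀ x : F, ord (algebraMap F E x) = e * ord x
  unram_iff : Unramified F E ↔ e = 1
  ord_δ : e = 1 → ord δ = 0

variable {F E}

theorem ord_algebraMap_of_ord_zero [ValuativeExtension F E] {u : F} (hu0 : u ≠ 0)
    (hu : ord u = 0) : ord (algebraMap F E u) = 0 := by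
  have hle : ∀ v : F, v ∈ pPow F 0 → algebraMap F E v ∈ pPow E 0 := by
    intro v hv
    rw [← mem_integers_iff, Valuation.mem_integer_iff, ← map_one (ValuativeRel.valuation _),
      ← Valuation.Compatible.vle_iff_le] at hv ⊢
    rw [← map_one (algebraMap F E)]
    exact (ValuativeExtension.vle_iff_vle _ _).mpr hv
  have hE0 : algebraMap F E u ≠ 0 := by simpa using hu0
  have h1 := hle u (hu ▸ mem_pPow_ord u)
  have h2 := hle u⁻¹ (by rw [mem_pPow_iff (inv_ne_zero hu0), ord_inv, hu]; simp)
  rw [mem_pPow_iff hE0] at h1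
  rw [map_inv₀, mem_pPow_iff (inv_ne_zero hE0), ord_inv] at h2
  omega

theorem exists_ord_map [ValuativeExtension F E] :
    ∃ e : ℤ, 0 < e ∧ ∀ x : F, ord (algebraMap F E x) = e * ord x := by
  refine ⟨ord (algebraMap F E (unif F)), ?_, fun x => ?_⟩
  · have h : unif F ∈ pPow F 1 := by simpa using mem_pPow_ord (unif F)
    have hE0 : algebraMap F E (unif F) ≠ 0 := by simpa using unif_ne_zero (L := F)
    have : algebraMap F E (unif F) ∈ pPow E 0 ∧ (algebraMap F E (unif F))⁻¹ ∉ pPow E 0 := by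
      rw [← map_inv₀]
      simp only [← mem_integers_iff, Valuation.mem_integer_iff]
      simp only [← map_one (ValuativeRel.valuation E), ← Valuation.Compatible.vle_iff_le]
      rw [← map_one (algebraMap F E)]
      simp only [ValuativeExtension.vle_iff_vle]
      simp only [Valuation.Compatible.vle_iff_le (v := ValuativeRel.valuation F), map_one]
      simp only [← Valuation.mem_integer_iff, mem_integers_iff]
      constructor
      · exact pPow_anti (by omega) h
      · rw [mem_pPow_iff (inv_ne_zero unif_ne_zero), ord_inv, ord_unif]; omega
    rw [mem_pPow_iff (inv_ne_zero hE0), ord_inv] at this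
    omega
  · by_cases hx : x = 0
    · simp [hx, ord]
    have hu := unif_zpow_ne_zero (L := F) (ord x)
    have h0 : ord (algebraMap F E (x / unif F ^ ord x)) = 0 :=
      ord_algebraMap_of_ord_zero (div_ne_zero hx hu) (by
        rw [ord_div hx hu, ord_unif_zpow, sub_self])
    have hE0 : algebraMap F E (unif F) ≠ 0 := by simpa using unif_ne_zero (L := F)
    rw [map_div₀, map_zpow₀, ord_div (by simpa using hx) (zpow_ne_zero _ hE0), ord_zpow hE0] at h0
    linarith

theorem isSeparable_of_finrank_two (h2 : (2 : F) ≠ 0) (hE : Module.finrank F E = 2) :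
    Algebra.IsSeparable F E := by
  have : FiniteDimensional F E := .of_finrank_pos (by omega)
  refine ⟨fun x => ?_⟩
  have hint := Algebra.IsIntegral.isIntegral (R := F) x
  have hdvd := minpoly.degree_dvd hint
  rw [hE, Nat.dvd_prime Nat.prime_two] at hdvd
  rw [IsSeparable, Polynomial.separable_iff_derivative_ne_zero (minpoly.irreducible hint)]
  intro h
  have hc := congrArg (fun p => p.coeff ((minpoly F x).natDegree - 1)) h
  simp only [Polynomial.coeff_derivative, Polynomial.coeff_zero] at hc
  have hd : (minpoly F x).natDegree - 1 + 1 = (minpoly F x).natDegree := by omega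
  have hm : (minpoly F x).leadingCoeff = 1 := minpoly.monic hint
  rw [hd] at hc
  rw [Polynomial.leadingCoeff] at hm
  rw [hm] at hc
  rcases hdvd with h1 | h1 <;> rw [h1] at hc <;> norm_num at hc
  exact h2 hc

theorem exists_conjugation (h2 : (2 : F) ≠ 0) (hE : Module.finrank F E = 2) :
    ∃ σ : E ≃ₐ[F] E, (∀ x, algebraMap F E (Algebra.trace F E x) = x + σ x) ∧
      (∀ x, algebraMap F E (Algebra.norm F x) = x * σ x) ∧ σ ≠ 1 := by
  have := isSeparable_of_finrank_two h2 hE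
  have : FiniteDimensional F E := .of_finrank_pos (by omega)
  have : Algebra.IsQuadraticExtension F E := ⟨hE⟩
  have hcard : Nat.card Gal(E/F) = 2 := by rw [IsGalois.card_aut_eq_finrank, hE]
  classical
  rw [Nat.card_eq_fintype_card, ← Finset.card_univ, Finset.card_eq_two] at hcard
  obtain ⟨s, t, hst, huniv⟩ := hcard
  have h1 : ∃ σ : Gal(E/F), σ ≠ 1 ∧ (Finset.univ : Finset Gal(E/F)) = {1, σ} := by
    have : (1 : Gal(E/F)) ∈ ({s, t} : Finset _) := huniv ▸ Finset.mem_univ _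
    simp only [Finset.mem_insert, Finset.mem_singleton] at this
    rcases this with rfl | rfl
    · exact ⟨t, hst.symm, huniv⟩
    · exact ⟨s, hst, by rw [huniv, Finset.pair_comm]⟩
  obtain ⟨σ, hσ, hu⟩ := h1
  refine ⟨σ, fun x => ?_, fun x => ?_, hσ⟩
  · rw [trace_eq_sum_automorphisms, hu, Finset.sum_pair hσ.symm]; rfl
  · rw [Algebra.norm_eq_prod_automorphisms, hu, Finset.prod_pair hσ.symm]; rfl

/-- The valuation of a quadratic extension is invariant under conjugation: otherwise there is `u`
of norm one and positive valuation, whose minimal polynomial has distinct roots modulo `𝔭` after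
rescaling, hence splits over `F` by Hensel's lemma. -/
theorem ord_conj_eq {e : ℤ} (he : 0 < e) (hmap : ∀ x : F, ord (algebraMap F E x) = e * ord x)
    (σ : E ≃ₐ[F] E) (htr : ∀ x, algebraMap F E (Algebra.trace F E x) = x + σ x)
    (hinv : ∀ x, σ (σ x) = x) (x : E) : ord (σ x) = ord x := by
  have key : ∀ u : E, u * σ u = 1 → ¬ 0 < ord u := by
    intro u hu hpos
    have hu0 : u ≠ 0 := left_ne_zero_of_mul_eq_one hu
    have hσ : σ u = u⁻¹ := eq_inv_of_mul_eq_one_right hu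
    set T := Algebra.trace F E u with hT
    have hTE : algebraMap F E T = u⁻¹ + u := by rw [hT, htr, hσ, add_comm]
    have hord : algebraMap F E T ≠ 0 ∧ ord (algebraMap F E T) = -ord u := by
      rw [hTE]
      exact ord_add_eq (inv_ne_zero hu0) (ord_inv u) (pPow_anti (by omega) (mem_pPow_ord u))
    have hT0 : T ≠ 0 := by simpa using hord.1
    have hTn : ord T < 0 := by
      have := hord.2
      rw [hmap] at this
      nlinarith
    have hT2 : (T⁻¹) ^ 2 ∈ pPow F 1 := by
      rw [mem_pPow_iff (pow_ne_zero _ (inv_ne_zero hT0)), ord_pow (inv_ne_zero hT0), ord_inv]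
      push_cast; omega
    open Polynomial in
    obtain ⟨b, hb, -⟩ := exists_root_of_simple_root
      (X ^ 2 - X + C (⟨_, mem_integers_iff.mpr (pPow_anti (by omega : (0 : ℤ) ≤ 1) hT2)⟩ : 𝒪[F]))
      (by monicity!) 0 (by simpa using hT2) (by
        simp only [derivative_add, derivative_sub, derivative_X_pow, derivative_X, derivative_C]
        simp only [Nat.cast_ofNat, map_ofNat, Nat.add_one_sub_one, pow_one, add_zero, eval_sub,
          eval_mul, eval_X, mul_zero, eval_one, zero_sub]
        intro h
        have h' : (-1 : F) ∈ pPow F 1 := h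
        rw [mem_pPow_iff (by simp), ord_neg, ord_one] at h'
        omega)
    have hb' : (b : F) ^ 2 - b + T⁻¹ ^ 2 = 0 := by
      have := congrArg Subtype.val hb
      simpa using this
    have hX : (algebraMap F E (T * b) - u) * (algebraMap F E (T * b) - u⁻¹) = 0 := by
      have h3 : (T * b) ^ 2 - T * (T * b) + 1 = 0 := by
        field_simp at hb'
        linear_combination hb'
      have h4 := congrArg (algebraMap F E) h3
      simp only [map_add, map_sub, map_pow, map_mul, map_one, map_zero] at h4 ⊢
      rw [hTE] at h4 ⊢
      field_simp at h4 ⊢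
      linear_combination h4
    have hfix : σ u = u := by
      rcases mul_eq_zero.mp hX with h | h
      · rw [← sub_eq_zero.mp h, AlgEquiv.commutes]
      · have h5 : u = algebraMap F E (T * b)⁻¹ := by
          rw [map_inv₀, sub_eq_zero.mp h, inv_inv]
        rw [h5, AlgEquiv.commutes]
    rw [hfix] at hu
    have := ord_mul hu0 hu0
    rw [hu, ord_one] at this
    omega
  by_cases hx : x = 0
  · simp [hx]
  have hσx : σ x ≠ 0 := by simpa using hx
  have h1 := key (x / σ x) (by rw [map_div₀, hinv]; field_simp)
  have h2 := key (σ x / x) (by rw [map_div₀, hinv]; field_simp)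
  rw [ord_div hx hσx] at h1
  rw [ord_div hσx hx] at h2
  omega

theorem exists_quad [ValuativeExtension F E] (hp : ringChar 𝓀[F] ≠ 2)
    (hE : Module.finrank F E = 2) : Nonempty (Quad F E) := by
  obtain ⟨h2, h2o⟩ := two_unit hp
  obtain ⟨σ, htr, hnm, hσ⟩ := exists_conjugation h2 hE
  obtain ⟨e, he, hmap⟩ := exists_ord_map (F := F) (E := E)
  have hinv : ∀ x, σ (σ x) = x := by
    intro x
    have := congrArg σ (htr x)
    rw [AlgEquiv.commutes, htr, map_add] at this
    linear_combination -this
  have hσord := ord_conj_eq he hmap σ htr hinv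
  have h2E : (2 : E) ≠ 0 := by
    rw [← map_ofNat (algebraMap F E) 2]; simpa using h2
  have he12 : e = 1 ∨ e = 2 := by
    have h := hmap (Algebra.norm F (unif E))
    rw [hnm, ord_mul unif_ne_zero (by simpa using unif_ne_zero (L := E)), hσord, ord_unif] at h
    have hd : e ∣ 2 := ⟨_, h⟩
    have := Int.le_of_dvd (by omega) hd
    omega
  have hun : Unramified F E ↔ e = 1 := by
    constructor
    · intro h
      have := h (unif F)
      rw [hmap, ord_unif] at this
      omega
    · rintro rfl x
      rw [hmap, one_mul]
  obtain ⟨y, hy⟩ : ∃ y, σ y ≠ y := by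
    by_contra! h
    exact hσ (AlgEquiv.ext h)
  have hδ0 : y - σ y ≠ 0 := sub_ne_zero.mpr (Ne.symm hy)
  have hϖ : algebraMap F E (unif F ^ (-ord (y - σ y))) ≠ 0 := by
    exact (map_ne_zero _).mpr (unif_zpow_ne_zero _)
  refine ⟨⟨σ, algebraMap F E (unif F ^ (-ord (y - σ y))) * (y - σ y), mul_ne_zero hϖ hδ0,
    by rw [map_mul, AlgEquiv.commutes, map_sub, hinv]; ring, htr, hnm, h2E, ?_, h2o, hp, hσord, e, he12,
    hmap, hun, ?_⟩⟩
  · rw [← map_ofNat (algebraMap F E) 2, hmap, h2o, mul_zero]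
  · rintro rfl
    rw [ord_mul hϖ hδ0, hmap, ord_unif_zpow]; ring

end Quadratic

section QuadraticArith

variable {F E : Type*} [Field F] [ValuativeRel F] [TopologicalSpace F]
  [IsNonarchimedeanLocalField F] [Field E] [ValuativeRel E] [TopologicalSpace E]
  [IsNonarchimedeanLocalField E] [Algebra F E]

namespace Quad

variable (Q : Quad F E)

include Q

theorem two_ne' : (2 : F) ≠ 0 := fun h => Q.two_ne (by
  rw [← map_ofNat (algebraMap F E) 2, h, map_zero])

theorem e_pos : 0 < Q.e := by rcases Q.e_cases with h | h <;> omega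

@[simp] theorem σ_σ (x : E) : Q.σ (Q.σ x) = x := by
  have := congrArg Q.σ (Q.tr_eq x)
  rw [AlgEquiv.commutes, Q.tr_eq, map_add] at this
  linear_combination -this

@[simp] theorem σ_mem {n : ℤ} {x : E} : Q.σ x ∈ pPow E n ↔ x ∈ pPow E n := by
  by_cases hx : x = 0
  · simp [hx]
  · rw [mem_pPow_iff hx, mem_pPow_iff (by simpa using hx), Q.ord_σ]

theorem map_mem_iff {n : ℤ} {x : F} : algebraMap F E x ∈ pPow E (Q.e * n) ↔ x ∈ pPow F n := by
  by_cases hx : x = 0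
  · simp [hx]
  · rw [mem_pPow_iff hx, mem_pPow_iff (by simpa using hx), Q.ord_map]
    exact Int.mul_le_mul_left Q.e_pos

theorem map_mem {n : ℕ} {x : F} (hx : x ∈ pPow F n) : algebraMap F E x ∈ pPow E n :=
  pPow_anti (by have := Q.e_pos; nlinarith) (Q.map_mem_iff.mpr hx)

theorem mem_of_map_mem_one {x : F} (hx : algebraMap F E x ∈ pPow E 1) : x ∈ pPow F 1 := by
  by_cases hx0 : x = 0
  · simp [hx0]
  rw [mem_pPow_iff (by simpa using hx0), Q.ord_map] at hx
  rw [mem_pPow_iff hx0]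
  by_contra h
  have := Q.e_pos
  nlinarith

theorem half_mem {n : ℤ} {x : E} (hx : x ∈ pPow E n) : x / 2 ∈ pPow E n := by
  rw [div_eq_inv_mul]
  refine pPow_mul' (n := 0) ?_ hx (by omega)
  rw [mem_pPow_iff (inv_ne_zero Q.two_ne), ord_inv, Q.ord_two]; simp

theorem two_mem_iff {n : ℤ} {x : E} : 2 * x ∈ pPow E n ↔ x ∈ pPow E n := by
  have := pPow_mul_iff (n := n) (y := x) Q.two_ne Q.ord_two
  rwa [zero_add] at this

theorem ord_norm {x : E} (hx : x ≠ 0) : ord (algebraMap F E (Algebra.norm F x)) = 2 * ord x := by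
  rw [Q.nm_eq, ord_mul hx (by simpa using hx), Q.ord_σ]; ring

theorem norm_map (a : F) : Algebra.norm F (algebraMap F E a) = a ^ 2 := by
  apply (algebraMap F E).injective
  rw [Q.nm_eq, AlgEquiv.commutes, map_pow, sq]

theorem trace_map (a : F) : Algebra.trace F E (algebraMap F E a) = 2 * a := by
  apply (algebraMap F E).injective
  rw [Q.tr_eq, AlgEquiv.commutes, map_mul, map_ofNat, two_mul]

theorem trace_σ (x : E) : Algebra.trace F E (Q.σ x) = Algebra.trace F E x := by
  apply (algebraMap F E).injective
  rw [Q.tr_eq, Q.tr_eq, σ_σ, add_comm]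

theorem exists_of_fixed {x : E} (h : Q.σ x = x) : ∃ a : F, algebraMap F E a = x := by
  refine ⟨Algebra.trace F E x / 2, ?_⟩
  rw [map_div₀, Q.tr_eq, h, map_ofNat]
  field_simp [Q.two_ne]
  ring

theorem exists_coords (x : E) : ∃ a b : F, x = algebraMap F E a + algebraMap F E b * Q.δ := by
  have h2 := Q.two_ne
  have hδ := Q.δ_ne
  obtain ⟨a, ha⟩ := Q.exists_of_fixed (x := (x + Q.σ x) / 2) (by
    rw [map_div₀, map_add, σ_σ, map_ofNat, add_comm])
  obtain ⟨b, hb⟩ := Q.exists_of_fixed (x := (x - Q.σ x) / (2 * Q.δ)) (by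
    rw [map_div₀, map_sub, σ_σ, map_mul, map_ofNat, Q.σ_δ]
    field_simp
    ring)
  refine ⟨a, b, ?_⟩
  rw [ha, hb]
  field_simp
  ring

theorem δ_not_mem : Q.δ ∉ Set.range (algebraMap F E) := by
  rintro ⟨a, ha⟩
  have := Q.σ_δ
  rw [← ha, AlgEquiv.commutes, ha] at this
  have h : 2 * Q.δ = 0 := by linear_combination this
  rcases mul_eq_zero.mp h with h | h
  · exact Q.two_ne h
  · exact Q.δ_ne h

theorem σ_coords (a b : F) : Q.σ (algebraMap F E a + algebraMap F E b * Q.δ)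
    = algebraMap F E a - algebraMap F E b * Q.δ := by
  rw [map_add, map_mul, AlgEquiv.commutes, AlgEquiv.commutes, Q.σ_δ]; ring

theorem coords_mem_iff (he : Q.e = 1) {n : ℤ} {a b : F} :
    algebraMap F E a + algebraMap F E b * Q.δ ∈ pPow E n ↔ a ∈ pPow F n ∧ b ∈ pPow F n := by
  have hm : ∀ x : F, algebraMap F E x ∈ pPow E n ↔ x ∈ pPow F n := fun x => by
    have := Q.map_mem_iff (n := n) (x := x)
    rwa [he, one_mul] at this
  have hδ : ∀ x : E, x * Q.δ ∈ pPow E n ↔ x ∈ pPow E n := fun x => by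
    have := pPow_mul_iff (n := n) (y := x) Q.δ_ne (Q.ord_δ he)
    rwa [zero_add, mul_comm] at this
  constructor
  · intro h
    have h' := Q.σ_mem.mpr h
    rw [σ_coords] at h'
    have h1 := pPow_add h h'
    have h2 := pPow_sub h h'
    rw [show algebraMap F E a + algebraMap F E b * Q.δ + (algebraMap F E a - algebraMap F E b * Q.δ)
      = 2 * algebraMap F E a by ring, Q.two_mem_iff, hm] at h1
    rw [show algebraMap F E a + algebraMap F E b * Q.δ - (algebraMap F E a - algebraMap F E b * Q.δ)
      = 2 * (algebraMap F E b * Q.δ) by ring, Q.two_mem_iff, hδ, hm] at h2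
    exact ⟨h1, h2⟩
  · rintro ⟨h1, h2⟩
    exact pPow_add ((hm a).mpr h1) ((hδ _).mpr ((hm b).mpr h2))

/-- An unramified quadratic extension has residue degree two. -/
theorem card_residue (he : Q.e = 1) : Nat.card 𝓀[E] = Nat.card 𝓀[F] ^ 2 := by
  let r : 𝓀[F] → 𝒪[F] := Function.surjInv (IsLocalRing.residue_surjective (R := 𝒪[F]))
  have hr : ∀ x, IsLocalRing.residue 𝒪[F] (r x) = x :=
    Function.surjInv_eq (IsLocalRing.residue_surjective (R := 𝒪[F]))
  have hmem : ∀ x y : 𝒪[F], algebraMap F E x + algebraMap F E y * Q.δ ∈ 𝒪[E] := fun x y => by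
    rw [mem_integers_iff, Q.coords_mem_iff he]
    exact ⟨mem_integers_iff.mp x.2, mem_integers_iff.mp y.2⟩
  have hsub : ∀ a b a' b' : F, (algebraMap F E a + algebraMap F E b * Q.δ)
      - (algebraMap F E a' + algebraMap F E b' * Q.δ)
      = algebraMap F E (a - a') + algebraMap F E (b - b') * Q.δ := fun a b a' b' => by
    simp only [map_sub]; ring
  let f : 𝓀[F] × 𝓀[F] → 𝓀[E] := fun p => IsLocalRing.residue 𝒪[E] ⟨_, hmem (r p.1) (r p.2)⟩
  have hf : Function.Bijective f := by
    constructor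
    · rintro ⟨a, b⟩ ⟨a', b'⟩ h
      simp only [f] at h
      rw [residue_eq_iff, hsub, Q.coords_mem_iff he, ← residue_eq_iff, ← residue_eq_iff] at h
      simp only [hr] at h
      ext1
      exacts [h.1, h.2]
    · intro z
      obtain ⟨⟨x, hx⟩, rfl⟩ := IsLocalRing.residue_surjective z
      obtain ⟨a, b, hab⟩ := Q.exists_coords x
      have hx' := mem_integers_iff.mp hx
      rw [hab, Q.coords_mem_iff he] at hx'
      refine ⟨(IsLocalRing.residue _ ⟨a, mem_integers_iff.mpr hx'.1⟩,
        IsLocalRing.residue _ ⟨b, mem_integers_iff.mpr hx'.2⟩), ?_⟩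
      simp only [f]
      rw [residue_eq_iff]
      simp only [hab]
      rw [hsub, Q.coords_mem_iff he]
      have h1 := hr (IsLocalRing.residue _ ⟨a, mem_integers_iff.mpr hx'.1⟩)
      have h2 := hr (IsLocalRing.residue _ ⟨b, mem_integers_iff.mpr hx'.2⟩)
      rw [residue_eq_iff] at h1 h2
      exact ⟨h1, h2⟩
  rw [← Nat.card_congr (Equiv.ofBijective f hf), Nat.card_prod, sq]

theorem norm_coords (a b : F) : Algebra.norm F (algebraMap F E a + algebraMap F E b * Q.δ)
    = a ^ 2 + b ^ 2 * Algebra.norm F Q.δ := by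
  apply (algebraMap F E).injective
  rw [Q.nm_eq, σ_coords]
  simp only [map_add, map_mul, map_pow, Q.nm_eq, Q.σ_δ]
  ring

theorem norm_of_sub_one_mem {u : F} (hu : u - 1 ∈ pPow F 1) : ∃ x : E, Algebra.norm F x = u := by
  obtain ⟨w, hw, -⟩ := exists_sq_eq Q.ord_two' Q.two_ne' hu
  exact ⟨algebraMap F E w, by rw [Q.norm_map, hw]⟩

/-- A unit congruent to a norm modulo `𝔭` is a norm. -/
theorem norm_of_sub_mem {u : F} {x : E} (hu0 : u ≠ 0) (hu : ord u = 0)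
    (h : Algebra.norm F x - u ∈ pPow F 1) : ∃ y : E, Algebra.norm F y = u := by
  have h1 : Algebra.norm F x ≠ 0 ∧ ord (Algebra.norm F x) = 0 := by
    have := ord_add_eq hu0 hu (y := Algebra.norm F x - u) (by simpa using h)
    simpa using this
  obtain ⟨z, hz⟩ := Q.norm_of_sub_one_mem (u := (Algebra.norm F x)⁻¹ * u) (by
    rw [show (Algebra.norm F x)⁻¹ * u - 1 = (Algebra.norm F x)⁻¹ * (-(Algebra.norm F x - u)) by
      field_simp [h1.1]; ring, mem_pPow_inv_mul h1.1, h1.2, zero_add]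
    exact pPow_neg h)
  refine ⟨x * z, ?_⟩
  rw [map_mul, hz, mul_inv_cancel_left₀ h1.1]

/-- Units are norms in an unramified extension. -/
theorem exists_norm_eq (he : Q.e = 1) {u : F} (hu0 : u ≠ 0) (hu : ord u = 0) :
    ∃ x : E, Algebra.norm F x = u := by
  have : Fintype 𝓀[F] := Fintype.ofFinite _
  have hδN : Algebra.norm F Q.δ ≠ 0 ∧ ord (Algebra.norm F Q.δ) = 0 := by
    refine ⟨fun h => ?_, ?_⟩
    · have := Q.nm_eq Q.δ
      rw [h, map_zero, Q.σ_δ, eq_comm, mul_eq_zero, neg_eq_zero, or_self] at this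
      exact Q.δ_ne this
    · have := Q.ord_norm Q.δ_ne
      rw [Q.ord_map, Q.ord_δ he, he] at this
      omega
  set d : 𝒪[F] := ⟨_, mem_integers_iff.mpr (hδN.2 ▸ mem_pPow_ord (Algebra.norm F Q.δ))⟩ with hd
  set u' : 𝒪[F] := ⟨u, mem_integers_iff.mpr (hu ▸ mem_pPow_ord u)⟩ with hu'
  have hdn : IsLocalRing.residue _ d ≠ 0 := by
    rw [Ne, IsLocalRing.residue_eq_zero_iff, mem_maximalIdeal_iff]
    simp only [hd]
    rw [mem_pPow_iff hδN.1]; omega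
  open Polynomial in
  obtain ⟨a, b, hab⟩ := FiniteField.exists_root_sum_quadratic
    (f := (X ^ 2 - C (IsLocalRing.residue _ u') : 𝓀[F][X]))
    (g := (C (IsLocalRing.residue _ d) * X ^ 2 : 𝓀[F][X]))
    (degree_X_pow_sub_C (by norm_num) _) (degree_C_mul_X_pow 2 hdn)
    (FiniteField.odd_card_of_char_ne_two Q.odd_char)
  obtain ⟨a, rfl⟩ := IsLocalRing.residue_surjective a
  obtain ⟨b, rfl⟩ := IsLocalRing.residue_surjective b
  simp only [Polynomial.eval_sub, Polynomial.eval_pow, Polynomial.eval_X, Polynomial.eval_C,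
    Polynomial.eval_mul, ← map_pow, ← map_mul, ← map_sub, ← map_add] at hab
  rw [IsLocalRing.residue_eq_zero_iff, mem_maximalIdeal_iff] at hab
  refine Q.norm_of_sub_mem (x := algebraMap F E a + algebraMap F E b * Q.δ) hu0 hu ?_
  rw [Q.norm_coords]
  have h : (a : F) ^ 2 + (b : F) ^ 2 * Algebra.norm F Q.δ - u
    = ((a ^ 2 - u' + d * b ^ 2 : 𝒪[F]) : F) := by
    push_cast; simp only [hd, hu']; ring
  rw [h]; exact hab

end Quad

/-! ### Additive characters -/

variable {Ω : Type*} [Field Ω] {ψ : AddChar F Ω}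

namespace Quad

variable (Q : Quad F E)

include Q

theorem psi_trace_eq_one (hψ : HasLevelZero ψ) {x : E} (hx : x ∈ pPow E 1) :
    ψ (Algebra.trace F E x) = 1 := by
  refine hψ.1 _ (Q.mem_of_map_mem_one ?_)
  rw [Q.tr_eq]
  exact pPow_add hx (Q.σ_mem.mpr hx)

/-- The pairing `(x, y) ↦ ψ_E (x y)` is nondegenerate: the orthogonal of `𝔭 ^ k` is
`𝔭 ^ (1 - k)`. -/
theorem mem_of_psi_trace (hψ : HasLevelZero ψ) {y : E} {k : ℤ}
    (h : ∀ z ∈ pPow E k, ψ (Algebra.trace F E (y * z)) = 1) : y ∈ pPow E (1 - k) := by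
  by_contra hy
  have hy0 : y ≠ 0 := fun h0 => hy (h0 ▸ zero_mem_pPow _)
  rw [mem_pPow_iff hy0] at hy
  obtain ⟨u, hu, hψu⟩ := hψ.2
  apply hψu
  have hz : y⁻¹ * (algebraMap F E u / 2) ∈ pPow E k := by
    rw [mem_pPow_inv_mul hy0]
    refine pPow_anti (by omega) (Q.half_mem (Q.map_mem (n := 0) hu))
  rw [← h _ hz, mul_inv_cancel_left₀ hy0]
  congr 1
  apply (algebraMap F E).injective
  rw [Q.tr_eq, map_div₀, AlgEquiv.commutes, map_ofNat]
  field_simp [Q.two_ne]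
  ring

end Quad

theorem finite_pSub_quotient {h k : ℤ} (hhk : h ≤ k) :
    Finite (pSub E h ⧸ (pSub E k).addSubgroupOf (pSub E h)) := by
  obtain ⟨N, rfl⟩ : ∃ N : ℕ, k = h + N := ⟨(k - h).toNat, by omega⟩
  obtain ⟨S, hS, hS'⟩ := exists_finite_approx (L := E) N
  have : Finite S := hS
  classical
  -- Send each class to an approximation of its rescaled representative.
  have key : ∀ x : pSub E h, ∃ s : S, (unif E ^ h)⁻¹ * x - s ∈ pPow E N := by
    intro x
    obtain ⟨s, hs, h1⟩ := hS' ((unif E ^ h)⁻¹ * x) (by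
      rw [mem_pPow_inv_mul (unif_zpow_ne_zero h), ord_unif_zpow, add_zero]; exact x.2)
    exact ⟨⟨s, hs⟩, h1⟩
  choose f hf using key
  refine Finite.of_injective
    (fun q : pSub E h ⧸ (pSub E (h + N)).addSubgroupOf (pSub E h) => f (Quotient.out q)) ?_
  intro a b hab
  simp only at hab
  rw [← QuotientAddGroup.out_eq' a, ← QuotientAddGroup.out_eq' b, QuotientAddGroup.eq,
    AddSubgroup.mem_addSubgroupOf]
  have h1 := pPow_sub (hf (Quotient.out b)) (hf (Quotient.out a))
  rw [hab, sub_sub_sub_cancel_right, ← mul_sub, mem_pPow_inv_mul (unif_zpow_ne_zero h),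
    ord_unif_zpow] at h1
  simpa [neg_add_eq_sub] using h1

/-- The characters of `𝔭 ^ h` trivial on `𝔭 ^ k` are all of the form `x ↦ ψ_E (β x)`: there are at
least as many characters of this form as elements of `𝔭 ^ h / 𝔭 ^ k`, and at most as many
characters by linear independence. -/
theorem Quad.exists_of_additive (Q : Quad F E) (hψ : HasLevelZero ψ) {h k : ℤ} (hhk : h ≤ k)
    (θ : E → Ω)
    (hadd : ∀ x ∈ pPow E h, ∀ y ∈ pPow E h, θ (x + y) = θ x * θ y)
    (hone : ∀ x ∈ pPow E k, θ x = 1) :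
    ∃ β : E, ∀ x ∈ pPow E h, θ x = ψ (Algebra.trace F E (β * x)) := by
  set H := (pSub E k).addSubgroupOf (pSub E h) with hH
  let G := pSub E h ⧸ H
  have : Finite G := finite_pSub_quotient hhk
  have hle : ∀ {x : E}, x ∈ pPow E k → x ∈ pPow E h := fun hx => pPow_anti hhk hx
  -- A function on `𝔭 ^ h` which is additive and trivial on `𝔭 ^ k` descends.
  have desc : ∀ η : E → Ω, (∀ x ∈ pPow E h, ∀ y ∈ pPow E h, η (x + y) = η x * η y) →
      (∀ x ∈ pPow E k, η x = 1) →
      ∃ f : Multiplicative G →* Ω, ∀ x : pSub E h,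
        f (Multiplicative.ofAdd (QuotientAddGroup.mk x)) = η x := by
    intro η h1 h2
    refine ⟨⟨⟨fun g => Quotient.liftOn' (Multiplicative.toAdd g) (fun x => η x) ?_, ?_⟩, ?_⟩,
      fun x => rfl⟩
    · intro x y hxy
      rw [QuotientAddGroup.leftRel_apply, AddSubgroup.mem_addSubgroupOf] at hxy
      have : (y : E) = x + ((-x + y : pSub E h) : E) := by push_cast; abel
      change η x = η y
      rw [this, h1 _ x.2 _ (hle hxy), h2 _ hxy, mul_one]
    · exact h2 0 (zero_mem_pPow _)
    · intro a b
      obtain ⟨x, rfl⟩ : ∃ x : pSub E h, Multiplicative.ofAdd (QuotientAddGroup.mk x : G) = a :=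
        QuotientAddGroup.mk_surjective (Multiplicative.toAdd a)
      obtain ⟨y, rfl⟩ : ∃ y : pSub E h, Multiplicative.ofAdd (QuotientAddGroup.mk y : G) = b :=
        QuotientAddGroup.mk_surjective (Multiplicative.toAdd b)
      exact h1 _ x.2 _ y.2
  let c : E := unif E ^ (1 - h - k)
  have hpair : ∀ {x y : E} {a b : ℤ}, x ∈ pPow E a → y ∈ pPow E b → h + k ≤ a + b →
      ψ (Algebra.trace F E (c * x * y)) = 1 := by
    intro x y a b hx hy hab
    refine Q.psi_trace_eq_one hψ ?_
    exact pPow_mul' (pPow_mul (unif_zpow_mem (1 - h - k)) hx) hy (by omega)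
  have hadd' : ∀ z x y : E, ψ (Algebra.trace F E (c * z * (x + y)))
      = ψ (Algebra.trace F E (c * z * x)) * ψ (Algebra.trace F E (c * z * y)) := by
    intro z x y
    rw [mul_add, map_add, AddChar.map_add_eq_mul]
  have hex : ∀ g : G, ∃ f : Multiplicative G →* Ω, ∀ x : pSub E h,
      f (Multiplicative.ofAdd (QuotientAddGroup.mk x))
        = ψ (Algebra.trace F E (c * (Quotient.out g : pSub E h) * x)) := fun g =>
    desc _ (fun x _ y _ => hadd' _ x y)
      (fun x hx => hpair (Quotient.out g : pSub E h).2 hx (by omega))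
  choose f hf using hex
  have hinj : Function.Injective f := by
    intro a b hab
    rw [← QuotientAddGroup.out_eq' a, ← QuotientAddGroup.out_eq' b, eq_comm, QuotientAddGroup.eq,
      AddSubgroup.mem_addSubgroupOf]
    have h1 : c * (-(Quotient.out b : pSub E h) + (Quotient.out a : pSub E h) : E)
        ∈ pPow E (1 - h) := by
      refine Q.mem_of_psi_trace hψ fun z hz => ?_
      have h2 := hf a ⟨z, hz⟩
      rw [hab, hf b ⟨z, hz⟩] at h2
      rw [show c * (-((Quotient.out b : pSub E h) : E) + ((Quotient.out a : pSub E h) : E)) * z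
        = c * ((Quotient.out a : pSub E h) : E) * z - c * ((Quotient.out b : pSub E h) : E) * z
        by ring, map_sub, AddChar.map_sub_eq_div, ← h2]
      exact div_self (ψ.val_isUnit _).ne_zero
    have h2 := pPow_mul_iff (n := k) (x := c)
      (y := (-(Quotient.out b : pSub E h) + (Quotient.out a : pSub E h) : E))
      (unif_zpow_ne_zero _) (ord_unif_zpow _)
    rw [show 1 - h - k + k = 1 - h by ring] at h2
    simpa using h2.mp h1
  have hli := linearIndependent_monoidHom (Multiplicative G) Ω
  have : Fintype (Multiplicative G) := Fintype.ofFinite _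
  have hfin : Finite (Multiplicative G →* Ω) := hli.finite
  have : Fintype (Multiplicative G →* Ω) := Fintype.ofFinite _
  have hcard : Nat.card (Multiplicative G →* Ω) ≤ Nat.card G := by
    have := hli.fintype_card_le_finrank
    rw [Module.finrank_fintype_fun_eq_card] at this
    rw [Nat.card_eq_fintype_card]
    exact this.trans (by rw [← Nat.card_eq_fintype_card]; rfl)
  have hbij := hinj.bijective_of_nat_card_le hcard
  obtain ⟨fθ, hfθ⟩ := desc θ hadd hone
  obtain ⟨g, hg⟩ := hbij.2 fθ
  refine ⟨c * (Quotient.out g : pSub E h), fun x hx => ?_⟩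
  rw [← hfθ ⟨x, hx⟩, ← hg, hf]

end QuadraticArith

/-! ### Quaternion algebras containing a quadratic extension -/

section Frames

variable {F E : Type*} [Field F] [ValuativeRel F] [TopologicalSpace F]
  [IsNonarchimedeanLocalField F] [Field E] [ValuativeRel E] [TopologicalSpace E]
  [IsNonarchimedeanLocalField E] [Algebra F E]

/-- A presentation `D = E ⊕ E c` of a quaternion algebra `D` with reduced trace `T` and reduced norm
`nr`, where `c` induces the conjugation on `E` and `c ^ 2 = γ`. -/
structure Frame (Q : Quad F E) {D : Type*} [Ring D] [Algebra F D] (T : D →ₗ[F] F) (nr : D →* F)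
    (j : E →ₐ[F] D) where
  /-- A generator of the complement of `E`. -/
  c : D
  /-- The square of `c`. -/
  γ : F
  γ_ne : γ ≠ 0
  c_sq : c * c = algebraMap F D γ
  c_mul : ∀ x, c * j x = j (Q.σ x) * c
  /-- The `E`-coordinate. -/
  X : D → E
  /-- The `E c`-coordinate. -/
  Y : D → E
  eq : ∀ d, d = j (X d) + j (Y d) * c
  X_eq : ∀ x y, X (j x + j y * c) = x
  Y_eq : ∀ x y, Y (j x + j y * c) = y
  T_eq : ∀ x y, T (j x + j y * c) = Algebra.trace F E x
  nr_eq : ∀ x y, nr (j x + j y * c) = Algebra.norm F x - γ * Algebra.norm F y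

namespace Frame

variable {Q : Quad F E} {D : Type*} [Ring D] [Algebra F D]

/-- The only input about a quaternion algebra is its canonical involution `bar` and the
nondegeneracy of the trace form. -/
theorem exists_of_involution {T : D →ₗ[F] F} {nr : D →* F} (j : E →ₐ[F] D) (hD : Module.finrank F D = 4)
    (hE : Module.finrank F E = 2) (bar : D → D) (bar_mul : ∀ x y, bar (x * y) = bar y * bar x)
    (hT : ∀ x, x + bar x = algebraMap F D (T x)) (hnr : ∀ x, x * bar x = algebraMap F D (nr x))
    (nondeg : ∀ c, c ≠ 0 → ∃ d, T (c * d) ≠ 0) : Nonempty (Frame Q T nr j) := by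
  have hfD : FiniteDimensional F D := .of_finrank_pos (by omega)
  have hfE : FiniteDimensional F E := .of_finrank_pos (by omega)
  have hnt : Nontrivial D := Module.nontrivial_of_finrank_pos (R := F) (by omega)
  have hinj : Function.Injective (algebraMap F D) := (algebraMap F D).injective
  have hjinj : Function.Injective j := j.toRingHom.injective
  have hbar : ∀ x, bar x = algebraMap F D (T x) - x := fun x => by
    rw [← hT x]; abel
  have hjalg : ∀ a : F, j (algebraMap F E a) = algebraMap F D a := j.commutes
  have hT1 : T 1 = 2 := by
    have h1 := hnr 1
    rw [map_one, map_one, one_mul] at h1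
    have h2 := hT 1
    rw [h1, one_add_one_eq_two, ← map_ofNat (algebraMap F D) 2] at h2
    exact (hinj h2).symm
  have hTalg : ∀ a : F, T (algebraMap F D a) = 2 * a := fun a => by
    rw [Algebra.algebraMap_eq_smul_one, map_smul, hT1, smul_eq_mul, mul_comm]
  set u := j Q.δ with hu
  have hδσ := Q.σ_δ
  obtain ⟨d, hd⟩ := Q.exists_of_fixed (x := Q.δ * Q.δ) (by rw [map_mul, Q.σ_δ]; ring)
  have huu : u * u = algebraMap F D d := by rw [hu, ← map_mul, ← hd, hjalg]
  have hTu : T u = 0 := by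
    by_contra h
    have h1 := hnr u
    rw [hbar, mul_sub, huu, sub_eq_iff_eq_add, ← map_add, ← Algebra.commutes,
      ← hjalg, hu, ← map_mul, ← hjalg] at h1
    have h2 := hjinj h1
    refine Q.δ_not_mem ⟨(nr (j Q.δ) + d) / T (j Q.δ), ?_⟩
    rw [map_div₀, ← h2, mul_div_cancel_left₀]
    simpa using h
  have htrδ : Algebra.trace F E Q.δ = 0 := by
    apply (algebraMap F E).injective
    rw [Q.tr_eq, hδσ, add_neg_cancel, map_zero]
  have hjcoord : ∀ a b : F, j (algebraMap F E a + algebraMap F E b * Q.δ)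
      = algebraMap F D a + b • u := fun a b => by
    rw [map_add, map_mul, hjalg, hjalg, ← Algebra.smul_def]
  have hTj : ∀ x, T (j x) = Algebra.trace F E x := by
    intro x
    obtain ⟨a, b, rfl⟩ := Q.exists_coords x
    rw [hjcoord, map_add, hTalg, map_smul, hTu, ← Algebra.smul_def, map_add, map_smul, htrδ,
      Q.trace_map]
  -- the elements orthogonal to `E`, which anticommute with `u`
  let φ : D →ₗ[F] F × F := T.prod (T ∘ₗ LinearMap.mulLeft F u)
  obtain ⟨c, hcφ, hc0⟩ : ∃ c, φ c = 0 ∧ c ≠ 0 := by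
    by_contra! h
    have h1 : Function.Injective φ := (injective_iff_map_eq_zero φ).mpr fun x hx => h x hx
    have h2 := LinearMap.finrank_le_finrank_of_injective h1
    simp [hD] at h2
  have hTc : T c = 0 := congrArg Prod.fst hcφ
  have hTuc : T (u * c) = 0 := congrArg Prod.snd hcφ
  have hcu : c * u = -(u * c) := by
    have h1 := bar_mul u c
    rw [hbar, hbar, hbar, hTc, hTu, hTuc, map_zero, zero_sub, zero_sub, zero_sub, neg_mul_neg] at h1
    exact h1.symm
  have hcj : ∀ x, c * j x = j (Q.σ x) * c := by
    intro x
    obtain ⟨a, b, rfl⟩ := Q.exists_coords x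
    rw [Q.σ_coords, sub_eq_add_neg, ← neg_mul, ← map_neg, hjcoord, hjcoord, mul_add, add_mul,
      mul_smul_comm, hcu, ← Algebra.commutes, neg_smul, neg_mul, smul_mul_assoc, smul_neg]
  have hTjc : ∀ y, T (j y * c) = 0 := by
    intro y
    obtain ⟨a, b, rfl⟩ := Q.exists_coords y
    rw [hjcoord, add_mul, smul_mul_assoc, ← Algebra.smul_def, map_add, map_smul, map_smul, hTc,
      hTuc]
    simp
  have hc2 : c * c = algebraMap F D (-nr c) := by
    have h1 := hnr c
    rw [hbar, hTc, map_zero, zero_sub, mul_neg] at h1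
    rw [map_neg, ← h1, neg_neg]
  let Ψ : (E × E) →ₗ[F] D :=
    (j.toLinearMap).coprod ((LinearMap.mulRight F c) ∘ₗ j.toLinearMap)
  have hΨ : ∀ x y, Ψ (x, y) = j x + j y * c := fun x y => rfl
  have h2j : ∀ d : D, d + d = 0 → d = 0 := fun d h => by
    rw [← two_smul F d] at h
    exact (smul_eq_zero.mp h).resolve_left Q.two_ne'
  have hΨinj : Function.Injective Ψ := by
    refine (injective_iff_map_eq_zero Ψ).mpr ?_
    rintro ⟨x, y⟩ h
    rw [hΨ] at h
    have h1 : j Q.δ * (j x + j y * c) + (j x + j y * c) * j Q.δ = 0 := by rw [h]; simp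
    have h3 : j Q.δ * (j y * c) + j y * c * j Q.δ = 0 := by
      rw [mul_assoc, hcj, hδσ, map_neg, neg_mul, mul_neg, ← mul_assoc, ← mul_assoc, ← map_mul,
        ← map_mul, mul_comm, add_neg_cancel]
    have h4 : j (Q.δ * x) + j (Q.δ * x) = 0 := by
      rw [← h1, mul_add, add_mul, map_mul]
      nth_rw 2 [← map_mul]
      rw [mul_comm Q.δ x, map_mul, add_add_add_comm, h3, add_zero]
    have hx : x = 0 := by
      have h5 := h2j _ h4
      rw [← map_zero j] at h5
      exact (mul_eq_zero.mp (hjinj h5)).resolve_left Q.δ_ne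
    rw [hx, map_zero, zero_add] at h
    have hy : y = 0 := by
      by_contra hy
      apply hc0
      have h5 : j y⁻¹ * (j y * c) = c := by
        rw [← mul_assoc, ← map_mul, inv_mul_cancel₀ hy, map_one, one_mul]
      rw [← h5, h, mul_zero]
    rw [hx, hy]; rfl
  let e := LinearEquiv.ofInjectiveOfFinrankEq Ψ hΨinj (by rw [Module.finrank_prod, hE, hD])
  have he : ∀ x y, e (x, y) = j x + j y * c := fun x y => rfl
  have hγ : -nr c ≠ 0 := by
    intro h0
    obtain ⟨d, hd⟩ := nondeg c hc0
    apply hd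
    obtain ⟨⟨x, y⟩, rfl⟩ := e.surjective d
    rw [he, mul_add, hcj, ← mul_assoc, hcj, mul_assoc, hc2, h0, map_zero, mul_zero, add_zero, hTjc]
  have hTd : ∀ x y, T (j x + j y * c) = Algebra.trace F E x := fun x y => by
    rw [map_add, hTj, hTjc, add_zero]
  refine ⟨⟨c, -nr c, hγ, hc2, hcj, fun d => (e.symm d).1, fun d => (e.symm d).2, fun d => ?_,
    fun x y => ?_, fun x y => ?_, hTd, fun x y => ?_⟩⟩
  · rw [← he]; exact (e.apply_symm_apply d).symm
  · rw [← he, e.symm_apply_apply]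
  · rw [← he, e.symm_apply_apply]
  · apply hinj
    have hb : bar (j x + j y * c) = j (Q.σ x) - j y * c := by
      rw [hbar, hTd, ← hjalg, Q.tr_eq, map_add]; abel
    have h1 : j y * c * j (Q.σ x) = j x * (j y * c) := by
      rw [mul_assoc, hcj, Q.σ_σ, ← mul_assoc, ← map_mul, mul_comm, map_mul, mul_assoc]
    have h2 : j y * c * (j y * c) = algebraMap F D (-nr c * Algebra.norm F y) := by
      rw [mul_assoc, ← mul_assoc c, hcj, mul_assoc, hc2, ← mul_assoc, ← map_mul, ← Q.nm_eq, hjalg,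
        ← map_mul, mul_comm]
    rw [← hnr, hb, add_mul, mul_sub, mul_sub, h1, h2, ← map_mul, ← Q.nm_eq, hjalg, map_sub]
    abel

/-- Replacing `c` by `z c` replaces `γ` by `N(z) γ`. -/
def rescale {T : D →ₗ[F] F} {nr : D →* F} {j : E →ₐ[F] D} (fr : Frame Q T nr j) (z : E)
    (hz : z ≠ 0) : Frame Q T nr j where
  c := j z * fr.c
  γ := Algebra.norm F z * fr.γ
  γ_ne := mul_ne_zero (fun h => by
    have := Q.nm_eq z
    rw [h, map_zero, eq_comm, mul_eq_zero] at this
    simp [hz] at this) fr.γ_ne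
  c_sq := by
    rw [mul_assoc, ← mul_assoc fr.c, fr.c_mul, mul_assoc, fr.c_sq, ← mul_assoc, ← map_mul,
      ← Q.nm_eq, j.commutes, ← map_mul]
  c_mul x := by
    rw [mul_assoc, fr.c_mul, ← mul_assoc, ← mul_assoc, ← map_mul, ← map_mul, mul_comm]
  X := fr.X
  Y d := fr.Y d * z⁻¹
  eq d := by
    rw [← mul_assoc, ← map_mul, inv_mul_cancel_right₀ hz]; exact fr.eq d
  X_eq x y := by rw [← mul_assoc, ← map_mul, fr.X_eq]
  Y_eq x y := by rw [← mul_assoc, ← map_mul, fr.Y_eq, mul_inv_cancel_right₀ hz]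
  T_eq x y := by rw [← mul_assoc, ← map_mul, fr.T_eq]
  nr_eq x y := by rw [← mul_assoc, ← map_mul, fr.nr_eq, map_mul]; ring

/-! #### Coordinates -/

variable {T : D →ₗ[F] F} {nr : D →* F} {j : E →ₐ[F] D} (fr : Frame Q T nr j)

theorem ext_iff {d d' : D} : d = d' ↔ fr.X d = fr.X d' ∧ fr.Y d = fr.Y d' :=
  ⟨fun h => h ▸ ⟨rfl, rfl⟩, fun h => by rw [fr.eq d, fr.eq d', h.1, h.2]⟩

theorem ext {d d' : D} (h1 : fr.X d = fr.X d') (h2 : fr.Y d = fr.Y d') : d = d' :=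
  fr.ext_iff.mpr ⟨h1, h2⟩

theorem add_eq (d d' : D) :
    d + d' = j (fr.X d + fr.X d') + j (fr.Y d + fr.Y d') * fr.c := by
  nth_rw 1 [fr.eq d, fr.eq d']
  rw [map_add, map_add, add_mul]; abel

@[simp] theorem X_add (d d' : D) : fr.X (d + d') = fr.X d + fr.X d' := by rw [fr.add_eq, fr.X_eq]
@[simp] theorem Y_add (d d' : D) : fr.Y (d + d') = fr.Y d + fr.Y d' := by rw [fr.add_eq, fr.Y_eq]

theorem mul_eq (d d' : D) : d * d' =
    j (fr.X d * fr.X d' + algebraMap F E fr.γ * fr.Y d * Q.σ (fr.Y d'))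
      + j (fr.X d * fr.Y d' + fr.Y d * Q.σ (fr.X d')) * fr.c := by
  nth_rw 1 [fr.eq d, fr.eq d']
  have h1 : j (fr.Y d) * fr.c * j (fr.X d') = j (fr.Y d * Q.σ (fr.X d')) * fr.c := by
    rw [mul_assoc, fr.c_mul, ← mul_assoc, map_mul]
  have h2 : j (fr.Y d) * fr.c * (j (fr.Y d') * fr.c)
      = j (algebraMap F E fr.γ * fr.Y d * Q.σ (fr.Y d')) := by
    rw [mul_assoc, ← mul_assoc fr.c, fr.c_mul, mul_assoc, fr.c_sq, ← j.commutes, ← map_mul,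
      ← map_mul]
    congr 1; ring
  rw [add_mul, mul_add, mul_add, h1, h2, ← mul_assoc, ← map_mul, ← map_mul, map_add, map_add,
    add_mul]
  abel

theorem X_mul (d d' : D) : fr.X (d * d')
    = fr.X d * fr.X d' + algebraMap F E fr.γ * fr.Y d * Q.σ (fr.Y d') := by rw [fr.mul_eq, fr.X_eq]

theorem Y_mul (d d' : D) : fr.Y (d * d') = fr.X d * fr.Y d' + fr.Y d * Q.σ (fr.X d') := by
  rw [fr.mul_eq, fr.Y_eq]

@[simp] theorem X_j (x : E) : fr.X (j x) = x := by
  have := fr.X_eq x 0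
  simpa using this

@[simp] theorem Y_j (x : E) : fr.Y (j x) = 0 := by
  have := fr.Y_eq x 0
  simpa using this

@[simp] theorem X_one : fr.X 1 = 1 := by rw [← map_one j, X_j]
@[simp] theorem Y_one : fr.Y 1 = 0 := by rw [← map_one j, Y_j]
@[simp] theorem X_zero : fr.X 0 = 0 := by rw [← map_zero j, X_j]
@[simp] theorem Y_zero : fr.Y 0 = 0 := by rw [← map_zero j, Y_j]

@[simp] theorem X_neg (d : D) : fr.X (-d) = -fr.X d := by
  rw [eq_neg_iff_add_eq_zero, ← X_add, neg_add_cancel, X_zero]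
@[simp] theorem Y_neg (d : D) : fr.Y (-d) = -fr.Y d := by
  rw [eq_neg_iff_add_eq_zero, ← Y_add, neg_add_cancel, Y_zero]
@[simp] theorem X_sub (d d' : D) : fr.X (d - d') = fr.X d - fr.X d' := by
  rw [sub_eq_add_neg, X_add, X_neg, sub_eq_add_neg]
@[simp] theorem Y_sub (d d' : D) : fr.Y (d - d') = fr.Y d - fr.Y d' := by
  rw [sub_eq_add_neg, Y_add, Y_neg, sub_eq_add_neg]

@[simp] theorem X_j_mul (x : E) (d : D) : fr.X (j x * d) = x * fr.X d := by simp [X_mul]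
@[simp] theorem Y_j_mul (x : E) (d : D) : fr.Y (j x * d) = x * fr.Y d := by simp [Y_mul]
@[simp] theorem X_mul_j (x : E) (d : D) : fr.X (d * j x) = fr.X d * x := by simp [X_mul]
@[simp] theorem Y_mul_j (x : E) (d : D) : fr.Y (d * j x) = fr.Y d * Q.σ x := by simp [Y_mul]

theorem T_apply (d : D) : T d = Algebra.trace F E (fr.X d) := by
  conv_lhs => rw [fr.eq d, fr.T_eq]

theorem nr_apply (d : D) :
    nr d = Algebra.norm F (fr.X d) - fr.γ * Algebra.norm F (fr.Y d) := by
  conv_lhs => rw [fr.eq d, fr.nr_eq]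

include fr in
theorem nr_j (x : E) : nr (j x) = Algebra.norm F x := by
  have h0 : Algebra.norm F (0 : E) = 0 := by
    apply (algebraMap F E).injective
    rw [Q.nm_eq, zero_mul, map_zero]
  have := fr.nr_eq x 0
  simpa [h0] using this

include fr in
theorem corestr_eq (d : D) : corestr T j d = fr.X d := by
  have hex : ∀ x : E, T ((d - j (fr.X d)) * j x) = 0 := fun x => by
    rw [fr.T_apply]; simp
  have h : ∃ e : E, ∀ x : E, T ((d - j e) * j x) = 0 := ⟨_, hex⟩
  rw [corestr, dif_pos h]
  have hs := h.choose_spec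
  by_contra hne
  have hne' : fr.X d - h.choose ≠ 0 := sub_ne_zero.mpr (Ne.symm hne)
  have h1 := hs (fr.X d - h.choose)⁻¹
  rw [fr.T_apply, X_mul_j, X_sub, X_j, mul_inv_cancel₀ hne', ← map_one (algebraMap F E),
    Q.trace_map, mul_one] at h1
  exact Q.two_ne' h1

end Frame

end Frames

section Orders

variable {F E : Type*} [Field F] [ValuativeRel F] [TopologicalSpace F]
  [IsNonarchimedeanLocalField F] [Field E] [ValuativeRel E] [TopologicalSpace E]
  [IsNonarchimedeanLocalField E] [Algebra F E] {Q : Quad F E}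

theorem Quad.norm_ne_zero (Q : Quad F E) {x : E} (hx : x ≠ 0) : Algebra.norm F x ≠ 0 := fun h => by
  have := Q.nm_eq x
  rw [h, map_zero, eq_comm, mul_eq_zero] at this
  simp [hx] at this

theorem Quad.norm_zero (Q : Quad F E) : Algebra.norm F (0 : E) = 0 := by
  apply (algebraMap F E).injective
  rw [Q.nm_eq, zero_mul, map_zero]

theorem Quad.ord_norm' (Q : Quad F E) {x : E} (hx : x ≠ 0) :
    Q.e * ord (Algebra.norm F x) = 2 * ord x := by
  rw [← Q.ord_map, Q.ord_norm hx]

/-- The lattice `𝔭 ^ s ⊕ 𝔭 ^ t c`. -/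
def Frame.L {D : Type*} [Ring D] [Algebra F D] {T : D →ₗ[F] F} {nr : D →* F} {j : E →ₐ[F] D}
    (fr : Frame Q T nr j) (s t : ℤ) : Set D := {d | fr.X d ∈ pPow E s ∧ fr.Y d ∈ pPow E t}

/-! #### The matrix algebra -/

theorem exists_frame_matrix (hE : Module.finrank F E = 2)
    (jA : E →ₐ[F] Matrix (Fin 2) (Fin 2) F) :
    ∃ fr : Frame Q trA (Matrix.detMonoidHom : Matrix (Fin 2) (Fin 2) F →* F) jA, fr.γ = 1 := by
  obtain ⟨fr⟩ := Frame.exists_of_involution (Q := Q) (T := trA) (nr := Matrix.detMonoidHom) jA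
    (by rw [Module.finrank_matrix]; simp) hE Matrix.adjugate
    (fun x y => Matrix.adjugate_mul_distrib x y)
    (fun x => by
      ext i k
      fin_cases i <;> fin_cases k <;>
        simp [trA, Matrix.adjugate_fin_two, Matrix.trace_fin_two, Matrix.algebraMap_eq_diagonal,
          add_comm])
    (fun x => by
      rw [Matrix.mul_adjugate, Algebra.algebraMap_eq_smul_one]; rfl)
    (fun c hc => by
      obtain ⟨i, k, hik⟩ : ∃ i k, c i k ≠ 0 := by
        by_contra! h
        exact hc (Matrix.ext h)
      refine ⟨Matrix.single k i 1, ?_⟩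
      simpa [trA, Matrix.trace_mul_single] using hik)
  -- a singular matrix exhibits `γ` as a norm
  have hd := fr.nr_apply (Matrix.single 0 0 1)
  have hdet : (Matrix.detMonoidHom : Matrix (Fin 2) (Fin 2) F →* F) (Matrix.single 0 0 1) = 0 := by
    simp [Matrix.det_fin_two, Matrix.single]
  rw [hdet] at hd
  set X := fr.X (Matrix.single 0 0 1) with hX
  set Y := fr.Y (Matrix.single 0 0 1) with hY
  have hne : ¬ (X = 0 ∧ Y = 0) := by
    rintro ⟨h1, h2⟩
    have : (Matrix.single 0 0 1 : Matrix (Fin 2) (Fin 2) F) = 0 :=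
      fr.ext (by rw [← hX, h1, fr.X_zero]) (by rw [← hY, h2, fr.Y_zero])
    have h3 := congrFun (congrFun this 0) 0
    simp at h3
  have hXn : X ≠ 0 := by
    intro h
    rw [h, Q.norm_zero, zero_sub, eq_comm, neg_eq_zero] at hd
    rcases mul_eq_zero.mp hd with h' | h'
    · exact fr.γ_ne h'
    · exact Q.norm_ne_zero (fun h'' => hne ⟨h, h''⟩) h'
  have hYn : Y ≠ 0 := by
    intro h
    rw [h, Q.norm_zero, mul_zero, sub_zero] at hd
    exact Q.norm_ne_zero hXn hd.symm
  refine ⟨fr.rescale (Y / X) (div_ne_zero hYn hXn), ?_⟩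
  change Algebra.norm F (Y / X) * fr.γ = 1
  have hN := Q.norm_ne_zero hXn
  have hmul : Algebra.norm F (Y / X) * Algebra.norm F X = Algebra.norm F Y := by
    rw [← map_mul, div_mul_cancel₀ _ hXn]
  apply mul_right_cancel₀ hN
  linear_combination fr.γ * hmul + hd

/-- `𝔓_𝔄 ^ n = 𝔭_E ^ n ⊕ 𝔭_E ^ n c`, for `c` an involution. In a basis vector of the `E`-line `F²`
fixed by `c`, the involution `c` becomes the conjugation of `E`. -/
theorem radA_eq (hE : Module.finrank F E = 2) {jA : E →ₐ[F] Matrix (Fin 2) (Fin 2) F}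
    (fr : Frame Q trA (Matrix.detMonoidHom : Matrix (Fin 2) (Fin 2) F →* F) jA) (hγ : fr.γ = 1)
    (n : ℕ) : radA jA n = fr.L n n := by
  have hfE : FiniteDimensional F E := .of_finrank_pos (by omega)
  have hcc : fr.c * fr.c = 1 := by rw [fr.c_sq, hγ, map_one]
  obtain ⟨w, hw⟩ : ∃ w : Fin 2 → F, (1 + fr.c).mulVec w ≠ 0 := by
    by_contra! h
    have h1 : (1 + fr.c) = 0 := by
      apply Matrix.mulVec_injective
      ext w : 1
      rw [h w, Matrix.zero_mulVec]
    have h2 := congrArg fr.X h1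
    have h3 : fr.X fr.c = 0 := by
      have := fr.X_eq 0 1
      simpa using this
    rw [fr.X_add, fr.X_one, fr.X_zero, h3, add_zero] at h2
    exact one_ne_zero h2
  set v₀ := (1 + fr.c).mulVec w with hv₀
  have hcv : fr.c.mulVec v₀ = v₀ := by
    rw [hv₀, Matrix.mulVec_mulVec, mul_add, hcc, mul_one, add_comm]
  have hinv : ∀ (e : E), e ≠ 0 → ∀ v, (jA e).mulVec v = 0 → v = 0 := by
    intro e he v hv
    have : (jA e⁻¹).mulVec ((jA e).mulVec v) = v := by
      rw [Matrix.mulVec_mulVec, ← map_mul, inv_mul_cancel₀ he, map_one, Matrix.one_mulVec]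
    rw [← this, hv, Matrix.mulVec_zero]
  let φ : E →ₗ[F] (Fin 2 → F) :=
    { toFun := fun e => (jA e).mulVec v₀
      map_add' := fun x y => by rw [map_add, Matrix.add_mulVec]
      map_smul' := fun a x => by rw [map_smul, Matrix.smul_mulVec]; rfl }
  have hφinj : Function.Injective φ := by
    refine (injective_iff_map_eq_zero φ).mpr fun e he => ?_
    by_contra hne
    exact hw (hinv e hne _ he)
  have hφsurj : Function.Surjective φ :=
    (LinearMap.injective_iff_surjective_of_finrank_eq_finrank (by simp [hE])).mp hφinj
  have hact : ∀ (x : Matrix (Fin 2) (Fin 2) F) (e : E),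
      x.mulVec (φ e) = φ (fr.X x * e + fr.Y x * Q.σ e) := by
    intro x e
    change x.mulVec ((jA e).mulVec v₀) = (jA (fr.X x * e + fr.Y x * Q.σ e)).mulVec v₀
    conv_lhs => rw [Matrix.mulVec_mulVec, fr.eq (x * jA e), fr.X_mul_j, fr.Y_mul_j,
      Matrix.add_mulVec, ← Matrix.mulVec_mulVec, hcv]
    rw [map_add, Matrix.add_mulVec]
  have hφ0 : ∀ e, φ e = 0 ↔ e = 0 := fun e => by rw [← map_zero φ, hφinj.eq_iff]
  have hφmul : ∀ e f, (jA e).mulVec (φ f) = φ (e * f) := fun e f => by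
    change (jA e).mulVec ((jA f).mulVec v₀) = (jA (e * f)).mulVec v₀
    rw [Matrix.mulVec_mulVec, map_mul]
  ext x
  constructor
  · intro hx
    have h1 : fr.X x + fr.Y x ∈ pPow E n := by
      obtain ⟨e, he, h⟩ := hx v₀ hw 0 (φ 1) ⟨1, one_mem_pPow, rfl⟩
      rw [hact, map_one, mul_one, mul_one] at h
      rw [hφinj h]
      simpa using he
    have h2 : fr.X x - fr.Y x ∈ pPow E n := by
      obtain ⟨e, he, h⟩ := hx v₀ hw (ord Q.δ) (φ Q.δ) ⟨Q.δ, mem_pPow_ord _, rfl⟩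
      rw [hact, Q.σ_δ] at h
      have h' := hφinj h
      rw [← pPow_mul_iff Q.δ_ne rfl]
      rw [← h'] at he
      convert he using 1; ring
    have h3 := pPow_add h1 h2
    have h4 := pPow_sub h1 h2
    rw [show fr.X x + fr.Y x + (fr.X x - fr.Y x) = 2 * fr.X x by ring, Q.two_mem_iff] at h3
    rw [show fr.X x + fr.Y x - (fr.X x - fr.Y x) = 2 * fr.Y x by ring, Q.two_mem_iff] at h4
    exact ⟨h3, h4⟩
  · rintro ⟨h1, h2⟩ v hv i w ⟨e, he, rfl⟩
    obtain ⟨f, rfl⟩ := hφsurj v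
    have hf : f ≠ 0 := fun h => hv ((hφ0 f).mpr h)
    rw [hφmul, hact]
    refine ⟨f⁻¹ * (fr.X x * (e * f) + fr.Y x * Q.σ (e * f)), ?_, ?_⟩
    · rw [mem_pPow_inv_mul hf]
      have hef := pPow_mul he (mem_pPow_ord f)
      exact pPow_add (pPow_mul' h1 hef (by omega)) (pPow_mul' h2 (Q.σ_mem.mpr hef) (by omega))
    · rw [hφmul]
      congr 1
      field_simp

/-! #### The division algebra -/

variable {a b : F}

theorem exists_frame_quaternion (hE : Module.finrank F E = 2)
    (hB : ∀ x : ℍ[F,a,b], x ≠ 0 → IsUnit x) (jB : E →ₐ[F] ℍ[F,a,b]) :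
    Nonempty (Frame Q trd (nrd : ℍ[F,a,b] →* F) jB) := by
  refine Frame.exists_of_involution jB (QuaternionAlgebra.finrank_eq_four a 0 b) hE star
    (fun x y => star_mul x y) (fun x => ?_) (fun x => ?_) (fun c hc => ?_)
  · ext <;> simp [trd]
  · ext <;> simp [nrd] <;> ring
  · obtain ⟨d, hd⟩ := (hB c hc).exists_right_inv
    refine ⟨d, ?_⟩
    rw [hd]
    have : trd (1 : ℍ[F,a,b]) = 2 := by simp [trd, one_add_one_eq_two]
    rw [this]
    exact Q.two_ne'

theorem nrd_eq_zero (hB : ∀ x : ℍ[F,a,b], x ≠ 0 → IsUnit x) {x : ℍ[F,a,b]} (hx : nrd x = 0) :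
    x = 0 := by
  by_contra h
  have h1 := (hB x h).map (nrd : ℍ[F,a,b] →* F)
  rw [hx] at h1
  exact not_isUnit_zero h1

variable {jB : E →ₐ[F] ℍ[F,a,b]}

/-- In a division algebra `γ` is not a norm. -/
theorem Frame.norm_ne (hB : ∀ x : ℍ[F,a,b], x ≠ 0 → IsUnit x)
    (fr : Frame Q trd (nrd : ℍ[F,a,b] →* F) jB) (z : E) : Algebra.norm F z ≠ fr.γ := by
  intro h
  have h1 := fr.nr_eq z 1
  have hN1 : Algebra.norm F (1 : E) = 1 := map_one _
  rw [h, hN1, mul_one, sub_self] at h1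
  have h2 := congrArg fr.Y (nrd_eq_zero hB h1)
  rw [fr.Y_eq, fr.Y_zero] at h2
  exact one_ne_zero h2

/-- If no norm is close to `γ`, the valuation of `N x - γ N y` is the minimum of the valuations of
the two terms. -/
theorem Frame.nr_mem_iff {D : Type*} [Ring D] [Algebra F D] {T : D →ₗ[F] F} {nr : D →* F}
    {j : E →ₐ[F] D} (fr : Frame Q T nr j)
    (h : ∀ z : E, Algebra.norm F z - fr.γ ∉ pPow F (ord fr.γ + 1)) (d : D) (n : ℤ) :
    nr d ∈ pPow F n ↔ Algebra.norm F (fr.X d) ∈ pPow F n ∧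
      fr.γ * Algebra.norm F (fr.Y d) ∈ pPow F n := by
  rw [fr.nr_apply]
  refine ⟨fun hd => ?_, fun hd => pPow_sub hd.1 hd.2⟩
  have h2 : fr.γ * Algebra.norm F (fr.Y d) ∈ pPow F n := by
    by_contra hY
    have hY0 : fr.Y d ≠ 0 := fun h0 => hY (by rw [h0, Q.norm_zero, mul_zero]; exact zero_mem_pPow _)
    have hN := Q.norm_ne_zero hY0
    rw [mem_pPow_iff (mul_ne_zero fr.γ_ne hN), ord_mul fr.γ_ne hN] at hY
    apply h (fr.X d / fr.Y d)
    have hmul : Algebra.norm F (fr.Y d) * Algebra.norm F (fr.X d / fr.Y d)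
        = Algebra.norm F (fr.X d) := by rw [← map_mul, mul_div_cancel₀ _ hY0]
    rw [← pPow_mul_iff hN rfl, mul_sub, hmul, mul_comm _ fr.γ]
    exact pPow_anti (by omega) hd
  have := pPow_add hd h2
  rw [sub_add_cancel] at this
  exact ⟨this, h2⟩

theorem exists_frame_unramified (he : Q.e = 1) (hB : ∀ x : ℍ[F,a,b], x ≠ 0 → IsUnit x)
    (fr : Frame Q trd (nrd : ℍ[F,a,b] →* F) jB) :
    ∃ fr : Frame Q trd (nrd : ℍ[F,a,b] →* F) jB, ord fr.γ = 1 ∧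
      ∀ z : E, Algebra.norm F z - fr.γ ∉ pPow F (ord fr.γ + 1) := by
  have hev : ∀ z : E, z ≠ 0 → ord (Algebra.norm F z) = 2 * ord z := fun z hz => by
    have := Q.ord_norm' hz
    rwa [he, one_mul] at this
  obtain ⟨k, hk⟩ : Odd (ord fr.γ) := by
    rw [← Int.not_even_iff_odd]
    rintro ⟨k, hk⟩
    obtain ⟨x, hx⟩ := Q.exists_norm_eq he (u := fr.γ / unif F ^ (2 * k))
      (div_ne_zero fr.γ_ne (unif_zpow_ne_zero _))
      (by rw [ord_div fr.γ_ne (unif_zpow_ne_zero _), ord_unif_zpow, hk]; ring)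
    apply fr.norm_ne hB (x * algebraMap F E (unif F ^ k))
    rw [map_mul, hx, Q.norm_map, ← zpow_natCast, ← zpow_mul, mul_comm k]
    exact div_mul_cancel₀ _ (unif_zpow_ne_zero _)
  have hz0 : algebraMap F E (unif F ^ (-k)) ≠ 0 := (map_ne_zero _).mpr (unif_zpow_ne_zero _)
  have hγ : ord (fr.rescale _ hz0).γ = 1 := by
    change ord (Algebra.norm F _ * fr.γ) = 1
    rw [ord_mul (Q.norm_ne_zero hz0) fr.γ_ne, Q.norm_map, ord_pow (unif_zpow_ne_zero _),
      ord_unif_zpow, hk]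
    push_cast; ring
  refine ⟨fr.rescale _ hz0, hγ, fun z hz => ?_⟩
  have h1 := ord_add_eq (fr.rescale _ hz0).γ_ne rfl hz
  rw [add_sub_cancel, hγ] at h1
  have hz0 : z ≠ 0 := by
    rintro rfl
    exact h1.1 Q.norm_zero
  have := hev z hz0
  omega

theorem exists_frame_ramified (he : Q.e = 2) (hB : ∀ x : ℍ[F,a,b], x ≠ 0 → IsUnit x)
    (fr : Frame Q trd (nrd : ℍ[F,a,b] →* F) jB) :
    ∃ fr : Frame Q trd (nrd : ℍ[F,a,b] →* F) jB, ord fr.γ = 0 ∧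
      ∀ z : E, Algebra.norm F z - fr.γ ∉ pPow F (ord fr.γ + 1) := by
  have hz0 := unif_zpow_ne_zero (L := E) (-ord fr.γ)
  have hγ : ord (fr.rescale _ hz0).γ = 0 := by
    change ord (Algebra.norm F _ * fr.γ) = 0
    have := Q.ord_norm' hz0
    rw [he, ord_unif_zpow] at this
    rw [ord_mul (Q.norm_ne_zero hz0) fr.γ_ne]
    omega
  refine ⟨fr.rescale _ hz0, hγ, fun z hz => ?_⟩
  rw [hγ, zero_add] at hz
  obtain ⟨y, hy⟩ := Q.norm_of_sub_mem (fr.rescale _ hz0).γ_ne hγ hz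
  exact (fr.rescale _ hz0).norm_ne hB y hy

theorem mem_radB_iff (hB : ∀ x : ℍ[F,a,b], x ≠ 0 → IsUnit x) {x : ℍ[F,a,b]} {n : ℕ} :
    x ∈ radB a b n ↔ nrd x ∈ pPow F n := by
  have : nrd x = 0 ↔ x = 0 := ⟨nrd_eq_zero hB, fun h => by rw [h]; simp [nrd]⟩
  simp only [radB, pPow, Set.mem_ofPred_eq, this]

theorem radB_eq_unramified (he : Q.e = 1) (hB : ∀ x : ℍ[F,a,b], x ≠ 0 → IsUnit x)
    (fr : Frame Q trd (nrd : ℍ[F,a,b] →* F) jB) (hγ : ord fr.γ = 1)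
    (hfr : ∀ z : E, Algebra.norm F z - fr.γ ∉ pPow F (ord fr.γ + 1)) (n : ℕ) :
    radB a b n = fr.L ((n + 1) / 2 : ℕ) (n / 2 : ℕ) := by
  have hev : ∀ z : E, z ≠ 0 → ord (Algebra.norm F z) = 2 * ord z := fun z hz => by
    have := Q.ord_norm' hz
    rwa [he, one_mul] at this
  ext x
  rw [mem_radB_iff hB, fr.nr_mem_iff hfr, Frame.L, Set.mem_ofPred_eq]
  refine and_congr ?_ ?_
  · by_cases h : fr.X x = 0
    · simp [h, Q.norm_zero]
    · rw [mem_pPow_iff h, mem_pPow_iff (Q.norm_ne_zero h), hev _ h]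
      omega
  · by_cases h : fr.Y x = 0
    · simp [h, Q.norm_zero]
    · have hN := Q.norm_ne_zero h
      rw [mem_pPow_iff h, mem_pPow_iff (mul_ne_zero fr.γ_ne hN), ord_mul fr.γ_ne hN, hev _ h, hγ]
      omega

theorem radB_eq_ramified (he : Q.e = 2) (hB : ∀ x : ℍ[F,a,b], x ≠ 0 → IsUnit x)
    (fr : Frame Q trd (nrd : ℍ[F,a,b] →* F) jB) (hγ : ord fr.γ = 0)
    (hfr : ∀ z : E, Algebra.norm F z - fr.γ ∉ pPow F (ord fr.γ + 1)) (n : ℕ) :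
    radB a b n = fr.L n n := by
  have hev : ∀ z : E, z ≠ 0 → ord (Algebra.norm F z) = ord z := fun z hz => by
    have := Q.ord_norm' hz
    rw [he] at this
    omega
  ext x
  rw [mem_radB_iff hB, fr.nr_mem_iff hfr, Frame.L, Set.mem_ofPred_eq]
  refine and_congr ?_ ?_
  · by_cases h : fr.X x = 0
    · simp [h, Q.norm_zero]
    · rw [mem_pPow_iff h, mem_pPow_iff (Q.norm_ne_zero h), hev _ h]
  · by_cases h : fr.Y x = 0
    · simp [h, Q.norm_zero]
    · have hN := Q.norm_ne_zero h
      rw [mem_pPow_iff h, mem_pPow_iff (mul_ne_zero fr.γ_ne hN), ord_mul fr.γ_ne hN, hev _ h, hγ]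
      omega

end Orders

/-! ### Unit groups in coordinates -/

section Groups

variable {F E : Type*} [Field F] [ValuativeRel F] [TopologicalSpace F]
  [IsNonarchimedeanLocalField F] [Field E] [ValuativeRel E] [TopologicalSpace E]
  [IsNonarchimedeanLocalField E] [Algebra F E] {Q : Quad F E}
  {D : Type*} [Ring D] [Algebra F D] {T : D →ₗ[F] F} {nr : D →* F} {j : E →ₐ[F] D}

namespace Frame

variable (fr : Frame Q T nr j)

/-- The normalized valuation of `γ` in `E`. -/
def g : ℤ := ord (algebraMap F E fr.γ)

theorem γ_mem : algebraMap F E fr.γ ∈ pPow E fr.g := mem_pPow_ord _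

/-- The reduced norm, as an element of `E`. -/
def nE (d : D) : E := fr.X d * Q.σ (fr.X d) - algebraMap F E fr.γ * fr.Y d * Q.σ (fr.Y d)

theorem nE_eq (d : D) : fr.nE d = algebraMap F E (nr d) := by
  rw [fr.nr_apply, map_sub, map_mul, Q.nm_eq, Q.nm_eq, nE]; ring

theorem σ_nE (d : D) : Q.σ (fr.nE d) = fr.nE d := by rw [nE_eq, AlgEquiv.commutes]

theorem nE_ne_zero (u : Dˣ) : fr.nE u ≠ 0 := by
  rw [nE_eq]
  have : nr (u : D) ≠ 0 := (u.isUnit.map nr).ne_zero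
  simpa using this

/-- The canonical involution divided by the norm. -/
def invAux (d : D) : D := j (Q.σ (fr.X d) / fr.nE d) + j (-fr.Y d / fr.nE d) * fr.c

theorem mul_invAux {d : D} (h : fr.nE d ≠ 0) : d * fr.invAux d = 1 := by
  apply fr.ext
  · rw [X_mul, invAux, X_eq, Y_eq, X_one, map_div₀, σ_nE, map_neg]
    field_simp
    rw [nE]; ring
  · rw [Y_mul, invAux, X_eq, Y_eq, Y_one, map_div₀, σ_nE, Q.σ_σ]
    field_simp
    ring

theorem invAux_mul {d : D} (h : fr.nE d ≠ 0) : fr.invAux d * d = 1 := by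
  apply fr.ext
  · rw [X_mul, invAux, X_eq, Y_eq, X_one]
    field_simp
    rw [nE]; ring
  · rw [Y_mul, invAux, X_eq, Y_eq, Y_one]
    field_simp
    ring

/-- Elements of nonzero norm are units. -/
def unit (d : D) (h : fr.nE d ≠ 0) : Dˣ := ⟨d, fr.invAux d, fr.mul_invAux h, fr.invAux_mul h⟩

@[simp] theorem coe_unit (d : D) (h : fr.nE d ≠ 0) : (fr.unit d h : D) = d := rfl

theorem coe_inv (u : Dˣ) : ((u⁻¹ : Dˣ) : D) = fr.invAux u :=
  Units.inv_eq_of_mul_eq_one_right (fr.mul_invAux (fr.nE_ne_zero u))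

theorem X_inv (u : Dˣ) : fr.X ((u⁻¹ : Dˣ) : D) = Q.σ (fr.X u) / fr.nE u := by
  rw [fr.coe_inv, invAux, fr.X_eq]

theorem Y_inv (u : Dˣ) : fr.Y ((u⁻¹ : Dˣ) : D) = -fr.Y u / fr.nE u := by
  rw [fr.coe_inv, invAux, fr.Y_eq]

@[simp] theorem coe_embU (e : Eˣ) : (embU j e : D) = j (e : E) := rfl

/-- Elements whose `c`-coordinate is small compared to their `E`-coordinate. -/
def Near (t : ℤ) (u : D) : Prop := fr.X u ≠ 0 ∧ fr.Y u ∈ pPow E (ord (fr.X u) + t)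

variable {fr}

theorem ord_nE {t : ℤ} (ht : 1 ≤ fr.g + 2 * t) {u : D} (hu : fr.Near t u) :
    fr.nE u ≠ 0 ∧ ord (fr.nE u) = 2 * ord (fr.X u) := by
  have hσ : Q.σ (fr.X u) ≠ 0 := by simpa using hu.1
  rw [nE, sub_eq_add_neg]
  refine ord_add_eq (mul_ne_zero hu.1 hσ) (by rw [ord_mul hu.1 hσ, Q.ord_σ]; ring) (pPow_neg ?_)
  exact pPow_mul' (pPow_mul fr.γ_mem hu.2) (Q.σ_mem.mpr hu.2) (by omega)

theorem Near.mul {t : ℤ} (ht : 1 ≤ fr.g + 2 * t) {u v : D} (hu : fr.Near t u)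
    (hv : fr.Near t v) : fr.Near t (u * v) ∧ ord (fr.X (u * v)) = ord (fr.X u) + ord (fr.X v) := by
  have h := ord_add_eq (mul_ne_zero hu.1 hv.1) (ord_mul hu.1 hv.1)
    (y := algebraMap F E fr.γ * fr.Y u * Q.σ (fr.Y v))
    (pPow_mul' (pPow_mul fr.γ_mem hu.2) (Q.σ_mem.mpr hv.2) (by omega))
  rw [← X_mul] at h
  refine ⟨⟨h.1, ?_⟩, h.2⟩
  rw [h.2, Y_mul]
  exact pPow_add (pPow_mul' (mem_pPow_ord _) hv.2 (by omega))
    (pPow_mul' hu.2 (Q.σ_mem.mpr (mem_pPow_ord _)) (by omega))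

theorem Near.inv {t : ℤ} (ht : 1 ≤ fr.g + 2 * t) {u : Dˣ} (hu : fr.Near t u) :
    fr.Near t ((u⁻¹ : Dˣ) : D) := by
  have h := ord_nE ht hu
  have hσ : Q.σ (fr.X u) ≠ 0 := by simpa using hu.1
  refine ⟨by rw [X_inv]; exact div_ne_zero hσ h.1, ?_⟩
  rw [Y_inv, X_inv, ord_div hσ h.1, Q.ord_σ, h.2, div_eq_inv_mul, mem_pPow_inv_mul h.1, h.2]
  exact pPow_anti (by omega) (pPow_neg hu.2)

variable (fr) in
/-- The group of `u = x + y c` with `x ∈ U` and `y / x ∈ 𝔭 ^ t`. It is a group if `U` contains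
`1 + 𝔭 ^ m`, where `m ≤ v_E(γ) + 2 t`. -/
def grp (U : Subgroup Eˣ) {m t : ℤ} (hm : 1 ≤ m) (ht : m ≤ fr.g + 2 * t)
    (hU : ∀ e : Eˣ, (e : E) - 1 ∈ pPow E m → e ∈ U) : Subgroup Dˣ where
  carrier := {u | fr.Near t u ∧ ∀ e : Eˣ, (e : E) = fr.X u → e ∈ U}
  one_mem' := by
    refine ⟨⟨by simp, by simp⟩, fun e he => ?_⟩
    rw [Units.val_one, X_one, Units.val_eq_one] at he
    rw [he]; exact one_mem U
  mul_mem' := by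
    rintro u v ⟨hu, hu'⟩ ⟨hv, hv'⟩
    refine ⟨(hu.mul (by omega) hv).1, fun e he => ?_⟩
    have h1 : e * ((Units.mk0 _ hu.1) * (Units.mk0 _ hv.1))⁻¹ ∈ U := by
      refine hU _ ?_
      have hu1 := hu.1
      have hv1 := hv.1
      have : ((e * ((Units.mk0 _ hu.1) * (Units.mk0 _ hv.1))⁻¹ : Eˣ) : E) - 1
          = (fr.X u * fr.X v)⁻¹ * (algebraMap F E fr.γ * fr.Y u * Q.σ (fr.Y v)) := by
        push_cast
        rw [he, Units.val_mul, X_mul]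
        simp only [Units.val_mk0]
        field_simp
        ring
      rw [this, mem_pPow_inv_mul (mul_ne_zero hu.1 hv.1), ord_mul hu.1 hv.1]
      exact pPow_mul' (pPow_mul fr.γ_mem hu.2) (Q.σ_mem.mpr hv.2) (by omega)
    have := U.mul_mem h1 (U.mul_mem (hu' _ (Units.val_mk0 hu.1)) (hv' _ (Units.val_mk0 hv.1)))
    rwa [inv_mul_cancel_right] at this
  inv_mem' := by
    rintro u ⟨hu, hu'⟩
    refine ⟨hu.inv (by omega), fun e he => ?_⟩
    have h := ord_nE (by omega) hu
    have h1 : e * (Units.mk0 _ hu.1) ∈ U := by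
      refine hU _ ?_
      have : ((e * (Units.mk0 _ hu.1) : Eˣ) : E) - 1
          = (fr.nE u)⁻¹ * (algebraMap F E fr.γ * fr.Y u * Q.σ (fr.Y u)) := by
        push_cast
        rw [he, X_inv]
        have h1 := h.1
        simp only [Units.val_mk0]
        field_simp
        rw [nE]; ring
      rw [this, mem_pPow_inv_mul h.1, h.2]
      exact pPow_mul' (pPow_mul fr.γ_mem hu.2) (Q.σ_mem.mpr hu.2) (by omega)
    have := U.mul_mem h1 (U.inv_mem (hu' _ (Units.val_mk0 hu.1)))
    rwa [mul_inv_cancel_right] at this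

theorem mem_grp {U : Subgroup Eˣ} {m t : ℤ} {hm : 1 ≤ m} {ht : m ≤ fr.g + 2 * t}
    {hU : ∀ e : Eˣ, (e : E) - 1 ∈ pPow E m → e ∈ U} {u : Dˣ} :
    u ∈ fr.grp U hm ht hU ↔ fr.Near t u ∧ ∀ e : Eˣ, (e : E) = fr.X u → e ∈ U := Iff.rfl

theorem near_of_mem {s t : ℤ} (hs : 1 ≤ s) {u : Dˣ} (hu : u ∈ unitsNear (fr.L s t)) :
    fr.Near t u ∧ ord (fr.X u) = 0 ∧ fr.X u - 1 ∈ pPow E s := by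
  have h1 : fr.X u - 1 ∈ pPow E s := by
    have := hu.1
    rwa [X_sub, X_one] at this
  have h2 : fr.Y u ∈ pPow E t := by
    have := hu.2
    rwa [Y_sub, Y_one, sub_zero] at this
  have h3 := ord_of_sub_one (pPow_anti hs h1)
  have h4 := one_add_ne_zero (pPow_anti hs h1)
  rw [add_sub_cancel] at h4
  exact ⟨⟨h4, by rwa [h3, zero_add]⟩, h3, h1⟩

theorem mem_unitsNear {s t : ℤ} {u : Dˣ} :
    u ∈ unitsNear (fr.L s t) ↔ fr.X u - 1 ∈ pPow E s ∧ fr.Y u ∈ pPow E t := by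
  simp [unitsNear, L]

theorem grp_eq_closure {U : Subgroup Eˣ} {m t s : ℤ} {hm : 1 ≤ m} {ht : m ≤ fr.g + 2 * t}
    {hU : ∀ e : Eˣ, (e : E) - 1 ∈ pPow E m → e ∈ U} (hs : 1 ≤ s)
    (hsU : ∀ e : Eˣ, (e : E) - 1 ∈ pPow E s → e ∈ U) :
    Subgroup.closure (embU j '' U ∪ unitsNear (fr.L s t)) = fr.grp U hm ht hU := by
  apply le_antisymm
  · rw [Subgroup.closure_le]
    rintro u (⟨e, he, rfl⟩ | hu)
    · refine ⟨⟨by simp, by simp⟩, fun e' he' => ?_⟩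
      rw [coe_embU, X_j, Units.val_inj] at he'
      rw [he']; exact he
    · obtain ⟨h1, h2, h3⟩ := near_of_mem hs hu
      exact ⟨h1, fun e he => hsU e (by rw [he]; exact h3)⟩
  · rintro u ⟨hu, hu'⟩
    set e := Units.mk0 _ hu.1 with he
    have hmul : u = embU j e * (embU j e⁻¹ * u) := by
      rw [← mul_assoc, ← map_mul, mul_inv_cancel, map_one, one_mul]
    rw [hmul]
    refine Subgroup.mul_mem _ (Subgroup.subset_closure (Or.inl ⟨e, hu' e rfl, rfl⟩))
      (Subgroup.subset_closure (Or.inr ?_))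
    rw [mem_unitsNear, Units.val_mul, coe_embU, X_j_mul, Y_j_mul, Units.val_inv_eq_inv_val, he,
      Units.val_mk0, inv_mul_cancel₀ hu.1, sub_self, mem_pPow_inv_mul hu.1]
    exact ⟨zero_mem_pPow _, hu.2⟩

/-- Conjugation of a small element by an element near `E`. -/
theorem conj_coords {m t t' : ℤ} (ht : m ≤ fr.g + 2 * t) (hm : 1 ≤ m) (htt : t' ≤ t + 1)
    (ht0 : t ≤ t') (h : m + 1 ≤ fr.g + t + t') {u w : Dˣ} (hu : fr.Near t u)
    (hw : w ∈ unitsNear (fr.L m t')) :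
    u⁻¹ * w * u ∈ unitsNear (fr.L m t') ∧
      fr.X ((u⁻¹ * w * u : Dˣ) - 1 : D) - fr.X (w - 1 : D) ∈ pPow E (m + 1) := by
  have hn := ord_nE (fr := fr) (t := t) (by omega) hu
  set v : D := (w : D) - 1 with hv
  have hx : fr.X v ∈ pPow E m := hw.1
  have hy : fr.Y v ∈ pPow E t' := hw.2
  have hconj : ((u⁻¹ * w * u : Dˣ) : D) - 1 = ((u⁻¹ : Dˣ) : D) * (v * u) := by
    rw [hv, sub_mul, mul_sub, one_mul, Units.inv_mul, Units.val_mul, Units.val_mul, mul_assoc]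
  have hγ := fr.γ_mem
  have hX := mem_pPow_ord (fr.X (u : D))
  have hσX := Q.σ_mem.mpr hX
  have hY := hu.2
  have hσY := Q.σ_mem.mpr hY
  have hσx := Q.σ_mem.mpr hx
  have hσy := Q.σ_mem.mpr hy
  have hn1 := hn.1
  have e1 : fr.X (((u⁻¹ : Dˣ) : D) * (v * u)) - fr.X v = (fr.nE u)⁻¹ *
      (-(algebraMap F E fr.γ * fr.Y u * Q.σ (fr.Y u) * (Q.σ (fr.X v) - fr.X v))
        + (algebraMap F E fr.γ * fr.Y v * (Q.σ (fr.X u) * Q.σ (fr.Y u))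
          - algebraMap F E fr.γ * fr.Y u * (Q.σ (fr.Y v) * fr.X u))) := by
    rw [X_mul, X_mul, Y_mul, X_inv, Y_inv]
    simp only [map_add, map_mul, Q.σ_σ]
    field_simp
    rw [nE]; ring
  have e2 : fr.Y (((u⁻¹ : Dˣ) : D) * (v * u)) = (fr.nE u)⁻¹ *
      ((fr.X v * (Q.σ (fr.X u) * fr.Y u) + fr.Y v * (Q.σ (fr.X u) * Q.σ (fr.X u)))
        - (Q.σ (fr.X v) * (Q.σ (fr.X u) * fr.Y u)
          + algebraMap F E fr.γ * fr.Y u * (Q.σ (fr.Y v) * fr.Y u))) := by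
    rw [Y_mul, X_mul, Y_mul, X_inv, Y_inv]
    simp only [map_add, map_mul, Q.σ_σ, AlgEquiv.commutes]
    field_simp
    ring
  have key : fr.X (((u⁻¹ : Dˣ) : D) * (v * u)) - fr.X v ∈ pPow E (m + 1) := by
    rw [e1, mem_pPow_inv_mul hn.1, hn.2]
    refine pPow_add (pPow_neg ?_) (pPow_sub ?_ ?_)
    · exact pPow_mul' (pPow_mul (pPow_mul hγ hY) hσY) (pPow_sub hσx hx) (by omega)
    · exact pPow_mul' (pPow_mul hγ hy) (pPow_mul hσX hσY) (by omega)
    · exact pPow_mul' (pPow_mul hγ hY) (pPow_mul hσy hX) (by omega)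
  have key2 : fr.Y (((u⁻¹ : Dˣ) : D) * (v * u)) ∈ pPow E t' := by
    rw [e2, mem_pPow_inv_mul hn.1, hn.2]
    refine pPow_sub (pPow_add ?_ ?_) (pPow_add ?_ ?_)
    · exact pPow_mul' hx (pPow_mul hσX hY) (by omega)
    · exact pPow_mul' hy (pPow_mul hσX hσX) (by omega)
    · exact pPow_mul' hσx (pPow_mul hσX hY) (by omega)
    · exact pPow_mul' (pPow_mul hγ hY) (pPow_mul hσy hY) (by omega)
  refine ⟨⟨?_, ?_⟩, ?_⟩
  · rw [hconj]
    have := pPow_add (pPow_anti (by omega : m ≤ m + 1) key) hx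
    rwa [sub_add_cancel] at this
  · rw [hconj]; exact key2
  · rw [hconj]; exact key

/-- The commutator of an element near `E` with a one-unit of `E`. -/
theorem conj_torus {m t t' : ℤ} (ht : m ≤ fr.g + 2 * t) (hm : 1 ≤ m) (htt : t' ≤ t + 1)
    {u : Dˣ} (hu : fr.Near t u) {e : Eˣ} (he : (e : E) - 1 ∈ pPow E 1) :
    ∃ w : Dˣ, u⁻¹ * embU j e * u = embU j e * w ∧ w ∈ unitsNear (fr.L (m + 1) t') := by
  have hn := ord_nE (fr := fr) (t := t) (by omega) hu
  have he0 : (e : E) ≠ 0 := e.ne_zero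
  have hσe0 : Q.σ (e : E) ≠ 0 := by simp
  have he1 : ord (e : E) = 0 := ord_of_sub_one he
  have hε : (e : E) - Q.σ (e : E) ∈ pPow E 1 := by
    have := pPow_sub he (Q.σ_mem.mpr he)
    rw [map_sub, map_one] at this
    convert this using 1; ring
  refine ⟨(embU j e)⁻¹ * (u⁻¹ * embU j e * u), by group, ?_⟩
  rw [mem_unitsNear, ← map_inv]
  have hn1 := hn.1
  have e1 : fr.X ((embU j e⁻¹ * (u⁻¹ * embU j e * u) : Dˣ) : D) - 1
      = (fr.nE u)⁻¹ * ((e : E)⁻¹ * (algebraMap F E fr.γ * fr.Y u * Q.σ (fr.Y u)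
        * ((e : E) - Q.σ (e : E)))) := by
    simp only [Units.val_mul, coe_embU, X_j_mul, Units.val_inv_eq_inv_val]
    rw [X_mul, X_mul_j, Y_mul_j, X_inv, Y_inv]
    field_simp
    rw [nE]; ring
  have e2 : fr.Y ((embU j e⁻¹ * (u⁻¹ * embU j e * u) : Dˣ) : D)
      = (fr.nE u)⁻¹ * ((e : E)⁻¹ * (fr.Y u * Q.σ (fr.X u) * ((e : E) - Q.σ (e : E)))) := by
    simp only [Units.val_mul, coe_embU, Y_j_mul, Units.val_inv_eq_inv_val]
    rw [Y_mul, X_mul_j, Y_mul_j, X_inv, Y_inv]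
    field_simp
    ring
  rw [e1, e2, mem_pPow_inv_mul hn.1, mem_pPow_inv_mul hn.1, mem_pPow_inv_mul he0,
    mem_pPow_inv_mul he0, hn.2, he1]
  constructor
  · exact pPow_mul' (pPow_mul (pPow_mul fr.γ_mem hu.2) (Q.σ_mem.mpr hu.2)) hε (by omega)
  · exact pPow_mul' (pPow_mul hu.2 (Q.σ_mem.mpr (mem_pPow_ord _))) hε (by omega)

end Frame

end Groups

/-! ### Minimal elements -/

section Minimal

open Polynomial

variable {F E : Type*} [Field F] [ValuativeRel F] [TopologicalSpace F]
  [IsNonarchimedeanLocalField F] [Field E] [ValuativeRel E] [TopologicalSpace E]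
  [IsNonarchimedeanLocalField E] [Algebra F E] (Q : Quad F E)

namespace Quad

theorem minpoly_coords (he : Q.e = 1) (a b : 𝒪[F]) (hb : (b : F) ≠ 0) :
    ∃ d : 𝒪[F], (d : F) = -Algebra.norm F Q.δ ∧
    minpoly 𝒪[F] (algebraMap F E a + algebraMap F E b * Q.δ)
      = X ^ 2 + (C (-(2 * a)) * X + C (a ^ 2 - d * b ^ 2)) := by
  have hδ2 : Q.δ * Q.δ = algebraMap F E (-Algebra.norm F Q.δ) := by
    rw [map_neg, Q.nm_eq, Q.σ_δ]; ring
  have hd : -Algebra.norm F Q.δ ∈ 𝒪[F] := by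
    rw [mem_integers_iff, ← Q.map_mem_iff, ← hδ2, he]
    exact pPow_mul' (mem_pPow_ord _) (mem_pPow_ord _) (by rw [Q.ord_δ he]; norm_num)
  refine ⟨⟨_, hd⟩, rfl, (minpoly.unique' 𝒪[F] _ ?_ ?_ ?_).symm⟩
  · monicity!
  · have halg : ∀ x : 𝒪[F], algebraMap 𝒪[F] E x = algebraMap F E x := fun x => rfl
    simp only [map_add, map_pow, aeval_X, map_mul, aeval_C, halg]
    have h2 : ((2 : 𝒪[F]) : F) = 2 := rfl
    push_cast
    rw [h2]
    simp only [map_neg, map_ofNat] at hδ2 ⊢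
    linear_combination (algebraMap F E b) ^ 2 * hδ2
  · intro q hq
    by_contra! hcon
    obtain ⟨hq0, hqa⟩ := hcon
    have hdeg : q.degree < 2 := by
      refine hq.trans_le ?_
      compute_degree
    have hq1 : q = C (q.coeff 1) * X + C (q.coeff 0) :=
      eq_X_add_C_of_degree_le_one (Order.lt_succ_iff.mp hdeg)
    have halg : ∀ x : 𝒪[F], algebraMap 𝒪[F] E x = algebraMap F E x := fun x => rfl
    rw [hq1] at hqa
    simp only [map_add, aeval_X, map_mul, aeval_C, halg] at hqa
    by_cases h1 : q.coeff 1 = 0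
    · rw [h1] at hqa hq1
      simp only [ZeroMemClass.coe_zero, map_zero, zero_mul, zero_add, map_eq_zero,
        ZeroMemClass.coe_eq_zero] at hqa
      rw [hqa] at hq1
      simp at hq1
      exact hq0 hq1
    · apply Q.δ_not_mem
      have h1' : (q.coeff 1 : F) ≠ 0 := by simpa using h1
      have h1'' : algebraMap F E (q.coeff 1 : F) ≠ 0 := by simpa using h1'
      have hb' : algebraMap F E (b : F) ≠ 0 := by simpa using hb
      refine ⟨-(q.coeff 0 + q.coeff 1 * a) / (q.coeff 1 * b), ?_⟩
      rw [map_div₀, map_neg, map_add, map_mul, map_mul]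
      field_simp
      linear_combination -hqa

/-- In the unramified case, minimality of `α` means that `α` and its conjugate are as far apart as
their valuation allows. -/
theorem minimal_iff (he : Q.e = 1) {m : ℕ} {α : Eˣ} :
    IsMinimal F m α ↔ ord (α : E) = -(m : ℤ) ∧ (α : E) - Q.σ α ∉ pPow E (1 - m) := by
  have hun := Q.unram_iff.mpr he
  have hϖ : ∀ ϖ : F, ord ϖ = 1 → algebraMap F E ϖ ^ m ≠ 0 ∧ ord (algebraMap F E ϖ ^ m) = m := by
    intro ϖ h1
    have h0 : algebraMap F E ϖ ≠ 0 := by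
      rw [Ne, map_eq_zero]
      rintro rfl
      simp [ord] at h1
    refine ⟨pow_ne_zero _ h0, ?_⟩
    rw [ord_pow h0, Q.ord_map, he, h1]; ring
  have hsub : ∀ (ϖ x y : F), algebraMap F E ϖ ^ m * (α : E)
      = algebraMap F E x + algebraMap F E y * Q.δ →
      algebraMap F E ϖ ^ m * ((α : E) - Q.σ α) = 2 * (algebraMap F E y * Q.δ) := by
    intro ϖ x y h
    have h2 := congrArg Q.σ h
    rw [map_mul, map_pow, AlgEquiv.commutes, Q.σ_coords] at h2
    rw [mul_sub, h, h2]; ring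
  have hδmem : ∀ y : F, algebraMap F E y * Q.δ ∈ pPow E 1 ↔ y ∈ pPow F 1 := fun y => by
    have := Q.coords_mem_iff he (n := 1) (a := 0) (b := y)
    rw [map_zero, zero_add] at this
    simpa using this
  -- everything reduces to whether the coordinate of `ϖ ^ m α` along `δ` is a unit
  have hkey : ∀ (ϖ x y : F), ord ϖ = 1 → algebraMap F E ϖ ^ m * (α : E)
      = algebraMap F E x + algebraMap F E y * Q.δ →
      ((α : E) - Q.σ α ∈ pPow E (1 - m) ↔ y ∈ pPow F 1) := by
    intro ϖ x y h1 h
    obtain ⟨h2, h3⟩ := hϖ ϖ h1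
    rw [← hδmem, ← Q.two_mem_iff (x := algebraMap F E y * Q.δ), ← hsub ϖ x y h]
    have := pPow_mul_iff (n := 1 - m) (y := (α : E) - Q.σ α) h2 h3
    rw [add_sub_cancel] at this
    exact this.symm
  have hint : ∀ (ϖ x y : F), ord ϖ = 1 → ord (α : E) = -(m : ℤ) → algebraMap F E ϖ ^ m * (α : E)
      = algebraMap F E x + algebraMap F E y * Q.δ → x ∈ 𝒪[F] ∧ y ∈ 𝒪[F] := by
    intro ϖ x y h1 hα h
    rw [mem_integers_iff, mem_integers_iff, ← Q.coords_mem_iff he, ← h]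
    obtain ⟨h2, h3⟩ := hϖ ϖ h1
    exact pPow_mul' (mem_pPow_ord _) (mem_pPow_ord _) (by rw [h3, hα]; simp)
  -- the residue of the minimal polynomial
  have hmap : ∀ a b d : 𝒪[F],
      ((X ^ 2 + (C (-(2 * a)) * X + C (a ^ 2 - d * b ^ 2)) : 𝒪[F][X]).map (IsLocalRing.residue 𝒪[F]))
      = (X - C (IsLocalRing.residue _ a)) ^ 2
        - C (IsLocalRing.residue _ d * IsLocalRing.residue _ b ^ 2) := by
    intro a b d
    simp only [Polynomial.map_add, Polynomial.map_pow, map_X, Polynomial.map_mul, map_C]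
    simp only [map_neg, map_sub, map_mul, map_pow, map_ofNat]
    ring
  constructor
  · rintro ⟨hα, -, h⟩
    refine ⟨hα, fun hmem => ?_⟩
    obtain ⟨hαF, hirr⟩ := h hun
    obtain ⟨ϖ, hϖ0, h1⟩ := exists_ord_eq_one (L := F)
    obtain ⟨x, y, hxy⟩ := Q.exists_coords (algebraMap F E ϖ ^ m * (α : E))
    obtain ⟨hx, hy⟩ := hint ϖ x y h1 hα hxy
    have hy1 := (hkey ϖ x y h1 hxy).mp hmem
    have hy0 : y ≠ 0 := by
      rintro rfl
      apply hαF
      refine ⟨x / ϖ ^ m, ?_⟩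
      have := (hϖ ϖ h1).1
      rw [map_div₀, map_pow, div_eq_iff this]
      rw [map_zero, zero_mul, add_zero] at hxy
      rw [← hxy]; ring
    obtain ⟨d, -, hpoly⟩ := Q.minpoly_coords he ⟨x, hx⟩ ⟨y, hy⟩ hy0
    have := hirr ϖ h1
    rw [hxy, hpoly, hmap] at this
    have hy2 : IsLocalRing.residue 𝒪[F] ⟨y, hy⟩ = 0 := by
      rw [IsLocalRing.residue_eq_zero_iff, mem_maximalIdeal_iff]; exact hy1
    rw [hy2] at this
    simp only [ne_eq, OfNat.ofNat_ne_zero, not_false_eq_true, zero_pow, mul_zero, map_zero,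
      sub_zero] at this
    exact not_irreducible_pow (by norm_num) this
  · rintro ⟨hα, hmem⟩
    refine ⟨hα, fun h => absurd hun h, fun _ => ⟨?_, fun ϖ h1 => ?_⟩⟩
    · rintro ⟨x, hx⟩
      apply hmem
      rw [← hx, AlgEquiv.commutes, sub_self]
      exact zero_mem_pPow _
    · obtain ⟨x, y, hxy⟩ := Q.exists_coords (algebraMap F E ϖ ^ m * (α : E))
      obtain ⟨hx, hy⟩ := hint ϖ x y h1 hα hxy
      have hy1 : y ∉ pPow F 1 := fun h => hmem ((hkey ϖ x y h1 hxy).mpr h)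
      have hy0 : y ≠ 0 := fun h => hy1 (h ▸ zero_mem_pPow _)
      obtain ⟨d, hd, hpoly⟩ := Q.minpoly_coords he ⟨x, hx⟩ ⟨y, hy⟩ hy0
      rw [hxy, hpoly, hmap]
      have hy2 : IsLocalRing.residue 𝒪[F] ⟨y, hy⟩ ≠ 0 := by
        rw [Ne, IsLocalRing.residue_eq_zero_iff, mem_maximalIdeal_iff]; exact hy1
      have hdeg : ((X - C (IsLocalRing.residue 𝒪[F] (⟨x, hx⟩ : 𝒪[F]))) ^ 2
        - C (IsLocalRing.residue 𝒪[F] d * IsLocalRing.residue 𝒪[F] ⟨y, hy⟩ ^ 2)).natDegree = 2 := by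
        rw [natDegree_sub_C, natDegree_pow, natDegree_X_sub_C]
      refine irreducible_of_degree_le_three_of_not_isRoot (by rw [hdeg]; simp) fun r hr => ?_
      simp only [IsRoot.def, eval_sub, eval_pow, eval_X, eval_C] at hr
      -- a root makes `d` a square modulo `𝔭`
      obtain ⟨s, hs⟩ := IsLocalRing.residue_surjective
        ((r - IsLocalRing.residue 𝒪[F] ⟨x, hx⟩) / IsLocalRing.residue 𝒪[F] ⟨y, hy⟩)
      have hs2 : IsLocalRing.residue 𝒪[F] (s ^ 2) = IsLocalRing.residue 𝒪[F] d := by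
        rw [map_pow, hs, div_pow, div_eq_iff (pow_ne_zero 2 hy2)]
        linear_combination hr
      rw [residue_eq_iff] at hs2
      have hfac : (algebraMap F E s + algebraMap F E 1 * Q.δ)
          * (algebraMap F E s + algebraMap F E (-1) * Q.δ) ∈ pPow E 1 := by
        have h4 := Q.map_mem (n := 1) hs2
        push_cast at h4
        rw [hd] at h4
        convert h4 using 1
        simp only [map_neg, Q.nm_eq, Q.σ_δ, map_one]
        ring
      have h5 : ∀ b : F, ord b = 0 → b ≠ 0 →
          algebraMap F E s + algebraMap F E b * Q.δ ∉ pPow E 1 := by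
        intro b hb hb0 h6
        rw [Q.coords_mem_iff he, mem_pPow_iff hb0] at h6
        omega
      have h6 : ∀ b : F, ord b = 0 → b ≠ 0 →
          algebraMap F E s + algebraMap F E b * Q.δ ≠ 0 ∧
          ord (algebraMap F E s + algebraMap F E b * Q.δ) = 0 := by
        intro b hb hb0
        refine ⟨fun h7 => h5 b hb hb0 (h7 ▸ zero_mem_pPow _), ord_eq_of_mem_of_not_mem ?_ (h5 b hb hb0)⟩
        rw [Q.coords_mem_iff he]
        exact ⟨mem_integers_iff.mp s.2, hb ▸ mem_pPow_ord b⟩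
      obtain ⟨h7, h8⟩ := h6 1 ord_one one_ne_zero
      obtain ⟨h9, h10⟩ := h6 (-1) (by rw [ord_neg, ord_one]) (by simp)
      rw [mem_pPow_iff (mul_ne_zero h7 h9), ord_mul h7 h9] at hfac
      omega

include Q in
/-- Minimality of `α` of valuation `-m` only depends on `α` modulo `𝔭 ^ (1 - m)`. -/
theorem minimal_of_sub_mem {m : ℕ} {α β : Eˣ} (hα : IsMinimal F m α)
    (h : (β : E) - α ∈ pPow E (1 - m)) : IsMinimal F m β := by
  have hord : ord (β : E) = -(m : ℤ) := by
    have := (ord_add_eq α.ne_zero hα.1 (by rwa [neg_add_eq_sub])).2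
    rwa [add_sub_cancel] at this
  rcases Q.e_cases with he | he
  · rw [Q.minimal_iff he] at hα ⊢
    refine ⟨hord, fun hβ => hα.2 ?_⟩
    have := pPow_add (pPow_sub hβ h) (Q.σ_mem.mpr h)
    rw [map_sub] at this
    convert this using 1; ring
  · have hun : ¬ Unramified F E := by rw [Q.unram_iff]; omega
    exact ⟨hord, hα.2.1, fun h => absurd h hun⟩

end Quad

end Minimal

/-! ### Irreducible representations -/

section Irreducible

variable {Ω G V : Type*} [Field Ω] [Group G] [AddCommGroup V] [Module Ω V]

theorem isIrreducible_iff {ρ : Representation Ω G V} :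
    Representation.IsIrreducible ρ ↔ Nontrivial V ∧
      ∀ W : Submodule Ω V, (∀ g, ∀ v ∈ W, ρ g v ∈ W) → W = ⊥ ∨ W = ⊤ := by
  constructor
  · intro h
    constructor
    · by_contra hV
      rw [not_nontrivial_iff_subsingleton] at hV
      obtain ⟨x, y, hxy⟩ := h.toNontrivial
      exact hxy (Subrepresentation.toSubmodule_injective (Subsingleton.elim _ _))
    · intro W hW
      rcases h.eq_bot_or_eq_top ⟨W, fun g v hv => hW g v hv⟩ with h1 | h1
      · exact Or.inl (congrArg Subrepresentation.toSubmodule h1)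
      · exact Or.inr (congrArg Subrepresentation.toSubmodule h1)
  · rintro ⟨hV, h⟩
    refine { toNontrivial := ⟨⊥, ⊤, fun h1 => ?_⟩, eq_bot_or_eq_top := fun W => ?_ }
    · have := congrArg Subrepresentation.toSubmodule h1
      exact bot_ne_top (α := Submodule Ω V) this
    · rcases h W.toSubmodule (fun g v hv => W.apply_mem_toSubmodule g hv) with h1 | h1
      · exact Or.inl (Subrepresentation.toSubmodule_injective h1)
      · exact Or.inr (Subrepresentation.toSubmodule_injective h1)

theorem eq_top_of_stable {ρ : Representation Ω G V} (hρ : Representation.IsIrreducible ρ)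
    {W : Submodule Ω V} (hW : ∀ g, ∀ v ∈ W, ρ g v ∈ W) {v : V} (hv : v ∈ W) (hv0 : v ≠ 0) :
    W = ⊤ := by
  refine ((isIrreducible_iff.mp hρ).2 W hW).resolve_left fun h => hv0 ?_
  rwa [h, Submodule.mem_bot] at hv

theorem exists_irreducible_sub [FiniteDimensional Ω V] [Nontrivial V] (ρ : Representation Ω G V) :
    ∃ W : Subrepresentation ρ, Representation.IsIrreducible W.toRepresentation := by
  have hwf : WellFounded (fun a b : Submodule Ω V => a < b) := wellFounded_lt
  let S : Set (Submodule Ω V) := {W | W ≠ ⊥ ∧ ∀ g, ∀ v ∈ W, ρ g v ∈ W}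
  have hS : S.Nonempty := ⟨⊤, top_ne_bot, fun _ _ _ => trivial⟩
  obtain ⟨h1, h2⟩ := hwf.min_mem S hS
  set W := hwf.min S hS
  refine ⟨⟨W, fun g v hv => h2 g v hv⟩, isIrreducible_iff.mpr
    ⟨(Submodule.nontrivial_iff_ne_bot).mpr h1, fun U hU => ?_⟩⟩
  by_cases hU0 : U = ⊥
  · exact Or.inl hU0
  right
  have hmem : U.map W.subtype ∈ S := by
    refine ⟨fun h => hU0 ?_, ?_⟩
    · exact Submodule.map_injective_of_injective W.injective_subtype
        (h.trans (Submodule.map_bot _).symm)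
    · rintro g _ ⟨u, hu, rfl⟩
      exact ⟨_, hU g u hu, rfl⟩
  have hle : U.map W.subtype ≤ W := Submodule.map_subtype_le _ _
  have heq : U.map W.subtype = W := by
    by_contra hne
    exact hwf.not_lt_min S hmem (lt_of_le_of_ne hle hne)
  rw [eq_top_iff]
  intro x _
  have hx : (x : V) ∈ U.map W.subtype := by rw [heq]; exact x.2
  obtain ⟨y, hy, hyx⟩ := hx
  rwa [← Subtype.ext (a1 := y) (a2 := x) hyx]

theorem exists_scalar_of_commute [IsAlgClosed Ω] [FiniteDimensional Ω V]
    {ρ : Representation Ω G V} (hρ : Representation.IsIrreducible ρ) (A : V →ₗ[Ω] V)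
    (h : ∀ g v, A (ρ g v) = ρ g (A v)) : ∃ c : Ω, ∀ v, A v = c • v := by
  have := (isIrreducible_iff.mp hρ).1
  obtain ⟨c, hc⟩ := Module.End.exists_eigenvalue A
  obtain ⟨v, hv⟩ := hc.exists_hasEigenvector
  have htop := eq_top_of_stable hρ (W := Module.End.eigenspace A c) (fun g w hw => by
    rw [Module.End.mem_eigenspace_iff] at hw ⊢
    rw [h, hw, map_smul]) hv.1 hv.2
  exact ⟨c, fun w => Module.End.mem_eigenspace_iff.mp (htop ▸ Submodule.mem_top)⟩

theorem exists_common_eigenvector [IsAlgClosed Ω] [FiniteDimensional Ω V] [Nontrivial V]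
    (ρ : Representation Ω G V) (h : ∀ g g' v, ρ g (ρ g' v) = ρ g' (ρ g v)) :
    ∃ v : V, v ≠ 0 ∧ ∀ g, ∃ c : Ω, ρ g v = c • v := by
  obtain ⟨W, hW⟩ := exists_irreducible_sub ρ
  have := (isIrreducible_iff.mp hW).1
  obtain ⟨w, hw⟩ := exists_ne (0 : W.toSubmodule)
  refine ⟨w, fun h0 => hw (Subtype.ext h0), fun g => ?_⟩
  obtain ⟨c, hc⟩ := exists_scalar_of_commute hW (W.toRepresentation g)
    (fun g' v => Subtype.ext (h g g' v))
  exact ⟨c, congrArg Subtype.val (hc w)⟩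

/-- The vectors on which the elements of a conjugation-invariant set act by prescribed scalars form
a subrepresentation. -/
theorem apply_eq_smul_of_conj {ρ : Representation Ω G V} (hρ : Representation.IsIrreducible ρ)
    (R : G → Ω → Prop) (hR : ∀ g s c, R s c → R (g⁻¹ * s * g) c) {v : V} (hv : v ≠ 0)
    (h : ∀ s c, R s c → ρ s v = c • v) {s : G} {c : Ω} (hs : R s c) (w : V) : ρ s w = c • w := by
  let W : Submodule Ω V :=
    { carrier := {w | ∀ s c, R s c → ρ s w = c • w}
      zero_mem' := fun s c _ => by simp
      add_mem' := fun {x y} hx hy s c hs => by rw [map_add, hx s c hs, hy s c hs, smul_add]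
      smul_mem' := fun a x hx s c hs => by rw [map_smul, hx s c hs, smul_comm] }
  have htop : W = ⊤ := by
    refine eq_top_of_stable hρ (fun g x hx s c hs => ?_) (v := v) h hv
    have h1 := hx _ _ (hR g s c hs)
    rw [← map_smul, ← h1, ← Module.End.mul_apply, ← Module.End.mul_apply, ← map_mul, ← map_mul]
    congr 2; group
  have : w ∈ W := htop ▸ Submodule.mem_top
  exact this s c hs

/-- The representation `ρ ⊗ μ`. -/
def twist (μ : G →* Ωˣ) (ρ : Representation Ω G V) : Representation Ω G V where
  toFun g := (μ g : Ω) • ρ g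
  map_one' := by simp
  map_mul' g h := by
    ext v
    simp [smul_smul, mul_comm]

@[simp] theorem twist_apply (μ : G →* Ωˣ) (ρ : Representation Ω G V) (g : G) (v : V) :
    twist μ ρ g v = (μ g : Ω) • ρ g v := rfl

theorem trace_twist (μ : G →* Ωˣ) (ρ : Representation Ω G V) (g : G) :
    LinearMap.trace Ω V (twist μ ρ g) = (μ g : Ω) * LinearMap.trace Ω V (ρ g) := by
  change LinearMap.trace Ω V ((μ g : Ω) • ρ g) = _
  rw [map_smul, smul_eq_mul]

theorem isIrreducible_twist {μ : G →* Ωˣ} {ρ : Representation Ω G V}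
    (h : Representation.IsIrreducible ρ) : Representation.IsIrreducible (twist μ ρ) := by
  rw [isIrreducible_iff] at h ⊢
  refine ⟨h.1, fun W hW => h.2 W fun g v hv => ?_⟩
  have := W.smul_mem (((μ g)⁻¹ : Ωˣ) : Ω) (hW g v hv)
  rwa [twist_apply, smul_smul, Units.inv_mul, one_smul] at this

/-- Transport of a representation along a linear equivalence. -/
def transport {V' : Type*} [AddCommGroup V'] [Module Ω V'] (e : V ≃ₗ[Ω] V')
    (ρ : Representation Ω G V) : Representation Ω G V' where
  toFun g := e.conj (ρ g)
  map_one' := by rw [map_one]; exact e.conj_id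
  map_mul' g h := by rw [map_mul]; exact e.conj_comp _ _

@[simp] theorem transport_apply {V' : Type*} [AddCommGroup V'] [Module Ω V'] (e : V ≃ₗ[Ω] V')
    (ρ : Representation Ω G V) (g : G) (v : V') : transport e ρ g v = e (ρ g (e.symm v)) := rfl

theorem trace_transport {V' : Type*} [AddCommGroup V'] [Module Ω V'] (e : V ≃ₗ[Ω] V')
    (ρ : Representation Ω G V) (g : G) :
    LinearMap.trace Ω V' (transport e ρ g) = LinearMap.trace Ω V (ρ g) :=
  LinearMap.trace_conj' _ _

theorem isIrreducible_transport {V' : Type*} [AddCommGroup V'] [Module Ω V'] (e : V ≃ₗ[Ω] V')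
    {ρ : Representation Ω G V} (h : Representation.IsIrreducible ρ) :
    Representation.IsIrreducible (transport e ρ) := by
  rw [isIrreducible_iff] at h ⊢
  refine ⟨(e.toEquiv.nontrivial_congr).mp h.1, fun W hW => ?_⟩
  have := h.2 (W.comap e.toLinearMap) fun g v hv => by
    have := hW g _ hv
    rw [transport_apply] at this
    simpa using this
  rcases this with h1 | h1
  · left
    rw [eq_bot_iff]
    intro x hx
    have h2 : e.symm x ∈ W.comap e.toLinearMap := by simpa using hx
    rw [h1, Submodule.mem_bot] at h2
    simpa using h2
  · right
    rw [eq_top_iff]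
    intro x _
    have h2 : e.symm x ∈ W.comap e.toLinearMap := h1 ▸ Submodule.mem_top
    simpa using h2

/-- If `H ≤ G` and every element of `G` acts as an element of `H` up to a scalar, then an irreducible
representation of `G` remains irreducible on `H`. -/
theorem isIrreducible_of_scalar {H : Type*} [Group H] {ρ : Representation Ω G V}
    (hρ : Representation.IsIrreducible ρ) (i : H →* G)
    (h : ∀ g, ∃ (k : H) (c : Ω), ∀ v, ρ g v = c • ρ (i k) v) :
    Representation.IsIrreducible (ρ.comp i) := by
  rw [isIrreducible_iff] at hρ ⊢
  refine ⟨hρ.1, fun W hW => hρ.2 W fun g v hv => ?_⟩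
  obtain ⟨k, c, hk⟩ := h g
  rw [hk]
  exact W.smul_mem c (hW k v hv)

end Irreducible

/-! ### Dimension formula -/

section Dimension

variable {Ω G V : Type*} [Field Ω] [IsAlgClosed Ω] [CharZero Ω] [Group G] [AddCommGroup V]
  [Module Ω V] [FiniteDimensional Ω V]

/-- Orthonormality of the character of an irreducible representation on which a normal subgroup of
finite index acts by scalars. -/
theorem sum_trace_mul_trace_inv {ρ : Representation Ω G V} (hρ : Representation.IsIrreducible ρ)
    (N : Subgroup G) [N.FiniteIndex] (hN : ∀ n ∈ N, ∃ c : Ω, ∀ v, ρ n v = c • v) :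
    letI := Fintype.ofFinite (G ⧸ N)
    ∑ x : G ⧸ N, LinearMap.trace Ω V (ρ x.out) * LinearMap.trace Ω V (ρ (x.out)⁻¹)
      = Fintype.card (G ⧸ N) := by
  let := Fintype.ofFinite (G ⧸ N)
  classical
  have hV := (isIrreducible_iff.mp hρ).1
  have hconj : ∀ (A : Module.End Ω V) (g h : G), (g : G ⧸ N) = h →
      ρ g * A * ρ g⁻¹ = ρ h * A * ρ h⁻¹ := by
    intro A g h hgh
    rw [QuotientGroup.eq] at hgh
    obtain ⟨c, hc⟩ := hN _ hgh
    have hc' : ρ (g⁻¹ * h) = c • 1 := by ext v; exact hc v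
    have hh : ρ h = c • ρ g := by
      rw [← mul_inv_cancel_left g h, map_mul, hc', mul_smul_comm, mul_one]
    have hg : ρ g⁻¹ = c • ρ h⁻¹ := by
      have : g⁻¹ = (g⁻¹ * h) * h⁻¹ := by group
      rw [this, map_mul, hc', smul_mul_assoc, one_mul]
    rw [hh, hg, mul_smul_comm, smul_mul_assoc, smul_mul_assoc]
  let avg : Module.End Ω V → Module.End Ω V := fun A => ∑ x : G ⧸ N, ρ x.out * A * ρ (x.out)⁻¹
  have hcomm : ∀ A g, ρ g * avg A = avg A * ρ g := by
    intro A g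
    simp only [avg]
    rw [Finset.mul_sum, Finset.sum_mul, ← Equiv.sum_comp (MulAction.toPerm g)
      (fun x : G ⧸ N => ρ x.out * A * ρ (x.out)⁻¹ * ρ g)]
    refine Finset.sum_congr rfl fun x _ => ?_
    have h1 : (((g • x).out : G) : G ⧸ N) = ((g * x.out : G) : G ⧸ N) := by
      rw [QuotientGroup.out_eq', ← smul_eq_mul, ← MulAction.Quotient.smul_coe, QuotientGroup.out_eq']
    rw [MulAction.toPerm_apply, hconj A _ _ h1, map_mul, mul_inv_rev, map_mul]
    simp only [mul_assoc]
    rw [← map_mul, inv_mul_cancel, map_one, mul_one]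
  have hscal : ∀ A, ∃ c : Ω, avg A = c • 1 := fun A => by
    obtain ⟨c, hc⟩ := exists_scalar_of_commute hρ (avg A) (fun g v => by
      have := congrArg (fun f => f v) (hcomm A g)
      simpa using this.symm)
    exact ⟨c, by ext v; exact hc v⟩
  choose c hc using hscal
  have htr : ∀ A, c A * Module.finrank Ω V = Fintype.card (G ⧸ N) * LinearMap.trace Ω V A := by
    intro A
    have h1 : LinearMap.trace Ω V (avg A) = c A * Module.finrank Ω V := by
      rw [hc, map_smul, LinearMap.trace_one, smul_eq_mul]
    rw [← h1]
    simp only [avg, map_sum]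
    rw [Finset.sum_congr rfl (fun x _ => ?_), Finset.sum_const, nsmul_eq_mul, Finset.card_univ]
    rw [LinearMap.trace_mul_comm, ← mul_assoc, ← map_mul, inv_mul_cancel, map_one, one_mul]
  have hd : (Module.finrank Ω V : Ω) ≠ 0 := by
    have := Module.finrank_pos (R := Ω) (M := V)
    exact_mod_cast this.ne'
  let b := Module.finBasis Ω V
  -- Expand the product of traces through the elementary endomorphisms.
  let E : Fin (Module.finrank Ω V) → Fin (Module.finrank Ω V) → Module.End Ω V :=
    fun i k => Matrix.toLin b b (Matrix.single i k 1)
  have hEtr : ∀ i k, LinearMap.trace Ω V (E i k) = if i = k then 1 else 0 := by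
    intro i k
    rw [LinearMap.trace_eq_matrix_trace Ω b, LinearMap.toMatrix_toLin]
    split_ifs with h
    · subst h; simp
    · simp [h]
  have hprod : ∀ A B : Module.End Ω V, LinearMap.trace Ω V A * LinearMap.trace Ω V B
      = ∑ i, ∑ k, (LinearMap.toMatrix b b (A * E i k * B)) i k := by
    intro A B
    rw [LinearMap.trace_eq_matrix_trace Ω b, LinearMap.trace_eq_matrix_trace Ω b, Matrix.trace,
      Matrix.trace, Finset.sum_mul_sum]
    refine Finset.sum_congr rfl fun i _ => Finset.sum_congr rfl fun k _ => ?_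
    rw [LinearMap.toMatrix_mul, LinearMap.toMatrix_mul, LinearMap.toMatrix_toLin]
    simp only [Matrix.diag_apply, Matrix.mul_apply, Matrix.single_apply]
    simp [ite_and, Finset.sum_ite_eq]
  simp only [hprod]
  rw [Finset.sum_comm]
  have h2 : ∀ i, ∑ x : G ⧸ N, ∑ k, LinearMap.toMatrix b b (ρ x.out * E i k * ρ (x.out)⁻¹) i k
      = Fintype.card (G ⧸ N) / Module.finrank Ω V := by
    intro i
    rw [Finset.sum_comm]
    have h3 : ∀ k, ∑ x : G ⧸ N, LinearMap.toMatrix b b (ρ x.out * E i k * ρ (x.out)⁻¹) i k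
        = c (E i k) * if i = k then 1 else 0 := by
      intro k
      have := congrArg (fun f => LinearMap.toMatrix b b f i k) (hc (E i k))
      simp only [avg, map_sum, Matrix.sum_apply, map_smul, LinearMap.toMatrix_one,
        Matrix.smul_apply, Matrix.one_apply, smul_eq_mul] at this
      exact this
    rw [Finset.sum_congr rfl fun k _ => h3 k]
    simp only [mul_ite, mul_one, mul_zero, Finset.sum_ite_eq, Finset.mem_univ, if_true]
    rw [eq_div_iff hd, htr, hEtr, if_pos rfl, mul_one]
  rw [Finset.sum_congr rfl fun i _ => h2 i, Finset.sum_const, Finset.card_univ, Fintype.card_fin,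
    nsmul_eq_mul]
  field_simp

/-- If the character of an irreducible representation is concentrated on a subgroup `N` acting by
scalars and outside of `M`, where it has absolute value one, then the square of the dimension is the
index of `N` in `M`. -/
theorem finrank_sq_eq {ρ : Representation Ω G V} (hρ : Representation.IsIrreducible ρ)
    (N M : Subgroup G) [N.FiniteIndex] (hNM : N ≤ M)
    (hN : ∀ n ∈ N, ∃ c : Ω, ∀ v, ρ n v = c • v)
    (hM : ∀ g ∈ M, g ∉ N → LinearMap.trace Ω V (ρ g) = 0)
    (hG : ∀ g, g ∉ M → LinearMap.trace Ω V (ρ g) * LinearMap.trace Ω V (ρ g⁻¹) = 1)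
    {κ : Type*} [Finite κ] (φ : G → κ) (hφ : ∀ g ∈ M, ∀ h ∈ M, φ g = φ h ↔ g⁻¹ * h ∈ N)
    (hφs : ∀ k, ∃ g ∈ M, φ g = k) : Module.finrank Ω V ^ 2 = Nat.card κ := by
  classical
  let := Fintype.ofFinite (G ⧸ N)
  have hsum := sum_trace_mul_trace_inv hρ N hN
  have hval : ∀ x : G ⧸ N,
      LinearMap.trace Ω V (ρ x.out) * LinearMap.trace Ω V (ρ (x.out)⁻¹)
      = (if x = (1 : G) then (Module.finrank Ω V : Ω) ^ 2 else 0)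
        + (1 - if x.out ∈ M then 1 else 0) := by
    intro x
    by_cases hx : x.out ∈ N
    · have hx1 : x = (1 : G) := by
        rw [← QuotientGroup.out_eq' x, eq_comm, QuotientGroup.eq, inv_one, one_mul]
        exact hx
      obtain ⟨c, hc⟩ := hN _ hx
      have hc' : ρ x.out = c • 1 := by ext v; exact hc v
      have hinv : ρ (x.out)⁻¹ * ρ x.out = 1 := by rw [← map_mul, inv_mul_cancel, map_one]
      rw [hc', mul_smul_comm, mul_one] at hinv
      have htr := congrArg (LinearMap.trace Ω V) hinv
      rw [map_smul, LinearMap.trace_one, smul_eq_mul] at htr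
      rw [if_pos hx1, if_pos (hNM hx), hc', map_smul, LinearMap.trace_one, smul_eq_mul,
        mul_right_comm, htr]
      ring
    · have hx1 : x ≠ (1 : G) := by
        rintro h
        rw [← QuotientGroup.out_eq' x, eq_comm, QuotientGroup.eq, inv_one, one_mul] at h
        exact hx h
      rw [if_neg hx1]
      by_cases hxM : x.out ∈ M
      · rw [hM _ hxM hx, if_pos hxM]; ring
      · rw [hG _ hxM, if_neg hxM]; ring
  rw [Finset.sum_congr rfl fun x _ => hval x, Finset.sum_add_distrib, Finset.sum_sub_distrib,
    Finset.sum_ite_eq' Finset.univ, if_pos (Finset.mem_univ _), Finset.sum_const, Finset.card_univ,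
    nsmul_eq_mul, mul_one, Finset.sum_boole, ← Fintype.card_subtype] at hsum
  have h1 : ((Module.finrank Ω V ^ 2 : ℕ) : Ω) = (Fintype.card {x : G ⧸ N // x.out ∈ M} : ℕ) := by
    push_cast
    linear_combination hsum
  rw [Nat.cast_inj] at h1
  rw [h1, ← Nat.card_eq_fintype_card]
  refine Nat.card_eq_of_bijective (fun x => φ x.1.out) ⟨fun x y hxy => ?_, fun k => ?_⟩
  · rw [hφ _ x.2 _ y.2, ← QuotientGroup.eq, QuotientGroup.out_eq', QuotientGroup.out_eq'] at hxy
    exact Subtype.ext hxy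
  · obtain ⟨g, hg, rfl⟩ := hφs k
    have h2 : g⁻¹ * (g : G ⧸ N).out ∈ N := by
      rw [← QuotientGroup.eq, QuotientGroup.out_eq']
    have h3 : (g : G ⧸ N).out ∈ M := by
      have := M.mul_mem hg (hNM h2)
      rwa [mul_inv_cancel_left] at this
    exact ⟨⟨_, h3⟩, ((hφ _ hg _ h3).mpr h2).symm⟩

end Dimension

/-! ### Finite-dimensionality and extension of characters -/

section Finiteness

open scoped IsMulCommutative

variable {Ω G V : Type*} [Field Ω] [IsAlgClosed Ω] [Group G] [AddCommGroup V] [Module Ω V]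

/-- An irreducible representation that is finitely generated over a finitely generated commutative
algebra of endomorphisms is finite-dimensional, and this algebra acts by scalars. -/
theorem finiteDimensional_of_algebra {ρ : Representation Ω G V}
    (hρ : Representation.IsIrreducible ρ) (A : Type*) [CommRing A] [Algebra Ω A]
    [Algebra.FiniteType Ω A] [Module A V] [IsScalarTower Ω A V]
    (hA : ∀ (a : A) g v, ρ g (a • v) = a • ρ g v) (hfg : Module.Finite A V) :
    FiniteDimensional Ω V := by
  have hV := (isIrreducible_iff.mp hρ).1
  have hann : Module.annihilator A V ≠ ⊤ := by
    intro h
    obtain ⟨v, hv⟩ := exists_ne (0 : V)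
    have h1 : (1 : A) ∈ Module.annihilator A V := h ▸ Submodule.mem_top
    rw [Module.mem_annihilator] at h1
    exact hv (by simpa using h1 v)
  obtain ⟨𝔪, hmax, hle⟩ := Ideal.exists_le_maximal _ hann
  -- By Nakayama's lemma `𝔪 V` is a proper subrepresentation, so it vanishes.
  have hne : 𝔪 • (⊤ : Submodule A V) ≠ ⊤ := by
    intro h
    obtain ⟨r, hr, hr'⟩ := Submodule.exists_sub_one_mem_and_smul_eq_zero_of_fg_of_le_smul 𝔪 ⊤
      hfg.fg_top h.ge
    have h1 : r ∈ 𝔪 := hle (Module.mem_annihilator.mpr fun v => hr' v trivial)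
    apply hmax.ne_top
    rw [Ideal.eq_top_iff_one]
    have := 𝔪.sub_mem h1 hr
    rwa [sub_sub_cancel] at this
  obtain ⟨W, hW⟩ : ∃ W : Submodule Ω V, ∀ v, v ∈ W ↔ v ∈ 𝔪 • (⊤ : Submodule A V) :=
    ⟨(𝔪 • (⊤ : Submodule A V)).restrictScalars Ω, fun v => Submodule.restrictScalars_mem _ _ _⟩
  have hstab : ∀ g, ∀ v ∈ W, ρ g v ∈ W := by
    intro g v hv
    rw [hW] at hv ⊢
    refine Submodule.smul_induction_on (p := fun v => ρ g v ∈ 𝔪 • (⊤ : Submodule A V)) hv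
      (fun a ha w _ => ?_) (fun x y hx hy => ?_)
    · rw [hA]
      exact Submodule.smul_mem_smul ha trivial
    · rw [map_add]
      exact Submodule.add_mem _ hx hy
  have hzero : ∀ a ∈ 𝔪, ∀ v : V, a • v = 0 := by
    intro a ha v
    rcases (isIrreducible_iff.mp hρ).2 W hstab with h | h
    · have h1 : a • v ∈ W := (hW _).mpr (Submodule.smul_mem_smul ha trivial)
      rwa [h, Submodule.mem_bot] at h1
    · exfalso
      apply hne
      rw [eq_top_iff]
      intro x _
      rw [← hW, h]
      trivial
  let := Ideal.Quotient.field 𝔪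
  have : Module.Finite Ω (A ⧸ 𝔪) := finite_of_finite_type_of_isJacobsonRing Ω (A ⧸ 𝔪)
  have hscal : ∀ a : A, ∃ c : Ω, ∀ v : V, a • v = c • v := by
    intro a
    obtain ⟨c, hc⟩ := (IsAlgClosed.algebraMap_bijective_of_isIntegral (k := Ω) (K := A ⧸ 𝔪)).2
      (Ideal.Quotient.mk 𝔪 a)
    refine ⟨c, fun v => ?_⟩
    have h1 : a - algebraMap Ω A c ∈ 𝔪 := by
      rw [← Ideal.Quotient.eq, ← hc]; rfl
    have h2 := hzero _ h1 v
    rwa [sub_smul, algebraMap_smul, sub_eq_zero] at h2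
  obtain ⟨S, hS⟩ := hfg.fg_top
  refine ⟨⟨S, ?_⟩⟩
  rw [eq_top_iff]
  intro v _
  have hv : v ∈ Submodule.span A (S : Set V) := hS ▸ Submodule.mem_top
  refine Submodule.span_induction (fun x hx => Submodule.subset_span hx) (Submodule.zero_mem _)
    (fun x y _ _ hx hy => Submodule.add_mem _ hx hy) (fun a x _ hx => ?_) hv
  obtain ⟨c, hc⟩ := hscal a
  rw [hc]
  exact Submodule.smul_mem _ _ hx

/-- An irreducible representation is finite-dimensional if some nonzero vector has a stabilizer with
finitely many cosets modulo a finitely generated central subgroup. -/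
theorem finiteDimensional_of_cosets {ρ : Representation Ω G V}
    (hρ : Representation.IsIrreducible ρ) (S : Set G) (hS : S.Finite)
    (hcent : ∀ z ∈ S, ∀ g, z * g = g * z) (R : Set G) (hR : R.Finite) {v : V} (hv : v ≠ 0)
    (h : ∀ g, ∃ z ∈ Submonoid.closure S, ∃ r ∈ R, ∃ k, g = z * r * k ∧ ρ k v = v) :
    FiniteDimensional Ω V := by
  let S' : Set (Module.End Ω V) := (fun z => ρ z) '' S
  have hcomm : ∀ a ∈ S', ∀ b ∈ S', a * b = b * a := by
    rintro _ ⟨z, hz, rfl⟩ _ ⟨z', hz', rfl⟩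
    change ρ z * ρ z' = ρ z' * ρ z
    rw [← map_mul, ← map_mul, hcent z hz]
  let A := Algebra.adjoin Ω S'
  have := Algebra.isMulCommutative_adjoin Ω hcomm
  have : Algebra.FiniteType Ω A := by
    rw [← Subalgebra.fg_iff_finiteType]
    exact ⟨(hS.image _).toFinset, by rw [Set.Finite.coe_toFinset]⟩
  have hsmul : ∀ (a : A) (w : V), a • w = (a : Module.End Ω V) w := fun _ _ => rfl
  have hA : ∀ (a : A) g w, ρ g (a • w) = a • ρ g w := by
    intro a g w
    rw [hsmul, hsmul]
    have h1 : ρ g * (a : Module.End Ω V) = a * ρ g := by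
      obtain ⟨a, ha⟩ := a
      induction ha using Algebra.adjoin_induction with
      | mem x hx =>
        obtain ⟨z, hz, rfl⟩ := hx
        change ρ g * ρ z = ρ z * ρ g
        rw [← map_mul, ← map_mul, hcent z hz]
      | algebraMap c => exact (Algebra.commutes c (ρ g)).symm
      | add x y _ _ hx hy =>
        change ρ g * (x + y) = (x + y) * ρ g
        rw [mul_add, add_mul]
        exact congrArg₂ _ hx hy
      | mul x y _ _ hx hy =>
        change ρ g * (x * y) = (x * y) * ρ g
        change ρ g * x = x * ρ g at hx
        change ρ g * y = y * ρ g at hy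
        rw [← mul_assoc, hx, mul_assoc, hy, mul_assoc]
    exact congrArg (fun f => f w) h1
  have hmem : ∀ z ∈ Submonoid.closure S, ρ z ∈ A := by
    intro z hz
    induction hz using Submonoid.closure_induction with
    | mem x hx => exact Algebra.subset_adjoin ⟨x, hx, rfl⟩
    | one => rw [map_one]; exact A.one_mem
    | mul x y _ _ hx hy => rw [map_mul]; exact A.mul_mem hx hy
  let W : Submodule A V := Submodule.span A ((fun r => ρ r v) '' R)
  have htop : W.restrictScalars Ω = ⊤ := by
    have hgen : ∀ g, ρ g v ∈ W := by
      intro g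
      obtain ⟨z, hz, r, hr, k, rfl, hk⟩ := h g
      rw [map_mul, map_mul, Module.End.mul_apply, Module.End.mul_apply, hk]
      exact W.smul_mem (⟨ρ z, hmem z hz⟩ : A) (Submodule.subset_span ⟨r, hr, rfl⟩)
    refine eq_top_of_stable hρ (v := v) (fun g w hw => ?_) ?_ hv
    · refine Submodule.span_induction (p := fun w _ => ρ g w ∈ W) ?_ ?_ ?_ ?_ hw
      · rintro _ ⟨r, -, rfl⟩
        change ρ g (ρ r v) ∈ W
        rw [← Module.End.mul_apply, ← map_mul]
        exact hgen _
      · rw [map_zero]; exact W.zero_mem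
      · intro x y _ _ hx hy
        rw [map_add]; exact W.add_mem hx hy
      · intro a x _ hx
        rw [hA]; exact W.smul_mem a hx
    · have := hgen 1
      rwa [map_one] at this
  have hfg : Module.Finite A V := by
    refine ⟨⟨(hR.image (fun r => ρ r v)).toFinset, ?_⟩⟩
    rw [Set.Finite.coe_toFinset, eq_top_iff]
    intro x _
    have : x ∈ W.restrictScalars Ω := htop ▸ Submodule.mem_top
    exact this
  exact finiteDimensional_of_algebra hρ A hA hfg

/-- A character of `K` that factors through the commutative quotient `f` extends to a character of
the target of `f`, since the unit group of an algebraically closed field is divisible. -/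
theorem exists_char_factor {K A : Type*} [Group K] [CommGroup A] (f : K →* A) (ξ : K →* Ωˣ)
    (h : ∀ k, f k = 1 → ξ k = 1) : ∃ ω : A →* Ωˣ, ∀ k, ω (f k) = ξ k := by
  have hroot : ∀ (n : ℤ) (x : Ωˣ), n ≠ 0 → ∃ y : Ωˣ, y ^ n = x := by
    intro n x hn
    have hn' : 0 < n.natAbs := Int.natAbs_pos.mpr hn
    obtain ⟨y, hy⟩ := IsAlgClosed.exists_pow_nat_eq (x : Ω) hn'
    have hy0 : y ≠ 0 := by
      rintro rfl
      rw [zero_pow hn'.ne'] at hy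
      exact x.ne_zero hy.symm
    have h1 : (Units.mk0 y hy0) ^ n.natAbs = x := Units.ext (by simpa using hy)
    rcases Int.natAbs_eq n with h2 | h2
    · exact ⟨Units.mk0 y hy0, by rw [h2, zpow_natCast, h1]⟩
    · exact ⟨(Units.mk0 y hy0)⁻¹, by rw [h2, zpow_neg, inv_zpow, inv_inv, zpow_natCast, h1]⟩
  classical
  let : DivisibleBy (Additive Ωˣ) ℤ :=
    { div := fun x n => if h : n = 0 then 0
        else Additive.ofMul (hroot n x.toMul h).choose
      div_zero := fun a => by simp
      div_cancel := fun {n} a hn => by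
        rw [dif_neg hn]
        exact (hroot n a.toMul hn).choose_spec }
  have hb := Module.Baer.of_divisible (Additive Ωˣ)
  -- The induced character on the range of `f`.
  have hfac : ∃ θ : f.range →* Ωˣ, ∀ k, θ ⟨f k, k, rfl⟩ = ξ k := by
    refine ⟨f.rangeRestrict.liftOfSurjective f.rangeRestrict_surjective ⟨ξ, fun k hk => ?_⟩,
      fun k => ?_⟩
    · rw [MonoidHom.ker_rangeRestrict] at hk
      exact h k hk
    · exact MonoidHom.liftOfRightInverse_comp_apply _ _ _ _ k
  obtain ⟨θ, hθ⟩ := hfac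
  obtain ⟨ω, hω⟩ := hb.extension_property_addMonoidHom (MonoidHom.toAdditive f.range.subtype)
    (fun x y hxy => Subtype.ext hxy) (MonoidHom.toAdditive θ)
  refine ⟨MonoidHom.toAdditive.symm ω, fun k => ?_⟩
  have := DFunLike.congr_fun hω (Additive.ofMul ⟨f k, k, rfl⟩)
  rw [← hθ]
  exact this

end Finiteness

/-! ### The unit filtration and elements near `E` -/

section Filtration

variable {F E : Type*} [Field F] [ValuativeRel F] [TopologicalSpace F]
  [IsNonarchimedeanLocalField F] [Field E] [ValuativeRel E] [TopologicalSpace E]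
  [IsNonarchimedeanLocalField E] [Algebra F E]

variable (E) in
/-- The subgroup of units of `𝒪_E` congruent to `1` modulo `𝔭 ^ n`. -/
def U (n : ℤ) : Subgroup Eˣ where
  carrier := {e | ord (e : E) = 0 ∧ (e : E) - 1 ∈ pPow E n}
  one_mem' := by
    refine ⟨ord_one, ?_⟩
    rw [Units.val_one, sub_self]; exact zero_mem_pPow _
  mul_mem' := by
    rintro a b ⟨ha, ha'⟩ ⟨hb, hb'⟩
    refine ⟨by rw [Units.val_mul, ord_mul a.ne_zero b.ne_zero, ha, hb, add_zero], ?_⟩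
    have := pPow_add (pPow_mul' (l := n) (mem_pPow_ord (a : E)) hb' (by omega)) ha'
    convert this using 1
    rw [Units.val_mul]; ring
  inv_mem' := by
    rintro a ⟨ha, ha'⟩
    refine ⟨by rw [Units.val_inv_eq_inv_val, ord_inv, ha, neg_zero], ?_⟩
    have : ((a⁻¹ : Eˣ) : E) - 1 = (a : E)⁻¹ * -((a : E) - 1) := by
      rw [Units.val_inv_eq_inv_val]
      field_simp
      ring
    rw [this, mem_pPow_inv_mul a.ne_zero, ha, zero_add]
    exact pPow_neg ha'

theorem mem_U {n : ℤ} (hn : 1 ≤ n) {e : Eˣ} : e ∈ U E n ↔ (e : E) - 1 ∈ pPow E n :=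
  ⟨fun h => h.2, fun h => ⟨ord_of_sub_one (pPow_anti hn h), h⟩⟩

theorem U_anti {n k : ℤ} (h : n ≤ k) : U E k ≤ U E n := fun _ he => ⟨he.1, pPow_anti h he.2⟩

theorem div_mem_U {n : ℤ} (hn : 1 ≤ n) {e f : Eˣ} :
    e / f ∈ U E n ↔ (e : E) - f ∈ pPow E (ord (f : E) + n) := by
  rw [mem_U hn, ← mem_pPow_inv_mul f.ne_zero, Units.val_div_eq_div_val]
  have : (e : E) / f - 1 = (f : E)⁻¹ * (e - f) := by field_simp
  rw [this]

theorem ord_eq_of_div_mem {n : ℤ} {e f : Eˣ} (h : e / f ∈ U E n) : ord (e : E) = ord (f : E) := by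
  have := h.1
  rw [Units.val_div_eq_div_val, ord_div e.ne_zero f.ne_zero] at this
  omega

variable (F E) in
/-- The group `Fˣ U_E¹`. -/
def FU : Subgroup Eˣ := (Units.map (algebraMap F E : F →* E)).range ⊔ U E 1

theorem U_le_FU {n : ℤ} (hn : 1 ≤ n) : U E n ≤ FU F E := (U_anti hn).trans le_sup_right

theorem algebraMap_mem_FU (c : Fˣ) : Units.map (algebraMap F E : F →* E) c ∈ FU F E :=
  (le_sup_left : _ ≤ FU F E) ⟨c, rfl⟩

theorem mem_FU {e : Eˣ} :
    e ∈ FU F E ↔ ∃ c : Fˣ, ∃ u ∈ U E 1, Units.map (algebraMap F E : F →* E) c * u = e := by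
  rw [FU, Subgroup.mem_sup]
  constructor
  · rintro ⟨_, ⟨c, rfl⟩, u, hu, rfl⟩
    exact ⟨c, u, hu, rfl⟩
  · rintro ⟨c, u, hu, rfl⟩
    exact ⟨_, ⟨c, rfl⟩, u, hu, rfl⟩

theorem mem_FU_of_div {e f : Eˣ} {n : ℤ} (hn : 1 ≤ n) (hf : f ∈ FU F E) (h : e / f ∈ U E n) :
    e ∈ FU F E := by
  have := (FU F E).mul_mem (U_le_FU hn h) hf
  rwa [div_mul_cancel] at this

namespace Quad

variable (Q : Quad F E)

/-- The conjugation on `Eˣ`. -/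
def σU : Eˣ →* Eˣ := Units.map (Q.σ : E →* E)

@[simp] theorem coe_σU (e : Eˣ) : (Q.σU e : E) = Q.σ e := rfl

theorem σU_mem {n : ℤ} {e : Eˣ} (h : e ∈ U E n) : Q.σU e ∈ U E n := by
  refine ⟨by rw [coe_σU, Q.ord_σ, h.1], ?_⟩
  have := Q.σ_mem.mpr h.2
  rwa [map_sub, map_one] at this

theorem div_σU_mem {e : Eˣ} (h : e ∈ FU F E) : e / Q.σU e ∈ U E 1 := by
  obtain ⟨c, u, hu, rfl⟩ := mem_FU.mp h
  have : Q.σU (Units.map (algebraMap F E : F →* E) c) = Units.map (algebraMap F E : F →* E) c :=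
    Units.ext (Q.σ.commutes c)
  rw [map_mul, this, mul_div_mul_left_eq_div]
  exact (U E 1).div_mem hu (Q.σU_mem hu)

end Quad

variable {Q : Quad F E} {D : Type*} [Ring D] [Algebra F D] {T : D →ₗ[F] F} {nr : D →* F}
  {j : E →ₐ[F] D}

namespace Frame

variable (fr : Frame Q T nr j)

/-- The element `u` is `e + y c` with `y / e ∈ 𝔭 ^ t`. -/
def At (t : ℤ) (u : D) (e : Eˣ) : Prop := fr.X u = e ∧ fr.Y u ∈ pPow E (ord (e : E) + t)

variable {fr} {t s r : ℤ}

theorem Near.exists_at {u : D} (h : fr.Near t u) : ∃ e, fr.At t u e :=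
  ⟨Units.mk0 _ h.1, rfl, h.2⟩

namespace At

theorem near {u : D} {e : Eˣ} (h : fr.At t u e) : fr.Near t u := by
  refine ⟨by rw [h.1]; exact e.ne_zero, ?_⟩
  rw [h.1]; exact h.2

theorem unique {u : D} {e f : Eˣ} (h : fr.At t u e) (h' : fr.At s u f) : e = f :=
  Units.ext (h.1.symm.trans h'.1)

theorem mono (hst : s ≤ t) {u : D} {e : Eˣ} (h : fr.At t u e) : fr.At s u e :=
  ⟨h.1, pPow_anti (by omega) h.2⟩

theorem torus (e : Eˣ) : fr.At t (embU j e : D) e := by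
  constructor <;> simp

theorem torus_mul (f : Eˣ) {u : D} {e : Eˣ} (h : fr.At t u e) :
    fr.At t ((embU j f : D) * u) (f * e) := by
  refine ⟨by rw [coe_embU, X_j_mul, h.1, Units.val_mul], ?_⟩
  rw [coe_embU, Y_j_mul, Units.val_mul, ord_mul f.ne_zero e.ne_zero]
  exact pPow_mul' (mem_pPow_ord _) h.2 (by omega)

theorem mul (hts : 1 ≤ fr.g + t + s) (ht : r ≤ t) (hs : r ≤ s) {u v : D} {e f : Eˣ}
    (hu : fr.At t u e) (hv : fr.At s v f) :
    ∃ e', fr.At r (u * v) e' ∧ e' / (e * f) ∈ U E (fr.g + t + s) := by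
  have hX := fr.X_mul u v
  rw [hu.1, hv.1] at hX
  have hy : algebraMap F E fr.γ * fr.Y u * Q.σ (fr.Y v)
      ∈ pPow E (ord ((e * f : Eˣ) : E) + (fr.g + t + s)) := by
    rw [Units.val_mul, ord_mul e.ne_zero f.ne_zero]
    exact pPow_mul' (pPow_mul fr.γ_mem hu.2) (Q.σ_mem.mpr hv.2) (by omega)
  have h := ord_add_eq (e * f : Eˣ).ne_zero rfl (pPow_anti (by omega) hy)
  rw [Units.val_mul, ← hX] at h
  have hdiv : Units.mk0 _ h.1 / (e * f) ∈ U E (fr.g + t + s) := by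
    rw [div_mem_U hts, Units.val_mk0, hX, Units.val_mul, add_sub_cancel_left]
    rwa [Units.val_mul] at hy
  refine ⟨Units.mk0 _ h.1, ⟨rfl, ?_⟩, hdiv⟩
  rw [Units.val_mk0, h.2, ord_mul e.ne_zero f.ne_zero, Y_mul, hu.1, hv.1]
  exact pPow_add (pPow_mul' (mem_pPow_ord _) hv.2 (by omega))
    (pPow_mul' hu.2 (Q.σ_mem.mpr (mem_pPow_ord _)) (by omega))

theorem inv (ht : 1 ≤ fr.g + 2 * t) {u : Dˣ} {e : Eˣ} (hu : fr.At t (u : D) e) :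
    ∃ e', fr.At t ((u⁻¹ : Dˣ) : D) e' ∧ e' * e ∈ U E (fr.g + 2 * t) := by
  obtain ⟨e', he'⟩ := (hu.near.inv ht).exists_at
  refine ⟨e', he', ?_⟩
  obtain ⟨f, hf, hf'⟩ := mul (r := t) (by omega) le_rfl le_rfl he' hu
  have hf1 : f = 1 := by
    refine unique (t := t) (s := t) hf ⟨?_, ?_⟩ <;> rw [Units.inv_mul] <;> simp
  rw [hf1, one_div] at hf'
  have := (U E _).inv_mem hf'
  rw [inv_inv] at this
  convert this using 2; ring

/-- The `E`-coordinate of a commutator of elements near `E` is a small unit, as `E` is commutative. -/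
theorem commutator (ht : 1 ≤ fr.g + 2 * t) {u v : Dˣ} {e f : Eˣ} (hu : fr.At t (u : D) e)
    (hv : fr.At t (v : D) f) :
    ∃ e', fr.At t ((u⁻¹ * v⁻¹ * u * v : Dˣ) : D) e' ∧ e' ∈ U E (fr.g + 2 * t) := by
  have hadd : fr.g + t + t = fr.g + 2 * t := by ring
  obtain ⟨a, ha, ha'⟩ := hu.inv ht
  obtain ⟨b, hb, hb'⟩ := hv.inv ht
  obtain ⟨x, hx, hx'⟩ := ha.mul (r := t) (by omega) le_rfl le_rfl hb
  obtain ⟨y, hy, hy'⟩ := hx.mul (r := t) (by omega) le_rfl le_rfl hu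
  obtain ⟨z, hz, hz'⟩ := hy.mul (r := t) (by omega) le_rfl le_rfl hv
  rw [hadd] at hx' hy' hz'
  refine ⟨z, by push_cast; exact hz, ?_⟩
  have := (U E _).mul_mem ((U E _).mul_mem hz' hy') ((U E _).mul_mem hx' ((U E _).mul_mem ha' hb'))
  convert this using 1
  simp only [div_eq_mul_inv, mul_inv]
  rw [eq_comm]
  calc _ = z * (f * f⁻¹) * (y * y⁻¹) * (e * e⁻¹) * (x * x⁻¹) * (a * a⁻¹) * (b * b⁻¹) := by ac_rfl
    _ = z := by simp

end At

theorem mem_unitsNear_iff {n : ℤ} (hn : 1 ≤ n) {u : Dˣ} :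
    u ∈ unitsNear (fr.L n t) ↔ ∃ e ∈ U E n, fr.At t (u : D) e := by
  constructor
  · intro h
    obtain ⟨h1, h2, h3⟩ := near_of_mem hn h
    obtain ⟨e, he⟩ := h1.exists_at
    exact ⟨e, (mem_U hn).mpr (by rw [← he.1]; exact h3), he⟩
  · rintro ⟨e, he, h⟩
    rw [mem_unitsNear, h.1]
    refine ⟨he.2, ?_⟩
    have := h.2
    rwa [he.1, zero_add] at this

variable (fr) in
/-- The numerical conditions on the levels `t ≤ t'` attached to an element of valuation `-m`. They
concern the group `J` of all `e + y c` with `y / e ∈ 𝔭 ^ t`, its subgroup `M` given by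
`e ∈ Fˣ U_E¹`, and the subgroup `N` of `M` given by `y / e ∈ 𝔭 ^ t'`. -/
structure IsLevel (m : ℕ) (t t' : ℤ) : Prop where
  one_le : 1 ≤ m
  g_nonneg : 0 ≤ fr.g
  t_nonneg : 0 ≤ t
  le : t ≤ t'
  le_succ : t' ≤ t + 1
  le_two : (m : ℤ) ≤ fr.g + 2 * t
  lt_add : (m : ℤ) + 1 ≤ fr.g + t + t'

variable {m : ℕ} {t' : ℤ}

/-- Conjugation by elements near `E` fixes the `E`-coordinate of elements of `N`, up to
multiplication by `U_E ^ (m + 1)`. -/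
theorem At.conj (hl : fr.IsLevel m t t') {u w : Dˣ} {e f : Eˣ} (hu : fr.At t (u : D) e)
    (hw : fr.At t' (w : D) f) (hf : f ∈ FU F E) :
    ∃ f', fr.At t' ((u⁻¹ * w * u : Dˣ) : D) f' ∧ f' / f ∈ U E (m + 1) := by
  obtain ⟨h0, h1, h2, h3, h4, h5, h6⟩ := hl
  have hm : (1 : ℤ) ≤ m := by exact_mod_cast h0
  obtain ⟨c, f₁, hf₁, rfl⟩ := mem_FU.mp hf
  set c' := Units.map (algebraMap F E : F →* E) c with hc'
  set w₁ : Dˣ := embU j (c' * f₁)⁻¹ * w with hw₁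
  have hw₁' : fr.At t' (w₁ : D) 1 := by
    have := hw.torus_mul (c' * f₁)⁻¹
    rwa [inv_mul_cancel] at this
  have hw₁'' : w₁ ∈ unitsNear (fr.L m t') := (mem_unitsNear_iff hm).mpr ⟨1, one_mem _, hw₁'⟩
  obtain ⟨h7, h8⟩ := conj_coords h5 hm h4 h3 h6 hu.near hw₁''
  obtain ⟨w₂, hw₂, hw₂'⟩ := conj_torus h5 hm h4 hu.near hf₁.2
  have h9 : u⁻¹ * w₁ * u ∈ unitsNear (fr.L (m + 1) t') := by
    rw [X_sub, X_sub, hw₁'.1, X_one, Units.val_one, sub_self, sub_zero] at h8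
    rw [mem_unitsNear] at h7 ⊢
    exact ⟨h8, h7.2⟩
  obtain ⟨e₂, he₂, hAt₂⟩ := (mem_unitsNear_iff (by omega)).mp hw₂'
  obtain ⟨e₃, he₃, hAt₃⟩ := (mem_unitsNear_iff (by omega)).mp h9
  obtain ⟨e₄, hAt₄, he₄⟩ := hAt₂.mul (r := t') (by omega) le_rfl le_rfl hAt₃
  have hcent : ∀ v : Dˣ, v * embU j c' = embU j c' * v := fun v => by
    ext
    change (v : D) * j (algebraMap F E c) = j (algebraMap F E c) * v
    rw [j.commutes, Algebra.commutes]
  have heq : u⁻¹ * w * u = embU j (c' * f₁) * (w₂ * (u⁻¹ * w₁ * u)) := by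
    have e1 : w = embU j c' * (embU j f₁ * w₁) := by
      rw [hw₁, ← mul_assoc, ← mul_assoc, ← map_mul, ← map_mul, mul_inv_cancel, map_one, one_mul]
    calc u⁻¹ * w * u = (u⁻¹ * embU j c') * (embU j f₁ * w₁) * u := by rw [e1]; group
      _ = embU j c' * (u⁻¹ * embU j f₁ * u) * (u⁻¹ * w₁ * u) := by rw [hcent]; group
      _ = _ := by rw [hw₂, map_mul]; group
  refine ⟨c' * f₁ * e₄, ?_, ?_⟩
  · rw [heq, Units.val_mul, Units.val_mul]
    exact hAt₄.torus_mul _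
  · rw [mul_div_cancel_left]
    have h10 := (U E (m + 1 : ℤ)).mul_mem (U_anti (by omega) he₄) ((U E _).mul_mem he₂ he₃)
    rwa [div_mul_cancel] at h10

open Classical in
variable (fr) in
/-- The residue class of `y / (e ϖ ^ t)`, for `u = e + y c`. -/
def slope (t : ℤ) (u : D) : 𝓀[E] :=
  if h : (fr.X u)⁻¹ * fr.Y u * (unif E ^ t)⁻¹ ∈ 𝒪[E] then IsLocalRing.residue 𝒪[E] ⟨_, h⟩ else 0

theorem slope_eq_iff {u v : D} {e f : Eˣ} (hu : fr.At t u e) (hv : fr.At t v f) :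
    fr.slope t u = fr.slope t v ↔ (e : E)⁻¹ * fr.Y u - (f : E)⁻¹ * fr.Y v ∈ pPow E (t + 1) := by
  have hint : ∀ {w : D} {a : Eˣ}, fr.At t w a →
      (fr.X w)⁻¹ * fr.Y w * (unif E ^ t)⁻¹ ∈ 𝒪[E] := by
    intro w a h
    rw [mem_integers_iff, mul_comm, mem_pPow_inv_mul (unif_zpow_ne_zero t), ord_unif_zpow, h.1,
      mem_pPow_inv_mul a.ne_zero, add_zero]
    exact h.2
  rw [slope, slope, dif_pos (hint hu), dif_pos (hint hv), residue_eq_iff]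
  change (fr.X u)⁻¹ * fr.Y u * (unif E ^ t)⁻¹ - (fr.X v)⁻¹ * fr.Y v * (unif E ^ t)⁻¹ ∈ _ ↔ _
  rw [hu.1, hv.1, ← sub_mul, mul_comm, mem_pPow_inv_mul (unif_zpow_ne_zero t), ord_unif_zpow]

/-- Two elements of `M` have the same slope if and only if they agree modulo `N`. -/
theorem slope_eq_iff_at (ht : 1 ≤ fr.g + 2 * t) {u v : Dˣ} {e f : Eˣ} (hu : fr.At t (u : D) e)
    (hv : fr.At t (v : D) f) (he : e ∈ FU F E) (hf : f ∈ FU F E) :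
    fr.slope t (u : D) = fr.slope t (v : D) ↔ ∃ e', fr.At (t + 1) ((u⁻¹ * v : Dˣ) : D) e' := by
  have hn := ord_nE ht hu.near
  rw [hu.1] at hn
  obtain ⟨e₁, he₁, -⟩ := hu.inv ht
  obtain ⟨e₂, he₂, he₂'⟩ := he₁.mul (r := t) (by omega) le_rfl le_rfl hv
  rw [← Units.val_mul] at he₂
  have hord : ord (e₂ : E) = ord (f : E) - ord (e : E) := by
    have h1 := he₁.1
    rw [X_inv, hu.1] at h1
    have hσ : Q.σ (e : E) ≠ 0 := by simp
    rw [ord_eq_of_div_mem he₂', Units.val_mul, ord_mul e₁.ne_zero f.ne_zero, ← h1,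
      ord_div hσ hn.1, Q.ord_σ, hn.2]
    ring
  have hiff : (∃ e', fr.At (t + 1) ((u⁻¹ * v : Dˣ) : D) e') ↔
      fr.Y ((u⁻¹ * v : Dˣ) : D) ∈ pPow E (ord (f : E) - ord (e : E) + (t + 1)) := by
    constructor
    · rintro ⟨e', h⟩
      rw [← hord, ← At.unique h he₂]
      exact h.2
    · intro h
      exact ⟨e₂, he₂.1, by rwa [hord]⟩
  rw [hiff, slope_eq_iff hu hv]
  -- replace `e`, `f` by their conjugates, which agree with them up to `Fˣ U_E¹`
  have hσe : (e : E) / Q.σ e - 1 ∈ pPow E 1 := by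
    have := (Q.div_σU_mem he).2
    rwa [Units.val_div_eq_div_val] at this
  have hσf : Q.σ f / (f : E) - 1 ∈ pPow E 1 := by
    have := ((U E 1).inv_mem (Q.div_σU_mem hf)).2
    rwa [inv_div, Units.val_div_eq_div_val] at this
  have hy : (e : E)⁻¹ * fr.Y u ∈ pPow E t := by
    rw [mem_pPow_inv_mul e.ne_zero]; exact hu.2
  set p := (e : E) / Q.σ e with hp
  set q := Q.σ f / (f : E) with hq
  have hpq : p * q - 1 ∈ pPow E 1 := by
    have h1 := pPow_mul' (l := 1) hσe (pPow_anti (by omega : (0 : ℤ) ≤ 1) hσf) (by omega)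
    have := pPow_add h1 (pPow_add hσe hσf)
    convert this using 1; ring
  have hσe0 : Q.σ (e : E) ≠ 0 := by simp
  have hn1 := hn.1
  have key : fr.Y ((u⁻¹ * v : Dˣ) : D) = (Q.σ e * f / fr.nE u) *
      (-((e : E)⁻¹ * fr.Y u - (f : E)⁻¹ * fr.Y v) - (e : E)⁻¹ * fr.Y u * (p * q - 1)) := by
    rw [Units.val_mul, Y_mul, X_inv, Y_inv, hu.1, hv.1, hp, hq]
    field_simp
    ring
  have hord2 : ord (Q.σ e * f / fr.nE u) = ord (f : E) - ord (e : E) := by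
    rw [ord_div (mul_ne_zero hσe0 f.ne_zero) hn.1, ord_mul hσe0 f.ne_zero, Q.ord_σ, hn.2]; ring
  rw [key, pPow_mul_iff (div_ne_zero (mul_ne_zero hσe0 f.ne_zero) hn.1) hord2]
  have hz : (e : E)⁻¹ * fr.Y u * (p * q - 1) ∈ pPow E (t + 1) := pPow_mul hy hpq
  constructor
  · intro h
    exact pPow_sub (pPow_neg h) hz
  · intro h
    have := pPow_neg (pPow_add h hz)
    convert this using 1; ring

theorem exists_slope (ht : 1 ≤ fr.g + 2 * t) (k : 𝓀[E]) :
    ∃ u : Dˣ, fr.At t (u : D) 1 ∧ fr.slope t (u : D) = k := by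
  obtain ⟨x, rfl⟩ := IsLocalRing.residue_surjective k
  set y : E := unif E ^ t * x with hy
  have hymem : y ∈ pPow E t :=
    pPow_mul' (unif_zpow_mem t) (mem_integers_iff.mp x.2) (by omega)
  set d : D := j 1 + j y * fr.c with hd
  have hX : fr.X d = 1 := fr.X_eq _ _
  have hY : fr.Y d = y := fr.Y_eq _ _
  have hAt : fr.At t d 1 := ⟨by rw [hX, Units.val_one], by rw [hY]; simpa [ord_one] using hymem⟩
  refine ⟨fr.unit d (ord_nE ht hAt.near).1, hAt, ?_⟩
  have h0 := unif_zpow_ne_zero (L := E) t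
  have h1 : (fr.X d)⁻¹ * fr.Y d * (unif E ^ t)⁻¹ = x := by
    rw [hX, hY, hy]; field_simp
  rw [coe_unit, slope, dif_pos (by rw [h1]; exact x.2)]
  congr 1
  exact Subtype.ext h1

end Frame

end Filtration

/-! ### Conjugacy and commutators in `J` -/

section Conjugacy

variable {F E : Type*} [Field F] [ValuativeRel F] [TopologicalSpace F]
  [IsNonarchimedeanLocalField F] [Field E] [ValuativeRel E] [TopologicalSpace E]
  [IsNonarchimedeanLocalField E] [Algebra F E]

/-- In the unramified case, the elements outside `Fˣ U_E¹` are roots of unity up to this group. -/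
theorem Quad.exists_rootsOutside (Q : Quad F E) (he : Q.e = 1) {e : Eˣ} (h : e ∉ FU F E) :
    ∃ c : Fˣ, ∃ ζ ∈ rootsOutside F (E := E), ∃ u ∈ U E 1,
      e = Units.map (algebraMap F E : F →* E) c * ζ * u ∧ (ζ : E) - Q.σ ζ ∉ pPow E 1 := by
  set ϖ : Fˣ := Units.mk0 (unif F) unif_ne_zero with hϖ
  set c : Eˣ := Units.map (algebraMap F E : F →* E) (ϖ ^ ord (e : E)) with hc
  have hcord : ord (c : E) = ord (e : E) := by
    change ord (algebraMap F E ((ϖ ^ ord (e : E) : Fˣ) : F)) = _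
    rw [Q.ord_map, he, one_mul, Units.val_zpow_eq_zpow_val, hϖ, Units.val_mk0, ord_unif_zpow]
  have hx : ord ((e / c : Eˣ) : E) = 0 := by
    rw [Units.val_div_eq_div_val, ord_div e.ne_zero c.ne_zero, hcord, sub_self]
  obtain ⟨z, hz, hzx⟩ := exists_root_of_unity (e / c : Eˣ).ne_zero hx
  have hcard := Q.card_residue he
  have hF2 : 2 ≤ Nat.card 𝓀[F] := by
    have := Finite.one_lt_card (α := 𝓀[F]); omega
  have hn : Nat.card 𝓀[E] - 1 ≠ 0 := by
    rw [hcard]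
    have : 2 ^ 2 ≤ Nat.card 𝓀[F] ^ 2 := Nat.pow_le_pow_left hF2 2
    omega
  have hz0 : z ≠ 0 := by
    rintro rfl
    rw [zero_pow hn] at hz
    exact zero_ne_one hz
  set ζ : Eˣ := Units.mk0 z hz0 with hζ
  have hu : ζ / (e / c) ∈ U E 1 := by
    rw [div_mem_U le_rfl, hx, zero_add]; exact hzx
  have heq : e = c * ζ * (ζ / (e / c))⁻¹ := by
    rw [inv_div, div_eq_mul_inv, div_eq_mul_inv]
    calc e = (c * c⁻¹) * (ζ * ζ⁻¹) * e := by simp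
      _ = _ := by ac_rfl
  have hnot : ζ ∉ FU F E := fun hmem => h (by
    rw [heq]
    exact mul_mem (mul_mem (algebraMap_mem_FU _) hmem) (inv_mem (U_le_FU le_rfl hu)))
  refine ⟨_, ζ, ⟨⟨Nat.card 𝓀[E] - 1, ?_, Units.ext ?_⟩, ?_⟩, _, inv_mem hu, heq, ?_⟩
  · rw [hcard, Nat.coprime_iff_gcd_eq_one]
    have h1 : Nat.card 𝓀[F] ^ 2 - 1 + 1 = Nat.card 𝓀[F] ^ 2 := by
      have : 1 ≤ Nat.card 𝓀[F] ^ 2 := Nat.one_le_pow _ _ (by omega)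
      omega
    have h2 : (Nat.card 𝓀[F] ^ 2 - 1).Coprime (Nat.card 𝓀[F] ^ 2 - 1 + 1) := by simp
    rw [h1] at h2
    exact Nat.Coprime.coprime_dvd_right (dvd_pow_self _ two_ne_zero) h2
  · rw [Units.val_pow_eq_pow_val, hζ, Units.val_mk0, Units.val_one]; exact hz
  · rintro ⟨a, ha⟩
    have ha0 : a ≠ 0 := by
      rintro rfl
      rw [map_zero] at ha
      exact ζ.ne_zero ha.symm
    apply hnot
    have : ζ = Units.map (algebraMap F E : F →* E) (Units.mk0 a ha0) := Units.ext ha.symm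
    rw [this]
    exact algebraMap_mem_FU _
  · intro hmem
    obtain ⟨a, b, hab⟩ := Q.exists_coords (ζ : E)
    have hζord : ord (ζ : E) = 0 := by rw [ord_eq_of_div_mem hu, hx]
    have hb : algebraMap F E b * Q.δ ∈ pPow E 1 := by
      rw [← Q.two_mem_iff]
      rw [hab, Q.σ_coords] at hmem
      convert hmem using 1; ring
    have ha : ord (algebraMap F E a) = 0 ∧ algebraMap F E a ≠ 0 := by
      have := ord_add_eq ζ.ne_zero hζord (y := -(algebraMap F E b * Q.δ)) (by simpa using pPow_neg hb)
      rw [hab, add_neg_cancel_right] at this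
      exact ⟨this.2, this.1⟩
    have ha0 : a ≠ 0 := by
      rintro rfl
      exact ha.2 (map_zero _)
    apply hnot
    refine mem_FU_of_div (f := Units.map (algebraMap F E : F →* E) (Units.mk0 a ha0)) le_rfl
      (algebraMap_mem_FU _) ?_
    rw [div_mem_U le_rfl]
    change (ζ : E) - algebraMap F E a ∈ pPow E (ord (algebraMap F E a) + 1)
    rw [ha.1, hab, add_sub_cancel_left]
    exact hb

variable {Q : Quad F E} {D : Type*} [Ring D] [Algebra F D] {T : D →ₗ[F] F} {nr : D →* F}
  {j : E →ₐ[F] D}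

namespace Frame

variable {fr : Frame Q T nr j} {m : ℕ} {t t' : ℤ}

theorem exists_unit (ht : 1 ≤ fr.g + 2 * t) {y : E} (hy : y ∈ pPow E t) :
    ∃ h : Dˣ, fr.At t (h : D) 1 ∧ fr.Y (h : D) = y := by
  have hX : fr.X (j 1 + j y * fr.c) = 1 := fr.X_eq _ _
  have hY : fr.Y (j 1 + j y * fr.c) = y := fr.Y_eq _ _
  have hAt : fr.At t (j 1 + j y * fr.c) 1 :=
    ⟨by rw [hX, Units.val_one], by rw [hY]; simpa [ord_one] using hy⟩
  exact ⟨fr.unit _ (ord_nE ht hAt.near).1, hAt, hY⟩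

/-- An element of `J` whose `E`-coordinate is a root of unity outside `F` is conjugate to that root
of unity, up to elements acting by scalars. -/
theorem exists_conj (he : Q.e = 1) (hm : 1 ≤ fr.g + 2 * t) {u : Dˣ} {e : Eˣ}
    (hu : fr.At t (u : D) e) (heF : e ∉ FU F E) :
    ∃ c : Fˣ, ∃ ζ ∈ rootsOutside F (E := E), ∃ h n : Dˣ, fr.At t (h : D) 1 ∧
      (∃ f ∈ U E 1, fr.At (t + 1) (n : D) f) ∧
      u = embU j (Units.map (algebraMap F E : F →* E) c) * (h⁻¹ * embU j ζ * h) * n := by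
  obtain ⟨c, ζ, hζ, u₁, hu₁, heq, hζσ⟩ := Q.exists_rootsOutside he heF
  set c' := Units.map (algebraMap F E : F →* E) c with hc'
  -- `w = ζ⁻¹ c⁻¹ u`
  set w : Dˣ := embU j (c' * ζ)⁻¹ * u with hw
  have hwAt : fr.At t (w : D) u₁ := by
    have := hu.torus_mul (c' * ζ)⁻¹
    rwa [heq, inv_mul_cancel_left] at this
  set y : E := (u₁ : E)⁻¹ * fr.Y w with hy
  have hymem : y ∈ pPow E t := by
    rw [hy, mem_pPow_inv_mul u₁.ne_zero]; exact hwAt.2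
  have hζord : ord (ζ : E) = 0 := by
    by_contra h0
    obtain ⟨⟨n, hn, hζn⟩, -⟩ := hζ
    have h1 : (ζ : E) ^ n = 1 := by
      rw [← Units.val_pow_eq_pow_val, hζn, Units.val_one]
    have h2 := ord_pow ζ.ne_zero n
    rw [h1, ord_one, eq_comm, mul_eq_zero, or_iff_left h0] at h2
    have h3 : n = 0 := by exact_mod_cast h2
    rw [h3, Nat.coprime_zero_left] at hn
    have := Finite.one_lt_card (α := 𝓀[F])
    omega
  set ε : E := Q.σ ζ / ζ with hε
  have h1ε : 1 - ε ≠ 0 ∧ ord (1 - ε) = 0 := by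
    have e1 : 1 - ε = ((ζ : E) - Q.σ ζ) / ζ := by
      rw [hε, sub_div, div_self ζ.ne_zero]
    have h0 : (ζ : E) - Q.σ ζ ≠ 0 := fun h => hζσ (h ▸ zero_mem_pPow _)
    have h2 : (ζ : E) - Q.σ ζ ∈ pPow E 0 := by
      rw [← hζord]
      exact pPow_sub (mem_pPow_ord _) (Q.σ_mem.mpr (mem_pPow_ord _))
    rw [e1, ord_div h0 ζ.ne_zero, hζord, ord_eq_of_mem_of_not_mem h2 hζσ]
    exact ⟨div_ne_zero h0 ζ.ne_zero, by norm_num⟩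
  set y₀ : E := (1 - ε)⁻¹ * y with hy₀
  have hy₀mem : y₀ ∈ pPow E t := by
    rw [hy₀, mem_pPow_inv_mul h1ε.1, h1ε.2, zero_add]; exact hymem
  obtain ⟨h, hh, hhY⟩ := exists_unit (fr := fr) hm hy₀mem
  set k : Dˣ := (embU j ζ)⁻¹ * h⁻¹ * embU j ζ * h with hk
  obtain ⟨e', he', he'U⟩ := (At.torus (fr := fr) (t := t) ζ).commutator hm hh
  rw [← hk] at he'
  have he'1 : e' ∈ U E 1 := U_anti hm he'U
  have hnE := ord_nE hm hh.near
  rw [hh.1, Units.val_one, ord_one, mul_zero] at hnE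
  have hn0 := hnE.1
  have hkX : (e' : E) = (fr.nE h)⁻¹ * (1 - algebraMap F E fr.γ * y₀ * Q.σ y₀ * ε) := by
    rw [← he'.1, hk, ← map_inv]
    simp only [Units.val_mul, coe_embU, mul_assoc, X_j_mul, Units.val_inv_eq_inv_val]
    rw [X_mul, X_inv, Y_inv, X_j_mul, Y_j_mul, hh.1, hhY, hε, Units.val_one, map_one, map_mul]
    field_simp
    ring
  have hkY : fr.Y (k : D) = (fr.nE h)⁻¹ * (y₀ * (1 - ε)) := by
    rw [hk, ← map_inv]
    simp only [Units.val_mul, coe_embU, mul_assoc, Y_j_mul, Units.val_inv_eq_inv_val]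
    rw [Y_mul, X_inv, Y_inv, X_j_mul, Y_j_mul, hh.1, hhY, hε, Units.val_one, map_one, mul_one]
    field_simp
    ring
  have hslope : fr.slope t (k : D) = fr.slope t (w : D) := by
    rw [slope_eq_iff he' hwAt, ← hy]
    have e1 : (e' : E)⁻¹ * fr.Y (k : D) - y = (e' : E)⁻¹ * ((fr.nE h)⁻¹ *
        (algebraMap F E fr.γ * y₀ * Q.σ y₀ * ε * y)) := by
      have e2 : y = y₀ * (1 - ε) := by
        have := h1ε.1
        rw [hy₀]; field_simp
      have e3 : (e' : E)⁻¹ * fr.Y (k : D) - y = (e' : E)⁻¹ * (fr.Y (k : D) - e' * y) := by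
        rw [mul_sub, inv_mul_cancel_left₀ e'.ne_zero]
      rw [e3, hkY, ← e2, hkX]
      ring
    rw [e1, mem_pPow_inv_mul e'.ne_zero, he'1.1, mem_pPow_inv_mul hn0, hnE.2]
    have hεmem : ε ∈ pPow E 0 := by
      have := mem_pPow_ord ε
      rwa [hε, ord_div (by simp) ζ.ne_zero, Q.ord_σ, sub_self] at this
    exact pPow_mul' (pPow_mul (pPow_mul (pPow_mul fr.γ_mem hy₀mem) (Q.σ_mem.mpr hy₀mem)) hεmem)
      hymem (by omega)
  obtain ⟨f, hf⟩ := (slope_eq_iff_at hm he' hwAt (U_le_FU le_rfl he'1) (U_le_FU le_rfl hu₁)).mp hslope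
  refine ⟨c, ζ, hζ, h, k⁻¹ * w, hh, ⟨f, ?_, hf⟩, ?_⟩
  · obtain ⟨a, ha, haU⟩ := he'.inv hm
    obtain ⟨b, hb, hbU⟩ := ha.mul (r := t) (by omega) le_rfl le_rfl hwAt
    rw [← Units.val_mul] at hb
    rw [At.unique hf hb]
    have h3 := mul_mem (U_anti (by omega : (1 : ℤ) ≤ _) hbU)
      (mul_mem (mul_mem (U_anti hm haU) (inv_mem he'1)) hu₁)
    rwa [mul_inv_cancel_right, div_mul_cancel] at h3
  · rw [← hc', hk, hw, map_inv, map_mul]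
    group

/-- The commutator pairing on `M / N` is nondegenerate. -/
theorem exists_commutator {Ω : Type*} [Field Ω] {ψ : AddChar F Ω} (hψ : HasLevelZero ψ) {α : Eˣ}
    (hα : ord (α : E) = -(m : ℤ)) (hα' : (α : E) - Q.σ α ∉ pPow E (1 - m))
    (hl : fr.IsLevel m t (t + 1)) (hg : fr.g + 2 * t = m) {b : Dˣ} (hb : fr.At t (b : D) 1)
    (hb' : ¬ ∃ e, fr.At (t + 1) (b : D) e) :
    ∃ h : Dˣ, fr.At t (h : D) 1 ∧ ∃ f ∈ U E m, fr.At (t + 1) ((b⁻¹ * h⁻¹ * b * h : Dˣ) : D) f ∧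
      ψ (Algebra.trace F E (α * ((f : E) - 1))) ≠ 1 := by
  have hm : (1 : ℤ) ≤ m := by exact_mod_cast hl.one_le
  have hm' : 1 ≤ fr.g + 2 * t := by omega
  set z := fr.Y (b : D) with hz
  have hzmem : z ∈ pPow E t := by
    have := hb.2
    rwa [Units.val_one, ord_one, zero_add] at this
  have hz' : z ∉ pPow E (t + 1) := fun h => hb' ⟨1, hb.1, by
    rw [Units.val_one, ord_one, zero_add]; exact h⟩
  have hz0 : z ≠ 0 := fun h => hz' (h ▸ zero_mem_pPow _)
  have hzord : ord z = t := ord_eq_of_mem_of_not_mem hzmem hz'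
  -- the commutator with `1 + y c` is `1 + γ (z σ(y) - y σ(z))` up to smaller terms
  set κ : E := (Q.σ α - α) * (algebraMap F E fr.γ * Q.σ z) with hκ
  have hγ0 : algebraMap F E fr.γ ≠ 0 := by simpa using fr.γ_ne
  obtain ⟨y, hy, hψy⟩ : ∃ y ∈ pPow E t, ψ (Algebra.trace F E (κ * y)) ≠ 1 := by
    by_contra! hcon
    have h1 := Q.mem_of_psi_trace hψ hcon
    have hσz : Q.σ z ≠ 0 := by simpa using hz0
    have h2 : algebraMap F E fr.γ * Q.σ z ≠ 0 := mul_ne_zero hγ0 hσz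
    have h3 : ord (algebraMap F E fr.γ * Q.σ z) = fr.g + t := by
      rw [ord_mul hγ0 hσz, Q.ord_σ, hzord, g]
    have h4 : (1 : ℤ) - t = (fr.g + t) + (1 - m) := by omega
    rw [hκ, mul_comm, h4, pPow_mul_iff h2 h3] at h1
    apply hα'
    have := pPow_neg h1
    rwa [neg_sub] at this
  obtain ⟨h, hh, hhY⟩ := exists_unit (fr := fr) hm' hy
  refine ⟨h, hh, ?_⟩
  obtain ⟨x₁, hx₁, hx₁'⟩ := hh.mul (r := t) (by omega) le_rfl le_rfl hb
  obtain ⟨x₂, hx₂, hx₂'⟩ := hb.mul (r := t) (by omega) le_rfl le_rfl hh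
  have hgt : fr.g + t + t = m := by omega
  rw [mul_one, div_one, hgt] at hx₁' hx₂'
  rw [← Units.val_mul] at hx₁ hx₂
  have hY₁ : fr.Y ((h * b : Dˣ) : D) = y + z := by
    rw [Units.val_mul, Y_mul, hb.1, hh.1, hhY, ← hz]; simp [add_comm]
  have hY₂ : fr.Y ((b * h : Dˣ) : D) = y + z := by
    rw [Units.val_mul, Y_mul, hb.1, hh.1, hhY, ← hz]; simp
  have hX₁ : (x₁ : E) = 1 + algebraMap F E fr.γ * y * Q.σ z := by
    rw [← hx₁.1, Units.val_mul, X_mul, hb.1, hh.1, hhY, ← hz]; simp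
  have hX₂ : (x₂ : E) = 1 + algebraMap F E fr.γ * z * Q.σ y := by
    rw [← hx₂.1, Units.val_mul, X_mul, hb.1, hh.1, hhY, ← hz]; simp
  have hyz : y + z ∈ pPow E t := pPow_add hy hzmem
  have hslope : fr.slope t ((h * b : Dˣ) : D) = fr.slope t ((b * h : Dˣ) : D) := by
    rw [slope_eq_iff hx₁ hx₂, hY₁, hY₂, ← sub_mul, mul_comm]
    have h1 := pPow_sub (inv_mem hx₁').2 (inv_mem hx₂').2
    rw [sub_sub_sub_cancel_right, Units.val_inv_eq_inv_val, Units.val_inv_eq_inv_val] at h1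
    exact pPow_mul' hyz h1 (by omega)
  obtain ⟨f, hf⟩ := (slope_eq_iff_at hm' hx₁ hx₂ (U_le_FU hm hx₁') (U_le_FU hm hx₂')).mp hslope
  have heq : (h * b)⁻¹ * (b * h) = b⁻¹ * h⁻¹ * b * h := by group
  have hnE := ord_nE hm' hx₁.near
  rw [hx₁.1, hx₁'.1, mul_zero] at hnE
  have hn0 := hnE.1
  set n := fr.nE ((h * b : Dˣ) : D) with hn
  have hneq : n = x₁ * Q.σ x₁ - algebraMap F E fr.γ * (y + z) * Q.σ (y + z) := by
    rw [hn, nE, hx₁.1, hY₁]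
  set θ := algebraMap F E fr.γ * (z * Q.σ y - y * Q.σ z) with hθ
  have hθmem : θ ∈ pPow E m := pPow_mul' fr.γ_mem (pPow_sub (pPow_mul hzmem (Q.σ_mem.mpr hy))
    (pPow_mul hy (Q.σ_mem.mpr hzmem))) (by omega)
  have hf1 : (f : E) - 1 = n⁻¹ * (Q.σ x₁ * θ) := by
    rw [← hf.1, Units.val_mul (h * b)⁻¹, X_mul, X_inv, Y_inv, hx₁.1, hx₂.1, hY₁, hY₂, ← hn]
    field_simp
    rw [hneq, hθ, hX₁, hX₂]
    ring
  have hσx₁ := (Q.σU_mem hx₁')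
  have hσx₁0 : Q.σ (x₁ : E) ∈ pPow E 0 := by
    have := mem_pPow_ord (Q.σ (x₁ : E))
    rwa [Q.ord_σ, hx₁'.1] at this
  have hfm : f ∈ U E m := by
    rw [mem_U hm, hf1, mem_pPow_inv_mul hn0, hnE.2]
    exact pPow_mul hσx₁0 hθmem
  refine ⟨f, hfm, heq ▸ hf, ?_⟩
  have hdiff : (f : E) - 1 - θ ∈ pPow E (m + 1) := by
    have e1 : (f : E) - 1 - θ = n⁻¹ * ((Q.σ x₁ * (1 - x₁)
        + algebraMap F E fr.γ * (y + z) * Q.σ (y + z)) * θ) := by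
      have : n⁻¹ * n = 1 := inv_mul_cancel₀ hn0
      rw [hf1]
      calc n⁻¹ * (Q.σ x₁ * θ) - θ = n⁻¹ * (Q.σ x₁ * θ) - n⁻¹ * n * θ := by rw [this, one_mul]
        _ = _ := by rw [mul_assoc, hneq]; ring
    rw [e1, mem_pPow_inv_mul hn0, hnE.2]
    refine pPow_mul' (n := m) (pPow_add ?_ ?_) hθmem (by omega)
    · have := pPow_neg hx₁'.2
      rw [neg_sub] at this
      exact pPow_mul' hσx₁0 this (by omega)
    · exact pPow_mul' (pPow_mul fr.γ_mem hyz) (Q.σ_mem.mpr hyz) (by omega)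
  have h1 : ψ (Algebra.trace F E (α * ((f : E) - 1))) = ψ (Algebra.trace F E (α * θ)) := by
    have e1 : (α : E) * ((f : E) - 1) = α * θ + α * ((f : E) - 1 - θ) := by ring
    rw [e1, map_add, AddChar.map_add_eq_mul, Q.psi_trace_eq_one hψ (x := α * ((f : E) - 1 - θ)),
      mul_one]
    exact pPow_mul' (mem_pPow_ord _) hdiff (by rw [hα]; omega)
  have h2 : Algebra.trace F E (α * θ) = Algebra.trace F E (κ * y) := by
    have e1 : (α : E) * θ = Q.σ (Q.σ α * (algebraMap F E fr.γ * Q.σ z) * y)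
        - α * (algebraMap F E fr.γ * Q.σ z) * y := by
      simp only [map_mul, Q.σ_σ, AlgEquiv.commutes]
      rw [hθ]; ring
    rw [e1, map_sub, Q.trace_σ, ← map_sub, hκ]
    congr 1; ring
  rw [h1, h2]
  exact hψy

/-- The norm of an element of `J` is that of its `E`-coordinate, up to `N(U_E ^ n)`. -/
theorem At.exists_nr {n : ℤ} (hn : 1 ≤ n) (hgn : n ≤ fr.g + 2 * t) {u : D} {e : Eˣ}
    (hu : fr.At t u e) : ∃ v ∈ U E n, nr u = Algebra.norm F ((e * v : Eˣ) : E) := by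
  set y := (e : E)⁻¹ * fr.Y u with hy
  have hymem : y ∈ pPow E t := by rw [hy, mem_pPow_inv_mul e.ne_zero]; exact hu.2
  have hγy : algebraMap F E (-(fr.γ * Algebra.norm F y)) ∈ pPow E n := by
    rw [map_neg, map_mul, Q.nm_eq]
    exact pPow_neg (pPow_mul' fr.γ_mem (pPow_mul hymem (Q.σ_mem.mpr hymem)) (by omega))
  set z : F := -(fr.γ * Algebra.norm F y) with hz
  have hz1 : (1 + z) - 1 ∈ pPow F 1 := by
    rw [add_sub_cancel_left]
    exact Q.mem_of_map_mem_one (pPow_anti hn hγy)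
  obtain ⟨w, hw, hw1⟩ := exists_sq_eq Q.ord_two' Q.two_ne' hz1
  have hw0 : w ≠ 0 := by
    rintro rfl
    have := one_add_ne_zero (x := z) (by rwa [add_sub_cancel_left] at hz1)
    rw [← hw] at this
    simp at this
  refine ⟨Units.map (algebraMap F E : F →* E) (Units.mk0 w hw0), ?_, ?_⟩
  · rw [mem_U hn]
    change algebraMap F E w - 1 ∈ _
    -- `w + 1` is a unit, since `w` is close to `1`
    have h1 : algebraMap F E w - 1 = (2 + (algebraMap F E w - 1))⁻¹ * algebraMap F E z := by
      have h3 : algebraMap F E z = (algebraMap F E w) ^ 2 - 1 := by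
        rw [← map_pow, hw, map_add, map_one]; ring
      have h4 := ord_add_eq Q.two_ne Q.ord_two (y := algebraMap F E w - 1) (by
        have := Q.map_mem (n := 1) hw1
        rwa [map_sub, map_one] at this)
      have h5 := h4.1
      rw [eq_inv_mul_iff_mul_eq₀ h5, h3]; ring
    have h4 := ord_add_eq Q.two_ne Q.ord_two (y := algebraMap F E w - 1) (by
        have := Q.map_mem (n := 1) hw1
        rwa [map_sub, map_one] at this)
    rw [h1, mem_pPow_inv_mul h4.1, h4.2, zero_add]
    exact hγy
  · rw [fr.nr_apply, hu.1, Units.val_mul, map_mul]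
    change _ = Algebra.norm F (e : E) * Algebra.norm F (algebraMap F E w)
    rw [Q.norm_map, hw, hz]
    have : fr.Y u = e * y := by rw [hy, mul_inv_cancel_left₀ e.ne_zero]
    rw [this, map_mul]
    ring

/-- Modulo the powers of a uniformizer of `F`, the elements near `E` fall into finitely many classes
modulo any given congruence subgroup. -/
theorem exists_finite_cosets (hg : 0 ≤ fr.g) (ht0 : 0 ≤ t) (ht : 1 ≤ fr.g + 2 * t) (n : ℕ) :
    ∃ R : Set Dˣ, R.Finite ∧ ∀ u : Dˣ, fr.Near t (u : D) → ∃ a : ℤ, ∃ r ∈ R,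
      ∃ w ∈ unitsNear (fr.L n n), fr.Near t (r : D) ∧
      u = (embU j (Units.map (algebraMap F E : F →* E) (Units.mk0 (unif F) unif_ne_zero))) ^ a
        * r * w := by
  classical
  set ϖ : Eˣ := Units.map (algebraMap F E : F →* E) (Units.mk0 (unif F) unif_ne_zero) with hϖ
  have hϖord : ord (ϖ : E) = Q.e := by
    change ord (algebraMap F E (unif F)) = _
    rw [Q.ord_map, ord_unif, mul_one]
  obtain ⟨S, hS, hS'⟩ := exists_finite_approx (L := E) (n + 2)
  let P : E × E → Dˣ → Prop := fun s r => fr.Near t (r : D) ∧ 0 ≤ ord (fr.X r) ∧ ord (fr.X r) ≤ 1 ∧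
    fr.X r - s.1 ∈ pPow E (n + 2 : ℕ) ∧ fr.Y r - s.2 ∈ pPow E (n + 2 : ℕ)
  let rep : E × E → Dˣ := fun s => if h : ∃ r, P s r then h.choose else 1
  refine ⟨rep '' (S ×ˢ S), (hS.prod hS).image _, fun u hu => ?_⟩
  obtain ⟨e, he⟩ := hu.exists_at
  set a := ord (e : E) / Q.e with ha
  set u' : Dˣ := embU j (ϖ ^ (-a)) * u with hu'
  have hu'At : fr.At t (u' : D) (ϖ ^ (-a) * e) := he.torus_mul _
  have hord : ord ((ϖ ^ (-a) * e : Eˣ) : E) = ord (e : E) % Q.e := by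
    rw [Units.val_mul, ord_mul (Units.ne_zero _) e.ne_zero, Units.val_zpow_eq_zpow_val,
      ord_zpow ϖ.ne_zero, hϖord, Int.emod_def, ha]
    ring
  have h0 : 0 ≤ ord (e : E) % Q.e := Int.emod_nonneg _ Q.e_pos.ne'
  have h1 : ord (e : E) % Q.e ≤ 1 := by
    have := Int.emod_lt_of_pos (ord (e : E)) Q.e_pos
    rcases Q.e_cases with h | h <;> omega
  have hXmem : fr.X u' ∈ pPow E 0 := by
    rw [hu'At.1]; exact pPow_anti (by omega) (mem_pPow_ord _)
  have hYmem : fr.Y u' ∈ pPow E 0 := pPow_anti (by omega) hu'At.2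
  obtain ⟨s₁, hs₁, hX₁⟩ := hS' _ hXmem
  obtain ⟨s₂, hs₂, hY₂⟩ := hS' _ hYmem
  have hex : ∃ r, P (s₁, s₂) r := ⟨u', hu'At.near, by rw [hu'At.1, hord]; exact h0,
    by rw [hu'At.1, hord]; exact h1, hX₁, hY₂⟩
  have hrep : rep (s₁, s₂) = hex.choose := dif_pos hex
  obtain ⟨hr, hr0, hr1, hrX, hrY⟩ := hex.choose_spec
  rw [← hrep] at hr hr0 hr1 hrX hrY
  set r := rep (s₁, s₂) with hrdef
  refine ⟨a, r, ⟨(s₁, s₂), ⟨hs₁, hs₂⟩, rfl⟩, r⁻¹ * u', ?_, hr, ?_⟩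
  · have hdX : fr.X u' - fr.X r ∈ pPow E (n + 2 : ℕ) := by
      have := pPow_sub hX₁ hrX
      rwa [sub_sub_sub_cancel_right] at this
    have hdY : fr.Y u' - fr.Y r ∈ pPow E (n + 2 : ℕ) := by
      have := pPow_sub hY₂ hrY
      rwa [sub_sub_sub_cancel_right] at this
    have hn := ord_nE ht hr
    have hn0 := hn.1
    have hXr := mem_pPow_ord (fr.X (r : D))
    have hYr := hr.2
    have e1 : fr.X ((r⁻¹ * u' : Dˣ) : D) - 1 = (fr.nE r)⁻¹ * (Q.σ (fr.X r) * (fr.X u' - fr.X r)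
        - algebraMap F E fr.γ * fr.Y r * Q.σ (fr.Y u' - fr.Y r)) := by
      rw [Units.val_mul, X_mul, X_inv, Y_inv, map_sub]
      field_simp
      rw [nE]; ring
    have e2 : fr.Y ((r⁻¹ * u' : Dˣ) : D) = (fr.nE r)⁻¹ * (Q.σ (fr.X r) * (fr.Y u' - fr.Y r)
        - fr.Y r * Q.σ (fr.X u' - fr.X r)) := by
      rw [Units.val_mul, Y_mul, X_inv, Y_inv, map_sub]
      field_simp
      ring
    rw [mem_unitsNear, e1, e2, mem_pPow_inv_mul hn0, mem_pPow_inv_mul hn0, hn.2]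
    refine ⟨pPow_sub ?_ ?_, pPow_sub ?_ ?_⟩
    · exact pPow_mul' (Q.σ_mem.mpr hXr) hdX (by push_cast; omega)
    · exact pPow_mul' (pPow_mul fr.γ_mem hYr) (Q.σ_mem.mpr hdY) (by push_cast; omega)
    · exact pPow_mul' (Q.σ_mem.mpr hXr) hdY (by push_cast; omega)
    · exact pPow_mul' hYr (Q.σ_mem.mpr hdX) (by push_cast; omega)
  · rw [hu', map_zpow]; group

end Frame

end Conjugacy

/-! ### Representations on which `N` acts by scalars -/

section Heisenberg

variable {F E : Type*} [Field F] [ValuativeRel F] [TopologicalSpace F]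
  [IsNonarchimedeanLocalField F] [Field E] [ValuativeRel E] [TopologicalSpace E]
  [IsNonarchimedeanLocalField E] [Algebra F E]
  {Ω : Type*} [Field Ω] {ψ : AddChar F Ω}

theorem AgreesOn.eq_one {Q : Quad F E} (hψ : HasLevelZero ψ) {α : Eˣ} {χ : Eˣ →* Ωˣ} {m n : ℕ}
    (h : AgreesOn ψ α χ n) (hα : ord (α : E) = -(m : ℤ)) (hn : n ≤ m + 1) {e : Eˣ}
    (he : e ∈ U E (m + 1)) : χ e = 1 := by
  apply Units.ext
  rw [h e (pPow_anti (by omega) he.2), Q.psi_trace_eq_one hψ, Units.val_one]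
  exact pPow_mul' (mem_pPow_ord _) he.2 (by rw [hα]; omega)

theorem AgreesOn.smooth {Q : Quad F E} (hψ : HasLevelZero ψ) {α : Eˣ} {χ : Eˣ →* Ωˣ} {m n : ℕ}
    (h : AgreesOn ψ α χ n) (hα : ord (α : E) = -(m : ℤ)) (hn : n ≤ m + 1) : IsSmoothChar χ :=
  ⟨m + 1, by omega, fun e he => h.eq_one (Q := Q) hψ hα hn
    ((mem_U (by omega)).mpr (by exact_mod_cast he))⟩

theorem map_eq_of_div_mem {χ : Eˣ →* Ωˣ} {n : ℤ} (hχ : ∀ e ∈ U E n, χ e = 1) {e f : Eˣ}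
    (h : e / f ∈ U E n) : χ e = χ f := by
  have := hχ _ h
  rwa [map_div, div_eq_one] at this

theorem inv_mem_rootsOutside {ζ : Eˣ} (h : ζ ∈ rootsOutside F (E := E)) :
    ζ⁻¹ ∈ rootsOutside F (E := E) := by
  obtain ⟨⟨n, hn, hζ⟩, h2⟩ := h
  refine ⟨⟨n, hn, by rw [inv_pow, hζ, inv_one]⟩, fun ⟨a, ha⟩ => h2 ⟨a⁻¹, ?_⟩⟩
  rw [map_inv₀, ha, Units.val_inv_eq_inv_val, inv_inv]

variable {Q : Quad F E} {D : Type*} [Ring D] [Algebra F D] {T : D →ₗ[F] F} {nr : D →* F}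
  {j : E →ₐ[F] D} {V : Type*} [AddCommGroup V] [Module Ω V]

namespace Frame

variable {fr : Frame Q T nr j} {m : ℕ} {t t' : ℤ}

variable (fr) in
/-- The group `N`, or more generally the group of `e + y c` with `e ∈ Fˣ U_E¹`, `y / e ∈ 𝔭 ^ s`,
acts through the values of `χ` on the `E`-coordinate. -/
def ActsOnN (s : ℤ) {G : Type*} [Group G] (p : G →* Dˣ) (χ : Eˣ →* Ωˣ)
    (ρ : Representation Ω G V) : Prop :=
  ∀ (g : G) (e : Eˣ), fr.At s (p g : D) e → e ∈ FU F E → ∀ v, ρ g v = (χ e : Ω) • v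

section Generic

variable {G : Type*} [Group G] {p : G →* Dˣ} {χ : Eˣ →* Ωˣ} {ρ : Representation Ω G V}

theorem mem_grp_FU_iff (hm : (1 : ℤ) ≤ m) (ht : (m : ℤ) ≤ fr.g + 2 * t)
    (hU : ∀ e : Eˣ, (e : E) - 1 ∈ pPow E m → e ∈ FU F E) {u : Dˣ} :
    u ∈ fr.grp (FU F E) hm ht hU ↔ ∃ e ∈ FU F E, fr.At t (u : D) e := by
  rw [mem_grp]
  constructor
  · rintro ⟨h1, h2⟩
    obtain ⟨e, he⟩ := h1.exists_at
    exact ⟨e, h2 e he.1.symm, he⟩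
  · rintro ⟨e, he, h⟩
    refine ⟨h.near, fun e' he' => ?_⟩
    rw [Units.ext (he'.trans h.1)]
    exact he

theorem finiteIndex_grp (hl : fr.IsLevel m t t') (hp : ∀ g, fr.Near t (p g : D))
    (hm : (1 : ℤ) ≤ m) (ht : (m : ℤ) ≤ fr.g + 2 * t')
    (hU : ∀ e : Eˣ, (e : E) - 1 ∈ pPow E m → e ∈ FU F E) :
    ((fr.grp (FU F E) hm ht hU).comap p).FiniteIndex := by
  obtain ⟨h0, h1, h2, h3, h4, h5, h6⟩ := hl
  obtain ⟨n, hn⟩ : ∃ n : ℕ, t' ≤ n ∧ 1 ≤ n := ⟨(max t' 1).toNat, by omega⟩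
  obtain ⟨R, hR, hcos⟩ := fr.exists_finite_cosets h1 h2 (by omega) n
  have := hR.to_subtype
  choose a r hrR w hw hr huw using fun g => hcos (p g) (hp g)
  set N := fr.grp (FU F E) hm ht hU with hN
  have hinj : ∀ g g', r g = r g' → g⁻¹ * g' ∈ N.comap p := by
    intro g g' hgg
    have hwN : ∀ g, w g ∈ N := fun g => by
      obtain ⟨e, he, he'⟩ := (mem_unitsNear_iff (by omega)).mp (hw g)
      exact (mem_grp_FU_iff hm ht hU).mpr ⟨e, U_le_FU (n := n) (by omega) he, he'.mono hn.1⟩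
    set ϖ : Dˣ := embU j (Units.map (algebraMap F E : F →* E)
      (Units.mk0 (unif F) unif_ne_zero)) with hϖ
    have hϖN : ϖ ∈ N := (mem_grp_FU_iff hm ht hU).mpr ⟨_, algebraMap_mem_FU _, At.torus _⟩
    have hcent : ∀ v : Dˣ, Commute ϖ v := fun v => by
      ext
      change j (algebraMap F E _) * (v : D) = v * j (algebraMap F E _)
      rw [j.commutes, Algebra.commutes]
    rw [Subgroup.mem_comap, map_mul, map_inv, huw g, huw g', hgg]
    have h7 : (ϖ ^ a g * r g' * w g)⁻¹ * (ϖ ^ a g' * r g' * w g')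
        = (w g)⁻¹ * (ϖ ^ a g)⁻¹ * ϖ ^ a g' * w g' := by
      have h8 := ((hcent (r g')).zpow_left (a g')).eq
      have h9 := ((hcent (r g')).zpow_left (a g)).eq
      rw [h8, h9]
      group
    rw [h7]
    exact mul_mem (mul_mem (mul_mem (inv_mem (hwN g)) (inv_mem (zpow_mem hϖN _)))
      (zpow_mem hϖN _)) (hwN g')
  have : Finite (G ⧸ N.comap p) := by
    refine Finite.of_injective (fun x : G ⧸ N.comap p => (⟨r x.out, hrR _⟩ : R)) fun x y hxy => ?_
    have := hinj _ _ (congrArg Subtype.val hxy)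
    rwa [← QuotientGroup.eq, QuotientGroup.out_eq', QuotientGroup.out_eq'] at this
  exact Subgroup.finiteIndex_of_finite_quotient

variable [CharZero Ω] [FiniteDimensional Ω V]

theorem trace_eq_zero (hψ : HasLevelZero ψ) {α : Eˣ} (hα : ord (α : E) = -(m : ℤ))
    (hα' : (α : E) - Q.σ α ∉ pPow E (1 - m)) (hl : fr.IsLevel m t (t + 1))
    (hg : fr.g + 2 * t = m) (hχ : AgreesOn ψ α χ m)
    (hp : ∀ h : Dˣ, fr.At t (h : D) 1 → ∃ g, p g = h) (hN : fr.ActsOnN (t + 1) p χ ρ)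
    {b : G} {e : Eˣ} (hb : fr.At t (p b : D) e) (he : e ∈ FU F E)
    (hb' : ¬ ∃ e, fr.At (t + 1) (p b : D) e) : LinearMap.trace Ω V (ρ b) = 0 := by
  have hm : (1 : ℤ) ≤ m := by exact_mod_cast hl.one_le
  have hb₁ : fr.At t ((embU j e⁻¹ * p b : Dˣ) : D) 1 := by
    have := hb.torus_mul e⁻¹
    rwa [inv_mul_cancel] at this
  obtain ⟨b₁, hb₁'⟩ := hp _ hb₁
  have hb₁'' : ¬ ∃ f, fr.At (t + 1) (p b₁ : D) f := by
    rintro ⟨f, hf⟩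
    rw [hb₁'] at hf
    refine hb' ⟨e * f, ?_⟩
    have := hf.torus_mul e
    rwa [← Units.val_mul, ← mul_assoc, ← map_mul, mul_inv_cancel, map_one, one_mul] at this
  -- replace `b` by an element with trivial `E`-coordinate
  have hscal : ρ b = (χ e : Ω) • ρ b₁ := by
    have h1 : p (b * b₁⁻¹) = embU j e := by
      rw [map_mul, map_inv, hb₁', map_inv]; group
    have h2 := hN (b * b₁⁻¹) e (by rw [h1]; exact At.torus e) he
    ext v
    have := h2 (ρ b₁ v)
    rw [← Module.End.mul_apply, ← map_mul, inv_mul_cancel_right] at this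
    exact this
  rw [hscal, map_smul]
  rw [← hb₁'] at hb₁
  obtain ⟨h, hh, f, hf, hfAt, hne⟩ := exists_commutator hψ hα hα' hl hg hb₁ hb₁''
  obtain ⟨h', rfl⟩ := hp h hh
  have h3 := hN (b₁⁻¹ * h'⁻¹ * b₁ * h') f (by simpa using hfAt) (U_le_FU hm hf)
  rw [hχ f hf.2] at h3
  set c := ψ (Algebra.trace F E (α * ((f : E) - 1))) with hc
  have h4 : ρ (h'⁻¹ * b₁ * h') = c • ρ b₁ := by
    ext v
    have e1 : h'⁻¹ * b₁ * h' = b₁ * (b₁⁻¹ * h'⁻¹ * b₁ * h') := by group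
    rw [e1, map_mul, Module.End.mul_apply, h3, map_smul]; rfl
  have h5 : LinearMap.trace Ω V (ρ (h'⁻¹ * b₁ * h')) = LinearMap.trace Ω V (ρ b₁) := by
    rw [map_mul, LinearMap.trace_mul_comm, ← map_mul, mul_inv_cancel_left]
  rw [h4, map_smul, smul_eq_mul] at h5
  have h6 : (c - 1) * LinearMap.trace Ω V (ρ b₁) = 0 := by linear_combination h5
  rw [(mul_eq_zero.mp h6).resolve_left (sub_ne_zero.mpr hne), smul_zero]

variable [IsAlgClosed Ω]

theorem finrank_eq_card (he : Q.e = 1) (hψ : HasLevelZero ψ) {α : Eˣ}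
    (hα : ord (α : E) = -(m : ℤ))
    (hα' : (α : E) - Q.σ α ∉ pPow E (1 - m)) (hl : fr.IsLevel m t (t + 1))
    (hg : fr.g + 2 * t = m) (hχ : AgreesOn ψ α χ m) (hpt : ∀ g, fr.Near t (p g : D))
    (hp : ∀ h : Dˣ, fr.At t (h : D) 1 → ∃ g, p g = h) (hN : fr.ActsOnN (t + 1) p χ ρ)
    (hρ : Representation.IsIrreducible ρ)
    (hout : ∀ g e, fr.At t (p g : D) e → e ∉ FU F E →
      LinearMap.trace Ω V (ρ g) * LinearMap.trace Ω V (ρ g⁻¹) = 1) :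
    Module.finrank Ω V = Nat.card 𝓀[F] := by
  have hm : (1 : ℤ) ≤ m := by exact_mod_cast hl.one_le
  have hU : ∀ e : Eˣ, (e : E) - 1 ∈ pPow E m → e ∈ FU F E :=
    fun e h => U_le_FU hm ((mem_U hm).mpr h)
  have hMlt : (m : ℤ) ≤ fr.g + 2 * t := by omega
  have hNlt : (m : ℤ) ≤ fr.g + 2 * (t + 1) := by omega
  have hfin := finiteIndex_grp (p := p) hl hpt hm hNlt hU
  have hmemM : ∀ g, g ∈ (fr.grp (FU F E) hm hMlt hU).comap p ↔ ∃ e ∈ FU F E, fr.At t (p g : D) e :=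
    fun g => mem_grp_FU_iff hm hMlt hU
  have hmemN : ∀ g, g ∈ (fr.grp (FU F E) hm hNlt hU).comap p
      ↔ ∃ e ∈ FU F E, fr.At (t + 1) (p g : D) e := fun g => mem_grp_FU_iff hm hNlt hU
  have key : Module.finrank Ω V ^ 2 = Nat.card 𝓀[E] := by
    refine finrank_sq_eq hρ ((fr.grp (FU F E) hm hNlt hU).comap p)
      ((fr.grp (FU F E) hm hMlt hU).comap p) (fun g hg => ?_) (fun g hg => ?_) (fun g hg hg' => ?_)
      (fun g hg => ?_) (fun g => fr.slope t (p g : D)) (fun g hg h hh => ?_) (fun k => ?_)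
    · rw [hmemM]; rw [hmemN] at hg
      obtain ⟨e, he, h⟩ := hg
      exact ⟨e, he, h.mono (by omega)⟩
    · rw [hmemN] at hg
      obtain ⟨e, he, h⟩ := hg
      exact ⟨_, hN g e h he⟩
    · rw [hmemM] at hg
      obtain ⟨e, he, h⟩ := hg
      refine trace_eq_zero hψ hα hα' hl ‹_› hχ hp hN h he fun ⟨f, hf⟩ => hg' ?_
      rw [hmemN]
      exact ⟨f, hf.unique h ▸ he, hf⟩
    · obtain ⟨e, h⟩ := (hpt g).exists_at
      exact hout g e h fun he => hg ((hmemM g).mpr ⟨e, he, h⟩)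
    · have hgh : g⁻¹ * h ∈ (fr.grp (FU F E) hm hMlt hU).comap p := mul_mem (inv_mem hg) hh
      rw [hmemM] at hg hh hgh
      obtain ⟨e, he, h1⟩ := hg
      obtain ⟨f, hf, h2⟩ := hh
      obtain ⟨e', he', h3⟩ := hgh
      rw [slope_eq_iff_at (by omega) h1 h2 he hf, hmemN, map_mul, map_inv]
      rw [map_mul, map_inv] at h3
      constructor
      · rintro ⟨f', hf'⟩
        exact ⟨f', hf'.unique h3 ▸ he', hf'⟩
      · rintro ⟨f', -, hf'⟩
        exact ⟨f', hf'⟩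
    · obtain ⟨u, hu, huk⟩ := exists_slope (fr := fr) (t := t) (by omega) k
      obtain ⟨g, rfl⟩ := hp u hu
      exact ⟨g, (hmemM g).mpr ⟨1, one_mem _, hu⟩, huk⟩
  rw [Q.card_residue he] at key
  exact Nat.pow_left_injective (n := 2) (by norm_num) key

end Generic

variable [CharZero Ω] [IsAlgClosed Ω] {χ : Eˣ →* Ωˣ} {J J₁ : Subgroup Dˣ}
  {ρ : Representation Ω J V}

/-- An irreducible representation of `J` on which `N` acts by scalars, and with the correct trace on
roots of unity, has dimension `q`. -/
theorem finrank_of_isIrreducible [FiniteDimensional Ω V] (he : Q.e = 1) (hψ : HasLevelZero ψ)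
    {α : Eˣ} (hα : ord (α : E) = -(m : ℤ))
    (hα' : (α : E) - Q.σ α ∉ pPow E (1 - m)) (hl : fr.IsLevel m t (t + 1))
    (hg : fr.g + 2 * t = m) (hχ : AgreesOn ψ α χ m) (hJ : ∀ u, u ∈ J ↔ fr.Near t (u : D))
    (hN : fr.ActsOnN (t + 1) J.subtype χ ρ) (hρ : Representation.IsIrreducible ρ)
    (htr : ∀ (ζ : Eˣ) (h : embU j ζ ∈ J), ζ ∈ rootsOutside F →
      LinearMap.trace Ω V (ρ ⟨embU j ζ, h⟩) = -(χ ζ : Ω)) :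
    Module.finrank Ω V = Nat.card 𝓀[F] := by
  have hm : (1 : ℤ) ≤ m := by exact_mod_cast hl.one_le
  refine finrank_eq_card he hψ hα hα' hl hg hχ (p := J.subtype) (fun g => (hJ _).mp g.2)
    (fun h hh => ⟨⟨h, (hJ h).mpr hh.near⟩, rfl⟩) hN hρ fun g e hge heF => ?_
  obtain ⟨c, ζ, hζ, h, n, hh, ⟨f, hf, hnf⟩, heq⟩ := exists_conj he (by omega) hge heF
  have hjJ : ∀ e : Eˣ, embU j e ∈ J := fun e => (hJ _).mpr (At.torus e).near
  set c' := Units.map (algebraMap F E : F →* E) c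
  let C : J := ⟨embU j c', hjJ _⟩
  let Z : J := ⟨embU j ζ, hjJ _⟩
  let H : J := ⟨h, (hJ h).mpr hh.near⟩
  let n' : J := ⟨n, (hJ n).mpr (hnf.mono (by omega : t ≤ t + 1)).near⟩
  have hgeq : g = C * (H⁻¹ * Z * H) * n' := Subtype.ext heq
  have hCs : ρ C = (χ c' : Ω) • 1 := by
    ext v; exact hN C c' (At.torus c') (algebraMap_mem_FU c) v
  have hns : ρ n' = (χ f : Ω) • 1 := by
    ext v; exact hN n' f hnf (U_le_FU le_rfl hf) v
  have hinv : ∀ (x : J) (c : Ωˣ), ρ x = (c : Ω) • 1 → ρ x⁻¹ = ((c⁻¹ : Ωˣ) : Ω) • 1 := by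
    intro x c hx
    have h1 : ρ x⁻¹ * ρ x = 1 := by rw [← map_mul, inv_mul_cancel, map_one]
    rw [hx, mul_smul_comm, mul_one] at h1
    rw [← h1, smul_smul, Units.inv_mul, one_smul]
  have hCi := hinv _ _ hCs
  have hni := hinv _ _ hns
  have hconj : ∀ x : J, LinearMap.trace Ω V (ρ (H⁻¹ * x * H)) = LinearMap.trace Ω V (ρ x) := by
    intro x
    rw [map_mul, LinearMap.trace_mul_comm, ← map_mul, mul_inv_cancel_left]
  have e1 : LinearMap.trace Ω V (ρ g) = χ c' * χ f * -(χ ζ : Ω) := by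
    rw [hgeq, map_mul ρ (C * _) n', map_mul ρ C, hCs, hns, smul_mul_assoc, one_mul, mul_smul_comm,
      mul_one, map_smul, map_smul, hconj, htr ζ (hjJ ζ) hζ, smul_eq_mul, smul_eq_mul]
    ring
  have hginv : g⁻¹ = n'⁻¹ * (H⁻¹ * Z⁻¹ * H) * C⁻¹ := by rw [hgeq]; group
  have hZinv : Z⁻¹ = ⟨embU j ζ⁻¹, hjJ _⟩ := Subtype.ext (map_inv _ _).symm
  have e2 : LinearMap.trace Ω V (ρ g⁻¹)
      = ((χ c')⁻¹ : Ωˣ) * ((χ f)⁻¹ : Ωˣ) * -(((χ ζ)⁻¹ : Ωˣ) : Ω) := by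
    rw [hginv, map_mul ρ (n'⁻¹ * _) C⁻¹, map_mul ρ n'⁻¹, hCi, hni, smul_mul_assoc, one_mul,
      mul_smul_comm, mul_one, map_smul, map_smul, hconj, hZinv,
      htr ζ⁻¹ (hjJ _) (inv_mem_rootsOutside hζ), smul_eq_mul, smul_eq_mul, map_inv]
    ring
  rw [e1, e2]
  have h1 := Units.mul_inv (χ c')
  have h2 := Units.mul_inv (χ f)
  have h3 := Units.mul_inv (χ ζ)
  calc _ = ((χ c' : Ω) * ((χ c')⁻¹ : Ωˣ)) * ((χ f : Ω) * ((χ f)⁻¹ : Ωˣ))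
        * ((χ ζ : Ω) * ((χ ζ)⁻¹ : Ωˣ)) := by ring
    _ = 1 := by rw [h1, h2, h3]; ring

/-- A `q`-dimensional representation on which `N` acts by scalars is irreducible on `J₁`. -/
theorem isIrreducible_of_finrank (he : Q.e = 1) (hψ : HasLevelZero ψ) {α : Eˣ}
    (hα : ord (α : E) = -(m : ℤ))
    (hα' : (α : E) - Q.σ α ∉ pPow E (1 - m)) (hl : fr.IsLevel m t (t + 1))
    (hg : fr.g + 2 * t = m) (hχ : AgreesOn ψ α χ m) (hJ : ∀ u, u ∈ J ↔ fr.Near t (u : D))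
    (hJ₁ : ∀ u, u ∈ J₁ ↔ ∃ e ∈ U E 1, fr.At t (u : D) e)
    (hN : fr.ActsOnN (t + 1) J.subtype χ ρ) (hdim : Module.finrank Ω V = Nat.card 𝓀[F]) :
    Representation.IsIrreducible (ρ.comp (J₁.subgroupOf J).subtype) := by
  have hpos : 0 < Nat.card 𝓀[F] := Nat.card_pos
  have : FiniteDimensional Ω V := .of_finrank_pos (by omega)
  have hV : Nontrivial V := Module.nontrivial_of_finrank_pos (R := Ω) (by omega)
  set p : J₁.subgroupOf J →* Dˣ := J.subtype.comp (J₁.subgroupOf J).subtype with hp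
  have hpAt : ∀ g, ∃ e ∈ U E 1, fr.At t (p g : D) e :=
    fun g => (hJ₁ _).mp (Subgroup.mem_subgroupOf.mp g.2)
  rw [isIrreducible_iff]
  refine ⟨hV, fun X hX => or_iff_not_imp_left.mpr fun hX0 => ?_⟩
  let X' : Subrepresentation (ρ.comp (J₁.subgroupOf J).subtype) := ⟨X, fun g v hv => hX g v hv⟩
  have : Nontrivial X'.toSubmodule := Submodule.nontrivial_iff_ne_bot.mpr hX0
  obtain ⟨W, hW⟩ := exists_irreducible_sub X'.toRepresentation
  have hWdim : Module.finrank Ω W.toSubmodule = Nat.card 𝓀[F] := by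
    refine finrank_eq_card he hψ hα hα' hl hg hχ (p := p) (fun g => ?_) (fun h hh => ?_)
      (fun g e hge heF v => ?_) hW fun g e hge heF => ?_
    · obtain ⟨e, -, h⟩ := hpAt g
      exact h.near
    · exact ⟨⟨⟨h, (hJ h).mpr hh.near⟩, Subgroup.mem_subgroupOf.mpr
        ((hJ₁ h).mpr ⟨1, one_mem _, hh⟩)⟩, rfl⟩
    · exact Subtype.ext (Subtype.ext (hN g.1 e hge heF _))
    · obtain ⟨f, hf, h⟩ := hpAt g
      exact absurd (U_le_FU le_rfl hf) (h.unique hge ▸ heF)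
  refine Submodule.eq_top_of_finrank_eq (le_antisymm (Submodule.finrank_le X) ?_)
  rw [hdim, ← hWdim]
  exact Submodule.finrank_le W.toSubmodule

end Frame

end Heisenberg

/-! ### The representations `Λ_χ` and `Λ'_χ` in coordinates -/

section Types

variable {F E : Type*} [Field F] [ValuativeRel F] [TopologicalSpace F]
  [IsNonarchimedeanLocalField F] [Field E] [ValuativeRel E] [TopologicalSpace E]
  [IsNonarchimedeanLocalField E] [Algebra F E]
  {Ω : Type*} [Field Ω] {ψ : AddChar F Ω}
  {Q : Quad F E} {D : Type*} [Ring D] [Algebra F D] {T : D →ₗ[F] F} {nr : D →* F}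
  {j : E →ₐ[F] D} {V : Type*} [AddCommGroup V] [Module Ω V]

namespace Frame

variable {fr : Frame Q T nr j} {m : ℕ} {t t' s : ℤ}

theorem T_mul_sub_one (fr : Frame Q T nr j) (β : Eˣ) {u : D} {e : Eˣ} (h : fr.At t u e) :
    T (j β * (u - 1)) = Algebra.trace F E (β * ((e : E) - 1)) := by
  rw [fr.T_apply, X_j_mul, X_sub, X_one, h.1]

variable {χ : Eˣ →* Ωˣ} {J J₁ : Subgroup Dˣ} {ρ : Representation Ω J V}

theorem exists_split (hJ : ∀ u, u ∈ J ↔ fr.Near t (u : D)) {u : J} {e f : Eˣ}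
    (hu : fr.At s ((u : Dˣ) : D) (e * f)) :
    ∃ w : J, fr.At s ((w : Dˣ) : D) f ∧ ∀ h : embU j e ∈ J, u = ⟨embU j e, h⟩ * w := by
  have hw := hu.torus_mul e⁻¹
  rw [inv_mul_cancel_left] at hw
  refine ⟨⟨embU j e⁻¹, (hJ _).mpr (At.torus e⁻¹).near⟩ * u, hw, fun h => Subtype.ext ?_⟩
  simp

theorem isCharType_iff (hJ : ∀ u, u ∈ J ↔ fr.Near t (u : D)) (hs : 1 ≤ s) {β : Eˣ} {ξ : Eˣ → Ω}
    (hξ : ∀ e ∈ U E s, ξ e = ψ (Algebra.trace F E (β * ((e : E) - 1)))) :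
    IsCharType ψ T j β ξ (fr.L s t) ρ ↔ Module.finrank Ω V = 1 ∧
      ∀ (u : J) (e : Eˣ), fr.At t (u : Dˣ) e → ∀ v, ρ u v = ξ e • v := by
  have hjJ : ∀ e : Eˣ, embU j e ∈ J := fun e => (hJ _).mpr (At.torus e).near
  constructor
  · intro h
    refine ⟨h.finrank_eq, fun u e hu v => ?_⟩
    obtain ⟨w, hw, hsplit⟩ := exists_split (f := 1) hJ (by rwa [mul_one])
    have h1 := h.unip w ((mem_unitsNear_iff hs).mpr ⟨1, one_mem _, hw⟩) v
    rw [fr.T_mul_sub_one β hw, Units.val_one, sub_self, mul_zero, map_zero,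
      AddChar.map_zero_eq_one, one_smul] at h1
    rw [hsplit (hjJ e), map_mul, Module.End.mul_apply, h1, h.torus e (hjJ e)]
  · rintro ⟨h1, h2⟩
    refine ⟨h1, fun e h v => h2 _ e (At.torus e) v, fun u hu v => ?_⟩
    obtain ⟨e, he, hAt⟩ := (mem_unitsNear_iff hs).mp hu
    rw [h2 u e hAt, fr.T_mul_sub_one β hAt, hξ e he]

theorem actsOnN_of_isHeisenbergType (hl : fr.IsLevel m t t')
    (hJ : ∀ u, u ∈ J ↔ fr.Near t (u : D)) (hJ₁ : ∀ u, u ∈ J₁ ↔ ∃ e ∈ U E 1, fr.At t (u : D) e)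
    (hs : 1 ≤ s) {β : Eˣ} (hχ : ∀ e ∈ U E (m + 1), χ e = 1)
    (h : IsHeisenbergType ψ T j β χ (fr.L s t') J₁ ρ) : fr.ActsOnN t' J.subtype χ ρ := by
  have hjJ : ∀ e : Eˣ, embU j e ∈ J := fun e => (hJ _).mpr (At.torus e).near
  obtain ⟨v, hv0, hvU, hvP⟩ := h.lies_over
  -- the subgroup `N ∩ J₁` acts by scalars on a vector, hence on the whole space
  have hvN : ∀ (u : J) (e : Eˣ), fr.At t' (u : Dˣ) e → e ∈ U E 1 → ρ u v = (χ e : Ω) • v := by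
    intro u e hu he
    obtain ⟨w, hw, hsplit⟩ := exists_split (f := 1) hJ (by rwa [mul_one])
    have h1 := hvP w ((mem_unitsNear_iff hs).mpr ⟨1, one_mem _, hw⟩)
    rw [fr.T_mul_sub_one β hw, Units.val_one, sub_self, mul_zero, map_zero,
      AddChar.map_zero_eq_one, one_smul] at h1
    rw [hsplit (hjJ e), map_mul, Module.End.mul_apply, h1, hvU e (hjJ e) he.2]
  have hall : ∀ (u : J) (e : Eˣ), fr.At t' (u : Dˣ) e → e ∈ U E 1 → ∀ w, ρ u w = (χ e : Ω) • w := by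
    intro u e hu he w
    have hu₁ : (u : Dˣ) ∈ J₁ := (hJ₁ _).mpr ⟨e, he, hu.mono hl.le⟩
    refine apply_eq_smul_of_conj h.irreducible
      (fun g c => ∃ f ∈ U E 1, fr.At t' ((g : J) : Dˣ) f ∧ c = χ f) ?_ hv0 ?_
      (s := ⟨u, Subgroup.mem_subgroupOf.mpr hu₁⟩) ⟨e, he, hu, rfl⟩ w
    · rintro g s c ⟨f, hf, hfs, rfl⟩
      obtain ⟨a, -, ha⟩ := (hJ₁ _).mp (Subgroup.mem_subgroupOf.mp g.2)
      obtain ⟨f', hf', hdiv⟩ := ha.conj hl hfs (U_le_FU le_rfl hf)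
      refine ⟨f', ?_, by simpa using hf', by rw [map_eq_of_div_mem hχ hdiv]⟩
      have := mul_mem (U_anti (by omega : (1 : ℤ) ≤ m + 1) hdiv) hf
      rwa [div_mul_cancel] at this
    · rintro s c ⟨f, hf, hfs, rfl⟩
      exact hvN s.1 f hfs hf
  intro u e hu he w
  obtain ⟨c, f, hf, rfl⟩ := mem_FU.mp he
  obtain ⟨x, hx, hsplit⟩ := exists_split hJ hu
  rw [hsplit (hjJ _), map_mul, Module.End.mul_apply, hall x f hx hf, h.central c (hjJ _), smul_smul,
    ← Units.val_mul, ← map_mul]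

variable (fr) in
/-- The common shape of the representations `Λ_χ` and `Λ'_χ`: the group `N` acts through `χ` on the
`E`-coordinate; for `t = t'` the whole group `J` acts through `ε χ`; for `t' = t + 1` the dimension
is `q` and the trace at the roots of unity outside `F` is prescribed. -/
structure IsTypeOn (t t' : ℤ) (ε : Eˣ → Ω) (χ : Eˣ →* Ωˣ) {J : Subgroup Dˣ}
    (ρ : Representation Ω J V) : Prop where
  acts : fr.ActsOnN t' J.subtype χ ρ
  char_case : t = t' → Module.finrank Ω V = 1 ∧
    ∀ (u : J) (e : Eˣ), fr.At t (u : Dˣ) e → ∀ v, ρ u v = (ε e * χ e) • v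
  heis_case : t' = t + 1 → Module.finrank Ω V = Nat.card 𝓀[F] ∧
    ∀ (ζ : Eˣ) (h : embU j ζ ∈ J), ζ ∈ rootsOutside F →
      LinearMap.trace Ω V (ρ ⟨embU j ζ, h⟩) = -(χ ζ : Ω)

variable {ε : Eˣ → Ω}

theorem isTypeOn_of (hl : fr.IsLevel m t t')
    (hJ : ∀ u, u ∈ J ↔ fr.Near t (u : D)) (hε : ∀ e ∈ FU F E, ε e = 1)
    (hs : 1 ≤ s) {β : Eˣ} (hχ : ∀ e ∈ U E (m + 1), χ e = 1)
    (hχs : ∀ e ∈ U E s, (χ e : Ω) = ψ (Algebra.trace F E (β * ((e : E) - 1))))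
    (hc : t = t' → IsCharType ψ T j β (fun e => ε e * χ e) (fr.L s t') ρ)
    (hh : t' = t + 1 → (∀ u, u ∈ J₁ ↔ ∃ e ∈ U E 1, fr.At t (u : D) e) ∧
      IsHeisenbergType ψ T j β χ (fr.L s t') J₁ ρ) : fr.IsTypeOn t t' ε χ ρ := by
  have hξ : ∀ e ∈ U E s, ε e * χ e = ψ (Algebra.trace F E (β * ((e : E) - 1))) := fun e he => by
    rw [hε e (U_le_FU hs he), one_mul, hχs e he]
  have hchar : t = t' → Module.finrank Ω V = 1 ∧
      ∀ (u : J) (e : Eˣ), fr.At t (u : Dˣ) e → ∀ v, ρ u v = (ε e * χ e) • v := by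
    intro h
    have h1 := hc h
    rw [← h] at h1
    exact (isCharType_iff hJ hs hξ).mp h1
  refine ⟨?_, hchar, fun h => ⟨(hh h).2.finrank_eq, (hh h).2.trace_eq⟩⟩
  rcases (by have := hl.le; have := hl.le_succ; omega : t = t' ∨ t' = t + 1) with h | h
  · intro u e hu he v
    rw [(hchar h).2 u e (h ▸ hu), hε e he, one_mul]
  · exact actsOnN_of_isHeisenbergType hl hJ (hh h).1 hs hχ (hh h).2

theorem IsTypeOn.isCharType (h : fr.IsTypeOn t t' ε χ ρ)
    (hJ : ∀ u, u ∈ J ↔ fr.Near t (u : D)) (hε : ∀ e ∈ FU F E, ε e = 1)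
    (hs : 1 ≤ s) {β : Eˣ}
    (hχs : ∀ e ∈ U E s, (χ e : Ω) = ψ (Algebra.trace F E (β * ((e : E) - 1)))) (htt : t = t') :
    IsCharType ψ T j β (fun e => ε e * χ e) (fr.L s t') ρ := by
  subst htt
  refine (isCharType_iff hJ hs fun e he => ?_).mpr (h.char_case rfl)
  rw [hε e (U_le_FU hs he), one_mul, hχs e he]

theorem IsTypeOn.isHeisenbergType [IsAlgClosed Ω] [CharZero Ω] (h : fr.IsTypeOn t t' ε χ ρ)
    (hQ : Q.e = 1) (hψ : HasLevelZero ψ) {α : Eˣ} (hα : IsMinimal F m α)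
    (hχα : AgreesOn ψ α χ m) (hl : fr.IsLevel m t t') (hg : fr.g + 2 * t = m)
    (hJ : ∀ u, u ∈ J ↔ fr.Near t (u : D)) (hJ₁ : ∀ u, u ∈ J₁ ↔ ∃ e ∈ U E 1, fr.At t (u : D) e)
    (hs : 1 ≤ s) {β : Eˣ}
    (hχs : ∀ e ∈ U E s, (χ e : Ω) = ψ (Algebra.trace F E (β * ((e : E) - 1))))
    (htt : t' = t + 1) : IsHeisenbergType ψ T j β χ (fr.L s t') J₁ ρ := by
  subst htt
  obtain ⟨hdim, htr⟩ := h.heis_case rfl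
  obtain ⟨hα1, hα2⟩ := (Q.minimal_iff hQ).mp hα
  have hpos : 0 < Nat.card 𝓀[F] := Nat.card_pos
  have hV : Nontrivial V := Module.nontrivial_of_finrank_pos (R := Ω) (by omega)
  obtain ⟨v, hv⟩ := exists_ne (0 : V)
  refine ⟨hdim, isIrreducible_of_finrank hQ hψ hα1 hα2 hl hg hχα hJ hJ₁ h.acts hdim,
    ⟨v, hv, fun e he h1 => ?_, fun u hu => ?_⟩, fun c hc w => ?_, htr⟩
  · exact h.acts ⟨_, he⟩ e (At.torus e) (U_le_FU le_rfl ((mem_U le_rfl).mpr h1)) v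
  · obtain ⟨e, he, hAt⟩ := (mem_unitsNear_iff hs).mp hu
    rw [h.acts u e hAt (U_le_FU hs he), fr.T_mul_sub_one β hAt, hχs e he]
  · exact h.acts ⟨_, hc⟩ _ (At.torus _) (algebraMap_mem_FU c) w

theorem At.exists_nrU {n : ℤ} (hn : 1 ≤ n) (hgn : n ≤ fr.g + 2 * t) {u : Dˣ} {e : Eˣ}
    (hu : fr.At t (u : D) e) : ∃ v ∈ U E n, Units.map nr u = normUnits (e * v) := by
  obtain ⟨v, hv, h⟩ := hu.exists_nr hn hgn
  exact ⟨v, hv, Units.ext h⟩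

theorem nrU_embU (fr : Frame Q T nr j) (e : Eˣ) : Units.map nr (embU j e) = normUnits e :=
  Units.ext (fr.nr_j e)

theorem At.char_nrU (hl : fr.IsLevel m t t') {ω : Fˣ →* Ωˣ}
    (hω : ∀ e ∈ U E (m + 1), ω (normUnits e) = 1) {u : Dˣ} {e : Eˣ} (hu : fr.At t' (u : D) e) :
    ω (Units.map nr u) = ω (normUnits e) := by
  obtain ⟨v, hv, h⟩ := hu.exists_nrU (n := m + 1) (by omega) (by
    have := hl.lt_add; have := hl.le; omega)
  rw [h, map_mul, map_mul, hω v hv, mul_one]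

/-- Twisting by `ω ∘ nr` multiplies `χ` by `ω ∘ N`. -/
theorem IsTypeOn.twist (hl : fr.IsLevel m t t') {ω : Fˣ →* Ωˣ}
    (hω : ∀ e ∈ U E (m + 1), ω (normUnits e) = 1) (h : fr.IsTypeOn t t' ε χ ρ) :
    fr.IsTypeOn t t' ε (χ * ω.comp normUnits)
      (LocalTypes.twist (ω.comp ((Units.map nr).comp J.subtype)) ρ) := by
  refine ⟨fun u e hu he v => ?_, fun htt => ⟨(h.char_case htt).1, fun u e hu v => ?_⟩,
    fun htt => ⟨(h.heis_case htt).1, fun ζ hζ hζ' => ?_⟩⟩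
  · rw [twist_apply, h.acts u e hu he, smul_smul]
    change ((ω (Units.map nr (u : Dˣ)) : Ω) * _) • v = _
    rw [At.char_nrU (u := (u : Dˣ)) hl hω hu, mul_comm]; rfl
  · rw [twist_apply, (h.char_case htt).2 u e hu, smul_smul]
    change ((ω (Units.map nr (u : Dˣ)) : Ω) * _) • v = _
    rw [At.char_nrU hl hω (htt ▸ hu), mul_comm, mul_assoc]; rfl
  · rw [trace_twist, (h.heis_case htt).2 ζ hζ hζ']
    change (ω (Units.map nr (embU j ζ)) : Ω) * _ = _
    rw [fr.nrU_embU, mul_neg, mul_comm]; rfl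

theorem IsTypeOn.transport {V' : Type*} [AddCommGroup V'] [Module Ω V'] (i : V ≃ₗ[Ω] V')
    (h : fr.IsTypeOn t t' ε χ ρ) : fr.IsTypeOn t t' ε χ (LocalTypes.transport i ρ) := by
  refine ⟨fun u e hu he v => ?_, fun htt => ⟨?_, fun u e hu v => ?_⟩,
    fun htt => ⟨?_, fun ζ hζ hζ' => ?_⟩⟩
  · rw [transport_apply, h.acts u e hu he, map_smul, LinearEquiv.apply_symm_apply]
  · rw [← (h.char_case htt).1, i.finrank_eq]
  · rw [transport_apply, (h.char_case htt).2 u e hu, map_smul, LinearEquiv.apply_symm_apply]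
  · rw [← (h.heis_case htt).1, i.finrank_eq]
  · rw [trace_transport, (h.heis_case htt).2 ζ hζ hζ']

end Frame

end Types

/-! ### The groups of the two algebras -/

section Setups

variable {F E : Type*} [Field F] [ValuativeRel F] [TopologicalSpace F]
  [IsNonarchimedeanLocalField F] [Field E] [ValuativeRel E] [TopologicalSpace E]
  [IsNonarchimedeanLocalField E] [Algebra F E]
  {Ω : Type*} [Field Ω] {ψ : AddChar F Ω}
  {Q : Quad F E}

namespace Frame

section

variable {D : Type*} [Ring D] [Algebra F D] {T : D →ₗ[F] F} {nr : D →* F}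
  {j : E →ₐ[F] D}

/-- The identification of the groups and lattices attached to one of the two algebras with those
given by coordinates. -/
structure Setup (fr : Frame Q T nr j) (m : ℕ) (t t' : ℤ) (J J₁ : Subgroup Dˣ) (Vs Ws Ps : Set D)
    (rad : ℕ → Set D) : Prop where
  level : fr.IsLevel m t t'
  g_eq : t' = t + 1 → fr.g + 2 * t = m
  mem_J : ∀ u, u ∈ J ↔ fr.Near t (u : D)
  mem_J₁ : t' = t + 1 → ∀ u, u ∈ J₁ ↔ ∃ e ∈ U E 1, fr.At t (u : D) e
  V_eq : Vs = fr.L m t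
  W_eq : Ws = fr.L m t'
  P_eq : Ps = fr.L (m / 2 + 1 : ℕ) t'
  rad_sub : ∀ n, ∃ k : ℕ, n ≤ k ∧ fr.L k k ⊆ rad n

variable {fr : Frame Q T nr j} {m : ℕ} {t t' s : ℤ}

theorem mem_torusGroup (hm : (1 : ℤ) ≤ m) (ht : (m : ℤ) ≤ fr.g + 2 * t) (hs : 1 ≤ s) (u : Dˣ) :
    u ∈ torusGroup j (fr.L s t) ↔ fr.Near t (u : D) := by
  have := grp_eq_closure (fr := fr) (U := ⊤) (hm := hm) (ht := ht)
    (hU := fun _ _ => Subgroup.mem_top _) hs (fun _ _ => Subgroup.mem_top _)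
  rw [Subgroup.coe_top, Set.image_univ] at this
  rw [torusGroup, this, mem_grp]
  exact ⟨fun h => h.1, fun h => ⟨h, fun _ _ => Subgroup.mem_top _⟩⟩

theorem mem_torusGroupOne (hm : (1 : ℤ) ≤ m) (ht : (m : ℤ) ≤ fr.g + 2 * t) (hs : 1 ≤ s) (u : Dˣ) :
    u ∈ torusGroupOne j (fr.L s t) ↔ ∃ e ∈ U E 1, fr.At t (u : D) e := by
  have := grp_eq_closure (fr := fr) (U := U E 1) (hm := hm) (ht := ht)
    (hU := fun e he => (mem_U le_rfl).mpr (pPow_anti hm he)) hs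
    (fun e he => (mem_U le_rfl).mpr (pPow_anti hs he))
  have hset : (U E 1 : Set Eˣ) = {e : Eˣ | (e : E) - 1 ∈ pPow E 1} := by
    ext e; exact mem_U le_rfl
  rw [hset] at this
  rw [torusGroupOne, this, mem_grp]
  constructor
  · rintro ⟨h1, h2⟩
    obtain ⟨e, he⟩ := h1.exists_at
    exact ⟨e, h2 e he.1.symm, he⟩
  · rintro ⟨e, he, h⟩
    refine ⟨h.near, fun e' he' => ?_⟩
    rw [Units.ext (he'.trans h.1)]
    exact he

theorem corestrModule_eq (hs : s ≤ m) : corestrModule T j m (fr.L s t) = fr.L m t := by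
  ext d
  simp only [corestrModule, L, Set.mem_inter_iff, Set.mem_ofPred_eq, fr.corestr_eq]
  exact ⟨fun h => ⟨h.1, h.2.2⟩, fun h => ⟨h.1, pPow_anti hs h.1, h.2⟩⟩

end

variable {m : ℕ}

theorem exists_setup_matrix (hE : Module.finrank F E = 2) (hm : 1 ≤ m)
    (jA : E →ₐ[F] Matrix (Fin 2) (Fin 2) F) :
    ∃ fr : Frame Q trA (Matrix.detMonoidHom : Matrix (Fin 2) (Fin 2) F →* F) jA, fr.γ = 1 ∧
      fr.Setup m ((m + 1) / 2 : ℕ) (m / 2 + 1 : ℕ) (JA jA m)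
        (torusGroupOne jA (radA jA (m / 2))) (VA jA m) (WA jA m) (radA jA (m / 2 + 1))
        (radA jA) := by
  obtain ⟨fr, hγ⟩ := exists_frame_matrix (Q := Q) hE jA
  have hrad := radA_eq hE fr hγ
  have hg : fr.g = 0 := by rw [g, hγ, map_one, ord_one]
  refine ⟨fr, hγ, ⟨hm, hg.ge, by omega, by omega, by omega, by omega, by omega⟩, fun h => by omega,
    fun u => ?_, fun h u => ?_, ?_, ?_, hrad _, fun n => ⟨n, le_rfl, (hrad n).ge⟩⟩
  · rw [JA, hrad]
    exact mem_torusGroup (m := m) (by omega) (by omega) (by omega) u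
  · have h2 : (m + 1) / 2 = m / 2 := by omega
    rw [hrad, h2]
    exact mem_torusGroupOne (m := m) (by omega) (by omega) (by omega) u
  · rw [VA, hrad]
    exact corestrModule_eq (by omega)
  · rw [WA, hrad]
    exact corestrModule_eq (by omega)

variable {a b : F}

theorem exists_setup_quaternion_unramified (he : Q.e = 1) (hE : Module.finrank F E = 2)
    (hB : ∀ x : ℍ[F,a,b], x ≠ 0 → IsUnit x) (hm : 1 ≤ m) (jB : E →ₐ[F] ℍ[F,a,b]) :
    ∃ fr : Frame Q trd (nrd : ℍ[F,a,b] →* F) jB,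
      fr.Setup m (m / 2 : ℕ) ((m + 1) / 2 : ℕ) (JB jB m) (torusGroupOne jB (radB a b m))
        (VB jB m) (WB jB m) (radB a b (m + 1)) (radB a b) := by
  have hun := Q.unram_iff.mpr he
  obtain ⟨fr₀⟩ := exists_frame_quaternion (Q := Q) hE hB jB
  obtain ⟨fr, hγ, hfr⟩ := exists_frame_unramified he hB fr₀
  have hrad := radB_eq_unramified he hB fr hγ hfr
  have hg : fr.g = 1 := by rw [g, Q.ord_map, he, hγ]; rfl
  refine ⟨fr, ⟨hm, by omega, by omega, by omega, by omega, by omega, by omega⟩, fun h => by omega,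
    fun u => ?_, fun h u => ?_, ?_, ?_, ?_, fun n => ⟨n, le_rfl, ?_⟩⟩
  · rw [JB, if_pos hun, hrad]
    exact mem_torusGroup (m := m) (by omega) (by omega) (by omega) u
  · rw [hrad]
    exact mem_torusGroupOne (m := m) (by omega) (by omega) (by omega) u
  · have h2 : 2 * (m / 2) / 2 = m / 2 := by omega
    rw [VB, if_pos hun, hrad, h2]
    exact corestrModule_eq (by omega)
  · rw [WB, if_pos hun, hrad]
    exact corestrModule_eq (by omega)
  · have h2 : (m + 1 + 1) / 2 = m / 2 + 1 := by omega
    rw [hrad, h2]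
  · rw [hrad]
    exact fun x hx => ⟨pPow_anti (by omega) hx.1, pPow_anti (by omega) hx.2⟩

theorem exists_setup_quaternion_ramified (he : Q.e = 2) (hE : Module.finrank F E = 2)
    (hB : ∀ x : ℍ[F,a,b], x ≠ 0 → IsUnit x) (hm : Odd m) (jB : E →ₐ[F] ℍ[F,a,b])
    (J₁ : Subgroup (ℍ[F,a,b])ˣ) :
    ∃ fr : Frame Q trd (nrd : ℍ[F,a,b] →* F) jB,
      fr.Setup m ((m + 1) / 2 : ℕ) ((m + 1) / 2 : ℕ) (JB jB m) J₁
        (VB jB m) (WB jB m) (radB a b (m / 2 + 1)) (radB a b) := by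
  obtain ⟨k, rfl⟩ := hm
  have hun : ¬ Unramified F E := by rw [Q.unram_iff]; omega
  obtain ⟨fr₀⟩ := exists_frame_quaternion (Q := Q) hE hB jB
  obtain ⟨fr, hγ, hfr⟩ := exists_frame_ramified he hB fr₀
  have hrad := radB_eq_ramified he hB fr hγ hfr
  have hg : fr.g = 0 := by rw [g, Q.ord_map, hγ, mul_zero]
  have h2 : (2 * k + 1 + 1) / 2 = k + 1 := by omega
  have h3 : (2 * k + 1) / 2 + 1 = k + 1 := by omega
  rw [h2, h3]
  refine ⟨fr, ⟨by omega, by omega, by omega, by omega, by omega, by omega, by omega⟩,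
    fun h => by omega, fun u => ?_, fun h u => by omega, ?_, ?_, ?_, fun n => ⟨n, le_rfl, ?_⟩⟩
  · rw [JB, if_neg hun, hrad, h2]
    exact mem_torusGroup (m := 2 * k + 1) (by omega) (by omega) (by omega) u
  · rw [VB, if_neg hun, hrad, h2]
    exact corestrModule_eq (by omega)
  · rw [WB, if_neg hun, hrad, h3]
    exact corestrModule_eq (by omega)
  · rw [hrad, h3]
  · rw [hrad]

end Frame

open Classical in
variable (F Ω) in
/-- The sign by which `Λ'_χ` differs from `χ` on `Eˣ`. -/
def signB (e : Eˣ) : Ω := if Unramified F E then 1 else (-1) ^ ord (e : E)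

include Q in
theorem signB_eq_one {e : Eˣ} (h : e ∈ FU F E) : signB F Ω e = 1 := by
  rw [signB]
  split_ifs with hun
  · rfl
  · have he : Q.e = 2 := Q.e_cases.resolve_left fun h => hun (Q.unram_iff.mpr h)
    obtain ⟨c, u, hu, rfl⟩ := mem_FU.mp h
    have h1 : ord ((Units.map (algebraMap F E : F →* E) c * u : Eˣ) : E) = 2 * ord (c : F) := by
      rw [Units.val_mul, ord_mul (Units.ne_zero _) u.ne_zero, hu.1, add_zero]
      change ord (algebraMap F E c) = _
      rw [Q.ord_map, he]
    rw [h1]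
    exact Even.neg_one_zpow ⟨ord (c : F), by ring⟩

/-! ### `Λ_χ` and `Λ'_χ` -/

variable {V : Type*} [AddCommGroup V] [Module Ω V] {m : ℕ} {a b : F}
  {jA : E →ₐ[F] Matrix (Fin 2) (Fin 2) F} {jB : E →ₐ[F] ℍ[F,a,b]}
  {χ : Eˣ →* Ωˣ} {β : Eˣ}

theorem isTypeOn_of_isBasicLambdaA
    {fr : Frame Q trA (Matrix.detMonoidHom : Matrix (Fin 2) (Fin 2) F →* F) jA}
    (hs : fr.Setup m ((m + 1) / 2 : ℕ) (m / 2 + 1 : ℕ) (JA jA m)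
        (torusGroupOne jA (radA jA (m / 2))) (VA jA m) (WA jA m) (radA jA (m / 2 + 1))
        (radA jA)) (hψ : HasLevelZero ψ) (hβ : ord (β : E) = -(m : ℤ))
    (hχ : AgreesOn ψ β χ (m / 2 + 1)) {ρ : Representation Ω (JA jA m) V}
    (h : IsBasicLambdaA ψ jA m β χ ρ) :
    fr.IsTypeOn ((m + 1) / 2 : ℕ) (m / 2 + 1 : ℕ) (fun _ => 1) χ ρ := by
  rw [IsBasicLambdaA, hs.P_eq] at h
  refine Frame.isTypeOn_of (β := β) hs.level hs.mem_J (fun _ _ => rfl)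
    (s := (m / 2 + 1 : ℕ)) (by omega)
    (fun e he => hχ.eq_one (Q := Q) hψ hβ (by omega) he) (fun e he => hχ e he.2) (fun htt => ?_)
    fun htt => ⟨hs.mem_J₁ htt, h.2 fun ⟨k, hk⟩ => ?_⟩
  · simp only [one_mul]
    exact h.1 (by rw [Nat.odd_iff]; omega)
  · omega

theorem isBasicLambdaA_of_isTypeOn [IsAlgClosed Ω] [CharZero Ω]
    {fr : Frame Q trA (Matrix.detMonoidHom : Matrix (Fin 2) (Fin 2) F →* F) jA}
    (hs : fr.Setup m ((m + 1) / 2 : ℕ) (m / 2 + 1 : ℕ) (JA jA m)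
        (torusGroupOne jA (radA jA (m / 2))) (VA jA m) (WA jA m) (radA jA (m / 2 + 1))
        (radA jA)) (hψ : HasLevelZero ψ) {α : Eˣ} (hα : IsMinimal F m α)
    (hχα : AgreesOn ψ α χ m)
    (hχ : AgreesOn ψ β χ (m / 2 + 1)) {ρ : Representation Ω (JA jA m) V}
    (h : fr.IsTypeOn ((m + 1) / 2 : ℕ) (m / 2 + 1 : ℕ) (fun _ => 1) χ ρ) :
    IsBasicLambdaA ψ jA m β χ ρ := by
  rw [IsBasicLambdaA, hs.P_eq]
  refine ⟨fun ⟨k, hk⟩ => ?_, fun hm => ?_⟩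
  · have := h.isCharType (β := β) hs.mem_J (fun _ _ => rfl) (s := (m / 2 + 1 : ℕ)) (by omega)
      (fun e he => hχ e he.2) (by omega)
    simpa only [one_mul] using this
  · have hun : Unramified F E := by
      by_contra hun
      exact hm (hα.2.1 hun)
    rw [Nat.odd_iff] at hm
    have htt : ((m / 2 + 1 : ℕ) : ℤ) = ((m + 1) / 2 : ℕ) + 1 := by omega
    exact h.isHeisenbergType (Q.unram_iff.mp hun) hψ hα hχα hs.level (hs.g_eq htt) hs.mem_J
      (hs.mem_J₁ htt) (s := (m / 2 + 1 : ℕ)) (by omega) (fun e he => hχ e he.2) htt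

open Classical in
/-- The levels `(t, t')` for the quaternion algebra. -/
def levelB (F E : Type*) [Field F] [ValuativeRel F] [TopologicalSpace F]
    [IsNonarchimedeanLocalField F] [Field E] [ValuativeRel E] [TopologicalSpace E]
    [IsNonarchimedeanLocalField E] [Algebra F E] (m : ℕ) : ℤ :=
  if Unramified F E then (m / 2 : ℕ) else ((m + 1) / 2 : ℕ)

open Classical in
/-- The identification of the groups of the quaternion algebra, in both cases. -/
abbrev SetupB (m : ℕ) (fr : Frame Q trd (nrd : ℍ[F,a,b] →* F) jB) : Prop :=
  fr.Setup m (levelB F E m) ((m + 1) / 2 : ℕ) (JB jB m) (torusGroupOne jB (radB a b m))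
    (VB jB m) (WB jB m) (if Unramified F E then radB a b (m + 1) else radB a b (m / 2 + 1))
    (radB a b)

theorem exists_setup_quaternion (hE : Module.finrank F E = 2)
    (hB : ∀ x : ℍ[F,a,b], x ≠ 0 → IsUnit x) (hm : 1 ≤ m) (hm' : ¬ Unramified F E → Odd m)
    (jB : E →ₐ[F] ℍ[F,a,b]) : ∃ fr : Frame Q trd (nrd : ℍ[F,a,b] →* F) jB, SetupB m fr := by
  by_cases hun : Unramified F E
  · simp only [SetupB, levelB, if_pos hun]
    exact Frame.exists_setup_quaternion_unramified (Q.unram_iff.mp hun) hE hB hm jB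
  · simp only [SetupB, levelB, if_neg hun]
    exact Frame.exists_setup_quaternion_ramified (Q.e_cases.resolve_left fun h =>
      hun (Q.unram_iff.mpr h)) hE hB (hm' hun) jB _

theorem isTypeOn_of_isBasicLambdaB {fr : Frame Q trd (nrd : ℍ[F,a,b] →* F) jB}
    (hs : SetupB m fr) (hψ : HasLevelZero ψ) (hβ : ord (β : E) = -(m : ℤ))
    (hχ : AgreesOn ψ β χ (m / 2 + 1)) {ρ : Representation Ω (JB jB m) V}
    (h : IsBasicLambdaB ψ jB m β χ ρ) :
    fr.IsTypeOn (levelB F E m) ((m + 1) / 2 : ℕ) (signB F Ω) χ ρ := by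
  have hP := hs.P_eq
  refine Frame.isTypeOn_of (β := β) hs.level hs.mem_J (fun e he => signB_eq_one (Q := Q) he)
    (s := (m / 2 + 1 : ℕ)) (by omega)
    (fun e he => hχ.eq_one (Q := Q) hψ hβ (by omega) he) (fun e he => hχ e he.2) (fun htt => ?_)
    fun htt => ⟨hs.mem_J₁ htt, ?_⟩
  · rw [← hP]
    by_cases hun : Unramified F E
    · rw [levelB, if_pos hun] at htt
      simp only [signB, if_pos hun, one_mul]
      exact h.2.1 hun (by rw [Nat.odd_iff]; omega)
    · simp only [signB, if_neg hun]
      exact h.1 hun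
  · rw [← hP]
    by_cases hun : Unramified F E
    · rw [levelB, if_pos hun] at htt
      rw [if_pos hun]
      exact h.2.2 hun (by rw [Nat.odd_iff]; omega)
    · rw [levelB, if_neg hun] at htt
      omega

theorem isBasicLambdaB_of_isTypeOn [IsAlgClosed Ω] [CharZero Ω]
    {fr : Frame Q trd (nrd : ℍ[F,a,b] →* F) jB}
    (hs : SetupB m fr) (hψ : HasLevelZero ψ) {α : Eˣ} (hα : IsMinimal F m α)
    (hχα : AgreesOn ψ α χ m)
    (hχ : AgreesOn ψ β χ (m / 2 + 1)) {ρ : Representation Ω (JB jB m) V}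
    (h : fr.IsTypeOn (levelB F E m) ((m + 1) / 2 : ℕ) (signB F Ω) χ ρ) :
    IsBasicLambdaB ψ jB m β χ ρ := by
  have hP := hs.P_eq
  have hchar : levelB F E m = ((m + 1) / 2 : ℕ) → _ := fun htt =>
    h.isCharType (β := β) hs.mem_J (fun e he => signB_eq_one (Q := Q) he)
      (s := (m / 2 + 1 : ℕ)) (by omega) (fun e he => hχ e he.2) htt
  rw [← hP] at hchar
  refine ⟨fun hun => ?_, fun hun hm => ?_, fun hun hm => ?_⟩
  · simp only [signB, levelB, if_neg hun] at hchar
    exact hchar trivial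
  · simp only [signB, levelB, if_pos hun, one_mul] at hchar
    rw [Nat.odd_iff] at hm
    exact hchar (by omega)
  · rw [Nat.odd_iff] at hm
    have htt : (((m + 1) / 2 : ℕ) : ℤ) = levelB F E m + 1 := by
      rw [levelB, if_pos hun]; omega
    have := h.isHeisenbergType (Q.unram_iff.mp hun) hψ hα hχα hs.level (hs.g_eq htt) hs.mem_J
      (hs.mem_J₁ htt) (s := (m / 2 + 1 : ℕ)) (by omega) (fun e he => hχ e he.2) htt
    rwa [← hP, if_pos hun] at this

end Setups

/-! ### Restriction to `𝒦` -/

section Linear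

variable {Ω G V : Type*} [Field Ω] [Group G] [AddCommGroup V] [Module Ω V]

theorem apply_inv_eq_smul {ρ : Representation Ω G V} {g : G} {c : Ω} (hc : c ≠ 0)
    (h : ∀ v, ρ g v = c • v) (v : V) : ρ g⁻¹ v = c⁻¹ • v := by
  have h1 := h (ρ g⁻¹ v)
  rw [← Module.End.mul_apply, ← map_mul, mul_inv_cancel, map_one, Module.End.one_apply] at h1
  conv_rhs => rw [h1]
  rw [smul_smul, inv_mul_cancel₀ hc, one_smul]

theorem dual_apply_eq_smul {ρ : Representation Ω G V} {g : G} {c : Ω}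
    (h : ∀ v, ρ g⁻¹ v = c • v) : ρ.dual g = c • LinearMap.id := by
  ext ℓ v
  rw [Representation.dual_apply, Module.Dual.transpose_apply, LinearMap.comp_apply, h, map_smul]
  rfl

theorem trace_eq_of_smul [FiniteDimensional Ω V] {A : V →ₗ[Ω] V} {c : Ω} (h : ∀ v, A v = c • v) :
    LinearMap.trace Ω V A = c * Module.finrank Ω V := by
  have : A = c • 1 := LinearMap.ext h
  rw [this, map_smul, LinearMap.trace_one, smul_eq_mul]

end Linear

section Restriction

variable {F E : Type*} [Field F] [ValuativeRel F] [TopologicalSpace F]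
  [IsNonarchimedeanLocalField F] [Field E] [ValuativeRel E] [TopologicalSpace E]
  [IsNonarchimedeanLocalField E] [Algebra F E]
  {Ω : Type*} [Field Ω] {ψ : AddChar F Ω}
  {Q : Quad F E}
  {V : Type*} [AddCommGroup V] [Module Ω V] {m : ℕ} {a b : F}
  {jA : E →ₐ[F] Matrix (Fin 2) (Fin 2) F} {jB : E →ₐ[F] ℍ[F,a,b]}

theorem Frame.At.one {D : Type*} [Ring D] [Algebra F D] {T : D →ₗ[F] F} {nr : D →* F}
    {j : E →ₐ[F] D} {fr : Frame Q T nr j} {t : ℤ} : fr.At t ((1 : Dˣ) : D) 1 := by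
  have := Frame.At.torus (fr := fr) (t := t) 1
  rwa [map_one] at this

/-- The identification of the groups of the matrix algebra. -/
abbrev SetupA (m : ℕ) (fr : Frame Q trA (Matrix.detMonoidHom : Matrix (Fin 2) (Fin 2) F →* F) jA) :
    Prop :=
  fr.Setup m ((m + 1) / 2 : ℕ) (m / 2 + 1 : ℕ) (JA jA m) (torusGroupOne jA (radA jA (m / 2)))
    (VA jA m) (WA jA m) (radA jA (m / 2 + 1)) (radA jA)

variable {frA : Frame Q trA (Matrix.detMonoidHom : Matrix (Fin 2) (Fin 2) F →* F) jA}
  {frB : Frame Q trd (nrd : ℍ[F,a,b] →* F) jB}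

theorem embU_mem_JA (hA : SetupA m frA) (e : Eˣ) : embU jA e ∈ JA jA m :=
  (hA.mem_J _).mpr (Frame.At.torus e).near

theorem embU_mem_JB (hB : SetupB m frB) (e : Eˣ) : embU jB e ∈ JB jB m :=
  (hB.mem_J _).mpr (Frame.At.torus e).near

theorem K_le (hA : SetupA m frA) (hB : SetupB m frB) :
    K jA jB m ≤ (JA jA m).prod (JB jB m) := by
  have hm : (1 : ℤ) ≤ m := by exact_mod_cast hA.level.one_le
  rw [K, Subgroup.closure_le]
  rintro x (⟨e, rfl⟩ | ⟨h1, h2⟩)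
  · exact ⟨embU_mem_JA hA e, embU_mem_JB hB e⟩
  · rw [hA.V_eq] at h1
    rw [hB.V_eq] at h2
    exact ⟨(hA.mem_J _).mpr (Frame.near_of_mem hm h1).1,
      (hB.mem_J _).mpr (Frame.near_of_mem hm h2).1⟩

/-- The inclusion of `𝒦` in `J_A × J_B`. -/
def KtoJ (h : K jA jB m ≤ (JA jA m).prod (JB jB m)) : K jA jB m →* JA jA m × JB jB m where
  toFun k := (⟨k.1.1, (h k.2).1⟩, ⟨k.1.2, (h k.2).2⟩)
  map_one' := rfl
  map_mul' _ _ := rfl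

variable (jA jB m) in
/-- The restriction of `δ` to `J_A × J_B`. -/
def deltaJ : JA jA m × JB jB m →* Fˣ := delta.comp ((JA jA m).subtype.prodMap (JB jB m).subtype)

theorem deltaJ_apply (x : JA jA m × JB jB m) : deltaJ m jA jB x =
    (Units.map (Matrix.detMonoidHom : Matrix (Fin 2) (Fin 2) F →* F) (x.1 : GL (Fin 2) F))⁻¹
      * Units.map nrd (x.2 : (ℍ[F,a,b])ˣ) := rfl

theorem mem_K_of_at (hA : SetupA m frA) (hB : SetupB m frB) {g : GL (Fin 2) F} {h : (ℍ[F,a,b])ˣ}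
    {e e' : Eˣ} (hg : frA.At ((m + 1) / 2 : ℕ) (g : Matrix (Fin 2) (Fin 2) F) e)
    (hh : frB.At (levelB F E m) (h : ℍ[F,a,b]) e') (hee : e / e' ∈ U E m) :
    (g, h) ∈ K jA jB m := by
  have hm : (1 : ℤ) ≤ m := by exact_mod_cast hA.level.one_le
  have h1 : (g, h) = diagE jA jB e' * (embU jA e'⁻¹ * g, embU jB e'⁻¹ * h) := by
    refine Prod.ext ?_ ?_ <;> simp [diagE]
  rw [h1]
  refine mul_mem (diagE_mem_K jA jB m e') (Subgroup.subset_closure (Or.inr ⟨?_, ?_⟩))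
  · rw [hA.V_eq, Frame.mem_unitsNear_iff hm]
    refine ⟨_, ?_, hg.torus_mul e'⁻¹⟩
    rwa [inv_mul_eq_div]
  · rw [hB.V_eq, Frame.mem_unitsNear_iff hm]
    have := hh.torus_mul e'⁻¹
    rw [inv_mul_cancel] at this
    exact ⟨1, one_mem _, this⟩

/-- One of the two factors acts by scalars. -/
def OneScalar (Λ : Representation Ω (JA jA m × JB jB m) V) : Prop :=
  (∀ g, ∃ c : Ω, ∀ v, Λ (g, 1) v = c • v) ∨ (∀ h, ∃ c : Ω, ∀ v, Λ (1, h) v = c • v)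

theorem isIrreducible_restrict (hA : SetupA m frA) (hB : SetupB m frB)
    {Λ : Representation Ω (JA jA m × JB jB m) V} (hΛ : Representation.IsIrreducible Λ)
    (hsc : OneScalar Λ) : Representation.IsIrreducible (Λ.comp (KtoJ (K_le hA hB))) := by
  refine isIrreducible_of_scalar hΛ _ fun ⟨g, h⟩ => ?_
  rcases hsc with hsc | hsc
  · obtain ⟨e, he⟩ := ((hB.mem_J _).mp h.2).exists_at
    obtain ⟨c, hc⟩ := hsc (g * ⟨embU jA e, embU_mem_JA hA e⟩⁻¹)
    refine ⟨⟨_, mem_K_of_at hA hB (Frame.At.torus e) he (by rw [div_self']; exact one_mem _)⟩, c, fun v => ?_⟩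
    rw [← hc, ← Module.End.mul_apply, ← map_mul]
    congr 2
    refine Prod.ext (Subtype.ext ?_) (Subtype.ext ?_)
    · simp [KtoJ]
    · simp [KtoJ]
  · obtain ⟨e, he⟩ := ((hA.mem_J _).mp g.2).exists_at
    obtain ⟨c, hc⟩ := hsc (h * ⟨embU jB e, embU_mem_JB hB e⟩⁻¹)
    refine ⟨⟨_, mem_K_of_at hA hB he (Frame.At.torus e) (by rw [div_self']; exact one_mem _)⟩, c, fun v => ?_⟩
    rw [← hc, ← Module.End.mul_apply, ← map_mul]
    congr 2
    refine Prod.ext (Subtype.ext ?_) (Subtype.ext ?_)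
    · simp [KtoJ]
    · simp [KtoJ]

/-- The group `𝒫` acts through `ψ_α`: here `(g, h)` lies in `𝒫` when the `E`-coordinates `e` of `g`
and `e'` of `h` are in `Fˣ U_E¹` and congruent modulo `U_E ^ m`, and the `c`-coordinates are small;
the value of `ψ_α` is then `ψ_E (α (e / e' - 1))`. -/
def ActsByPsi (ψ : AddChar F Ω) (α : Eˣ)
    (frA : Frame Q trA (Matrix.detMonoidHom : Matrix (Fin 2) (Fin 2) F →* F) jA)
    (frB : Frame Q trd (nrd : ℍ[F,a,b] →* F) jB) (m : ℕ)
    (Λ : Representation Ω (JA jA m × JB jB m) V) : Prop :=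
  ∀ (g : JA jA m) (h : JB jB m) (e e' : Eˣ),
    frA.At (m / 2 + 1 : ℕ) ((g : GL (Fin 2) F) : Matrix (Fin 2) (Fin 2) F) e →
    frB.At ((m + 1) / 2 : ℕ) ((h : (ℍ[F,a,b])ˣ) : ℍ[F,a,b]) e' → e ∈ FU F E → e' ∈ FU F E →
    e / e' ∈ U E m → ∀ v,
    Λ (g, h) v = ψ (Algebra.trace F E (α * (((e / e' : Eˣ) : E) - 1))) • v

/-- The properties of `τ_α`, for a representation of `J_A × J_B`. -/
structure IsTauLike (ψ : AddChar F Ω) (α : Eˣ)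
    (frA : Frame Q trA (Matrix.detMonoidHom : Matrix (Fin 2) (Fin 2) F →* F) jA)
    (frB : Frame Q trd (nrd : ℍ[F,a,b] →* F) jB) (m : ℕ)
    (Λ : Representation Ω (JA jA m × JB jB m) V) : Prop where
  acts : ActsByPsi ψ α frA frB m Λ
  ramified : ¬ Unramified F E → Module.finrank Ω V = 1 ∧
    ∀ (β : Eˣ) (h1 : embU jA β ∈ JA jA m) (h2 : embU jB β ∈ JB jB m) (v : V),
      Λ (⟨_, h1⟩, ⟨_, h2⟩) v = (-1 : Ω) ^ ord (β : E) • v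
  unramified : Unramified F E → ∀ ζ ∈ rootsOutside F (E := E), ∀ (h1 : embU jA ζ ∈ JA jA m)
    (h2 : embU jB ζ ∈ JB jB m), LinearMap.trace Ω V (Λ (⟨_, h1⟩, ⟨_, h2⟩)) = -1

theorem sAB_eq (frA : Frame Q trA (Matrix.detMonoidHom : Matrix (Fin 2) (Fin 2) F →* F) jA)
    (frB : Frame Q trd (nrd : ℍ[F,a,b] →* F) jB) (x : Matrix (Fin 2) (Fin 2) F) (y : ℍ[F,a,b]) :
    sAB jA jB x y = frA.X x - frB.X y := by
  rw [sAB, frA.corestr_eq, frB.corestr_eq]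

theorem psi_congr (Q : Quad F E) (hψ : HasLevelZero ψ) {α : Eˣ} (hα : ord (α : E) = -(m : ℤ))
    {x y : E} (h : x - y ∈ pPow E (m + 1)) :
    ψ (Algebra.trace F E (α * x)) = ψ (Algebra.trace F E (α * y)) := by
  have h1 : (α : E) * x = α * y + α * (x - y) := by ring
  rw [h1, map_add, AddChar.map_add_eq_mul, Q.psi_trace_eq_one hψ (x := α * (x - y)), mul_one]
  exact pPow_mul' (mem_pPow_ord _) h (by rw [hα]; omega)

theorem IsTauLike.isTau (hψ : HasLevelZero ψ) {α : Eˣ} (hα : ord (α : E) = -(m : ℤ))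
    (hA : SetupA m frA) (hB : SetupB m frB)
    {Λ : Representation Ω (JA jA m × JB jB m) V} (hΛ : Representation.IsIrreducible Λ)
    (hsc : OneScalar Λ) (hτ : IsTauLike ψ α frA frB m Λ) {V' : Type*} [AddCommGroup V']
    [Module Ω V'] (i : V ≃ₗ[Ω] V') :
    IsTau ψ jA jB m α (transport i (Λ.comp (KtoJ (K_le hA hB)))) := by
  have hm : (1 : ℤ) ≤ m := by exact_mod_cast hA.level.one_le
  have hirr := isIrreducible_transport i (isIrreducible_restrict hA hB hΛ hsc)
  have hV := (isIrreducible_iff.mp hirr).1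
  obtain ⟨v, hv⟩ := exists_ne (0 : V')
  have hdiag : ∀ e ∈ FU F E, ∀ w : V', transport i (Λ.comp (KtoJ (K_le hA hB)))
      ⟨_, diagE_mem_K jA jB m e⟩ w = w := by
    intro e he w
    have h1 := hτ.acts ⟨embU jA e, embU_mem_JA hA e⟩ ⟨embU jB e, embU_mem_JB hB e⟩ e e
      (Frame.At.torus e) (Frame.At.torus e) he he (by rw [div_self']; exact one_mem _) (i.symm w)
    rw [div_self', Units.val_one, sub_self, mul_zero, map_zero, AddChar.map_zero_eq_one,
      one_smul] at h1
    rw [transport_apply]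
    exact (congrArg i h1).trans (i.apply_symm_apply w)
  refine ⟨hirr, ⟨v, hv, fun c => hdiag _ (algebraMap_mem_FU c) v,
    fun e he => hdiag e (U_le_FU le_rfl ((mem_U le_rfl).mpr he)) v, fun k h1 h2 => ?_⟩,
    fun hun => ⟨?_, fun β w => ?_⟩, fun hun ζ hζ => ?_⟩
  · rw [hA.W_eq] at h1
    rw [hB.W_eq] at h2
    obtain ⟨e, he, hAt⟩ := (Frame.mem_unitsNear_iff hm).mp h1
    obtain ⟨e', he', hAt'⟩ := (Frame.mem_unitsNear_iff hm).mp h2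
    have h3 := hτ.acts ⟨k.1.1, (K_le hA hB k.2).1⟩ ⟨k.1.2, (K_le hA hB k.2).2⟩ e e' hAt hAt'
      (U_le_FU hm he) (U_le_FU hm he') (div_mem he he') (i.symm v)
    have h4 : ψ (Algebra.trace F E (α * (((e / e' : Eˣ) : E) - 1)))
        = ψ (Algebra.trace F E (α * sAB jA jB ((k.1.1 : Matrix (Fin 2) (Fin 2) F) - 1)
          ((k.1.2 : ℍ[F,a,b]) - 1))) := by
      apply psi_congr Q hψ hα
      rw [sAB_eq frA frB, Frame.X_sub, Frame.X_sub, Frame.X_one, Frame.X_one, hAt.1, hAt'.1]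
      have h5 : ((e / e' : Eˣ) : E) - 1 - ((e : E) - 1 - ((e' : E) - 1))
          = (e' : E)⁻¹ * (((e : E) - 1 - ((e' : E) - 1)) * (-((e' : E) - 1))) := by
        have := e'.ne_zero
        rw [Units.val_div_eq_div_val]
        field_simp
        ring
      rw [h5, mem_pPow_inv_mul e'.ne_zero, he'.1]
      exact pPow_mul' (pPow_sub he.2 he'.2) (pPow_neg he'.2) (by omega)
    rw [h4] at h3
    rw [transport_apply]
    refine (congrArg i h3).trans ?_
    rw [map_smul, i.apply_symm_apply]
  · rw [← (hτ.ramified hun).1, i.finrank_eq]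
  · rw [transport_apply]
    refine (congrArg i ((hτ.ramified hun).2 β (embU_mem_JA hA β) (embU_mem_JB hB β) _)).trans ?_
    rw [map_smul, i.apply_symm_apply]
  · rw [trace_transport]
    exact hτ.unramified hun ζ hζ (embU_mem_JA hA ζ) (embU_mem_JB hB ζ)

end Restriction

/-! ### The tensor products `Λ_χ ⊗ Λ̌'_χ` lie over `τ_α¹` -/

section Tensor

open scoped TensorProduct

theorem tensor_map_eq_smul {Ω V W : Type*} [Field Ω] [AddCommGroup V] [Module Ω V]
    [AddCommGroup W] [Module Ω W] {f : V →ₗ[Ω] V} {c d : Ω} (hf : ∀ v, f v = c • v)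
    (x : V ⊗[Ω] W) : TensorProduct.map f (d • LinearMap.id) x = (c * d) • x := by
  have : f = c • LinearMap.id := LinearMap.ext hf
  rw [this, TensorProduct.map_smul_left, TensorProduct.map_smul_right, TensorProduct.map_id,
    smul_smul]
  rfl

variable {F E : Type*} [Field F] [ValuativeRel F] [TopologicalSpace F]
  [IsNonarchimedeanLocalField F] [Field E] [ValuativeRel E] [TopologicalSpace E]
  [IsNonarchimedeanLocalField E] [Algebra F E]
  {Ω : Type*} [Field Ω] {ψ : AddChar F Ω}
  {Q : Quad F E}
  {V : Type*} [AddCommGroup V] [Module Ω V] {m : ℕ} {a b : F}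
  {jA : E →ₐ[F] Matrix (Fin 2) (Fin 2) F} {jB : E →ₐ[F] ℍ[F,a,b]}
  {frA : Frame Q trA (Matrix.detMonoidHom : Matrix (Fin 2) (Fin 2) F →* F) jA}
  {frB : Frame Q trd (nrd : ℍ[F,a,b] →* F) jB}

/-- The map `φ` identifies `Λ` with `ρ ⊗ ρ̌'`, where `ρ` and `ρ'` have the defining properties of
`Λ_χ` and `Λ'_χ`, in coordinates. -/
structure IsTensor (frA : Frame Q trA (Matrix.detMonoidHom : Matrix (Fin 2) (Fin 2) F →* F) jA)
    (frB : Frame Q trd (nrd : ℍ[F,a,b] →* F) jB) (m : ℕ) (χ : Eˣ →* Ωˣ)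
    (Λ : Representation Ω (JA jA m × JB jB m) V) {W W' : Type*} [AddCommGroup W] [Module Ω W]
    [AddCommGroup W'] [Module Ω W'] (ρ : Representation Ω (JA jA m) W)
    (ρ' : Representation Ω (JB jB m) W') (φ : V ≃ₗ[Ω] W ⊗[Ω] Module.Dual Ω W') : Prop where
  typeA : frA.IsTypeOn ((m + 1) / 2 : ℕ) (m / 2 + 1 : ℕ) (fun _ => 1) χ ρ
  typeB : frB.IsTypeOn (levelB F E m) ((m + 1) / 2 : ℕ) (signB F Ω) χ ρ'
  map_eq : ∀ g h v, φ (Λ (g, h) v) = TensorProduct.map (ρ g) (ρ'.dual h) (φ v)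

namespace IsTensor

variable {χ : Eˣ →* Ωˣ} {Λ : Representation Ω (JA jA m × JB jB m) V} {W W' : Type*}
  [AddCommGroup W] [Module Ω W] [AddCommGroup W'] [Module Ω W']
  {ρ : Representation Ω (JA jA m) W} {ρ' : Representation Ω (JB jB m) W'}
  {φ : V ≃ₗ[Ω] W ⊗[Ω] Module.Dual Ω W'}

theorem apply_eq_smul (H : IsTensor frA frB m χ Λ ρ ρ' φ) {g : JA jA m} {h : JB jB m} {c d : Ω}
    (hg : ∀ w, ρ g w = c • w) (hh : ∀ w, ρ' h⁻¹ w = d • w) (v : V) :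
    Λ (g, h) v = (c * d) • v := by
  apply φ.injective
  rw [H.map_eq, dual_apply_eq_smul hh, tensor_map_eq_smul hg, map_smul]

theorem oneScalar (H : IsTensor frA frB m χ Λ ρ ρ' φ) {α : Eˣ} (hα : IsMinimal F m α)
    (hA : SetupA m frA) (hB : SetupB m frB) : OneScalar Λ := by
  rcases Nat.even_or_odd m with hm | hm
  · right
    have hun : Unramified F E := by
      by_contra hun
      exact (Nat.not_odd_iff_even.mpr hm) (hα.2.1 hun)
    have htt : levelB F E m = ((m + 1) / 2 : ℕ) := by
      rw [levelB, if_pos hun]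
      obtain ⟨k, rfl⟩ := hm
      omega
    intro h
    obtain ⟨e, he⟩ := ((hB.mem_J _).mp (h⁻¹).2).exists_at
    exact ⟨_, H.apply_eq_smul (c := 1) (fun w => by rw [map_one, one_smul]; rfl)
      ((H.typeB.char_case htt).2 h⁻¹ e he)⟩
  · left
    have htt : (((m + 1) / 2 : ℕ) : ℤ) = (m / 2 + 1 : ℕ) := by
      obtain ⟨k, rfl⟩ := hm
      omega
    intro g
    obtain ⟨e, he⟩ := ((hA.mem_J _).mp g.2).exists_at
    exact ⟨_, H.apply_eq_smul (d := 1) ((H.typeA.char_case htt).2 g e he)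
      (fun w => by rw [inv_one, map_one, one_smul]; rfl)⟩

theorem trace_eq [FiniteDimensional Ω W] [FiniteDimensional Ω W']
    (H : IsTensor frA frB m χ Λ ρ ρ' φ) (g : JA jA m) (h : JB jB m) :
    LinearMap.trace Ω V (Λ (g, h)) = LinearMap.trace Ω W (ρ g) * LinearMap.trace Ω W' (ρ' h⁻¹) := by
  have h1 : φ.conj (Λ (g, h)) = TensorProduct.map (ρ g) (ρ'.dual h) := by
    ext1
    ext x
    simp [LinearEquiv.conj_apply, H.map_eq]
  rw [← LinearMap.trace_conj' (Λ (g, h)) φ, h1, LinearMap.trace_tensorProduct']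
  congr 1
  exact LinearMap.trace_transpose' _

theorem isTauLike [FiniteDimensional Ω W] [FiniteDimensional Ω W']
    (H : IsTensor frA frB m χ Λ ρ ρ' φ) {α : Eˣ} (hα : IsMinimal F m α)
    (hχ : AgreesOn ψ α χ m) (hA : SetupA m frA) : IsTauLike ψ α frA frB m Λ := by
  have hm : (1 : ℤ) ≤ m := by exact_mod_cast hA.level.one_le
  refine ⟨fun g h e e' he he' hF hF' hU v => ?_, fun hun => ?_, fun hun ζ hζ h1 h2 => ?_⟩
  · rw [H.apply_eq_smul (H.typeA.acts g e he hF)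
      (apply_inv_eq_smul (χ e').ne_zero (H.typeB.acts h e' he' hF'))]
    rw [← hχ _ ((mem_U hm).mp hU), map_div, Units.val_div_eq_div_val, div_eq_mul_inv]
  · obtain ⟨k, hk⟩ := hα.2.1 hun
    have hcA := H.typeA.char_case (by omega)
    have hcB := H.typeB.char_case (by rw [levelB, if_neg hun])
    refine ⟨?_, fun β h1 h2 v => ?_⟩
    · rw [φ.finrank_eq, Module.finrank_tensorProduct, Subspace.dual_finrank_eq, hcA.1, hcB.1]
    · rw [H.apply_eq_smul (hcA.2 _ β (Frame.At.torus β))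
        (hcB.2 _ β⁻¹ (by simpa using Frame.At.torus (fr := frB) (t := levelB F E m) β⁻¹))]
      congr 1
      rw [signB, if_neg hun, Units.val_inv_eq_inv_val, ord_inv, zpow_neg, ← inv_zpow, map_inv]
      have := (χ β).ne_zero
      rw [Units.val_inv_eq_inv_val]
      norm_num
      field_simp
  · have h2' : embU jB ζ⁻¹ ∈ JB jB m := by rw [map_inv]; exact inv_mem h2
    have hinv : (⟨embU jB ζ, h2⟩ : JB jB m)⁻¹ = ⟨embU jB ζ⁻¹, h2'⟩ := Subtype.ext (by simp)
    have hχζ : (χ ζ : Ω) * (χ ζ⁻¹ : Ω) = 1 := by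
      rw [← Units.val_mul, ← map_mul, mul_inv_cancel, map_one, Units.val_one]
    rw [H.trace_eq, hinv]
    rcases Nat.even_or_odd m with hm | hm
    · obtain ⟨k, hk⟩ := hm
      have hcA := H.typeA.heis_case (by omega)
      have hcB := H.typeB.char_case (by rw [levelB, if_pos hun]; omega)
      rw [hcA.2 ζ h1 hζ, trace_eq_of_smul (hcB.2 _ ζ⁻¹ (Frame.At.torus _)), hcB.1, signB,
        if_pos hun]
      linear_combination -hχζ
    · obtain ⟨k, hk⟩ := hm
      have hcA := H.typeA.char_case (by omega)
      have hcB := H.typeB.heis_case (by rw [levelB, if_pos hun]; omega)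
      rw [hcB.2 ζ⁻¹ h2' (inv_mem_rootsOutside hζ), trace_eq_of_smul (hcA.2 _ ζ (Frame.At.torus _)),
        hcA.1]
      linear_combination -hχζ

end IsTensor

/-- A representation of type `χ₁` is, up to a twist by `ω ∘ nr`, of type `χ₀` whenever `χ₀` and
`χ₁` differ by `ω ∘ N`. -/
theorem Frame.IsTypeOn.exists_untwist {D : Type*} [Ring D] [Algebra F D] {T : D →ₗ[F] F}
    {nr : D →* F} {j : E →ₐ[F] D} {fr : Frame Q T nr j} {t t' : ℤ} (hl : fr.IsLevel m t t')
    {J : Subgroup Dˣ} {ρ ρ₁ : Representation Ω J V} {ε : Eˣ → Ω} {χ₀ χ₁ : Eˣ →* Ωˣ}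
    {ω₀ ω₁ : Fˣ →* Ωˣ} (h : fr.IsTypeOn t t' ε χ₁ ρ₁)
    (hχ : χ₀ * ω₀.comp normUnits = χ₁ * ω₁.comp normUnits)
    (h₀ : ∀ e ∈ U E (m + 1), χ₀ e = 1) (h₁ : ∀ e ∈ U E (m + 1), χ₁ e = 1)
    (hρ : ∀ u v, ρ u v = (ω₁ (Units.map nr (u : Dˣ)) : Ω) • ρ₁ u v) :
    ∃ ρ₀ : Representation Ω J V, fr.IsTypeOn t t' ε χ₀ ρ₀ ∧
      ∀ u v, ρ u v = (ω₀ (Units.map nr (u : Dˣ)) : Ω) • ρ₀ u v := by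
  have hχ' : ∀ e, χ₀ e * ω₀ (normUnits e) = χ₁ e * ω₁ (normUnits e) := fun e =>
    DFunLike.congr_fun hχ e
  have hω : ∀ e ∈ U E (m + 1), (ω₁ / ω₀) (normUnits e) = 1 := by
    intro e he
    have := hχ' e
    rw [h₀ e he, h₁ e he, one_mul, one_mul] at this
    rw [MonoidHom.div_apply, this, div_self']
  refine ⟨LocalTypes.twist ((ω₁ / ω₀).comp ((Units.map nr).comp J.subtype)) ρ₁, ?_,
    fun u v => ?_⟩
  · have hχ0 : χ₀ = χ₁ * (ω₁ / ω₀).comp normUnits := by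
      ext1 e
      rw [MonoidHom.mul_apply, MonoidHom.comp_apply, MonoidHom.div_apply, ← mul_div_assoc, ← hχ',
        mul_div_cancel_right]
    rw [hχ0]
    exact h.twist hl hω
  · rw [hρ, twist_apply, smul_smul, ← Units.val_mul]
    congr 2
    simp only [MonoidHom.comp_apply, MonoidHom.div_apply, Subgroup.subtype_apply]
    rw [mul_div_cancel]

variable [IsAlgClosed Ω] [CharZero Ω]

theorem liesOverTauOne_of_isLambdaTensorDual (hψ : HasLevelZero ψ) {α : Eˣ}
    (hα : IsMinimal F m α) (hA : SetupA m frA) (hB : SetupB m frB)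
    {Λ : Representation Ω (JA jA m × JB jB m) V} (hΛ : Representation.IsIrreducible Λ)
    {χ : Eˣ →* Ωˣ} (hχ : χ ∈ Y ψ m α) (h : IsLambdaTensorDual ψ χ Λ) : LiesOverTauOne ψ α Λ := by
  obtain ⟨χ₀, ω₀, -, -, rfl, hχ₀⟩ := hχ
  obtain ⟨d, d', ρ, ρ', ⟨β₁, χ₁, ω₁, ρ₁, hβ₁, -, -, hχ₁, hag₁, hb₁, hρ₁⟩,
    ⟨β₂, χ₂, ω₂, ρ₂, hβ₂, -, -, hχ₂, hag₂, hb₂, hρ₂⟩, φ, hφ⟩ := h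
  have hm : 1 ≤ m := hA.level.one_le
  have h₀ : ∀ e ∈ U E (m + 1), χ₀ e = 1 := fun e he => hχ₀.eq_one (Q := Q) hψ hα.1 (by omega) he
  obtain ⟨ρA, htA, hρA⟩ := (isTypeOn_of_isBasicLambdaA hA hψ hβ₁.1 hag₁ hb₁).exists_untwist
    hA.level hχ₁ h₀ (fun e he => hag₁.eq_one (Q := Q) hψ hβ₁.1 (by omega) he)
    (ρ := ρ) fun u v => by rw [hρ₁]; rfl
  obtain ⟨ρB, htB, hρB⟩ := (isTypeOn_of_isBasicLambdaB hB hψ hβ₂.1 hag₂ hb₂).exists_untwist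
    hB.level hχ₂ h₀ (fun e he => hag₂.eq_one (Q := Q) hψ hβ₂.1 (by omega) he)
    (ρ := ρ') fun u v => by rw [hρ₂]; rfl
  have H : IsTensor frA frB m χ₀ (twist (ω₀.comp (deltaJ m jA jB)) Λ) ρA ρB φ := by
    refine ⟨htA, htB, fun g h v => ?_⟩
    have h1 : ρ g = (ω₀ (Units.map (Matrix.detMonoidHom : Matrix (Fin 2) (Fin 2) F →* F)
        (g : GL (Fin 2) F)) : Ω) • ρA g := LinearMap.ext (hρA g)
    have h2 : ρ'.dual h = (ω₀ (Units.map nrd (h : (ℍ[F,a,b])ˣ))⁻¹ : Ω) • ρB.dual h := by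
      refine LinearMap.ext fun ℓ => LinearMap.ext fun v => ?_
      rw [Representation.dual_apply, Module.Dual.transpose_apply, LinearMap.comp_apply, hρB]
      simp [Representation.dual_apply, Module.Dual.transpose_apply]
    rw [twist_apply, map_smul, hφ, h1, h2, TensorProduct.map_smul_left,
      TensorProduct.map_smul_right, LinearMap.smul_apply, LinearMap.smul_apply, smul_smul,
      smul_smul]
    convert one_smul Ω _ using 2
    rw [MonoidHom.comp_apply, deltaJ_apply, map_mul, map_inv, Units.val_mul,
      Units.val_inv_eq_inv_val]
    have h3 := (ω₀ (Units.map (Matrix.detMonoidHom : Matrix (Fin 2) (Fin 2) F →* F)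
        (g : GL (Fin 2) F))).ne_zero
    have h4 := (ω₀ (Units.map nrd (h : (ℍ[F,a,b])ˣ))).ne_zero
    field_simp
    rw [map_inv, Units.mul_inv]
  have : FiniteDimensional Ω V := φ.symm.finiteDimensional
  have hΛ' := isIrreducible_twist (μ := ω₀.comp (deltaJ m jA jB)) hΛ
  have i := (Module.finBasis Ω V).equivFun
  refine ⟨_, _, (H.isTauLike hα hχ₀ hA).isTau hψ hα.1 hA hB hΛ' (H.oneScalar hα hA hB) i,
    i.symm.toLinearMap, i.symm.injective, fun g h hk w => ?_⟩
  have hδ : deltaJ m jA jB (g, h) = 1 := hk.2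
  rw [transport_apply]
  refine (i.symm_apply_apply _).trans ?_
  change twist (ω₀.comp (deltaJ m jA jB)) Λ (g, h) _ = _
  rw [twist_apply, MonoidHom.comp_apply, hδ, map_one, Units.val_one, one_smul]
  rfl

end Tensor

/-! ### Intertwining operators -/

section Intertwining

variable {Ω G K A V W : Type*} [Field Ω] [Group G] [Group K] [CommGroup A] [AddCommGroup V]
  [Module Ω V] [AddCommGroup W] [Module Ω W]

theorem exists_char_of_eigenvector {ρ : Representation Ω G V} {v : V} (hv : v ≠ 0)
    (h : ∀ g, ∃ c : Ω, ρ g v = c • v) : ∃ ξ : G →* Ωˣ, ∀ g, ρ g v = (ξ g : Ω) • v := by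
  choose c hc using h
  have hmul : ∀ g g', c (g * g') = c g * c g' := fun g g' => by
    apply smul_left_injective Ω hv
    simp only
    rw [← hc, map_mul, Module.End.mul_apply, hc, map_smul, hc, smul_smul, mul_comm]
  have hone : c 1 = 1 := by
    apply smul_left_injective Ω hv
    simp only
    rw [← hc, map_one, one_smul]; rfl
  exact ⟨MonoidHom.toHomUnits ⟨⟨c, hone⟩, hmul⟩, hc⟩

/-- If the restriction of `Λ` to the kernel of a homomorphism `f` from `K` to a commutative group
contains (a nonzero quotient of) the restriction of `τ`, then some twist of `Λ|K` by a character
factoring through `f` contains (a nonzero quotient of) `τ`: the group `K` acts on the space of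
intertwining operators through a commutative quotient. -/
theorem exists_twist_intertwiner [IsAlgClosed Ω] [FiniteDimensional Ω V] [FiniteDimensional Ω W]
    (i : K →* G) (f : K →* A) (τ : Representation Ω K W) (Λ : Representation Ω G V)
    {φ₀ : W →ₗ[Ω] V} (hφ₀ : φ₀ ≠ 0) (h : ∀ k, f k = 1 → ∀ w, φ₀ (τ k w) = Λ (i k) (φ₀ w)) :
    ∃ ω : A →* Ωˣ, ∃ φ : W →ₗ[Ω] V, φ ≠ 0 ∧
      ∀ k w, φ (τ k w) = (ω (f k) : Ω) • Λ (i k) (φ w) := by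
  let σ : Representation Ω K (W →ₗ[Ω] V) := Representation.linHom τ (Λ.comp i)
  have hσ : ∀ k φ w, σ k φ w = Λ (i k) (φ (τ k⁻¹ w)) := fun k φ w => rfl
  have hinv : ∀ k w, τ k⁻¹ (τ k w) = w := fun k w => by
    rw [← Module.End.mul_apply, ← map_mul, inv_mul_cancel, map_one]; rfl
  have hinv' : ∀ k w, τ k (τ k⁻¹ w) = w := fun k w => by
    rw [← Module.End.mul_apply, ← map_mul, mul_inv_cancel, map_one]; rfl
  let H : Subrepresentation σ :=
    { toSubmodule :=
        { carrier := {φ | ∀ k, f k = 1 → σ k φ = φ}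
          zero_mem' := fun k _ => map_zero _
          add_mem' := fun {x y} hx hy k hk => by rw [map_add, hx k hk, hy k hk]
          smul_mem' := fun c x hx k hk => by rw [map_smul, hx k hk] }
      apply_mem_toSubmodule := fun g x hx k hk => by
        have h1 : f (g⁻¹ * k * g) = 1 := by
          rw [map_mul, map_mul, hk, mul_one, map_inv, inv_mul_cancel]
        have h2 : k * g = g * (g⁻¹ * k * g) := by group
        change σ k (σ g x) = σ g x
        rw [← Module.End.mul_apply, ← map_mul, h2, map_mul, Module.End.mul_apply, hx _ h1] }
  have hφ₀H : φ₀ ∈ H.toSubmodule := fun k hk => by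
    ext w
    rw [hσ, ← h k hk, hinv']
  have : Nontrivial H.toSubmodule := ⟨⟨φ₀, hφ₀H⟩, 0, fun h0 => hφ₀ (congrArg Subtype.val h0)⟩
  obtain ⟨φ, hφ, hφc⟩ := exists_common_eigenvector H.toRepresentation (fun g g' φ => by
    apply Subtype.ext
    change σ g (σ g' φ) = σ g' (σ g φ)
    have h1 : f ((g' * g)⁻¹ * (g * g')) = 1 := by
      rw [map_mul, map_inv, map_mul, map_mul, mul_comm (f g), inv_mul_cancel]
    have h2 := φ.2 _ h1
    have h3 : g * g' = g' * g * ((g' * g)⁻¹ * (g * g')) := by group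
    rw [← Module.End.mul_apply, ← map_mul, h3, map_mul, Module.End.mul_apply, h2, map_mul,
      Module.End.mul_apply])
  obtain ⟨ξ, hξ⟩ := exists_char_of_eigenvector hφ hφc
  have hξ' : ∀ k, σ k φ = (ξ k : Ω) • (φ : W →ₗ[Ω] V) := fun k => congrArg Subtype.val (hξ k)
  have hφ' : (φ : W →ₗ[Ω] V) ≠ 0 := fun h0 => hφ (Subtype.ext h0)
  obtain ⟨ω, hω⟩ := exists_char_factor f ξ⁻¹ fun k hk => by
    have h1 := hξ' k
    rw [φ.2 k hk] at h1
    have h2 : (1 : Ω) = ξ k := smul_left_injective Ω hφ' (by simpa using h1)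
    rw [MonoidHom.inv_apply, inv_eq_one]
    exact Units.ext h2.symm
  refine ⟨ω, φ, hφ', fun k w => ?_⟩
  have h1 := congrArg (fun x => x (τ k w)) (hξ' k)
  simp only [hσ, hinv, LinearMap.smul_apply] at h1
  rw [hω, h1, MonoidHom.inv_apply, smul_smul, Units.inv_mul, one_smul]

/-- An element whose commutators act trivially acts by a scalar in an irreducible representation. -/
theorem exists_scalar_of_commutator [IsAlgClosed Ω] [FiniteDimensional Ω V]
    {ρ : Representation Ω G V} (hρ : Representation.IsIrreducible ρ) {x : G}
    (h : ∀ y v, ρ (x⁻¹ * y⁻¹ * x * y) v = v) : ∃ c : Ω, ∀ v, ρ x v = c • v := by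
  refine exists_scalar_of_commute hρ (ρ x) fun y v => ?_
  have h1 : x * y = y * x * (x⁻¹ * y⁻¹ * x * y) := by group
  rw [← Module.End.mul_apply, ← map_mul, h1, map_mul, Module.End.mul_apply, h, map_mul,
    Module.End.mul_apply]

theorem zpow_mem_submonoid {S : Submonoid G} {x : G} (h : x ∈ S) (h' : x⁻¹ ∈ S) (n : ℤ) :
    x ^ n ∈ S := by
  obtain ⟨k, rfl | rfl⟩ := n.eq_nat_or_neg
  · rw [zpow_natCast]; exact pow_mem h k
  · rw [zpow_neg, zpow_natCast, ← inv_pow]; exact pow_mem h' k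

end Intertwining

section Local

variable {F E : Type*} [Field F] [ValuativeRel F] [TopologicalSpace F]
  [IsNonarchimedeanLocalField F] [Field E] [ValuativeRel E] [TopologicalSpace E]
  [IsNonarchimedeanLocalField E] [Algebra F E]
  {Ω : Type*} [Field Ω] {ψ : AddChar F Ω}
  {Q : Quad F E}
  {V : Type*} [AddCommGroup V] [Module Ω V] {m : ℕ} {a b : F}
  {jA : E →ₐ[F] Matrix (Fin 2) (Fin 2) F} {jB : E →ₐ[F] ℍ[F,a,b]}
  {frA : Frame Q trA (Matrix.detMonoidHom : Matrix (Fin 2) (Fin 2) F →* F) jA}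
  {frB : Frame Q trd (nrd : ℍ[F,a,b] →* F) jB}
  {Λ : Representation Ω (JA jA m × JB jB m) V}

theorem embU_algebraMap_comm {D : Type*} [Ring D] [Algebra F D] (j : E →ₐ[F] D) (c : Fˣ) (u : Dˣ) :
    embU j (Units.map (algebraMap F E : F →* E) c) * u
      = u * embU j (Units.map (algebraMap F E : F →* E) c) := by
  apply Units.ext
  change j (algebraMap F E c) * (u : D) = u * j (algebraMap F E c)
  rw [AlgHom.commutes, Algebra.commutes]

/-! ### Irreducible smooth representations are finite-dimensional -/

theorem finiteDimensional_of_isSmoothRep [IsAlgClosed Ω] (hA : SetupA m frA) (hB : SetupB m frB)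
    (hΛ : Representation.IsIrreducible Λ) (hsm : IsSmoothRep Λ) : FiniteDimensional Ω V := by
  have := (isIrreducible_iff.mp hΛ).1
  obtain ⟨v, hv⟩ := exists_ne (0 : V)
  obtain ⟨n, -, hn⟩ := hsm v
  obtain ⟨k, -, hk⟩ := hA.rad_sub n
  obtain ⟨l, -, hl⟩ := hB.rad_sub n
  have hmA := hA.level.one_le
  have hlA := hA.level.le_two
  have hlB := hB.level.le_two
  obtain ⟨R, hR, hcA⟩ := frA.exists_finite_cosets hA.level.g_nonneg hA.level.t_nonneg (by omega) k
  obtain ⟨R', hR', hcB⟩ := frB.exists_finite_cosets hB.level.g_nonneg hB.level.t_nonneg (by omega) l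
  set ϖ : Fˣ := Units.mk0 (unif F) unif_ne_zero
  set ϖE : Eˣ := Units.map (algebraMap F E : F →* E) ϖ
  let zA : JA jA m × JB jB m := (⟨embU jA ϖE, embU_mem_JA hA ϖE⟩, 1)
  let zB : JA jA m × JB jB m := (1, ⟨embU jB ϖE, embU_mem_JB hB ϖE⟩)
  have hzA : ∀ g, zA * g = g * zA := fun g => Prod.ext
    (Subtype.ext (embU_algebraMap_comm jA ϖ (g.1 : GL (Fin 2) F)))
    (by change 1 * g.2 = g.2 * 1; rw [one_mul, mul_one])
  have hzB : ∀ g, zB * g = g * zB := fun g => Prod.ext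
    (by change 1 * g.1 = g.1 * 1; rw [one_mul, mul_one])
    (Subtype.ext (embU_algebraMap_comm jB ϖ (g.2 : (ℍ[F,a,b])ˣ)))
  have hinv : ∀ z : JA jA m × JB jB m, (∀ g, z * g = g * z) → ∀ g, z⁻¹ * g = g * z⁻¹ :=
    fun z hz g => by
      rw [inv_mul_eq_iff_eq_mul, ← mul_assoc, hz, mul_inv_cancel_right]
  refine finiteDimensional_of_cosets hΛ {zA, zA⁻¹, zB, zB⁻¹} (Set.toFinite _) ?_
    {x | ((x.1 : GL (Fin 2) F), (x.2 : (ℍ[F,a,b])ˣ)) ∈ R ×ˢ R'} ?_ hv fun g => ?_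
  · rintro z (rfl | rfl | rfl | rfl)
    exacts [hzA, hinv _ hzA, hzB, hinv _ hzB]
  · exact (hR.prod hR').preimage (Set.injOn_of_injective fun x y hxy =>
      Prod.ext (Subtype.ext (Prod.ext_iff.mp hxy).1) (Subtype.ext (Prod.ext_iff.mp hxy).2))
  · obtain ⟨g, h⟩ := g
    obtain ⟨x, r, hr, w, hw, hrn, hg⟩ := hcA g ((hA.mem_J _).mp g.2)
    obtain ⟨y, r', hr', w', hw', hrn', hh⟩ := hcB h ((hB.mem_J _).mp h.2)
    have hrJ : r ∈ JA jA m := (hA.mem_J _).mpr hrn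
    have hrJ' : r' ∈ JB jB m := (hB.mem_J _).mpr hrn'
    have hwJ : w ∈ JA jA m := by
      have : w = (embU jA ϖE ^ x * r)⁻¹ * g := by rw [hg, inv_mul_cancel_left]
      rw [this]
      exact mul_mem (inv_mem (mul_mem (zpow_mem (embU_mem_JA hA _) _) hrJ)) g.2
    have hwJ' : w' ∈ JB jB m := by
      have : w' = (embU jB ϖE ^ y * r')⁻¹ * h := by rw [hh, inv_mul_cancel_left]
      rw [this]
      exact mul_mem (inv_mem (mul_mem (zpow_mem (embU_mem_JB hB _) _) hrJ')) h.2
    refine ⟨zA ^ x * zB ^ y, mul_mem (zpow_mem_submonoid (Submonoid.subset_closure (by simp))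
      (Submonoid.subset_closure (by simp)) x) (zpow_mem_submonoid
      (Submonoid.subset_closure (by simp)) (Submonoid.subset_closure (by simp)) y),
      (⟨r, hrJ⟩, ⟨r', hrJ'⟩), ⟨hr, hr'⟩, (⟨w, hwJ⟩, ⟨w', hwJ'⟩), ?_,
      hn _ _ (hk hw) (hl hw')⟩
    refine Prod.ext (Subtype.ext ?_) (Subtype.ext ?_)
    · rw [hg]
      simp [zA, zB]
    · rw [hh]
      simp [zA, zB]

end Local

/-! ### Representations lying over `τ_α¹` -/

section Over

variable {F E : Type*} [Field F] [ValuativeRel F] [TopologicalSpace F]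
  [IsNonarchimedeanLocalField F] [Field E] [ValuativeRel E] [TopologicalSpace E]
  [IsNonarchimedeanLocalField E] [Algebra F E]
  {Ω : Type*} [Field Ω] {ψ : AddChar F Ω}
  {Q : Quad F E}
  {V : Type*} [AddCommGroup V] [Module Ω V] {m : ℕ} {a b : F}
  {jA : E →ₐ[F] Matrix (Fin 2) (Fin 2) F} {jB : E →ₐ[F] ℍ[F,a,b]}
  {frA : Frame Q trA (Matrix.detMonoidHom : Matrix (Fin 2) (Fin 2) F →* F) jA}
  {frB : Frame Q trd (nrd : ℍ[F,a,b] →* F) jB}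
  {Λ : Representation Ω (JA jA m × JB jB m) V} {α : Eˣ}

theorem psi_eq_of_div_mem (Q : Quad F E) (hψ : HasLevelZero ψ) (hα : ord (α : E) = -(m : ℤ))
    {e f : Eˣ} (hf : ord (f : E) = 0) (h : e / f ∈ U E (m + 1)) :
    ψ (Algebra.trace F E (α * ((e : E) - 1))) = ψ (Algebra.trace F E (α * ((f : E) - 1))) := by
  apply psi_congr Q hψ hα
  rw [sub_sub_sub_cancel_right]
  have := (div_mem_U (by omega)).mp h
  rwa [hf, zero_add] at this

/-- The group `𝒫` acts through `ψ_α` on some nonzero vector of `τ_α`. -/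
theorem IsTau.exists_vector (hA : SetupA m frA) (hB : SetupB m frB)
    {τ : Representation Ω (K jA jB m) V} (hτ : IsTau ψ jA jB m α τ) :
    ∃ v : V, v ≠ 0 ∧ ∀ (k : K jA jB m) (e e' : Eˣ),
      frA.At (m / 2 + 1 : ℕ) (k.1.1 : Matrix (Fin 2) (Fin 2) F) e →
      frB.At ((m + 1) / 2 : ℕ) (k.1.2 : ℍ[F,a,b]) e' → e' ∈ FU F E → e / e' ∈ U E m →
      τ k v = ψ (Algebra.trace F E (α * (((e / e' : Eˣ) : E) - 1))) • v := by
  have hm : (1 : ℤ) ≤ m := by exact_mod_cast hA.level.one_le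
  obtain ⟨v, hv, hF, hU, hW⟩ := hτ.lies_over
  refine ⟨v, hv, fun k e e' hk hk' hFU hee => ?_⟩
  have hdiag : τ ⟨_, diagE_mem_K jA jB m e'⟩ v = v := by
    obtain ⟨c, u, hu, rfl⟩ := mem_FU.mp hFU
    have h1 : (⟨_, diagE_mem_K jA jB m (Units.map (algebraMap F E : F →* E) c * u)⟩ : K jA jB m)
        = ⟨_, diagE_mem_K jA jB m (Units.map (algebraMap F E : F →* E) c)⟩
          * ⟨_, diagE_mem_K jA jB m u⟩ := Subtype.ext (map_mul _ _ _)
    rw [h1, map_mul, Module.End.mul_apply, hU u hu.2]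
    exact hF c
  set k' : K jA jB m := ⟨_, diagE_mem_K jA jB m e'⁻¹⟩ * k with hk'_def
  have hsplit : k = ⟨_, diagE_mem_K jA jB m e'⟩ * k' := by
    apply Subtype.ext
    change k.1 = diagE jA jB e' * (diagE jA jB e'⁻¹ * k.1)
    rw [map_inv, mul_inv_cancel_left]
  have h1 : frA.At (m / 2 + 1 : ℕ) (k'.1.1 : Matrix (Fin 2) (Fin 2) F) (e / e') := by
    have := hk.torus_mul e'⁻¹
    rwa [inv_mul_eq_div] at this
  have h2 : frB.At ((m + 1) / 2 : ℕ) (k'.1.2 : ℍ[F,a,b]) 1 := by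
    have := hk'.torus_mul e'⁻¹
    rwa [inv_mul_cancel] at this
  have h3 := hW k' (by rw [hA.W_eq, Frame.mem_unitsNear_iff hm]; exact ⟨_, hee, h1⟩)
    (by rw [hB.W_eq, Frame.mem_unitsNear_iff hm]; exact ⟨1, one_mem _, h2⟩)
  rw [sAB_eq frA frB, Frame.X_sub, Frame.X_sub, Frame.X_one, Frame.X_one, h1.1, h2.1,
    Units.val_one, sub_self, sub_zero] at h3
  rw [hsplit, map_mul, Module.End.mul_apply, h3, map_smul, hdiag]

theorem actsByPsi_of_isTau (hψ : HasLevelZero ψ) (hα : ord (α : E) = -(m : ℤ))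
    (hA : SetupA m frA) (hB : SetupB m frB) (hΛ : Representation.IsIrreducible Λ) {W : Type*}
    [AddCommGroup W] [Module Ω W] {τ : Representation Ω (K jA jB m) W}
    (hτ : IsTau ψ jA jB m α τ) {φ : W →ₗ[Ω] V} (hφ : Function.Injective φ)
    (hφΛ : ∀ k w, φ (τ k w) = Λ (KtoJ (K_le hA hB) k) (φ w)) : ActsByPsi ψ α frA frB m Λ := by
  have hm : (1 : ℤ) ≤ m := by exact_mod_cast hA.level.one_le
  obtain ⟨v, hv, hact⟩ := hτ.exists_vector hA hB
  intro g h e e' hg hh he he' hee w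
  refine apply_eq_smul_of_conj hΛ (fun x c => ∃ e e' : Eˣ,
    frA.At (m / 2 + 1 : ℕ) ((x.1 : GL (Fin 2) F) : Matrix (Fin 2) (Fin 2) F) e ∧
    frB.At ((m + 1) / 2 : ℕ) ((x.2 : (ℍ[F,a,b])ˣ) : ℍ[F,a,b]) e' ∧ e ∈ FU F E ∧ e' ∈ FU F E ∧
    e / e' ∈ U E m ∧ c = ψ (Algebra.trace F E (α * (((e / e' : Eˣ) : E) - 1))))
    ?_ (v := φ v) (fun h0 => hv (hφ (by rw [h0, map_zero]))) ?_ (s := (g, h))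
    ⟨e, e', hg, hh, he, he', hee, rfl⟩ w
  · rintro ⟨g, h⟩ ⟨x, y⟩ c ⟨e, e', hx, hy, he, he', hee, rfl⟩
    obtain ⟨f, hf⟩ := ((hA.mem_J _).mp g.2).exists_at
    obtain ⟨f', hf'⟩ := ((hB.mem_J _).mp h.2).exists_at
    obtain ⟨e₁, he₁, hd⟩ := hf.conj hA.level hx he
    obtain ⟨e₂, he₂, hd'⟩ := hf'.conj hB.level hy he'
    have hq : (e₁ / e₂) / (e / e') ∈ U E (m + 1) := by
      rw [div_div_div_comm]
      exact div_mem hd hd'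
    refine ⟨e₁, e₂, by simpa using he₁, by simpa using he₂, mem_FU_of_div (by omega) he hd,
      mem_FU_of_div (by omega) he' hd', ?_, (psi_eq_of_div_mem Q hψ hα hee.1 hq).symm⟩
    have := mul_mem (U_anti (by omega : (m : ℤ) ≤ m + 1) hq) hee
    rwa [div_mul_cancel] at this
  · rintro ⟨x, y⟩ c ⟨e, e', hx, hy, he, he', hee, rfl⟩
    have hK := mem_K_of_at hA hB (hx.mono hA.level.le) (hy.mono hB.level.le) hee
    have h1 := hact ⟨_, hK⟩ e e' hx hy he' hee
    have h2 := hφΛ ⟨_, hK⟩ v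
    rw [h1, map_smul] at h2
    exact h2.symm

/-- The determinant `u ∈ 1 + 𝔭_F ^ N` is attained on an element of `GL₂(F)` close to the identity:
the element `(u + 1) / 2 + (u - 1) / 2 · c` where `c² = 1`. -/
theorem exists_det_eq (hA : SetupA m frA) (hγ : frA.γ = 1) {N : ℕ} (hN : m + 1 ≤ N) {u : Fˣ}
    (hu : (u : F) - 1 ∈ pPow F N) : ∃ g : GL (Fin 2) F, ∃ e ∈ U E N,
      frA.At N (g : Matrix (Fin 2) (Fin 2) F) e ∧
      Units.map (Matrix.detMonoidHom : Matrix (Fin 2) (Fin 2) F →* F) g = u := by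
  have h2 : (2 : E) ≠ 0 := Q.two_ne
  set y : E := (algebraMap F E u - 1) / 2 with hy
  set x : E := (algebraMap F E u + 1) / 2 with hx
  have hyN : y ∈ pPow E N := by
    refine Q.half_mem ?_
    have := Q.map_mem hu
    rwa [map_sub, map_one] at this
  have hxy : x - 1 = y := by rw [hx, hy]; field_simp; ring
  have hxN : x - 1 ∈ pPow E N := hxy ▸ hyN
  have hx0 : ord x = 0 := ord_of_sub_one (pPow_anti (by omega) hxN)
  have hne : x ≠ 0 := by
    rintro h0
    have h1 : y = -1 := by rw [← hxy, h0]; ring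
    rw [h1, mem_pPow_iff (by simp), ord_neg, ord_one] at hyN
    omega
  have hX : frA.X (jA x + jA y * frA.c) = x := frA.X_eq _ _
  have hY : frA.Y (jA x + jA y * frA.c) = y := frA.Y_eq _ _
  have hAt : frA.At N (jA x + jA y * frA.c) (Units.mk0 x hne) :=
    ⟨hX, by rw [hY, Units.val_mk0, hx0, zero_add]; exact hyN⟩
  have hg := hA.level.g_nonneg
  refine ⟨frA.unit _ (Frame.ord_nE (t := N) (by omega) hAt.near).1, Units.mk0 x hne,
    (mem_U (by omega)).mpr hxN, hAt, Units.ext ?_⟩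
  change Matrix.detMonoidHom (jA x + jA y * frA.c) = (u : F)
  apply (algebraMap F E).injective
  rw [frA.nr_eq, hγ, one_mul, map_sub, Q.nm_eq, Q.nm_eq, hx, hy]
  simp only [map_div₀, map_add, map_sub, map_one, map_ofNat, AlgEquiv.commutes]
  field_simp
  ring

theorem isSmoothChar_of_twist (hψ : HasLevelZero ψ) (hα : ord (α : E) = -(m : ℤ))
    (hA : SetupA m frA) (hB : SetupB m frB) (hγ : frA.γ = 1) (hsm : IsSmoothRep Λ) {W : Type*}
    [AddCommGroup W] [Module Ω W] {τ : Representation Ω (K jA jB m) W}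
    (hτ : IsTau ψ jA jB m α τ) {φ : W →ₗ[Ω] V} (hφ : Function.Injective φ) {ω : Fˣ →* Ωˣ}
    (hφΛ : ∀ k w, φ (τ k w)
      = twist (ω.comp (deltaJ m jA jB)) Λ (KtoJ (K_le hA hB) k) (φ w)) : IsSmoothChar ω := by
  have hm : (1 : ℤ) ≤ m := by exact_mod_cast hA.level.one_le
  obtain ⟨v, hv, hact⟩ := hτ.exists_vector hA hB
  obtain ⟨n, -, hn⟩ := hsm (φ v)
  obtain ⟨k, -, hk⟩ := hA.rad_sub n
  refine ⟨k + m + 1, by omega, fun u hu => ?_⟩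
  obtain ⟨g, e, he, hg, hdet⟩ := exists_det_eq hA hγ (N := k + m + 1) (by omega) hu
  have h1 : frB.At ((m + 1) / 2 : ℕ) ((1 : (ℍ[F,a,b])ˣ) : ℍ[F,a,b]) 1 := Frame.At.one
  have hgJ : frA.At (m / 2 + 1 : ℕ) (g : Matrix (Fin 2) (Fin 2) F) e := hg.mono (by omega)
  have hem : e / 1 ∈ U E m := by rw [div_one]; exact U_anti (by omega) he
  have hK : (g, 1) ∈ K jA jB m :=
    mem_K_of_at hA hB (hgJ.mono hA.level.le) (h1.mono hB.level.le) hem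
  have h2 := hact ⟨_, hK⟩ e 1 hgJ h1 (one_mem _) hem
  rw [psi_eq_of_div_mem Q hψ hα (f := 1) (by rw [Units.val_one, ord_one])
    (by rw [div_one, div_one]; exact U_anti (by omega) he), Units.val_one, sub_self, mul_zero,
    map_zero, AddChar.map_zero_eq_one, one_smul] at h2
  have h3 := hφΛ ⟨_, hK⟩ v
  have h4 : Λ (KtoJ (K_le hA hB) ⟨_, hK⟩) (φ v) = φ v := by
    refine hn ⟨g, _⟩ 1 (hk ?_) (by
      change (1 : ℍ[F,a,b]) - 1 ∈ radB a b n
      rw [sub_self]; exact Or.inl rfl)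
    refine ⟨?_, ?_⟩
    · rw [Frame.X_sub, Frame.X_one, hg.1]
      exact pPow_anti (by omega) he.2
    · have := hg.2
      rw [he.1] at this
      rw [Frame.Y_sub, Frame.Y_one, sub_zero]
      exact pPow_anti (by omega) this
  have h5 : deltaJ m jA jB (KtoJ (K_le hA hB) ⟨_, hK⟩) = u⁻¹ := by
    rw [deltaJ_apply]
    change (Units.map (Matrix.detMonoidHom : Matrix (Fin 2) (Fin 2) F →* F) g)⁻¹
      * Units.map nrd 1 = u⁻¹
    rw [hdet, map_one, mul_one]
  rw [h2, twist_apply, h4, MonoidHom.comp_apply, h5, map_inv] at h3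
  have hφv : φ v ≠ 0 := fun h0 => hv (hφ (by rw [h0, map_zero]))
  have h6 : (1 : Ω) = ((ω u)⁻¹ : Ωˣ) := smul_left_injective Ω hφv (by simpa using h3)
  exact inv_eq_one.mp (Units.ext h6.symm)

variable [IsAlgClosed Ω] [FiniteDimensional Ω V]

theorem exists_scalar_left (hA : SetupA m frA) (hB : SetupB m frB) (hψ : HasLevelZero ψ)
    (hα : ord (α : E) = -(m : ℤ)) (hΛ : Representation.IsIrreducible Λ)
    (hact : ActsByPsi ψ α frA frB m Λ) (hm : Odd m) (g : JA jA m) :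
    ∃ c : Ω, ∀ v, Λ (g, 1) v = c • v := by
  have hm1 : (1 : ℤ) ≤ m := by exact_mod_cast hA.level.one_le
  have htt : (((m + 1) / 2 : ℕ) : ℤ) = (m / 2 + 1 : ℕ) := by
    obtain ⟨k, rfl⟩ := hm; omega
  refine exists_scalar_of_commutator hΛ fun ⟨y, z⟩ v => ?_
  obtain ⟨e, he⟩ := ((hA.mem_J _).mp g.2).exists_at
  obtain ⟨f, hf⟩ := ((hA.mem_J _).mp y.2).exists_at
  have hl2 := hA.level.le_two
  have hl := hA.level.lt_add
  obtain ⟨x, hx, hxU⟩ := he.commutator (by omega) hf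
  have hxU' : x ∈ U E (m + 1) := U_anti (by omega) hxU
  have h1 : ((g, 1) : JA jA m × JB jB m)⁻¹ * (y, z)⁻¹ * (g, 1) * (y, z)
      = (g⁻¹ * y⁻¹ * g * y, 1) := Prod.ext rfl (by simp)
  rw [h1, hact _ 1 x 1 (htt ▸ hx) Frame.At.one (U_le_FU (by omega) hxU') (one_mem _)
    (by rw [div_one]; exact U_anti (by omega) hxU'),
    psi_eq_of_div_mem Q hψ hα (f := 1) (by rw [Units.val_one, ord_one])
    (by rw [div_one, div_one]; exact hxU'), Units.val_one, sub_self, mul_zero,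
    map_zero, AddChar.map_zero_eq_one, one_smul]

theorem exists_scalar_right (hA : SetupA m frA) (hB : SetupB m frB) (hψ : HasLevelZero ψ)
    (hα : ord (α : E) = -(m : ℤ)) (hΛ : Representation.IsIrreducible Λ)
    (hact : ActsByPsi ψ α frA frB m Λ) (htt : levelB F E m = ((m + 1) / 2 : ℕ)) (h : JB jB m) :
    ∃ c : Ω, ∀ v, Λ (1, h) v = c • v := by
  have hm1 : (1 : ℤ) ≤ m := by exact_mod_cast hA.level.one_le
  refine exists_scalar_of_commutator hΛ fun ⟨y, z⟩ v => ?_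
  obtain ⟨e, he⟩ := ((hB.mem_J _).mp h.2).exists_at
  obtain ⟨f, hf⟩ := ((hB.mem_J _).mp z.2).exists_at
  have hl2 := hB.level.le_two
  have hl := hB.level.lt_add
  obtain ⟨x, hx, hxU⟩ := he.commutator (by omega) hf
  have hxU' : x ∈ U E (m + 1) := U_anti (by omega) hxU
  have h1 : ((1, h) : JA jA m × JB jB m)⁻¹ * (y, z)⁻¹ * (1, h) * (y, z)
      = (1, h⁻¹ * z⁻¹ * h * z) := Prod.ext (by simp) rfl
  rw [h1, hact 1 _ 1 x Frame.At.one (htt ▸ hx) (one_mem _) (U_le_FU (by omega) hxU')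
    (by rw [one_div]; exact inv_mem (U_anti (by omega) hxU')),
    psi_eq_of_div_mem Q hψ hα (f := 1) (by rw [Units.val_one, ord_one])
    (by rw [div_one, one_div]; exact inv_mem hxU'), Units.val_one, sub_self, mul_zero,
    map_zero, AddChar.map_zero_eq_one, one_smul]

theorem levelB_eq_of_even (hα : IsMinimal F m α) (hm : ¬ Odd m) :
    levelB F E m = ((m + 1) / 2 : ℕ) := by
  have hun : Unramified F E := by
    by_contra hun
    exact hm (hα.2.1 hun)
  rw [levelB, if_pos hun]
  rw [Nat.odd_iff] at hm
  omega

theorem isTauLike_of_isTau (hψ : HasLevelZero ψ) (hα : IsMinimal F m α)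
    (hA : SetupA m frA) (hB : SetupB m frB) (hΛ : Representation.IsIrreducible Λ) {W : Type*}
    [AddCommGroup W] [Module Ω W] {τ : Representation Ω (K jA jB m) W}
    (hτ : IsTau ψ jA jB m α τ) {φ : W →ₗ[Ω] V} (hφ : Function.Injective φ)
    (hφΛ : ∀ k w, φ (τ k w) = Λ (KtoJ (K_le hA hB) k) (φ w)) : IsTauLike ψ α frA frB m Λ := by
  have hact := actsByPsi_of_isTau hψ hα.1 hA hB hΛ hτ hφ hφΛ
  have hsc : OneScalar Λ := by
    by_cases hm : Odd m
    · exact Or.inl (exists_scalar_left hA hB hψ hα.1 hΛ hact hm)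
    · exact Or.inr (exists_scalar_right hA hB hψ hα.1 hΛ hact (levelB_eq_of_even hα hm))
  have := (isIrreducible_iff.mp hτ.irreducible).1
  obtain ⟨w, hw⟩ := exists_ne (0 : W)
  have hrange : LinearMap.range φ = ⊤ := by
    refine eq_top_of_stable (isIrreducible_restrict hA hB hΛ hsc) ?_ (v := φ w) ⟨w, rfl⟩
      (fun h0 => hw (hφ (by rw [h0, map_zero])))
    rintro k _ ⟨x, rfl⟩
    exact ⟨_, hφΛ k x⟩
  let i : W ≃ₗ[Ω] V := LinearEquiv.ofBijective φ ⟨hφ, LinearMap.range_eq_top.mp hrange⟩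
  have hi : ∀ k, Λ (KtoJ (K_le hA hB) k) = transport i τ k := fun k => by
    ext v
    have := hφΛ k (i.symm v)
    have h1 : φ (i.symm v) = v := i.apply_symm_apply v
    rw [h1] at this
    exact this.symm
  refine ⟨hact, fun hun => ⟨?_, fun β h1 h2 v => ?_⟩, fun hun ζ hζ h1 h2 => ?_⟩
  · rw [← i.finrank_eq]; exact (hτ.ramified hun).1
  · refine (DFunLike.congr_fun (hi ⟨_, diagE_mem_K jA jB m β⟩) v).trans ?_
    rw [transport_apply, (hτ.ramified hun).2, map_smul, LinearEquiv.apply_symm_apply]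
  · refine (congrArg (LinearMap.trace Ω V) (hi ⟨_, diagE_mem_K jA jB m ζ⟩)).trans ?_
    rw [trace_transport, hτ.unramified hun ζ hζ]

theorem exists_isTauLike (hψ : HasLevelZero ψ) (hα : IsMinimal F m α) (hA : SetupA m frA)
    (hB : SetupB m frB) (hγ : frA.γ = 1) (hΛ : Representation.IsIrreducible Λ)
    (hsm : IsSmoothRep Λ) (h : LiesOverTauOne ψ α Λ) : ∃ ω : Fˣ →* Ωˣ, IsSmoothChar ω ∧
      IsTauLike ψ α frA frB m (twist (ω.comp (deltaJ m jA jB)) Λ) := by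
  obtain ⟨d, τ, hτ, f, hf, hfΛ⟩ := h
  have hf0 : f ≠ 0 := by
    have := (isIrreducible_iff.mp hτ.irreducible).1
    obtain ⟨w, hw⟩ := exists_ne (0 : Fin d → Ω)
    rintro rfl
    exact hw (hf (by simp))
  obtain ⟨ω, φ, hφ0, hφ⟩ := exists_twist_intertwiner (KtoJ (K_le hA hB))
    ((deltaJ m jA jB).comp (KtoJ (K_le hA hB))) τ Λ hf0 fun k hk w => hfΛ _ _ ⟨k.2, hk⟩ w
  have hinj : Function.Injective φ := by
    rw [← LinearMap.ker_eq_bot]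
    refine ((isIrreducible_iff.mp hτ.irreducible).2 _ fun k w hw => ?_).resolve_right fun htop =>
      hφ0 (LinearMap.ker_eq_top.mp htop)
    rw [LinearMap.mem_ker] at hw ⊢
    rw [hφ, hw, map_zero, smul_zero]
  exact ⟨ω, isSmoothChar_of_twist hψ hα.1 hA hB hγ hsm hτ hinj hφ,
    isTauLike_of_isTau hψ hα hA hB (isIrreducible_twist hΛ) hτ hinj hφ⟩

end Over

/-! ### Factorization of representations lying over `τ_α¹` -/

section Linear

variable {Ω G V : Type*} [Field Ω] [Group G] [AddCommGroup V] [Module Ω V]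

theorem exists_char_of_scalar [Nontrivial V] {ρ : Representation Ω G V}
    (h : ∀ g, ∃ c : Ω, ∀ v, ρ g v = c • v) : ∃ ξ : G →* Ωˣ, ∀ g v, ρ g v = (ξ g : Ω) • v := by
  obtain ⟨v, hv⟩ := exists_ne (0 : V)
  obtain ⟨ξ, hξ⟩ := exists_char_of_eigenvector hv fun g => (h g).imp fun c hc => hc v
  refine ⟨ξ, fun g w => ?_⟩
  obtain ⟨c, hc⟩ := h g
  have : c = ξ g := smul_left_injective Ω hv ((hc v).symm.trans (hξ g))
  rw [hc, this]

/-- Every finite-dimensional representation is the contragredient of a representation on some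
`Ω ^ n`, namely of its own contragredient. -/
theorem exists_dual_model [FiniteDimensional Ω V] (σ : Representation Ω G V) :
    ∃ (n : ℕ) (ρ : Representation Ω G (Fin n → Ω)) (θ : V ≃ₗ[Ω] Module.Dual Ω (Fin n → Ω)),
      (∀ g v, θ (σ g v) = ρ.dual g (θ v)) ∧
      (∀ g, LinearMap.trace Ω _ (ρ g) = LinearMap.trace Ω V (σ g⁻¹)) ∧
      (∀ g (c : Ω), (∀ v, σ g⁻¹ v = c • v) → ∀ w, ρ g w = c • w) := by
  let i := (Module.finBasis Ω (Module.Dual Ω V)).equivFun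
  refine ⟨_, transport i σ.dual, (Module.evalEquiv Ω V).trans i.symm.dualMap, fun g v => ?_,
    fun g => ?_, fun g c h w => ?_⟩
  · refine LinearMap.ext fun w => ?_
    change (i.symm w) (σ g v) = (i.symm (transport i σ.dual g⁻¹ w)) v
    rw [transport_apply, LinearEquiv.symm_apply_apply, Representation.dual_apply, inv_inv]
    rfl
  · rw [trace_transport]
    exact LinearMap.trace_transpose' _
  · rw [transport_apply, dual_apply_eq_smul h, LinearMap.smul_apply, LinearMap.id_apply, map_smul,
      LinearEquiv.apply_symm_apply]

end Linear

section Factor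

open scoped TensorProduct

variable {F E : Type*} [Field F] [ValuativeRel F] [TopologicalSpace F]
  [IsNonarchimedeanLocalField F] [Field E] [ValuativeRel E] [TopologicalSpace E]
  [IsNonarchimedeanLocalField E] [Algebra F E]
  {Ω : Type*} [Field Ω] {ψ : AddChar F Ω}
  {Q : Quad F E}
  {V : Type*} [AddCommGroup V] [Module Ω V] {m : ℕ} {a b : F}
  {jA : E →ₐ[F] Matrix (Fin 2) (Fin 2) F} {jB : E →ₐ[F] ℍ[F,a,b]}
  {frA : Frame Q trA (Matrix.detMonoidHom : Matrix (Fin 2) (Fin 2) F →* F) jA}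
  {frB : Frame Q trd (nrd : ℍ[F,a,b] →* F) jB}
  {Λ : Representation Ω (JA jA m × JB jB m) V} {α : Eˣ}

/-- A character that agrees with `ψ_E (α ·)` on `U_E ^ m`, `α` minimal, agrees with `ψ_E (β ·)` on
`U_E ^ (⌊m/2⌋ + 1)` for some minimal `β`. -/
theorem exists_agreesOn (Q : Quad F E) (hψ : HasLevelZero ψ) (hm : 1 ≤ m) (hα : IsMinimal F m α)
    {χ : Eˣ →* Ωˣ} (hχ : AgreesOn ψ α χ m) :
    ∃ β : Eˣ, IsMinimal F m β ∧ AgreesOn ψ β χ (m / 2 + 1) := by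
  classical
  have hχ1 : ∀ e ∈ U E (m + 1), χ e = 1 := fun e he => hχ.eq_one (Q := Q) hψ hα.1 (by omega) he
  let θ : E → Ω := fun x => if h : 1 + x ≠ 0 then χ (Units.mk0 _ h) else 1
  have hθ : ∀ (e : Eˣ) (x : E), (e : E) = 1 + x → θ x = χ e := by
    intro e x hx
    have hne : 1 + x ≠ 0 := hx ▸ e.ne_zero
    simp only [θ, dif_pos hne]
    congr 2
    exact Units.ext hx.symm
  have hunit : ∀ x ∈ pPow E (m / 2 + 1 : ℕ), ∃ e : Eˣ, (e : E) = 1 + x ∧ ord (e : E) = 0 := by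
    intro x hx
    have h1 : ord (1 + x) = 0 ∧ 1 + x ≠ 0 := by
      have := ord_add_eq (x := (1 : E)) (y := x) one_ne_zero (n := 0) ord_one
        (pPow_anti (by omega) hx)
      exact ⟨this.2, this.1⟩
    exact ⟨Units.mk0 _ h1.2, rfl, h1.1⟩
  obtain ⟨β, hβ⟩ := Q.exists_of_additive hψ (h := (m / 2 + 1 : ℕ)) (k := m + 1) (by omega) θ
    (fun x hx y hy => by
      obtain ⟨e, he, he0⟩ := hunit x hx
      obtain ⟨f, hf, hf0⟩ := hunit y hy
      obtain ⟨g, hg, hg0⟩ := hunit (x + y) (pPow_add hx hy)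
      rw [hθ e x he, hθ f y hf, hθ g (x + y) hg, ← Units.val_mul, ← map_mul]
      congr 1
      refine (map_eq_of_div_mem hχ1 ((div_mem_U (by omega)).mpr ?_)).symm
      rw [hg0, zero_add, Units.val_mul, he, hf, hg]
      have h1 : (1 + x) * (1 + y) - (1 + (x + y)) = x * y := by ring
      rw [h1]
      exact pPow_mul' hx hy (by omega))
    (fun x hx => by
      obtain ⟨e, he, he0⟩ := hunit x (pPow_anti (by omega) hx)
      rw [hθ e x he, hχ1 e ((mem_U (by omega)).mpr (by rw [he, add_sub_cancel_left]; exact hx)),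
        Units.val_one])
  have hsub : β - α ∈ pPow E (1 - m) := by
    refine Q.mem_of_psi_trace hψ fun z hz => ?_
    obtain ⟨e, he, he0⟩ := hunit z (pPow_anti (by omega) hz)
    have h1 := hβ z (pPow_anti (by omega) hz)
    have hez : (e : E) - 1 = z := by rw [he, add_sub_cancel_left]
    rw [hθ e z he, hχ e (by rw [hez]; exact hz), hez] at h1
    rw [sub_mul, map_sub, AddChar.map_sub_eq_div, ← h1, div_self]
    exact (ψ.val_isUnit _).ne_zero
  have hβ0 : β ≠ 0 := by
    rintro rfl
    rw [zero_sub, mem_pPow_iff (neg_ne_zero.mpr α.ne_zero), ord_neg, hα.1] at hsub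
    omega
  refine ⟨Units.mk0 β hβ0, Q.minimal_of_sub_mem hα hsub, fun e he => ?_⟩
  rw [Units.val_mk0, ← hβ _ (by exact_mod_cast he), hθ e _ (by rw [add_sub_cancel])]

variable [IsAlgClosed Ω] [CharZero Ω]

theorem isLambdaTensorDual_of_isTensor (hψ : HasLevelZero ψ) (hα : IsMinimal F m α)
    (hA : SetupA m frA) (hB : SetupB m frB) {ω : Fˣ →* Ωˣ} (hω : IsSmoothChar ω) {χ : Eˣ →* Ωˣ}
    (hχ : AgreesOn ψ α χ m) {d d' : ℕ} {ρA : Representation Ω (JA jA m) (Fin d → Ω)}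
    {ρB : Representation Ω (JB jB m) (Fin d' → Ω)}
    {φ : V ≃ₗ[Ω] (Fin d → Ω) ⊗[Ω] Module.Dual Ω (Fin d' → Ω)}
    (H : IsTensor frA frB m χ (twist (ω.comp (deltaJ m jA jB)) Λ) ρA ρB φ) :
    IsLambdaTensorDual ψ (χ * ω.comp normUnits) Λ := by
  obtain ⟨β, hβ, hβχ⟩ := exists_agreesOn Q hψ hA.level.one_le hα hχ
  have hχs : IsSmoothChar χ := hχ.smooth (Q := Q) hψ hα.1 (by omega)
  set ωA : JA jA m →* Ωˣ := ω.comp ((Units.map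
    (Matrix.detMonoidHom : Matrix (Fin 2) (Fin 2) F →* F)).comp (JA jA m).subtype) with hωA
  set ωB : JB jB m →* Ωˣ := ω.comp ((Units.map nrd).comp (JB jB m).subtype) with hωB
  refine ⟨d, d', twist ωA ρA, twist ωB ρB,
    ⟨β, χ, ω, ρA, hβ, hχs, hω, rfl, hβχ, isBasicLambdaA_of_isTypeOn hA hψ hα hχ hβχ H.typeA,
      fun g => rfl⟩,
    ⟨β, χ, ω, ρB, hβ, hχs, hω, rfl, hβχ, isBasicLambdaB_of_isTypeOn hB hψ hα hχ hβχ H.typeB,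
      fun g => rfl⟩, φ, fun g h v => ?_⟩
  have h1 : twist ωA ρA g = (ωA g : Ω) • ρA g := rfl
  have h2 : (twist ωB ρB).dual h = ((ωB h)⁻¹ : Ωˣ).val • ρB.dual h := by
    refine LinearMap.ext fun ℓ => LinearMap.ext fun v => ?_
    rw [Representation.dual_apply, Module.Dual.transpose_apply, LinearMap.comp_apply, twist_apply,
      map_inv, map_smul]
    rfl
  have h3 := H.map_eq g h v
  have h4 : ω.comp (deltaJ m jA jB) (g, h) = (ωA g)⁻¹ * ωB h := by
    rw [MonoidHom.comp_apply, deltaJ_apply, map_mul, map_inv]; rfl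
  rw [twist_apply, h4, map_smul, Units.val_mul] at h3
  rw [h1, h2, TensorProduct.map_smul_left, TensorProduct.map_smul_right, LinearMap.smul_apply,
    LinearMap.smul_apply, ← h3, smul_smul, smul_smul]
  convert (one_smul Ω _).symm using 2
  rw [Units.val_inv_eq_inv_val, Units.val_inv_eq_inv_val]
  have h5 := (ωA g).ne_zero
  have h6 := (ωB h).ne_zero
  field_simp

end Factor

section Factor

open scoped TensorProduct

variable {F E : Type*} [Field F] [ValuativeRel F] [TopologicalSpace F]
  [IsNonarchimedeanLocalField F] [Field E] [ValuativeRel E] [TopologicalSpace E]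
  [IsNonarchimedeanLocalField E] [Algebra F E]
  {Ω : Type*} [Field Ω] {ψ : AddChar F Ω}
  {Q : Quad F E}
  {V : Type*} [AddCommGroup V] [Module Ω V] {m : ℕ} {a b : F}
  {jA : E →ₐ[F] Matrix (Fin 2) (Fin 2) F} {jB : E →ₐ[F] ℍ[F,a,b]}
  {frA : Frame Q trA (Matrix.detMonoidHom : Matrix (Fin 2) (Fin 2) F →* F) jA}
  {frB : Frame Q trd (nrd : ℍ[F,a,b] →* F) jB}
  {Λ : Representation Ω (JA jA m × JB jB m) V} {α : Eˣ}

theorem IsTauLike.apply_eq (hτ : IsTauLike ψ α frA frB m Λ) {g : JA jA m}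
    {h : JB jB m} {e : Eˣ}
    (hg : frA.At (m / 2 + 1 : ℕ) ((g : GL (Fin 2) F) : Matrix (Fin 2) (Fin 2) F) e)
    (hh : frB.At ((m + 1) / 2 : ℕ) ((h : (ℍ[F,a,b])ˣ) : ℍ[F,a,b]) e) (he : e ∈ FU F E) (v : V) :
    Λ (g, h) v = v := by
  rw [hτ.acts g h e e hg hh he he (by rw [div_self']; exact one_mem _), div_self', Units.val_one,
    sub_self, mul_zero, map_zero, AddChar.map_zero_eq_one, one_smul]

/-- The embedding `Eˣ → J`. -/
def embJ {D : Type*} [Ring D] [Algebra F D] (j : E →ₐ[F] D) {J : Subgroup Dˣ}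
    (h : ∀ e, embU j e ∈ J) : Eˣ →* J := (embU j).codRestrict J h

theorem isIrreducible_comp_of_scalar {G H : Type*} [Group G] [Group H]
    {Λ : Representation Ω (G × H) V} (hΛ : Representation.IsIrreducible Λ) {ξ : G →* Ωˣ}
    (hξ : ∀ g v, Λ (g, 1) v = (ξ g : Ω) • v) :
    Representation.IsIrreducible (Λ.comp (MonoidHom.inr G H)) :=
  isIrreducible_of_scalar hΛ _ fun ⟨g, h⟩ => ⟨h, ξ g, fun v => by
    rw [← hξ]
    change Λ (g, h) v = Λ (g, 1) (Λ (1, h) v)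
    rw [← Module.End.mul_apply, ← map_mul, Prod.mk_mul_mk, mul_one, one_mul]⟩

variable [IsAlgClosed Ω] [CharZero Ω]

/-- The case where the matrix factor acts by scalars. -/
theorem IsTauLike.exists_isTensor_of_odd [FiniteDimensional Ω V]
    (hτ : IsTauLike ψ α frA frB m Λ) (hψ : HasLevelZero ψ)
    (hα : IsMinimal F m α) (hA : SetupA m frA) (hB : SetupB m frB)
    (hΛ : Representation.IsIrreducible Λ) (hm : Odd m) :
    ∃ χ : Eˣ →* Ωˣ, AgreesOn ψ α χ m ∧ ∃ (d d' : ℕ) (ρA : Representation Ω (JA jA m) (Fin d → Ω))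
      (ρB : Representation Ω (JB jB m) (Fin d' → Ω))
      (φ : V ≃ₗ[Ω] (Fin d → Ω) ⊗[Ω] Module.Dual Ω (Fin d' → Ω)),
      IsTensor frA frB m χ Λ ρA ρB φ := by
  have hm1 : (1 : ℤ) ≤ m := by exact_mod_cast hA.level.one_le
  have := (isIrreducible_iff.mp hΛ).1
  have hJA := embU_mem_JA hA
  have hJB := embU_mem_JB hB
  have httA : (((m + 1) / 2 : ℕ) : ℤ) = (m / 2 + 1 : ℕ) := by
    obtain ⟨k, rfl⟩ := hm; omega
  obtain ⟨ξ, hξ⟩ := exists_char_of_scalar (ρ := Λ.comp (MonoidHom.inl _ _))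
    (exists_scalar_left hA hB hψ hα.1 hΛ hτ.acts hm)
  replace hξ : ∀ g v, Λ (g, 1) v = (ξ g : Ω) • v := hξ
  have hirr := isIrreducible_comp_of_scalar hΛ hξ
  set σ : Representation Ω (JB jB m) V := Λ.comp (MonoidHom.inr _ _) with hσ
  have hsplit : ∀ g h v, Λ (g, h) v = (ξ g : Ω) • σ h v := fun g h v => by
    rw [← hξ]
    change Λ (g, h) v = Λ (g, 1) (Λ (1, h) v)
    rw [← Module.End.mul_apply, ← map_mul, Prod.mk_mul_mk, mul_one, one_mul]
  set χ : Eˣ →* Ωˣ := ξ.comp (embJ jA hJA) with hχdef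
  have hσsplit : ∀ (e : Eˣ) h v, σ h v = (χ e : Ω)⁻¹ • Λ (⟨embU jA e, hJA e⟩, h) v := by
    intro e h v
    rw [hsplit, smul_smul]
    change _ = ((χ e : Ω)⁻¹ * χ e) • _
    rw [inv_mul_cancel₀ (χ e).ne_zero, one_smul]
  have hσ1 : ∀ (h : JB jB m) e, frB.At ((m + 1) / 2 : ℕ) ((h : (ℍ[F,a,b])ˣ) : ℍ[F,a,b]) e → e ∈ FU F E →
      ∀ v, σ h v = (χ e : Ω)⁻¹ • v := by
    intro h e hh he v
    rw [hσsplit e, hτ.apply_eq (Frame.At.torus e) hh he]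
  have hA1 : ∀ (g : JA jA m) e, frA.At ((m + 1) / 2 : ℕ)
      ((g : GL (Fin 2) F) : Matrix (Fin 2) (Fin 2) F) e → ξ g = χ e := by
    intro g e hg
    obtain ⟨w, hw, hgw⟩ := Frame.exists_split (f := 1) hA.mem_J (by rwa [mul_one])
    rw [hgw (hJA e), map_mul]
    have h1 : ξ w = 1 := by
      obtain ⟨v, hv⟩ := exists_ne (0 : V)
      have h2 := hξ w v
      rw [hτ.apply_eq (httA ▸ hw) Frame.At.one (one_mem _)] at h2
      exact Units.ext (smul_left_injective Ω hv (by simpa using h2.symm))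
    rw [h1, mul_one]
    rfl
  have hχ : AgreesOn ψ α χ m := by
    intro e he
    obtain ⟨v, hv⟩ := exists_ne (0 : V)
    have heU : e ∈ U E m := (mem_U hm1).mpr he
    have h1 := hτ.acts ⟨embU jA e, hJA e⟩ 1 e 1 (Frame.At.torus e) Frame.At.one (U_le_FU hm1 heU)
      (one_mem _) (by rwa [div_one]) v
    rw [hξ, div_one] at h1
    exact smul_left_injective Ω hv h1
  have htr : Unramified F E → ∀ (ζ : Eˣ) (h : embU jB ζ ∈ JB jB m), ζ ∈ rootsOutside F →
      LinearMap.trace Ω V (σ ⟨embU jB ζ, h⟩) = -(χ ζ : Ω)⁻¹ := by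
    intro hun ζ h hζ
    have h1 : σ ⟨embU jB ζ, h⟩ = (χ ζ : Ω)⁻¹ • Λ (⟨embU jA ζ, hJA ζ⟩, ⟨embU jB ζ, h⟩) :=
      LinearMap.ext (hσsplit ζ _)
    rw [h1, map_smul, hτ.unramified hun ζ hζ, smul_eq_mul, mul_neg_one]
  obtain ⟨n, ρB, θ, hθ, htrB, hscB⟩ := exists_dual_model σ
  have hn : Module.finrank Ω (Fin n → Ω) = Module.finrank Ω V := by
    rw [θ.finrank_eq, Subspace.dual_finrank_eq]
  have hinvσ : ∀ h (c : Ω), c ≠ 0 → (∀ v, σ h v = c⁻¹ • v) → ∀ w, ρB h w = c • w := by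
    intro h c hc hv
    refine hscB h c fun v => ?_
    rw [apply_inv_eq_smul (inv_ne_zero hc) hv, inv_inv]
  let κ : Ω ≃ₗ[Ω] (Fin 1 → Ω) := LinearEquiv.ofFinrankEq _ _ (by simp)
  refine ⟨χ, hχ, 1, n, twist ξ 1, ρB, θ ≪≫ₗ (TensorProduct.lid Ω _).symm ≪≫ₗ
    TensorProduct.congr κ (LinearEquiv.refl Ω _), ⟨fun g e hg he w => ?_, fun _ =>
      ⟨by simp, fun g e hg w => ?_⟩, fun h => by omega⟩, ⟨fun h e hh he w =>
        hinvσ h _ (χ e).ne_zero (hσ1 h e hh he) w, fun htt => ?_, fun htt => ?_⟩, fun g h v => ?_⟩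
  · rw [twist_apply, hA1 g e (httA ▸ hg)]; rfl
  · rw [twist_apply, hA1 g e hg, one_mul]; rfl
  · have hun : ¬ Unramified F E := fun hun => by
      rw [levelB, if_pos hun] at htt
      obtain ⟨k, rfl⟩ := hm
      omega
    refine ⟨by rw [hn, (hτ.ramified hun).1], fun h e hh w => ?_⟩
    have hs : signB F Ω e ≠ 0 := by
      rw [signB, if_neg hun]
      exact zpow_ne_zero _ (by norm_num)
    refine hinvσ h _ (mul_ne_zero hs (χ e).ne_zero) (fun v => ?_) w
    obtain ⟨x, hx, hhx⟩ := Frame.exists_split (f := 1) hB.mem_J (by rwa [mul_one])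
    have hx1 := hσ1 x 1 (htt ▸ hx) (one_mem _) v
    rw [map_one, Units.val_one, inv_one, one_smul] at hx1
    rw [hhx (hJB e), map_mul, Module.End.mul_apply, hx1, hσsplit e, (hτ.ramified hun).2, smul_smul,
      mul_inv, mul_comm, signB, if_neg hun, ← inv_zpow]
    norm_num
  · have hun : Unramified F E := by
      by_contra hun
      rw [levelB, if_neg hun] at htt
      omega
    have he := Q.unram_iff.mp hun
    obtain ⟨hα1, hα2⟩ := (Q.minimal_iff he).mp hα
    refine ⟨?_, fun ζ h hζ => ?_⟩
    · rw [hn]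
      have hl := hB.level
      rw [htt] at hl
      refine Frame.finrank_of_isIrreducible (α := -α) (χ := χ⁻¹) (ρ := σ) he hψ
        (by rw [Units.val_neg, ord_neg, hα1])
        (fun h => hα2 ?_) hl (hB.g_eq htt) (fun e he => ?_) hB.mem_J
        (fun h e hh hF v => ?_) hirr (fun ζ h hζ => ?_)
      · rw [Units.val_neg, map_neg, ← neg_sub'] at h
        have := pPow_neg h
        rwa [neg_neg] at this
      · rw [MonoidHom.inv_apply, Units.val_inv_eq_inv_val, hχ e he, Units.val_neg, neg_mul, map_neg,
          AddChar.map_neg_eq_inv]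
      · rw [MonoidHom.inv_apply, Units.val_inv_eq_inv_val]
        exact hσ1 h e (htt ▸ hh) hF v
      · rw [MonoidHom.inv_apply, Units.val_inv_eq_inv_val]
        exact htr hun ζ h hζ
    · have h' : embU jB ζ⁻¹ ∈ JB jB m := hJB _
      have hinv : (⟨embU jB ζ, h⟩ : JB jB m)⁻¹ = ⟨embU jB ζ⁻¹, h'⟩ := Subtype.ext (by simp)
      rw [htrB, hinv, htr hun _ h' (inv_mem_rootsOutside hζ), map_inv, Units.val_inv_eq_inv_val,
        inv_inv]
  · change TensorProduct.congr κ (LinearEquiv.refl Ω _) ((TensorProduct.lid Ω _).symm (θ _))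
      = TensorProduct.map _ _ (TensorProduct.congr κ (LinearEquiv.refl Ω _)
        ((TensorProduct.lid Ω _).symm (θ v)))
    simp only [TensorProduct.lid_symm_apply, TensorProduct.congr_tmul, TensorProduct.map_tmul,
      LinearEquiv.refl_apply, twist_apply]
    rw [hsplit, map_smul, hθ, TensorProduct.tmul_smul, TensorProduct.smul_tmul']
    rfl

/-- The case where the quaternionic factor acts by scalars. -/
theorem IsTauLike.exists_isTensor_of_even [FiniteDimensional Ω V]
    (hτ : IsTauLike ψ α frA frB m Λ) (hψ : HasLevelZero ψ)
    (hα : IsMinimal F m α) (hA : SetupA m frA) (hB : SetupB m frB)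
    (hΛ : Representation.IsIrreducible Λ) (hm : ¬ Odd m) :
    ∃ χ : Eˣ →* Ωˣ, AgreesOn ψ α χ m ∧ ∃ (d d' : ℕ) (ρA : Representation Ω (JA jA m) (Fin d → Ω))
      (ρB : Representation Ω (JB jB m) (Fin d' → Ω))
      (φ : V ≃ₗ[Ω] (Fin d → Ω) ⊗[Ω] Module.Dual Ω (Fin d' → Ω)),
      IsTensor frA frB m χ Λ ρA ρB φ := by
  have hm1 : (1 : ℤ) ≤ m := by exact_mod_cast hA.level.one_le
  have := (isIrreducible_iff.mp hΛ).1
  have hJA := embU_mem_JA hA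
  have hJB := embU_mem_JB hB
  have hun : Unramified F E := by
    by_contra hun
    exact hm (hα.2.1 hun)
  have he := Q.unram_iff.mp hun
  obtain ⟨hα1, hα2⟩ := (Q.minimal_iff he).mp hα
  have httB := levelB_eq_of_even hα hm
  have httA : ((m / 2 + 1 : ℕ) : ℤ) = ((m + 1) / 2 : ℕ) + 1 := by
    rw [Nat.odd_iff] at hm; omega
  obtain ⟨ξ, hξ⟩ := exists_char_of_scalar (ρ := Λ.comp (MonoidHom.inr _ _))
    (exists_scalar_right hA hB hψ hα.1 hΛ hτ.acts httB)
  replace hξ : ∀ h v, Λ (1, h) v = (ξ h : Ω) • v := hξ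
  set σ : Representation Ω (JA jA m) V := Λ.comp (MonoidHom.inl _ _) with hσ
  have hsplit : ∀ g h v, Λ (g, h) v = (ξ h : Ω) • σ g v := fun g h v => by
    rw [← hξ]
    change Λ (g, h) v = Λ (1, h) (Λ (g, 1) v)
    rw [← Module.End.mul_apply, ← map_mul, Prod.mk_mul_mk, mul_one, one_mul]
  have hirr : Representation.IsIrreducible σ :=
    isIrreducible_of_scalar hΛ _ fun ⟨g, h⟩ => ⟨g, ξ h, hsplit g h⟩
  set χ : Eˣ →* Ωˣ := (ξ.comp (embJ jB hJB))⁻¹ with hχdef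
  have hξχ : ∀ e, ξ ⟨embU jB e, hJB e⟩ = (χ e)⁻¹ := fun e => (inv_inv _).symm
  have hσsplit : ∀ (e : Eˣ) g v, σ g v = (χ e : Ω) • Λ (g, ⟨embU jB e, hJB e⟩) v := by
    intro e g v
    rw [hsplit, smul_smul, hξχ, Units.mul_inv, one_smul]
  have hB1 : ∀ (h : JB jB m) e, frB.At ((m + 1) / 2 : ℕ)
      ((h : (ℍ[F,a,b])ˣ) : ℍ[F,a,b]) e → ξ h = (χ e)⁻¹ := by
    intro h e hh
    obtain ⟨w, hw, hhw⟩ := Frame.exists_split (f := 1) hB.mem_J (by rwa [mul_one])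
    rw [hhw (hJB e), map_mul]
    have h1 : ξ w = 1 := by
      obtain ⟨v, hv⟩ := exists_ne (0 : V)
      have h2 := hξ w v
      rw [hτ.apply_eq Frame.At.one hw (one_mem _)] at h2
      exact Units.ext (smul_left_injective Ω hv (by simpa using h2.symm))
    rw [h1, mul_one, hξχ]
  have hχ : AgreesOn ψ α χ m := by
    intro e he
    obtain ⟨v, hv⟩ := exists_ne (0 : V)
    have heU : e ∈ U E m := (mem_U hm1).mpr he
    have h1 := hτ.acts 1 ⟨embU jB e⁻¹, hJB _⟩ 1 e⁻¹ Frame.At.one (Frame.At.torus _)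
      (one_mem _) (inv_mem (U_le_FU hm1 heU)) (by rwa [one_div, inv_inv]) v
    rw [hξ, hξχ, map_inv, inv_inv, one_div, inv_inv] at h1
    exact smul_left_injective Ω hv h1
  have htr : ∀ (ζ : Eˣ) (h : embU jA ζ ∈ JA jA m), ζ ∈ rootsOutside F →
      LinearMap.trace Ω V (σ ⟨embU jA ζ, h⟩) = -(χ ζ : Ω) := by
    intro ζ h hζ
    have h1 : σ ⟨embU jA ζ, h⟩ = (χ ζ : Ω) • Λ (⟨embU jA ζ, h⟩, ⟨embU jB ζ, hJB ζ⟩) :=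
      LinearMap.ext (hσsplit ζ _)
    rw [h1, map_smul, hτ.unramified hun ζ hζ, smul_eq_mul, mul_neg_one]
  have hσ1 : frA.ActsOnN (m / 2 + 1 : ℕ) (JA jA m).subtype χ σ := by
    intro g e hg he v
    rw [hσsplit e, hτ.apply_eq hg (Frame.At.torus e) he]
  have hl := hA.level
  rw [httA] at hl
  have hdim : Module.finrank Ω V = Nat.card 𝓀[F] :=
    Frame.finrank_of_isIrreducible he hψ hα1 hα2 hl (hA.g_eq httA) hχ hA.mem_J (httA ▸ hσ1) hirr htr
  let i := (Module.finBasis Ω V).equivFun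
  have htype : frA.IsTypeOn ((m + 1) / 2 : ℕ) (m / 2 + 1 : ℕ) (fun _ => 1) χ σ :=
    ⟨hσ1, fun h => by omega, fun _ => ⟨hdim, htr⟩⟩
  let κ : Ω ≃ₗ[Ω] Module.Dual Ω (Fin 1 → Ω) := LinearEquiv.ofFinrankEq _ _ (by
    rw [Subspace.dual_finrank_eq]; simp)
  refine ⟨χ, hχ, _, 1, transport i σ, twist ξ⁻¹ 1, i ≪≫ₗ (TensorProduct.rid Ω _).symm ≪≫ₗ
    TensorProduct.congr (LinearEquiv.refl Ω _) κ, htype.transport i, ⟨fun h e hh he w => ?_,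
      fun _ => ⟨by simp, fun h e hh w => ?_⟩, fun h => by omega⟩, fun g h v => ?_⟩
  · rw [twist_apply, MonoidHom.inv_apply, hB1 h e hh, inv_inv]; rfl
  · rw [twist_apply, MonoidHom.inv_apply, hB1 h e (httB ▸ hh), inv_inv, signB, if_pos hun, one_mul]
    rfl
  · have hdual : (twist ξ⁻¹ (1 : Representation Ω (JB jB m) (Fin 1 → Ω))).dual h
        = (ξ h : Ω) • LinearMap.id := dual_apply_eq_smul fun w => by
      rw [twist_apply, MonoidHom.inv_apply, map_inv, inv_inv]; rfl
    change TensorProduct.congr (LinearEquiv.refl Ω _) κ ((TensorProduct.rid Ω _).symm (i _))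
      = TensorProduct.map _ _ (TensorProduct.congr (LinearEquiv.refl Ω _) κ
        ((TensorProduct.rid Ω _).symm (i v)))
    rw [hdual]
    simp only [TensorProduct.rid_symm_apply, TensorProduct.congr_tmul, TensorProduct.map_tmul,
      LinearEquiv.refl_apply, transport_apply, LinearEquiv.symm_apply_apply, LinearMap.smul_apply,
      LinearMap.id_apply]
    rw [hsplit, map_smul, TensorProduct.tmul_smul, TensorProduct.smul_tmul']

theorem isLambdaTensorDual_of_liesOverTauOne (hψ : HasLevelZero ψ) (hα : IsMinimal F m α)
    (hA : SetupA m frA) (hB : SetupB m frB) (hγ : frA.γ = 1)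
    (hΛ : Representation.IsIrreducible Λ) (hsm : IsSmoothRep Λ) (h : LiesOverTauOne ψ α Λ) :
    ∃ χ ∈ Y ψ m α, IsLambdaTensorDual ψ χ Λ := by
  have := finiteDimensional_of_isSmoothRep hA hB hΛ hsm
  obtain ⟨ω, hω, hτ⟩ := exists_isTauLike hψ hα hA hB hγ hΛ hsm h
  have hΛ' := isIrreducible_twist (μ := ω.comp (deltaJ m jA jB)) hΛ
  obtain ⟨χ, hχ, d, d', ρA, ρB, φ, H⟩ : ∃ χ : Eˣ →* Ωˣ, AgreesOn ψ α χ m ∧ ∃ (d d' : ℕ)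
      (ρA : Representation Ω (JA jA m) (Fin d → Ω)) (ρB : Representation Ω (JB jB m) (Fin d' → Ω))
      (φ : V ≃ₗ[Ω] (Fin d → Ω) ⊗[Ω] Module.Dual Ω (Fin d' → Ω)),
      IsTensor frA frB m χ (twist (ω.comp (deltaJ m jA jB)) Λ) ρA ρB φ := by
    by_cases hm : Odd m
    · exact hτ.exists_isTensor_of_odd hψ hα hA hB hΛ' hm
    · exact hτ.exists_isTensor_of_even hψ hα hA hB hΛ' hm
  exact ⟨_, ⟨χ, ω, hχ.smooth (Q := Q) hψ hα.1 (by omega), hω, rfl, hχ⟩,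
    isLambdaTensorDual_of_isTensor hψ hα hA hB hω hχ H⟩

end Factor

end

end LocalTypes

theorem mainTheorem9 {F E Ω : Type*}
    [Field F] [ValuativeRel F] [TopologicalSpace F] [IsNonarchimedeanLocalField F]
    [Field E] [ValuativeRel E] [TopologicalSpace E] [IsNonarchimedeanLocalField E]
    [Algebra F E] [ValuativeExtension F E]
    [Field Ω] [IsAlgClosed Ω] [CharZero Ω]
    (hp : ringChar 𝓀[F] ≠ 2)
    (hE : Module.finrank F E = 2)
    {a b : F} (hB : ∀ x : ℍ[F,a,b], x ≠ 0 → IsUnit x)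
    (jA : E →ₐ[F] Matrix (Fin 2) (Fin 2) F) (jB : E →ₐ[F] ℍ[F,a,b])
    (ψ : AddChar F Ω) (hψ : LocalTypes.HasLevelZero ψ)
    (m : ℕ) (hm : 1 ≤ m) (α : Eˣ) (hα : LocalTypes.IsMinimal F m α)
    {V : Type*} [AddCommGroup V] [Module Ω V]
    (Λ : Representation Ω (LocalTypes.JA jA m × LocalTypes.JB jB m) V)
    (hirr : Representation.IsIrreducible Λ) (hsm : LocalTypes.IsSmoothRep Λ) :
    LocalTypes.LiesOverTauOne ψ α Λ ↔
      ∃ χ ∈ LocalTypes.Y ψ m α, LocalTypes.IsLambdaTensorDual ψ χ Λ := by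
  obtain ⟨Q⟩ := LocalTypes.exists_quad (F := F) (E := E) hp hE
  obtain ⟨frA, hγ, hA⟩ := LocalTypes.Frame.exists_setup_matrix (Q := Q) hE hm jA
  obtain ⟨frB, hSB⟩ := LocalTypes.exists_setup_quaternion (Q := Q) hE hB hm hα.2.1 jB
  exact ⟨LocalTypes.isLambdaTensorDual_of_liesOverTauOne hψ hα hA hSB hγ hirr hsm,
    fun ⟨_, hχ, h⟩ => LocalTypes.liesOverTauOne_of_isLambdaTensorDual hψ hα hA hSB hirr hχ h⟩
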